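/- Let $Q$ be a finite quiver with vertex set $V(Q)$ which is symmetric, i.e. for all $i,j\in V(Q)$ there are as many edges from $i$ to $j$ as from $j$ to $i$. Let $a_i,b_i$ $(i\in V(Q))$ and $c$ be non-negative integers. The extended quiver $Q^\star$ has vertex set $\{0\}\sqcup V(Q)$, the same edges as $Q$ between vertices of $V(Q)$, $a_i$ edges from $0$ to $i$, $b_i$ edges from $i$ to $0$, and $c$ loops at $0$. For a dimension vector $m=(m_i)_{i\in V(Q)}$, $m_i\ge 0$, of $Q$ let $m^\star$ be the dimension vector of $Q^\star$ with $m^\star_0=1$ and $m^\star_i=m_i$ for $i\in V(Q)$. Let $\mathrm{Rep}=\prod_{e}\mathrm{Hom}(\mathbb C^{m^\star_{s(e)}},\mathbb C^{m^\star_{t(e)}})$, the product over the edges $e$ of $Q^\star$, with its action of $G=\prod_{i}\mathrm{GL}_{m^\star_i}(\mathbb C)$, the product over the vertices of $Q^\star$, by change of basis, and let $M=\operatorname{Spec}\mathbb C[\mathrm{Rep}]^G$. For a tuple $\xi=(\xi_i)$ of points of the upper half plane indexed by the vertices of $Q^\star$ put $Z_\xi(d)=\sum_i d_i\xi_i$.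 A representation of dimension vector $m^\star$ is $\xi$-semistable if $\arg Z_\xi(d)\le\arg Z_\xi(m^\star)$ for the dimension vector $d$ of every nonzero subrepresentation. Let $\mathrm{Rep}^{\xi}\subset\mathrm{Rep}$ be the Zariski open locus of $\xi$-semistable representations, $M^{\xi}=\mathrm{Rep}^\xi/\!\!/G$ its GIT quotient (good quotient), and $q^\xi\colon M^\xi\to M$ the induced morphism. Fix $\xi^{+},\xi^-$ as above with $\xi^\pm_i=\sqrt{-1}$ for $i\in V(Q)$, $\operatorname{Re}\xi^+_0<0$ and $\operatorname{Re}\xi^-_0>0$. Suppose that $a_i>b_i$ for all $i\in V(Q)$. Then the good quotients $M^{\xi^\pm}$ exist, and for the diagram $$M^{\xi^+}\xrightarrow{\;q^{\xi^+}\;}M\xleftarrow{\;q^{\xi^-}\;}M^{\xi^-}$$ one of the following holds: 1. $M^{\xi^-}=\emptyset$ and the diagram is a generalized Mori fiber space (generalized MFS); 2. $M^{\xi^+}\ne\emptyset$, $M^{\xi^-}\neq\emptyset$, and the diagram is a generalized flip. Here a diagram $Y^+\xrightarrow{f^+}Z\xleftarrow{f^-}Y^-$ over $\mathbb C$ is considered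 in which $Z$ is a variety, each $Y^\pm$ is a smooth variety or empty, each $f^\pm$ is a projective morphism, and $f^\pm_*\mathcal O_{Y^\pm}=\mathcal O_Z$ if $Y^\pm\ne\emptyset$ (all of this is part of the assertion for the diagram above). It is a *generalized flip* if $f^+$ and $f^-$ are birational morphisms, $-K_{Y^+}$ is $f^+$-ample and $K_{Y^-}$ is $f^-$-ample; it is a *generalized MFS* if $-K_{Y^+}$ is $f^+$-ample and $Y^-=\emptyset$ (conditions on $K_{Y^+}$ are void if $Y^+=\emptyset$). -/

import Mathlib

open CategoryTheory AlgebraicGeometry TopologicalSpace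

noncomputable section

/-! ## Algebraic geometry over the complex numbers -/

/-- The base scheme `Spec ℂ`. -/
abbrev SpecC : Scheme.{0} := Spec (CommRingCat.of ℂ)

/-- The scheme `Z` with structure morphism `z : Z ⟶ Spec ℂ` is a variety: an integral scheme,
separated and of finite type over `ℂ`. -/
structure IsVariety {Z : Scheme.{0}} (z : Z ⟶ SpecC) : Prop where
  integral : IsIntegral Z
  separated : IsSeparated z
  locallyOfFiniteType : LocallyOfFiniteType z
  quasiCompact : QuasiCompact z

/-- Projective space `ℙⁿ` over a scheme `S`. -/
def ProjSpace (n : ℕ) (S : Scheme.{0}) : Scheme.{0} :=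
  letI : GradedAlgebra (MvPolynomial.homogeneousSubmodule (Fin (n + 1)) ℤ) :=
    MvPolynomial.gradedAlgebra
  Limits.pullback (Limits.terminal.from S)
    (Limits.terminal.from (Proj (MvPolynomial.homogeneousSubmodule (Fin (n + 1)) ℤ)))

/-- The projection `ℙⁿ_S ⟶ S`. -/
def ProjSpace.toBase (n : ℕ) (S : Scheme.{0}) : ProjSpace n S ⟶ S :=
  Limits.pullback.fst _ _

/-- A morphism `f : Y ⟶ Z` is projective: it factors as a closed immersion into some `ℙⁿ_Z`
followed by the projection to `Z`. -/
def IsProjectiveMorphism {Y Z : Scheme.{0}} (f : Y ⟶ Z) : Prop :=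
  ∃ (n : ℕ) (i : Y ⟶ ProjSpace n Z), IsClosedImmersion i ∧ i ≫ ProjSpace.toBase n Z = f

/-- The natural map `𝒪_Z ⟶ f_* 𝒪_Y` is an isomorphism. -/
def PushforwardStructureSheafEq {Y Z : Scheme.{0}} (f : Y ⟶ Z) : Prop :=
  ∀ V : Z.Opens, Function.Bijective (f.app V)

/-- A morphism `f : Y ⟶ Z` is birational: it restricts to an isomorphism between dense open
subschemes of `Y` and of `Z`. -/
def IsBirationalMorphism {Y Z : Scheme.{0}} (f : Y ⟶ Z) : Prop :=
  Scheme.BirationalOver f (𝟙 Z)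

/-- The function field of an integral scheme `Y`, remembering the structure morphism
`s : Y ⟶ Spec ℂ`. -/
def FunField {Y : Scheme.{0}} (_s : Y ⟶ SpecC) [IsIntegral Y] : Type := Y.functionField

section Canonical

variable {Y : Scheme.{0}} (s : Y ⟶ SpecC) [IsIntegral Y]

instance : Field (FunField s) := inferInstanceAs (Field Y.functionField)

instance (y : Y) : Algebra (Y.presheaf.stalk y) (FunField s) :=
  inferInstanceAs (Algebra (Y.presheaf.stalk y) Y.functionField)

/-- The `ℂ`-algebra structure of the function field that is induced by the structure morphism. -/
instance : Algebra ℂ (FunField s) :=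
  RingHom.toAlgebra ((Y.presheaf.germ ⊤ (genericPoint Y) trivial).hom.comp
    (s.appTop.hom.comp (Scheme.ΓSpecIso (CommRingCat.of ℂ)).inv.hom))

/-- The dimension of the variety `Y`, as the rank of its rational Kähler differentials over the
function field (equal to the transcendence degree of the function field over `ℂ`). -/
def varietyDim : ℕ := Module.finrank (FunField s) (Ω[FunField s⁄ℂ])

/-- Rational differential forms of top degree on the variety `Y`. -/
abbrev RatTopForm : Type := ⋀[FunField s]^(varietyDim s) (Ω[FunField s⁄ℂ])

/-- The top degree rational forms that are regular at `y`: the sums of forms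
`c • (df₁ ∧ ⋯ ∧ dfₙ)` where `c, f₁, …, fₙ` are germs of regular functions at `y`. -/
def regularTopForms (y : Y) : AddSubmonoid (RatTopForm s) :=
  AddSubmonoid.closure {ω | ∃ (c : Y.presheaf.stalk y)
    (f : Fin (varietyDim s) → Y.presheaf.stalk y),
    ω = algebraMap _ (FunField s) c •
      exteriorPower.ιMulti (FunField s) (varietyDim s)
        (fun i => KaehlerDifferential.D ℂ (FunField s) (algebraMap _ (FunField s) (f i)))}

/-- A subsheaf of modules of the constant sheaf of rational functions, given by its stalks. Its
sections over an open `U` are the rational functions that lie in the stalk at each point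
of `U`. Divisors `D` enter through the stalks of `𝒪_Y(D)`. -/
abbrev FracStalks : Type := ∀ y : Y, Submodule (Y.presheaf.stalk y) (FunField s)

/-- The stalks of `𝒪_Y(K_Y)`, where `K_Y` is the canonical divisor `div η` of the rational top
form `η ≠ 0`: a rational function `h` belongs to the stalk at `y` if `h • η` is regular at `y`. -/
def canonicalStalks (η : RatTopForm s) : FracStalks s := fun y =>
  { carrier := {h | h • η ∈ regularTopForms s y}
    add_mem' := fun {h k} hh hk => by
      have := (regularTopForms s y).add_mem hh hk
      simpa [add_smul] using this
    zero_mem' := by simp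
    smul_mem' := fun r h hh => by
      have key : ∀ ω ∈ regularTopForms s y,
          algebraMap _ (FunField s) r • ω ∈ regularTopForms s y := by
        intro ω hω
        induction hω using AddSubmonoid.closure_induction with
        | mem x hx =>
          obtain ⟨c, f, rfl⟩ := hx
          refine AddSubmonoid.subset_closure ⟨r * c, f, ?_⟩
          rw [smul_smul, map_mul]
        | zero => simp
        | add a b _ _ ha hb => rw [smul_add]; exact add_mem ha hb
      have := key _ hh
      rwa [smul_smul, ← Algebra.smul_def] at this }

/-- The stalks of `𝒪_Y(-K_Y)`, dual to those of `𝒪_Y(K_Y)`. -/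
def anticanonicalStalks (η : RatTopForm s) : FracStalks s := fun y => 1 / canonicalStalks s η y

variable {s}

/-- The subsheaf is the invertible sheaf of a Cartier divisor: locally it is generated by one
nonzero rational function. -/
def FracStalks.IsCartier (L : FracStalks s) : Prop :=
  ∀ y : Y, ∃ U : Y.Opens, y ∈ U ∧ ∃ g : FunField s, g ≠ 0 ∧
    ∀ x ∈ U, L x = Submodule.span (Y.presheaf.stalk x) {g}

/-- The invertible sheaf `L` on `Y` is ample relative to `f : Y ⟶ Z`: the morphism `f` is
quasi-compact, and for each affine open `V` of `Z` the restriction of `L` to `f⁻¹ V` is ample,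
that is, each point `y` of `f⁻¹ V` has a section `t` of some power `L^k`, `k ≥ 1`, over `f⁻¹ V`
whose nonvanishing locus (the set of points of `f⁻¹ V` where `t` generates `L^k`) is an affine
open subset that contains `y`. -/
def FracStalks.IsRelAmple (L : FracStalks s) {Z : Scheme.{0}} (f : Y ⟶ Z) : Prop :=
  L.IsCartier ∧ QuasiCompact f ∧
    ∀ V : Z.Opens, IsAffineOpen V → ∀ y ∈ f ⁻¹ᵁ V, ∃ k : ℕ, 1 ≤ k ∧
      ∃ t : FunField s, (∀ x ∈ f ⁻¹ᵁ V, t ∈ L x ^ k) ∧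
        ∃ W : Y.Opens, IsAffineOpen W ∧ y ∈ W ∧
          ∀ x : Y, x ∈ W ↔
            x ∈ f ⁻¹ᵁ V ∧ Submodule.span (Y.presheaf.stalk x) {t} = L x ^ k

end Canonical

/-- `K_Y` is `f`-ample (for a smooth variety or the empty scheme `Y` over `ℂ`, with structure
morphism `s`; the condition is empty if `Y` is empty). -/
def CanonicalIsRelAmple {Y Z : Scheme.{0}} (s : Y ⟶ SpecC) (f : Y ⟶ Z) : Prop :=
  Nonempty Y → ∃ _ : IsIntegral Y, ∃ η : RatTopForm s, η ≠ 0 ∧ (canonicalStalks s η).IsRelAmple f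

/-- `-K_Y` is `f`-ample (for a smooth variety or the empty scheme `Y` over `ℂ`, with structure
morphism `s`; the condition is empty if `Y` is empty). -/
def AnticanonicalIsRelAmple {Y Z : Scheme.{0}} (s : Y ⟶ SpecC) (f : Y ⟶ Z) : Prop :=
  Nonempty Y →
    ∃ _ : IsIntegral Y, ∃ η : RatTopForm s, η ≠ 0 ∧ (anticanonicalStalks s η).IsRelAmple f

/-- The standing assumptions on one leg `f : Y ⟶ Z` of a diagram `Y⁺ ⟶ Z ⟵ Y⁻` over `ℂ`:
`Y` is a smooth variety or empty, `f` is projective, and `f_* 𝒪_Y = 𝒪_Z` unless `Y` is empty. -/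
structure IsDiagramLeg {Y Z : Scheme.{0}} (z : Z ⟶ SpecC) (f : Y ⟶ Z) : Prop where
  smooth : Smooth (f ≫ z)
  variety : Nonempty Y → IsVariety (f ≫ z)
  projective : IsProjectiveMorphism f
  pushforward : Nonempty Y → PushforwardStructureSheafEq f

/-- The diagram `Y⁺ ⟶ Z ⟵ Y⁻` of varieties over `ℂ` is a generalized flip. -/
structure IsGeneralizedFlip {Yp Ym Z : Scheme.{0}} (z : Z ⟶ SpecC) (fp : Yp ⟶ Z) (fm : Ym ⟶ Z) :
    Prop where
  base : IsVariety z
  leg_plus : IsDiagramLeg z fp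
  leg_minus : IsDiagramLeg z fm
  birational_plus : IsBirationalMorphism fp
  birational_minus : IsBirationalMorphism fm
  ample_plus : AnticanonicalIsRelAmple (fp ≫ z) fp
  ample_minus : CanonicalIsRelAmple (fm ≫ z) fm

/-- The diagram `Y⁺ ⟶ Z ⟵ Y⁻` of varieties over `ℂ` is a generalized Mori fiber space. -/
structure IsGeneralizedMFS {Yp Ym Z : Scheme.{0}} (z : Z ⟶ SpecC) (fp : Yp ⟶ Z) (fm : Ym ⟶ Z) :
    Prop where
  base : IsVariety z
  leg_plus : IsDiagramLeg z fp
  leg_minus : IsDiagramLeg z fm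
  ample_plus : AnticanonicalIsRelAmple (fp ≫ z) fp
  empty_minus : IsEmpty Ym

/-- Given a family of endomorphisms `ρ g` of `X` and a morphism `π : X ⟶ Y` with
`ρ g ≫ π = π`, a function on `π⁻¹ V` is invariant if it is fixed by the pullback along each
`ρ g`. -/
def IsInvariantSection {G : Type} {X Y : Scheme.{0}} (ρ : G → (X ⟶ X)) (π : X ⟶ Y)
    (hπ : ∀ g, ρ g ≫ π = π) (V : Y.Opens) (t : Γ(X, π ⁻¹ᵁ V)) : Prop :=
  ∀ g, (ρ g).appLE (π ⁻¹ᵁ V) (π ⁻¹ᵁ V)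
    (by rw [← Scheme.Hom.comp_preimage, hπ g]) t = t

/-- `π : X ⟶ Y` is a good quotient of `X` by the group `G`, acting through the automorphisms
`ρ g`. The group here is the group of `ℂ`-points of a complex reductive group and `X` is reduced
and of finite type over `ℂ`, so that invariance may be tested on the `ℂ`-points of the group. -/
structure IsGoodQuotient {G : Type} {X Y : Scheme.{0}} (ρ : G → (X ⟶ X)) (π : X ⟶ Y) :
    Prop where
  invariant : ∀ g, ρ g ≫ π = π
  affine : IsAffineHom π
  surjective : Function.Surjective π
  /-- `𝒪_Y` is the sheaf of invariant functions. -/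
  app_injective : ∀ V : Y.Opens, Function.Injective (π.app V)
  mem_range_app_iff : ∀ (V : Y.Opens) (t : Γ(X, π ⁻¹ᵁ V)),
    t ∈ Set.range (π.app V) ↔ IsInvariantSection ρ π invariant V t
  /-- Images of invariant closed subsets are closed. -/
  isClosed_image : ∀ T : Set X, IsClosed T → (∀ g, ρ g ⁻¹' T = T) → IsClosed (π '' T)
  /-- Disjoint invariant closed subsets have disjoint images. -/
  disjoint_image : ∀ T T' : Set X, IsClosed T → IsClosed T' → (∀ g, ρ g ⁻¹' T = T) →
    (∀ g, ρ g ⁻¹' T' = T') → Disjoint T T' → Disjoint (π '' T) (π '' T')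

/-! ## Representations of quivers -/

namespace QuiverRep

variable {V : Type} [Quiver.{0} V]

/-- The index set of the coordinates on the space of representations of dimension vector `m`:
the entries of one `m j × m i` matrix for each edge `i ⟶ j`. -/
structure Coord (m : V → ℕ) : Type where
  src : V
  tgt : V
  edge : src ⟶ tgt
  row : Fin (m tgt)
  col : Fin (m src)

variable (m : V → ℕ)

/-- Representations of dimension vector `m` on the vector spaces `ℂ ^ (m i)`. -/
abbrev Rep : Type := Coord m → ℂ

variable {m}

/-- The matrix of the edge `e` in the representation `v`. -/
def edgeMatrix (v : Rep m) {i j : V} (e : i ⟶ j) : Matrix (Fin (m j)) (Fin (m i)) ℂ :=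
  Matrix.of fun p q => v ⟨i, j, e, p, q⟩

/-- A subrepresentation of the representation `v`. -/
structure SubRep (v : Rep m) where
  space : ∀ i : V, Submodule ℂ (Fin (m i) → ℂ)
  map_mem : ∀ {i j : V} (e : i ⟶ j), ∀ x ∈ space i, (edgeMatrix v e).mulVec x ∈ space j

/-- The central charge of a dimension vector: `Z_ξ(d) = ∑ i, d i * ξ i`. -/
def centralCharge [Fintype V] (ξ : V → UpperHalfPlane) (d : V → ℕ) : ℂ :=
  ∑ i, (d i : ℂ) * (ξ i : ℂ)

/-- The representation `v` (of nonzero dimension vector) is `ξ`-semistable: each nonzero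
subrepresentation `W` has `arg Z_ξ(W) ≤ arg Z_ξ(v)`. -/
def IsSemistable [Fintype V] (ξ : V → UpperHalfPlane) (v : Rep m) : Prop :=
  ∀ W : SubRep v, (∃ i, W.space i ≠ ⊥) →
    (centralCharge ξ fun i => Module.finrank ℂ (W.space i)).arg ≤ (centralCharge ξ m).arg

variable (m)

/-- The structure group `∏ i, GL(m i, ℂ)`. -/
abbrev GaugeGroup : Type := ∀ i : V, GL (Fin (m i)) ℂ

/-- The coordinate ring of the affine space of representations. -/
abbrev RepRing : Type := MvPolynomial (Coord m) ℂ

/-- The affine space of representations, as a scheme. -/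
abbrev RepScheme : Scheme.{0} := Spec (CommRingCat.of (RepRing m))

variable {m}

/-- The action `(g · u)_e = g_{t(e)}⁻¹ u_e g_{s(e)}` on representations. -/
def act (g : GaugeGroup m) (v : Rep m) : Rep m := fun x =>
  (((g x.tgt)⁻¹ : GL (Fin (m x.tgt)) ℂ).val * edgeMatrix v x.edge * (g x.src).val) x.row x.col

/-- The action of a group element on functions, by composition with `v ↦ g · v`: each coordinate
function is sent to the corresponding entry of the product `g_{t(e)}⁻¹ u_e g_{s(e)}` of matrices,
where `u_e` is the matrix of coordinate functions. -/
def actRing (g : GaugeGroup m) : RepRing m →ₐ[ℂ] RepRing m :=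
  MvPolynomial.aeval fun x : Coord m =>
    ∑ q, (∑ p, MvPolynomial.C (((g x.tgt)⁻¹ : GL (Fin (m x.tgt)) ℂ).val x.row p) *
      MvPolynomial.X ⟨x.src, x.tgt, x.edge, p, q⟩) * MvPolynomial.C ((g x.src).val q x.col)

/-- The action of a group element on the scheme of representations. -/
def actScheme (g : GaugeGroup m) : RepScheme m ⟶ RepScheme m :=
  Spec.map (CommRingCat.ofHom (actRing g).toRingHom)

/-- The closed point of the scheme of representations given by a representation. -/
def point (v : Rep m) : RepScheme m := MvPolynomial.pointToPoint (k := ℂ) v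

variable (m)

/-- The ring of invariant functions on the space of representations. -/
def invariants : Subalgebra ℂ (RepRing m) :=
  ⨅ g : GaugeGroup m, AlgHom.equalizer (actRing g) (AlgHom.id ℂ (RepRing m))

/-- The moduli space `M_Q(m)`, the affine GIT quotient of the space of representations. -/
def Moduli : Scheme.{0} := Spec (CommRingCat.of (invariants m))

/-- The structure morphism of `M_Q(m)`. -/
def Moduli.structureMap : Moduli m ⟶ SpecC :=
  Spec.map (CommRingCat.ofHom (algebraMap ℂ (invariants m)))

/-- The quotient morphism from the space of representations to `M_Q(m)`. -/
def Moduli.quotientMap : RepScheme m ⟶ Moduli m :=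
  Spec.map (CommRingCat.ofHom (invariants m).val.toRingHom)

/-- The `ξ`-semistable locus, an open subscheme of the space of representations: the largest open
subset all of whose `ℂ`-points are `ξ`-semistable. As `ξ`-semistability is an open condition, its
`ℂ`-points are exactly the `ξ`-semistable representations. -/
def semistableLocus [Fintype V] (ξ : V → UpperHalfPlane) : (RepScheme m).Opens :=
  sSup {U | ∀ v : Rep m, point v ∈ U → IsSemistable ξ v}

variable {m}

lemma edgeMatrix_act (g : GaugeGroup m) (v : Rep m) {i j : V} (e : i ⟶ j) :
    edgeMatrix (act g v) e = ((g j)⁻¹ : GL (Fin (m j)) ℂ).val * edgeMatrix v e * (g i).val := rfl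

lemma eval_actRing (g : GaugeGroup m) (v : Rep m) (f : RepRing m) :
    MvPolynomial.eval v (actRing g f) = MvPolynomial.eval (act g v) f := by
  have h : ((MvPolynomial.aeval v : RepRing m →ₐ[ℂ] ℂ).comp (actRing g)) =
      MvPolynomial.aeval (act g v) := by
    refine MvPolynomial.algHom_ext fun x => ?_
    simp [actRing, act, Matrix.mul_apply, edgeMatrix]
  simpa [MvPolynomial.aeval_eq_eval] using DFunLike.congr_fun h f

lemma act_act (g h : GaugeGroup m) (v : Rep m) : act h (act g v) = act (g * h) v := by
  funext x
  change (((h x.tgt)⁻¹ : GL (Fin (m x.tgt)) ℂ).val * edgeMatrix (act g v) x.edge *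
    (h x.src).val) x.row x.col = _
  rw [edgeMatrix_act]
  simp only [act, Pi.mul_apply, mul_inv_rev, Units.val_mul, Matrix.mul_assoc]

lemma act_one (v : Rep m) : act (1 : GaugeGroup m) v = v := by
  funext x
  simp [act, edgeMatrix]

lemma actRing_actRing (g h : GaugeGroup m) (f : RepRing m) :
    actRing g (actRing h f) = actRing (g * h) f := by
  refine MvPolynomial.funext fun v => ?_
  simp only [eval_actRing, act_act]

lemma actRing_one (f : RepRing m) : actRing (1 : GaugeGroup m) f = f := by
  refine MvPolynomial.funext fun v => ?_
  simp only [eval_actRing, act_one]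

lemma actScheme_point (g : GaugeGroup m) (v : Rep m) :
    actScheme g (point v) = point (act g v) := by
  refine PrimeSpectrum.ext (Ideal.ext fun f => ?_)
  change actRing g f ∈ MvPolynomial.vanishingIdeal ℂ {v} ↔
    f ∈ MvPolynomial.vanishingIdeal ℂ {act g v}
  simp [MvPolynomial.mem_vanishingIdeal_iff, MvPolynomial.aeval_eq_eval, eval_actRing]

lemma actScheme_actScheme_inv (g : GaugeGroup m) :
    actScheme g ≫ actScheme g⁻¹ = 𝟙 (RepScheme m) := by
  rw [actScheme, actScheme, ← Spec.map_comp, ← Spec.map_id]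
  congr 1
  refine CommRingCat.hom_ext (RingHom.ext fun f => ?_)
  change actRing g (actRing g⁻¹ f) = f
  rw [actRing_actRing, mul_inv_cancel, actRing_one]

/-- Semistability depends only on the isomorphism class of a representation. -/
lemma IsSemistable.of_act [Fintype V] {ξ : V → UpperHalfPlane} (g : GaugeGroup m) {v : Rep m}
    (hv : IsSemistable ξ (act g v)) : IsSemistable ξ v := by
  intro W hW
  let φ : ∀ i, (Fin (m i) → ℂ) →ₗ[ℂ] (Fin (m i) → ℂ) := fun i =>
    Matrix.mulVecLin ((g i)⁻¹ : GL (Fin (m i)) ℂ).val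
  have hφ : ∀ i x, φ i x = (((g i)⁻¹ : GL (Fin (m i)) ℂ).val).mulVec x := fun i x =>
    Matrix.mulVecLin_apply _ _
  have hinj : ∀ i, Function.Injective (φ i) := fun i =>
    Function.LeftInverse.injective (g := fun x => (g i).val.mulVec x) fun x => by
      simp only [hφ, Matrix.mulVec_mulVec, Units.mul_inv, Matrix.one_mulVec]
  let W' : SubRep (act g v) :=
    { space := fun i => (W.space i).map (φ i)
      map_mem := by
        rintro i j e _ ⟨x, hx, rfl⟩
        refine ⟨(edgeMatrix v e).mulVec x, W.map_mem e x hx, ?_⟩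
        simp only [hφ, edgeMatrix_act, Matrix.mulVec_mulVec,
          Matrix.mul_assoc, Units.mul_inv, Matrix.mul_one] }
  have hW' : ∃ i, W'.space i ≠ ⊥ := by
    obtain ⟨i, hi⟩ := hW
    refine ⟨i, fun h => hi ?_⟩
    exact Submodule.map_injective_of_injective (hinj i) (h.trans (Submodule.map_bot _).symm)
  have hd : ∀ i, Module.finrank ℂ (W'.space i) = Module.finrank ℂ (W.space i) := fun i =>
    (Submodule.equivMapOfInjective (φ i) (hinj i) (W.space i)).finrank_eq.symm
  have := hv W' hW'
  simpa only [hd] using this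

lemma actScheme_inv_apply (g : GaugeGroup m) (x : RepScheme m) :
    actScheme g⁻¹ (actScheme g x) = x := by
  rw [← Scheme.Hom.comp_apply, actScheme_actScheme_inv]
  rfl

lemma semistableLocus_le_preimage [Fintype V] (ξ : V → UpperHalfPlane) (g : GaugeGroup m) :
    semistableLocus m ξ ≤ actScheme g ⁻¹ᵁ semistableLocus m ξ := by
  intro x hx
  obtain ⟨U, hU, hxU⟩ := Opens.mem_sSup.mp hx
  have hx' : actScheme g x ∈ actScheme g⁻¹ ⁻¹ᵁ U := by
    rw [Scheme.Hom.mem_preimage, actScheme_inv_apply]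
    exact hxU
  refine (Scheme.Hom.mem_preimage _).mpr (Opens.mem_sSup.mpr ⟨_, fun v hv => ?_, hx'⟩)
  rw [Scheme.Hom.mem_preimage, actScheme_point] at hv
  exact (hU _ hv).of_act _

/-- The action of a group element on the semistable locus. -/
def locusAct [Fintype V] (ξ : V → UpperHalfPlane) (g : GaugeGroup m) :
    (semistableLocus m ξ).toScheme ⟶ (semistableLocus m ξ).toScheme :=
  (actScheme g).resLE _ _ (semistableLocus_le_preimage ξ g)

variable (m)

/-- The GIT quotient `M_Q^ξ(m)` of the `ξ`-semistable locus by the structure group, together with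
the induced morphism `q : M_Q^ξ(m) ⟶ M_Q(m)`. -/
structure SemistableModuli [Fintype V] (ξ : V → UpperHalfPlane) where
  /-- The scheme `M_Q^ξ(m)`. -/
  space : Scheme.{0}
  /-- The quotient morphism. -/
  proj : (semistableLocus m ξ).toScheme ⟶ space
  isGoodQuotient : IsGoodQuotient (locusAct (m := m) ξ) proj
  /-- The morphism to the affine GIT quotient. -/
  q : space ⟶ Moduli m
  proj_q : proj ≫ q = (semistableLocus m ξ).ι ≫ Moduli.quotientMap m

end QuiverRep

/-! ## Extended quivers -/

/-- The quiver on `V` is symmetric: there are as many edges from `i` to `j` as from `j` to `i`. -/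
def IsSymmetricQuiver (V : Type) [Quiver.{0} V] : Prop :=
  ∀ i j : V, Nat.card (i ⟶ j) = Nat.card (j ⟶ i)

/-- The set of vertices of the extended quiver of the quiver on `V`: the vertices of `V` and one
more vertex `none`, with `a i` edges from `none` to `i`, `b i` edges from `i` to `none`, and `c`
loops at `none`. -/
def ExtQuiver {V : Type} (_a _b : V → ℕ) (_c : ℕ) : Type := Option V

namespace ExtQuiver

variable {V : Type} {a b : V → ℕ} {c : ℕ}

instance [Fintype V] : Fintype (ExtQuiver a b c) := inferInstanceAs (Fintype (Option V))

/-- The additional vertex. -/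
def zero : ExtQuiver a b c := (none : Option V)

/-- The vertices of the given quiver. -/
def vertex (i : V) : ExtQuiver a b c := some i

/-- The edges of the extended quiver. -/
def Edge [Quiver.{0} V] (a b : V → ℕ) (c : ℕ) : Option V → Option V → Type
  | none, none => Fin c
  | none, some i => Fin (a i)
  | some i, none => Fin (b i)
  | some i, some j => i ⟶ j

instance [Quiver.{0} V] : Quiver.{0} (ExtQuiver a b c) where
  Hom := Edge a b c

/-- The extended dimension vector, with entry `1` at the additional vertex. -/
def dimVector (m : V → ℕ) : ExtQuiver a b c → ℕ
  | none => 1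
  | some i => m i

end ExtQuiver

/-!
Let `o` be the additional vertex, of dimension one. If the central charges of the other vertices are
`i`, then a representation is semistable for `Re ξ_o < 0` if and only if the vector at `o` generates
it, and for `Re ξ_o > 0` if and only if no nonzero subrepresentation vanishes at `o`
(`QuiverRep.isSemistable_iff_isGenerated`, `QuiverRep.isSemistable_iff_isCogenerated`).
Transposition exchanges the two conditions, for a quiver and its opposite quiver, so the geometry has
to be studied for generated representations only.

*The quotient.* A path from `o` to `i` gives a vector in `ℂ ^ (d i)`, and a choice of `d i` paths to
each vertex `i` gives a semi-invariant, the product of the determinants of these vectors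
(`QuiverRep.Words.discr`). The locus of generated representations is the union of the sets where one
of these does not vanish, and on each of these sets the chosen vectors, as bases, provide a normal
form. By Hilbert's theorem for groups that are closed under adjoints (`Fischer.fixed_fg`), the
invariants are finitely generated and finitely many semi-invariants span all of them over the
invariants. `ChartSystem` records what is needed of this situation. The semi-invariants map the locus
to a projective space over `M`; the image is a good quotient, and each good quotient arises in this
way: the normal forms are sections of the quotient morphism over affine charts
(`ChartSystem.Locus.exists_sections`, `ChartSystem.Locus.nonempty_sections`). So it is projective
over `M`. If the paths form a tree, which can be achieved locally (`QuiverRep.exists_tree`), then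
the normal forms are an affine space: some entries are zero or one, and the others are free. So the
quotient is smooth.

*The canonical sheaf.* The transition between two of these affine spaces is a change of bases by
invertible matrices `h`. Its Jacobian determinant is, up to sign, the determinant of `h` on the space
of all representations, because the determinant on the Lie algebra is one
(`QuiverRep.exists_jacobian_slices`). This is a product of powers of the determinants `det (h i)`,
where the exponent is the difference of the dimensions of outgoing and incoming arrows. As the given
quiver is symmetric, the exponent is `b i - a i < 0` (`ExtQuiver.flow`). So the Jacobians are inverses
of semi-invariants whose nonvanishing loci are the charts, which makes the anticanonical sheaf ample
(`ChartSystem.Locus.Sections.anticanonicalIsRelAmple`). For the opposite quiver the sign is the other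
one, and the canonical sheaf is ample.

*The direct image of the structure sheaf.* Invariant functions on the locus are polynomials
(`QuiverRep.extendsRegular`), even though the complement of the locus may be a divisor. If such a
function had a pole, then its denominator would be a semi-invariant whose zeros are not generated.
At a zero with the largest generated subrepresentation one contracts to the associated graded
representation. The denominator vanishes on all deformations of that by maps from the generated part
to the quotient, so that, by maximality, these deformations are conjugate to the trivial one. Hence
the representations with such a subrepresentation are dense, and none is generated.

*The diagram.* The semi-invariants of the two loci have opposite weights, so their products are
invariant, and both morphisms to `M` are isomorphisms where such a product does not vanish
(`ChartSystem.Locus.Sections.isBirational`). If the locus for `Re ξ_o > 0` is nonempty, then so is the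
other, since each arrow that starts at a vertex other than `o` can be transposed to a reversed one of
its own (`QuiverRep.exists_isGenerated`).
-/

/-! ### Invariants of self-adjoint families of linear substitutions -/

namespace Fischer

open MvPolynomial

variable {σ : Type} [Fintype σ]

/-- The Fischer inner product on polynomials, conjugate-linear in the first variable: monomials are
orthogonal and `x ^ α` has square norm `α!`. -/
def form (f h : MvPolynomial σ ℂ) : ℂ :=
  ∑ α ∈ f.support, ((∏ i, (α i).factorial : ℕ) : ℂ) * (starRingEnd ℂ (coeff α f) * coeff α h)

lemma form_eq_sum (f h : MvPolynomial σ ℂ) {s : Finset (σ →₀ ℕ)} (hs : f.support ⊆ s) :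
    form f h = ∑ α ∈ s, ((∏ i, (α i).factorial : ℕ) : ℂ) *
      (starRingEnd ℂ (coeff α f) * coeff α h) := by
  refine Finset.sum_subset hs fun α _ hα => ?_
  rw [notMem_support_iff.mp hα]
  simp

lemma form_add_left (f f' h : MvPolynomial σ ℂ) : form (f + f') h = form f h + form f' h := by
  classical
  rw [form_eq_sum (f + f') h (s := f.support ∪ f'.support) support_add,
    form_eq_sum f h (s := f.support ∪ f'.support) Finset.subset_union_left,
    form_eq_sum f' h (s := f.support ∪ f'.support) Finset.subset_union_right,
    ← Finset.sum_add_distrib]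
  refine Finset.sum_congr rfl fun α _ => ?_
  rw [coeff_add, map_add]
  ring

lemma form_C_mul_left (a : ℂ) (f h : MvPolynomial σ ℂ) :
    form (C a * f) h = starRingEnd ℂ a * form f h := by
  rw [form_eq_sum (C a * f) h (s := f.support), form, Finset.mul_sum]
  · refine Finset.sum_congr rfl fun α _ => ?_
    rw [coeff_C_mul, map_mul]
    ring
  · intro α hα
    rw [mem_support_iff, coeff_C_mul] at hα
    exact mem_support_iff.mpr (right_ne_zero_of_mul hα)

lemma form_add_right (f h h' : MvPolynomial σ ℂ) : form f (h + h') = form f h + form f h' := by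
  simp only [form, coeff_add, mul_add, Finset.sum_add_distrib]

lemma form_C_mul_right (a : ℂ) (f h : MvPolynomial σ ℂ) :
    form f (C a * h) = a * form f h := by
  simp only [form, coeff_C_mul, Finset.mul_sum]
  exact Finset.sum_congr rfl fun α _ => by ring

lemma form_sum_right {κ : Type*} (s : Finset κ) (f : MvPolynomial σ ℂ)
    (h : κ → MvPolynomial σ ℂ) : form f (∑ k ∈ s, h k) = ∑ k ∈ s, form f (h k) := by
  classical
  induction s using Finset.induction_on with
  | empty => simp [form]
  | insert k s hk ih => rw [Finset.sum_insert hk, Finset.sum_insert hk, form_add_right, ih]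

lemma form_sum_left {κ : Type*} (s : Finset κ) (f : κ → MvPolynomial σ ℂ)
    (h : MvPolynomial σ ℂ) : form (∑ k ∈ s, f k) h = ∑ k ∈ s, form (f k) h := by
  classical
  induction s using Finset.induction_on with
  | empty => simp [form]
  | insert k s hk ih => rw [Finset.sum_insert hk, Finset.sum_insert hk, form_add_left, ih]

lemma form_conj (f h : MvPolynomial σ ℂ) : starRingEnd ℂ (form h f) = form f h := by
  classical
  rw [form_eq_sum f h (s := f.support ∪ h.support) Finset.subset_union_left,
    form_eq_sum h f (s := f.support ∪ h.support) Finset.subset_union_right, map_sum]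
  refine Finset.sum_congr rfl fun α _ => ?_
  simp only [map_mul, map_natCast, Complex.conj_conj]
  ring

lemma form_self (f : MvPolynomial σ ℂ) : form f f =
    ((∑ α ∈ f.support, ((∏ i, (α i).factorial : ℕ) : ℝ) * Complex.normSq (coeff α f) : ℝ) : ℂ) := by
  rw [form]
  push_cast
  refine Finset.sum_congr rfl fun α _ => ?_
  rw [Complex.normSq_eq_conj_mul_self]

lemma form_self_re_nonneg (f : MvPolynomial σ ℂ) : 0 ≤ (form f f).re := by
  rw [form_self, Complex.ofReal_re]
  exact Finset.sum_nonneg fun α _ => mul_nonneg (Nat.cast_nonneg _) (Complex.normSq_nonneg _)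

lemma eq_zero_of_form_self {f : MvPolynomial σ ℂ} (hf : form f f = 0) : f = 0 := by
  rw [form_self, Complex.ofReal_eq_zero, Finset.sum_eq_zero_iff_of_nonneg
    fun α _ => mul_nonneg (Nat.cast_nonneg _) (Complex.normSq_nonneg _)] at hf
  ext α
  by_cases hα : α ∈ f.support
  · have := hf α hα
    rw [mul_eq_zero, Nat.cast_eq_zero, Complex.normSq_eq_zero] at this
    exact this.resolve_left (Finset.prod_ne_zero_iff.mpr fun i _ => Nat.factorial_ne_zero _)
  · exact notMem_support_iff.mp hα

lemma form_one_left (h : MvPolynomial σ ℂ) : form 1 h = constantCoeff h := by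
  classical
  rw [form_eq_sum 1 h (s := {0}), Finset.sum_singleton, constantCoeff_eq]
  · simp
  · intro α hα
    rw [mem_support_iff, coeff_one] at hα
    simpa using (ne_eq _ _ ▸ hα : ¬ _ = _) |> fun h' => by
      by_contra hne
      exact hα (if_neg fun e => hne (by simp [← e]))

/-- Multiplication by a variable is adjoint to the partial derivative. -/
lemma form_X_mul_left (i : σ) (f h : MvPolynomial σ ℂ) :
    form (X i * f) h = form f (pderiv i h) := by
  classical
  rw [form_eq_sum (X i * f) h (s := f.support.map (addLeftEmbedding (Finsupp.single i 1))),
    Finset.sum_map, form]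
  · refine Finset.sum_congr rfl fun α _ => ?_
    rw [addLeftEmbedding_apply, coeff_X_mul, coeff_pderiv, add_comm α]
    have : (∏ k, ((Finsupp.single i 1 + α : σ →₀ ℕ) k).factorial) =
        (α i + 1) * ∏ k, (α k).factorial := by
      rw [← Finset.mul_prod_erase _ _ (Finset.mem_univ i),
        ← Finset.mul_prod_erase _ (fun k => (α k).factorial) (Finset.mem_univ i), ← mul_assoc]
      congr 1
      · simp [add_comm 1, Nat.factorial_succ]
      · refine Finset.prod_congr rfl fun k hk => ?_
        simp [(Finset.ne_of_mem_erase hk).symm]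
    rw [this]
    push_cast
    ring
  · rw [support_X_mul]

/-- The linear substitution `X i ↦ ∑ j, M i j X j`. -/
def subst (M : Matrix σ σ ℂ) : MvPolynomial σ ℂ →ₐ[ℂ] MvPolynomial σ ℂ :=
  aeval fun i => ∑ j, C (M i j) * X j

lemma subst_X (M : Matrix σ σ ℂ) (i : σ) : subst M (X i) = ∑ j, C (M i j) * X j :=
  aeval_X _ _

lemma pderiv_subst (M : Matrix σ σ ℂ) (i : σ) (h : MvPolynomial σ ℂ) :
    pderiv i (subst M h) = ∑ j, C (M j i) * subst M (pderiv j h) := by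
  classical
  induction h using MvPolynomial.induction_on with
  | C a => simp [subst]
  | add p q hp hq => simp only [map_add, hp, hq, mul_add, Finset.sum_add_distrib]
  | mul_X p k hp =>
    rw [map_mul, Derivation.leibniz, hp, subst_X]
    have h1 : pderiv i (∑ j, C (M k j) * X j : MvPolynomial σ ℂ) = C (M k i) := by
      rw [map_sum, Finset.sum_eq_single i]
      · simp
      · intro j _ hj
        simp [pderiv_X_of_ne hj]
      · simp
    have h2 : ∀ j, C (M j i) * subst M (pderiv j (p * X k)) =
        C (M j i) * (subst M p * C (Pi.single (M := fun _ => ℂ) j 1 k)) +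
          (∑ l, C (M k l) * X l) * (C (M j i) * subst M (pderiv j p)) := by
      intro j
      rw [Derivation.leibniz, map_add, smul_eq_mul, smul_eq_mul, map_mul, map_mul, subst_X,
        pderiv_X]
      rcases eq_or_ne j k with rfl | hjk
      · simp; ring
      · simp [Pi.single_eq_of_ne hjk.symm]; ring
    simp only [h2, Finset.sum_add_distrib, ← Finset.mul_sum, h1, smul_eq_mul]
    congr 1
    rw [Finset.sum_eq_single k]
    · simp; ring
    · intro j _ hj
      simp [Pi.single_eq_of_ne hj.symm]
    · simp

lemma constantCoeff_subst (M : Matrix σ σ ℂ) (h : MvPolynomial σ ℂ) :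
    constantCoeff (subst M h) = constantCoeff h := by
  induction h using MvPolynomial.induction_on with
  | C a => simp [subst]
  | add p q hp hq => simp only [map_add, hp, hq]
  | mul_X p k hp => simp [subst_X]

/-- The substitutions by a matrix and by its conjugate transpose are adjoint. -/
lemma form_subst_left (M : Matrix σ σ ℂ) (f h : MvPolynomial σ ℂ) :
    form (subst M f) h = form f (subst M.conjTranspose h) := by
  induction f using MvPolynomial.induction_on generalizing h with
  | C a =>
    have h1 : (C a : MvPolynomial σ ℂ) = C a * 1 := by rw [mul_one]
    have h2 : subst M (C a) = C a * 1 := by simp [subst]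
    rw [h2, form_C_mul_left, h1, form_C_mul_left, form_one_left, form_one_left,
      constantCoeff_subst]
  | add p q hp hq => rw [map_add, form_add_left, form_add_left, hp, hq]
  | mul_X p k hp =>
    rw [map_mul, subst_X, mul_comm p, mul_comm, Finset.sum_mul, form_sum_left, form_X_mul_left,
      pderiv_subst, form_sum_right]
    refine Finset.sum_congr rfl fun j _ => ?_
    rw [mul_assoc, form_C_mul_left, form_X_mul_left, hp, form_C_mul_right,
      Matrix.conjTranspose_apply]
    rfl

/-- Multiplication by a polynomial has an adjoint. -/
lemma exists_adjoint_mul (a : MvPolynomial σ ℂ) :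
    ∃ T : MvPolynomial σ ℂ → MvPolynomial σ ℂ, ∀ f h, form (a * f) h = form f (T h) := by
  induction a using MvPolynomial.induction_on with
  | C a => exact ⟨fun h => C (starRingEnd ℂ a) * h, fun f h => by
      rw [form_C_mul_left, form_C_mul_right]⟩
  | add p q hp hq =>
    obtain ⟨T, hT⟩ := hp
    obtain ⟨T', hT'⟩ := hq
    exact ⟨fun h => T h + T' h, fun f h => by
      rw [add_mul, form_add_left, form_add_right, hT, hT']⟩
  | mul_X p k hp =>
    obtain ⟨T, hT⟩ := hp
    exact ⟨fun h => pderiv k (T h), fun f h => by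
      rw [mul_assoc, hT, form_X_mul_left]⟩

lemma eq_of_form_eq {f h : MvPolynomial σ ℂ} (H : ∀ x, form x f = form x h) : f = h := by
  have h1 : form (f - h) (f + C (-1) * h) = 0 := by
    rw [form_add_right, form_C_mul_right, H]
    ring
  have h2 : f + C (-1) * h = f - h := by simp [sub_eq_add_neg]
  rw [h2] at h1
  exact sub_eq_zero.mp (eq_zero_of_form_self h1)

/-- Orthogonal projection onto a finite dimensional space of polynomials. -/
lemma exists_orthogonal (H : Submodule ℂ (MvPolynomial σ ℂ)) [FiniteDimensional ℂ H]
    (b : MvPolynomial σ ℂ) : ∃ b' ∈ H, ∀ h ∈ H, form (b - b') h = 0 := by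
  let core : InnerProductSpace.Core ℂ (MvPolynomial σ ℂ) :=
    { inner := form
      conj_inner_symm := fun f h => form_conj f h
      re_inner_nonneg := form_self_re_nonneg
      add_left := form_add_left
      smul_left := fun f h r => by rw [← C_mul', form_C_mul_left]
      definite := fun f => eq_zero_of_form_self }
  let _ : NormedAddCommGroup (MvPolynomial σ ℂ) := core.toNormedAddCommGroup
  let _ : InnerProductSpace ℂ (MvPolynomial σ ℂ) := InnerProductSpace.ofCore core.toCore
  obtain ⟨y, hy, z, hz, rfl⟩ := H.exists_add_mem_mem_orthogonal b
  refine ⟨y, hy, fun h hh => ?_⟩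
  rw [add_sub_cancel_left]
  exact (Submodule.mem_orthogonal' H z).mp hz h hh

section Invariants

variable {G : Type} (M : G → Matrix σ σ ℂ)

lemma subst_homogeneousComponent (N : Matrix σ σ ℂ) (n : ℕ) (f : MvPolynomial σ ℂ) :
    subst N (homogeneousComponent n f) = homogeneousComponent n (subst N f) := by
  have key : ∀ k (p : MvPolynomial σ ℂ), p.IsHomogeneous k → (subst N p).IsHomogeneous k := by
    intro k p hp
    have := hp.aeval (S := ℂ) (n := 1) (fun i => ∑ j, C (N i j) * X j) fun i =>
      IsHomogeneous.sum _ _ _ fun j _ => by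
        simpa using (isHomogeneous_C σ (N i j)).mul (isHomogeneous_X ℂ j)
    simpa [subst] using this
  conv_rhs => rw [← sum_homogeneousComponent f, map_sum, map_sum]
  rw [Finset.sum_congr rfl fun k _ => (homogeneousComponent_of_mem
    (key k _ (homogeneousComponent_isHomogeneous k f)) : homogeneousComponent n _ = _)]
  rw [Finset.sum_ite_eq]
  split_ifs with h
  · rfl
  · rw [homogeneousComponent_eq_zero n f (by simpa using h), map_zero]

/-- The polynomials that are fixed by all the substitutions. -/
def fixed : Subalgebra ℂ (MvPolynomial σ ℂ) := ⨅ g, AlgHom.equalizer (subst (M g)) (AlgHom.id _ _)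

variable {M}

lemma mem_fixed {f : MvPolynomial σ ℂ} : f ∈ fixed M ↔ ∀ g, subst (M g) f = f := by
  simp [fixed, Algebra.mem_iInf, AlgHom.mem_equalizer]

lemma homogeneousComponent_mem_fixed {f : MvPolynomial σ ℂ} (hf : f ∈ fixed M) (n : ℕ) :
    homogeneousComponent n f ∈ fixed M :=
  mem_fixed.mpr fun g => by rw [subst_homogeneousComponent, mem_fixed.mp hf]

lemma form_homogeneous_eq_zero {f h : MvPolynomial σ ℂ} {m n : ℕ} (hf : f.IsHomogeneous m)
    (hh : h.IsHomogeneous n) (hmn : m ≠ n) : form f h = 0 := by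
  refine Finset.sum_eq_zero fun α hα => ?_
  by_cases h0 : coeff α h = 0
  · simp [h0]
  · exact absurd ((hf (mem_support_iff.mp hα)).symm.trans (hh h0)) hmn

lemma exists_fixed_orthogonal (b : MvPolynomial σ ℂ) :
    ∃ b' ∈ fixed M, ∀ h ∈ fixed M, form (b - b') h = 0 := by
  -- the homogeneous components of `b` can be projected one by one
  have hom : ∀ n (b : MvPolynomial σ ℂ), b.IsHomogeneous n →
      ∃ b' ∈ fixed M, ∀ h ∈ fixed M, form (b - b') h = 0 := by
    intro n b hb
    let H : Submodule ℂ (MvPolynomial σ ℂ) :=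
      Subalgebra.toSubmodule (fixed M) ⊓ homogeneousSubmodule σ ℂ n
    have hfin : FiniteDimensional ℂ (homogeneousSubmodule σ ℂ n) := by
      have hle : homogeneousSubmodule σ ℂ n ≤ restrictTotalDegree σ ℂ n := fun p hp =>
        (mem_restrictTotalDegree σ n p).mpr (IsHomogeneous.totalDegree_le hp)
      exact Submodule.finiteDimensional_of_le hle
    have : FiniteDimensional ℂ H := Submodule.finiteDimensional_of_le inf_le_right
    obtain ⟨b', hb', horth⟩ := exists_orthogonal H b
    refine ⟨b', hb'.1, fun h hh => ?_⟩
    have hbb : (b - b').IsHomogeneous n := hb.sub hb'.2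
    rw [← sum_homogeneousComponent h, form_sum_right]
    refine Finset.sum_eq_zero fun k _ => ?_
    rcases eq_or_ne n k with rfl | hk
    · exact horth _ ⟨homogeneousComponent_mem_fixed hh n, homogeneousComponent_isHomogeneous n h⟩
    · exact form_homogeneous_eq_zero hbb (homogeneousComponent_isHomogeneous k h) hk
  choose p hp hporth using fun n => hom n _ (homogeneousComponent_isHomogeneous n b)
  refine ⟨∑ n ∈ Finset.range (b.totalDegree + 1), p n, sum_mem fun n _ => hp n, fun h hh => ?_⟩
  have hb : b - ∑ n ∈ Finset.range (b.totalDegree + 1), p n =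
      ∑ n ∈ Finset.range (b.totalDegree + 1), (homogeneousComponent n b - p n) := by
    rw [Finset.sum_sub_distrib, sum_homogeneousComponent]
  rw [hb, form_sum_left]
  exact Finset.sum_eq_zero fun n _ => hporth n h hh

/-- For a family of substitutions that is closed under conjugate transposition, the coefficients
of an invariant combination of invariants can be taken invariant: orthogonal projection onto the
invariants commutes with multiplication by an invariant. -/
lemma exists_fixed_coeff (hM : ∀ g, ∃ g', M g' = (M g).conjTranspose) {κ : Type*} (s : Finset κ)
    (a b : κ → MvPolynomial σ ℂ) (ha : ∀ k ∈ s, a k ∈ fixed M)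
    (hab : ∑ k ∈ s, a k * b k ∈ fixed M) :
    ∃ b' : κ → MvPolynomial σ ℂ, (∀ k, b' k ∈ fixed M) ∧
      ∑ k ∈ s, a k * b k = ∑ k ∈ s, a k * b' k := by
  choose b' hb' horth using fun k => exists_fixed_orthogonal (M := M) (b k)
  refine ⟨b', hb', ?_⟩
  have hdiff : ∑ k ∈ s, a k * b k - ∑ k ∈ s, a k * b' k = ∑ k ∈ s, a k * (b k - b' k) := by
    simp only [mul_sub, Finset.sum_sub_distrib]
  have hmem : ∑ k ∈ s, a k * (b k - b' k) ∈ fixed M :=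
    hdiff ▸ sub_mem hab (sum_mem fun k hk => mul_mem (ha k hk) (hb' k))
  refine sub_eq_zero.mp (hdiff.trans (eq_zero_of_form_self ?_))
  conv_lhs => rw [form_sum_left]
  refine Finset.sum_eq_zero fun k hk => ?_
  obtain ⟨T, hT⟩ := exists_adjoint_mul (a k)
  rw [hT]
  refine horth k _ (mem_fixed.mpr fun g => eq_of_form_eq fun x => ?_)
  obtain ⟨g', hg'⟩ := hM g
  have h1 : ∀ x y, form x (subst (M g) y) = form (subst (M g') x) y := fun x y => by
    rw [form_subst_left, hg', Matrix.conjTranspose_conjTranspose]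
  rw [h1, ← hT, ← hT, ← mem_fixed.mp (ha k hk) g', ← map_mul, ← h1, mem_fixed.mp hmem g,
    mem_fixed.mp (ha k hk) g']

/-- Hilbert's finiteness theorem. -/
lemma fixed_fg (hM : ∀ g, ∃ g', M g' = (M g).conjTranspose) : (fixed M).FG := by
  let P : Set (MvPolynomial σ ℂ) := {f | f ∈ fixed M ∧ ∃ n, 0 < n ∧ f.IsHomogeneous n}
  -- finitely many of the homogeneous invariants of positive degree generate their ideal
  obtain ⟨s, hsP, hs⟩ := Submodule.fg_span_iff_fg_span_finset_subset P |>.mp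
    (IsNoetherian.noetherian (Submodule.span (MvPolynomial σ ℂ) P))
  refine ⟨s, le_antisymm (Algebra.adjoin_le fun f hf => (hsP hf).1) ?_⟩
  have key : ∀ n (f : MvPolynomial σ ℂ), f ∈ fixed M → f.IsHomogeneous n →
      f ∈ Algebra.adjoin ℂ (s : Set (MvPolynomial σ ℂ)) := by
    intro n
    induction n using Nat.strong_induction_on with
    | _ n ih =>
    intro f hf hfn
    rcases Nat.eq_zero_or_pos n with rfl | hn
    · have : f = C (coeff 0 f) := by
        rw [← totalDegree_eq_zero_iff_eq_C]
        exact (totalDegree_zero_iff_isHomogeneous σ).mpr hfn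
      rw [this]
      exact Subalgebra.algebraMap_mem _ _
    · have hfs : f ∈ Submodule.span (MvPolynomial σ ℂ) (s : Set (MvPolynomial σ ℂ)) :=
        hs ▸ Submodule.subset_span ⟨hf, n, hn, hfn⟩
      obtain ⟨c, hc⟩ := Submodule.mem_span_finset'.mp hfs
      have hc' : f = ∑ k ∈ s.attach, k.1 * c k := by
        rw [← hc, Finset.univ_eq_attach]
        exact Finset.sum_congr rfl fun k _ => by rw [smul_eq_mul, mul_comm]
      -- by the self-adjointness, the coefficients may be chosen invariant; their homogeneous
      -- components of smaller degree are dealt with by induction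
      obtain ⟨b, hb, hfb⟩ := exists_fixed_coeff hM s.attach (fun k => k.1) c
        (fun k _ => (hsP k.2).1) (hc' ▸ hf)
      choose d hd0 hd using fun k : s => (hsP k.2).2
      have hf' : f = ∑ k ∈ s.attach, homogeneousComponent n (k.1 * b k) := by
        rw [← map_sum, ← hfb, ← hc', homogeneousComponent_of_mem hfn, if_pos rfl]
      rw [hf']
      refine sum_mem fun k _ => ?_
      by_cases hdn : d k ≤ n
      · have : homogeneousComponent n (k.1 * b k) =
            k.1 * homogeneousComponent (n - d k) (b k) := by
          conv_lhs => rw [← sum_homogeneousComponent (b k), Finset.mul_sum, map_sum]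
          rw [Finset.sum_congr rfl fun j _ => (homogeneousComponent_of_mem
            ((hd k).mul (homogeneousComponent_isHomogeneous j (b k))) :
            homogeneousComponent n _ = _)]
          have hif : ∀ j, (if n = d k + j then k.1 * homogeneousComponent j (b k) else 0) =
              if n - d k = j then k.1 * homogeneousComponent j (b k) else 0 := fun j =>
            if_congr (by omega) rfl rfl
          rw [Finset.sum_congr rfl fun j _ => hif j, Finset.sum_ite_eq]
          split_ifs with h
          · rfl
          · rw [homogeneousComponent_eq_zero (n - d k) (b k) (by
              rw [Finset.mem_range] at h; omega), mul_zero]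
        rw [this]
        refine mul_mem (Algebra.subset_adjoin k.2) (ih (n - d k) ?_ _
          (homogeneousComponent_mem_fixed (hb k) _) (homogeneousComponent_isHomogeneous _ _))
        have := hd0 k
        omega
      · have : homogeneousComponent n (k.1 * b k) = 0 := by
          conv_lhs => rw [← sum_homogeneousComponent (b k), Finset.mul_sum, map_sum]
          refine Finset.sum_eq_zero fun j _ => ?_
          rw [homogeneousComponent_of_mem
            ((hd k).mul (homogeneousComponent_isHomogeneous j (b k))), if_neg (by omega)]
        rw [this]
        exact zero_mem _
  intro f hf
  rw [← sum_homogeneousComponent f]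
  exact sum_mem fun n _ => key n _ (homogeneousComponent_mem_fixed hf n)
    (homogeneousComponent_isHomogeneous n f)

/-- A family of semi-invariants of the same weight spans a finitely generated module over the
invariants: the products with a variable of the opposite weight are invariants. -/
lemma exists_finset_span_semiInvariants (χ : G → ℂ) (hχ : ∀ g, χ g ≠ 0)
    (hM : ∀ g, ∃ g', M g' = (M g).conjTranspose ∧ χ g' = starRingEnd ℂ (χ g)) {I : Type}
    (F : I → MvPolynomial σ ℂ) (hF : ∀ g i, subst (M g) (F i) = C (χ g) * F i) :
    ∃ s : Finset I, ∀ i, ∃ c : I → MvPolynomial σ ℂ, (∀ k, c k ∈ fixed M) ∧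
      F i = ∑ k ∈ s, c k * F k := by
  classical
  -- the action on polynomials with one more variable, of weight inverse to `χ`
  let M' : G → Matrix (Option σ) (Option σ) ℂ := fun g => Matrix.of fun i j =>
    match i, j with
    | none, none => (χ g)⁻¹
    | some i, some j => M g i j
    | _, _ => 0
  have hM' : ∀ g, ∃ g', M' g' = (M' g).conjTranspose := by
    intro g
    obtain ⟨g', h1, h2⟩ := hM g
    refine ⟨g', ?_⟩
    ext i j
    rcases i with _ | i <;> rcases j with _ | j <;>
      simp [M', h1, h2, Matrix.conjTranspose_apply]
  have hren : ∀ g f, subst (M' g) (rename some f) = rename some (subst (M g) f) := by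
    intro g f
    refine DFunLike.congr_fun (f := (subst (M' g)).comp (rename some))
      (g := (rename some).comp (subst (M g))) (algHom_ext fun i => ?_) f
    simp [subst_X, M']
  -- setting the additional variable to zero is equivariant
  let ev : MvPolynomial (Option σ) ℂ →ₐ[ℂ] MvPolynomial σ ℂ :=
    aeval fun i => i.elim 0 X
  have hev : ∀ g f, ev (subst (M' g) f) = subst (M g) (ev f) := by
    intro g f
    refine DFunLike.congr_fun (f := ev.comp (subst (M' g)))
      (g := (subst (M g)).comp ev) (algHom_ext fun i => ?_) f
    rcases i with _ | i <;> simp [subst_X, M', ev]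
  have hevren : ∀ f, ev (rename some f) = f := by
    intro f
    refine DFunLike.congr_fun (f := ev.comp (rename some)) (g := AlgHom.id ℂ _)
      (algHom_ext fun i => ?_) f
    simp [ev]
  let P : I → MvPolynomial (Option σ) ℂ := fun i => X none * rename some (F i)
  have hP : ∀ i, P i ∈ fixed M' := fun i => mem_fixed.mpr fun g => by
    simp only [P, map_mul, hren, hF, subst_X, Fintype.sum_option]
    simp only [M', Matrix.of_apply, map_zero, zero_mul, Finset.sum_const_zero, add_zero,
      rename_C]
    calc C (χ g)⁻¹ * X none * (C (χ g) * rename some (F i)) =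
        C ((χ g)⁻¹ * χ g) * (X none * rename some (F i)) := by rw [map_mul]; ring
      _ = _ := by rw [inv_mul_cancel₀ (hχ g), map_one, one_mul]
  obtain ⟨t, htP, ht⟩ := Submodule.fg_span_iff_fg_span_finset_subset (Set.range P) |>.mp
    (IsNoetherian.noetherian (Submodule.span (MvPolynomial (Option σ) ℂ) (Set.range P)))
  obtain ⟨s, hs⟩ : ∃ s : Finset I, (t : Set _) ⊆ P '' s := by
    obtain ⟨s, -, hs⟩ := Finset.subset_set_image_iff.mp
      (show (t : Set _) ⊆ P '' Set.univ by rwa [Set.image_univ])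
    exact ⟨s, by rw [← hs]; simp⟩
  refine ⟨s, fun i => ?_⟩
  have hi : P i ∈ Submodule.span (MvPolynomial (Option σ) ℂ) (P '' s) :=
    Submodule.span_mono hs (ht ▸ Submodule.subset_span ⟨i, rfl⟩)
  obtain ⟨c, hc⟩ := (Submodule.mem_span_image_finset_iff_exists_fun _).mp hi
  let c' : I → MvPolynomial (Option σ) ℂ := fun k => if h : k ∈ s then c ⟨k, h⟩ else 0
  have hc' : P i = ∑ k ∈ s, P k * c' k := by
    rw [← hc, ← Finset.sum_coe_sort s]
    exact Finset.sum_congr rfl fun k _ => by simp [c', mul_comm]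
  obtain ⟨b, hb, hPb⟩ := exists_fixed_coeff hM' s P c' (fun k _ => hP k) (hc' ▸ hP i)
  have h1 : rename some (F i) = ∑ k ∈ s, rename some (F k) * b k := by
    refine mul_left_cancel₀ (X_ne_zero (R := ℂ) (none : Option σ)) ?_
    rw [Finset.mul_sum]
    simp only [← mul_assoc]
    exact hc'.trans hPb
  refine ⟨fun k => ev (b k), fun k => mem_fixed.mpr fun g => ?_, ?_⟩
  · rw [← hev, mem_fixed.mp (hb k)]
  · rw [← hevren (F i), h1, map_sum]
    exact Finset.sum_congr rfl fun k _ => by rw [map_mul, hevren, mul_comm]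

end Invariants

end Fischer

/-! ### Schemes with enough complex points -/

/-- The unique point of `Spec ℂ`. -/
def specCPoint : SpecC := default

/-- A set of `ℂ`-points is dense if it meets each nonempty locally closed subset. -/
def DensePoints {X : Scheme.{0}} (P : Set (SpecC ⟶ X)) : Prop :=
  ∀ Z : Set X, IsLocallyClosed Z → Z.Nonempty → ∃ p ∈ P, p specCPoint ∈ Z

lemma specC_mem_iff {X : Scheme.{0}} (p : SpecC ⟶ X) (U : X.Opens) :
    p ⁻¹ᵁ U = ⊤ ↔ p specCPoint ∈ U := by
  constructor
  · intro h
    have : specCPoint ∈ p ⁻¹ᵁ U := h ▸ trivial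
    exact this
  · intro h
    ext x
    rw [Subsingleton.elim x specCPoint]
    exact ⟨fun _ => trivial, fun _ => h⟩

/-- The value of a section at a `ℂ`-point. -/
lemma value_eq_zero_iff {X : Scheme.{0}} {U : X.Opens} (t : Γ(X, U)) (p : SpecC ⟶ X)
    (h : p ⁻¹ᵁ U = ⊤) : p.appLE U ⊤ h.ge t = 0 ↔ p specCPoint ∉ X.basicOpen t := by
  rw [← basicOpen_eq_bot_iff, Scheme.basicOpen_appLE, top_inf_eq]
  constructor
  · intro h1 h2
    rw [(specC_mem_iff p _).mpr h2] at h1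
    have h3 : specCPoint ∈ (⊤ : SpecC.Opens) := trivial
    rw [h1] at h3
    exact h3
  · intro h1
    ext x
    rw [Subsingleton.elim x specCPoint]
    exact ⟨fun h2 => (h1 h2).elim, fun h2 => h2.elim⟩

lemma hom_ext_of_appLE {X W : Scheme.{0}} {a b : X ⟶ W} (hab : ∀ x, a x = b x)
    (H : ∀ (U : W.Opens) (h : a ⁻¹ᵁ U = b ⁻¹ᵁ U), IsAffineOpen U →
      a.appLE U (a ⁻¹ᵁ U) le_rfl = b.appLE U (a ⁻¹ᵁ U) h.le) : a = b := by
  have hU : ∀ U : W.Opens, a ⁻¹ᵁ U = b ⁻¹ᵁ U := fun U => by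
    ext x
    change a x ∈ U ↔ b x ∈ U
    rw [hab]
  have hcov : IsOpenCover fun U : W.affineOpens => a ⁻¹ᵁ U.1 := by
    rw [IsOpenCover, eq_top_iff]
    intro x _
    obtain ⟨U, hU, hx, -⟩ := exists_isAffineOpen_mem_and_subset (x := a x) (U := ⊤) trivial
    exact Opens.mem_iSup.mpr ⟨⟨U, hU⟩, hx⟩
  refine (X.openCoverOfIsOpenCover _ hcov).hom_ext _ _ fun U => ?_
  change (a ⁻¹ᵁ U.1).ι ≫ a = (a ⁻¹ᵁ U.1).ι ≫ b
  rw [← Scheme.Hom.resLE_comp_ι a (le_refl (a ⁻¹ᵁ U.1)), ← Scheme.Hom.resLE_comp_ι b (hU U.1).le]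
  congr 1
  have : IsAffine U.1.toScheme := U.2
  refine ext_of_isAffine ?_
  rw [Scheme.Hom.appTop, Scheme.Hom.appTop, Scheme.Hom.resLE_app_top, Scheme.Hom.resLE_app_top,
    H U.1 (hU _) U.2]

namespace DensePoints

variable {X : Scheme.{0}} {P : Set (SpecC ⟶ X)} (hP : DensePoints P)

include hP

lemma opens_le {U V : X.Opens} (h : ∀ p ∈ P, p specCPoint ∈ U → p specCPoint ∈ V) : U ≤ V := by
  by_contra hUV
  obtain ⟨x, hxU, hxV⟩ := Set.not_subset.mp hUV
  obtain ⟨p, hp, hpU, hpV⟩ := hP ((U : Set X) \ V)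
    (U.2.isLocallyClosed.inter (isClosed_compl_iff.mpr V.2).isLocallyClosed) ⟨x, hxU, hxV⟩
  exact hpV (h p hp hpU)

lemma section_eq_zero [AlgebraicGeometry.IsReduced X] {U : X.Opens} {t : Γ(X, U)}
    (h : ∀ p ∈ P, ∀ h : p ⁻¹ᵁ U = ⊤, p.appLE U ⊤ h.ge t = 0) : t = 0 := by
  rw [← basicOpen_eq_bot_iff, eq_bot_iff]
  refine hP.opens_le fun p hp hpt => ?_
  have hU : p ⁻¹ᵁ U = ⊤ := (specC_mem_iff p U).mpr (X.basicOpen_le t hpt)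
  exact absurd hpt ((value_eq_zero_iff t p hU).mp (h p hp hU))

lemma section_ext [AlgebraicGeometry.IsReduced X] {U : X.Opens} {t t' : Γ(X, U)}
    (h : ∀ p ∈ P, ∀ h : p ⁻¹ᵁ U = ⊤, p.appLE U ⊤ h.ge t = p.appLE U ⊤ h.ge t') : t = t' :=
  sub_eq_zero.mp (hP.section_eq_zero fun p hp hU => by rw [map_sub, h p hp hU, sub_self])

/-- Two morphisms from a reduced scheme, to a scheme that need not be separated, are equal if they
agree on a dense set of `ℂ`-points. -/
lemma hom_ext [AlgebraicGeometry.IsReduced X] {W : Scheme.{0}} {a b : X ⟶ W}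
    (h : ∀ p ∈ P, p ≫ a = p ≫ b) : a = b := by
  have hpt : ∀ p ∈ P, a (p specCPoint) = b (p specCPoint) := fun p hp => by
    rw [← Scheme.Hom.comp_apply, ← Scheme.Hom.comp_apply, h p hp]
  have hU : ∀ U : W.Opens, a ⁻¹ᵁ U = b ⁻¹ᵁ U := by
    intro U
    refine le_antisymm (hP.opens_le fun p hp hpU => ?_) (hP.opens_le fun p hp hpU => ?_)
    · change b _ ∈ U
      rw [← hpt p hp]
      exact hpU
    · change a _ ∈ U
      rw [hpt p hp]
      exact hpU
  refine hom_ext_of_appLE (fun x => ?_) fun U hU' _ => ?_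
  · refine Inseparable.eq (inseparable_iff_forall_isOpen.mpr fun U hUo => ?_)
    have := SetLike.ext_iff.mp (hU ⟨U, hUo⟩) x
    exact this
  · ext t
    refine hP.section_ext fun p hp hpU => ?_
    rw [← CommRingCat.comp_apply, ← CommRingCat.comp_apply, Scheme.Hom.appLE_comp_appLE,
      Scheme.Hom.appLE_comp_appLE]
    simp only [h p hp]

lemma opens (U : X.Opens) : DensePoints {p : SpecC ⟶ U.toScheme | p ≫ U.ι ∈ P} := by
  intro Z hZ hne
  obtain ⟨p, hp, z, hz, hpz⟩ := hP (U.ι '' Z)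
    (hZ.image U.ι.isOpenEmbedding.isInducing (by
      rw [Scheme.Opens.range_ι]
      exact U.2.isLocallyClosed)) (hne.image _)
  have hr : Set.range p ⊆ Set.range U.ι := by
    rintro _ ⟨y, rfl⟩
    rw [Subsingleton.elim y specCPoint, ← hpz]
    exact ⟨z, rfl⟩
  refine ⟨IsOpenImmersion.lift U.ι p hr, ?_, ?_⟩
  · change _ ≫ _ ∈ P
    rwa [IsOpenImmersion.lift_fac]
  · have : U.ι (IsOpenImmersion.lift U.ι p hr specCPoint) = U.ι z := by
      rw [← Scheme.Hom.comp_apply, IsOpenImmersion.lift_fac, hpz]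
    rwa [U.ι.isOpenEmbedding.injective this]

end DensePoints

/-- A surjective morphism that is injective on functions is an epimorphism. -/
lemma cancel_of_surjective_of_injective {X Y : Scheme.{0}} (f : X ⟶ Y)
    (hf : Function.Surjective f) (hf' : ∀ U, Function.Injective (f.app U)) {W : Scheme.{0}}
    {a b : Y ⟶ W} (h : f ≫ a = f ≫ b) : a = b := by
  refine hom_ext_of_appLE (fun y => ?_) fun U hU _ => ?_
  · obtain ⟨x, rfl⟩ := hf y
    rw [← Scheme.Hom.comp_apply, h, Scheme.Hom.comp_apply]
  · ext t
    refine hf' _ ?_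
    rw [Scheme.Hom.app_eq_appLE, ← CommRingCat.comp_apply, ← CommRingCat.comp_apply,
      Scheme.Hom.appLE_comp_appLE, Scheme.Hom.appLE_comp_appLE]
    simp only [h]

/-- A morphism to an affine scheme that is injective on global functions is left cancellable
against morphisms to affine schemes. -/
lemma cancel_of_isAffine {X Y : Scheme.{0}} (f : X ⟶ Y)
    (hf : Function.Injective f.appTop) {W : Scheme.{0}} [IsAffine W]
    {a b : Y ⟶ W} (h : f ≫ a = f ≫ b) : a = b := by
  refine ext_of_isAffine ?_
  ext t
  refine hf ?_
  rw [← CommRingCat.comp_apply, ← CommRingCat.comp_apply, ← Scheme.Hom.comp_appTop,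
    ← Scheme.Hom.comp_appTop, h]

/-! ### Morphisms to affine space -/

section AffineSpace

variable {σ : Type}

/-- Affine space with coordinates indexed by `σ`. -/
abbrev AffSp (σ : Type) : Scheme.{0} := Spec (CommRingCat.of (MvPolynomial σ ℂ))

/-- The `ℂ`-point of affine space with coordinates `v`. -/
def affPt (v : σ → ℂ) : SpecC ⟶ AffSp σ :=
  Spec.map (CommRingCat.ofHom (MvPolynomial.aeval (R := ℂ) v).toRingHom)

lemma affPt_mem_basicOpen (v : σ → ℂ) (f : MvPolynomial σ ℂ) :
    affPt v specCPoint ∈ (PrimeSpectrum.basicOpen f : (AffSp σ).Opens) ↔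
      MvPolynomial.eval v f ≠ 0 := by
  change MvPolynomial.aeval v f ∉ (specCPoint : PrimeSpectrum ℂ).asIdeal ↔ _
  have : (specCPoint : PrimeSpectrum ℂ).asIdeal = ⊥ :=
    (Ideal.eq_bot_or_top _).resolve_right (specCPoint : PrimeSpectrum ℂ).2.ne_top
  rw [this, Ideal.mem_bot, MvPolynomial.aeval_eq_eval]

/-- The `ℂ`-points of affine space are dense. -/
lemma densePoints_affSp [Finite σ] : DensePoints (Set.range (affPt (σ := σ))) := by
  rintro Z ⟨U, C, hU, hC, rfl⟩ ⟨x, hxU, hxC⟩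
  obtain ⟨_, ⟨f, rfl⟩, hxf, hfU⟩ :=
    PrimeSpectrum.isTopologicalBasis_basic_opens.exists_subset_of_mem_open hxU hU
  obtain ⟨I, rfl⟩ := (PrimeSpectrum.isClosed_iff_zeroLocus_ideal C).mp hC
  by_contra hcon
  have key : f ∈ I.radical := by
    rw [← MvPolynomial.vanishingIdeal_zeroLocus_eq_radical (K := ℂ),
      MvPolynomial.mem_vanishingIdeal_iff]
    intro v hv
    by_contra hfv
    refine hcon ⟨affPt v, ⟨v, rfl⟩, hfU ((affPt_mem_basicOpen v f).mpr (by
      rwa [MvPolynomial.aeval_eq_eval] at hfv)), ?_⟩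
    intro g hg
    by_contra hgv
    exact (affPt_mem_basicOpen v g).mp hgv (by
      have := (MvPolynomial.mem_zeroLocus_iff).mp hv g hg
      rwa [MvPolynomial.aeval_eq_eval] at this)
  exact hxf (x.2.radical_le_iff.mpr hxC key)

/-- The morphism to an affine scheme that is given by a ring homomorphism. -/
def toSpecOf {T : Scheme.{0}} {R : Type} [CommRing R] (f : R →+* Γ(T, ⊤)) :
    T ⟶ Spec (CommRingCat.of R) :=
  T.toSpecΓ ≫ Spec.map (CommRingCat.ofHom f)

lemma comp_toSpecOf {T T' : Scheme.{0}} {R : Type} [CommRing R] (f : R →+* Γ(T, ⊤))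
    (h : T' ⟶ T) : h ≫ toSpecOf f = toSpecOf (h.appTop.hom.comp f) := by
  rw [toSpecOf, toSpecOf, Scheme.toSpecΓ_naturality_assoc, ← Spec.map_comp]
  rfl

lemma toSpecOf_preimage_basicOpen {T : Scheme.{0}} {R : Type} [CommRing R] (f : R →+* Γ(T, ⊤))
    (r : R) : toSpecOf f ⁻¹ᵁ (PrimeSpectrum.basicOpen r : (Spec (CommRingCat.of R)).Opens) =
      T.basicOpen (f r) := by
  rw [← Scheme.toSpecΓ_preimage_basicOpen]
  rfl

lemma toSpecOf_appTop {T : Scheme.{0}} {R : Type} [CommRing R] (f : R →+* Γ(T, ⊤)) :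
    (toSpecOf f).appTop.hom.comp (Scheme.ΓSpecIso (CommRingCat.of R)).inv.hom = f := by
  have : (Scheme.ΓSpecIso (CommRingCat.of R)).inv ≫ (toSpecOf f).appTop = CommRingCat.ofHom f := by
    rw [toSpecOf, Scheme.Hom.comp_appTop, ← Scheme.ΓSpecIso_inv_naturality_assoc]
    simp
  exact congr_arg CommRingCat.Hom.hom this

lemma toSpecOf_eq {T : Scheme.{0}} {R : Type} [CommRing R] (a : T ⟶ Spec (CommRingCat.of R)) :
    toSpecOf (a.appTop.hom.comp (Scheme.ΓSpecIso (CommRingCat.of R)).inv.hom) = a := by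
  refine ext_of_isAffine ?_
  rw [← cancel_epi (Scheme.ΓSpecIso (CommRingCat.of R)).inv]
  exact CommRingCat.hom_ext (toSpecOf_appTop _)

end AffineSpace

/-! ### Chart systems and their loci -/

lemma le_preimage_top {X Y : Scheme.{0}} (a : X ⟶ Y) (W : X.Opens) : W ≤ a ⁻¹ᵁ ⊤ := le_top

lemma appLE_top_top {X Y : Scheme.{0}} (a : X ⟶ Y) (h : ⊤ ≤ a ⁻¹ᵁ ⊤) :
    a.appLE ⊤ ⊤ h = a.appTop := by
  rw [Scheme.Hom.appTop, Scheme.Hom.app_eq_appLE]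
  rfl

/-- The subalgebra of polynomials fixed by a family of algebra endomorphisms. -/
def fixedBy {σ G : Type} (ρ : G → MvPolynomial σ ℂ →ₐ[ℂ] MvPolynomial σ ℂ) :
    Subalgebra ℂ (MvPolynomial σ ℂ) := ⨅ g, AlgHom.equalizer (ρ g) (AlgHom.id ℂ (MvPolynomial σ ℂ))

lemma mem_fixedBy {σ G : Type} {ρ : G → MvPolynomial σ ℂ →ₐ[ℂ] MvPolynomial σ ℂ}
    {f : MvPolynomial σ ℂ} : f ∈ fixedBy ρ ↔ ∀ g, ρ g f = f := by
  simp [fixedBy, Algebra.mem_iInf, AlgHom.mem_equalizer]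

/-- Semi-invariants `F s` of a common weight `χ`, such that on the locus `F s ≠ 0` each point `v`
is moved by the group to the point with coordinates `e s z / F s`, where the numerators `e s z`
are combinations of the `F s'` with invariant coefficients. Thus `v ↦ e s v / F s v` is a
normal form for the action on that locus. -/
structure ChartSystem {σ G : Type} (ρ : G → MvPolynomial σ ℂ →ₐ[ℂ] MvPolynomial σ ℂ) where
  /-- One less than the number of charts. -/
  n : ℕ
  /-- The semi-invariants. -/
  F : Fin (n + 1) → MvPolynomial σ ℂ
  /-- Their weight. -/
  χ : G → ℂ
  χ_ne_zero : ∀ g, χ g ≠ 0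
  ρ_F : ∀ g s, ρ g (F s) = MvPolynomial.C (χ g) * F s
  /-- The numerators of the coordinates of the normal form. -/
  e : Fin (n + 1) → σ → MvPolynomial σ ℂ
  e_mem : ∀ s z, e s z ∈ Submodule.span (fixedBy ρ) (Set.range F)
  exists_act : ∀ s v, MvPolynomial.eval v (F s) ≠ 0 → ∃ g,
    (∀ f, MvPolynomial.eval v (ρ g f) =
      MvPolynomial.eval (fun z => MvPolynomial.eval v (e s z) / MvPolynomial.eval v (F s)) f) ∧
    MvPolynomial.eval v (ρ g (F s)) = 1

namespace ChartSystem

variable {σ G : Type} {ρ : G → MvPolynomial σ ℂ →ₐ[ℂ] MvPolynomial σ ℂ} (S : ChartSystem ρ)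

lemma ρ_span (g : G) {a : MvPolynomial σ ℂ} (ha : a ∈ Submodule.span (fixedBy ρ) (Set.range S.F)) :
    ρ g a = MvPolynomial.C (S.χ g) * a := by
  induction ha using Submodule.span_induction with
  | mem x hx => obtain ⟨s, rfl⟩ := hx; exact S.ρ_F g s
  | zero => simp
  | add x y _ _ hx hy => rw [map_add, hx, hy, mul_add]
  | smul c x _ hx =>
    rw [Algebra.smul_def, map_mul, hx]
    have : ρ g (algebraMap (fixedBy ρ) (MvPolynomial σ ℂ) c) =
      algebraMap (fixedBy ρ) (MvPolynomial σ ℂ) c := mem_fixedBy.mp c.2 g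
    rw [this]; ring

/-- The normal form of the point `v` with respect to the chart `s`. -/
def normal (s : Fin (S.n + 1)) (v : σ → ℂ) : σ → ℂ := fun z =>
  MvPolynomial.eval v (S.e s z) / MvPolynomial.eval v (S.F s)

/-- The union of the loci `F s ≠ 0`, with the action of the group. -/
structure Locus where
  /-- The locus. -/
  X : (AffSp σ).Opens
  eq_iSup : X = ⨆ s, (PrimeSpectrum.basicOpen (S.F s) : (AffSp σ).Opens)
  /-- The action. -/
  act : G → (X.toScheme ⟶ X.toScheme)
  act_ι : ∀ g, act g ≫ X.ι = X.ι ≫ Spec.map (CommRingCat.ofHom (ρ g).toRingHom)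

namespace Locus

variable {S} (L : S.Locus)

/-- The chart domain `F s ≠ 0`. -/
def D (s : Fin (S.n + 1)) : L.X.toScheme.Opens :=
  L.X.ι ⁻¹ᵁ (PrimeSpectrum.basicOpen (S.F s) : (AffSp σ).Opens)

lemma iSup_D : ⨆ s, L.D s = ⊤ := by
  rw [eq_top_iff]
  intro x _
  have hx : L.X.ι x ∈ L.X := x.2
  obtain ⟨s, hs⟩ := Opens.mem_iSup.mp (L.eq_iSup.le hx)
  exact Opens.mem_iSup.mpr ⟨s, hs⟩

/-- Polynomials as functions on the open subset `W` of the locus. -/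
def res (W : L.X.toScheme.Opens) : MvPolynomial σ ℂ →+* Γ(L.X.toScheme, W) :=
  (L.X.ι.appLE ⊤ W (le_preimage_top _ _)).hom.comp
    (Scheme.ΓSpecIso (CommRingCat.of (MvPolynomial σ ℂ))).inv.hom

/-- The `ℂ`-points of the locus with rational coordinates. -/
def pts : Set (SpecC ⟶ L.X.toScheme) := {p | p ≫ L.X.ι ∈ Set.range affPt}

lemma densePoints [Finite σ] : DensePoints L.pts := densePoints_affSp.opens L.X

lemma mem_D_iff {p : SpecC ⟶ L.X.toScheme} {v : σ → ℂ} (hp : p ≫ L.X.ι = affPt v) (s) :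
    p specCPoint ∈ L.D s ↔ MvPolynomial.eval v (S.F s) ≠ 0 := by
  rw [← affPt_mem_basicOpen, ← hp]
  rfl

/-- The constant of `Γ(SpecC, ⊤)` with the given value. -/
abbrev const : ℂ →+* Γ(SpecC, ⊤) := (Scheme.ΓSpecIso (CommRingCat.of ℂ)).inv.hom

lemma appLE_res {T : Scheme.{0}} (a : T ⟶ L.X.toScheme) (W : L.X.toScheme.Opens) (W' : T.Opens)
    (h : W' ≤ a ⁻¹ᵁ W) (f : MvPolynomial σ ℂ) : a.appLE W W' h (L.res W f) =
      (a ≫ L.X.ι).appLE ⊤ W' (le_preimage_top _ _) ((Scheme.ΓSpecIso (CommRingCat.of (MvPolynomial σ ℂ))).inv f) := by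
  rw [← Scheme.Hom.appLE_comp_appLE a L.X.ι ⊤ W W' (le_preimage_top _ _) h]
  rfl

lemma value_res {p : SpecC ⟶ L.X.toScheme} {v : σ → ℂ} (hp : p ≫ L.X.ι = affPt v)
    (W : L.X.toScheme.Opens) (h : ⊤ ≤ p ⁻¹ᵁ W) (f : MvPolynomial σ ℂ) :
    p.appLE W ⊤ h (L.res W f) = const (MvPolynomial.eval v f) := by
  rw [appLE_res]
  simp only [hp]
  have := Scheme.ΓSpecIso_inv_naturality
    (CommRingCat.ofHom (MvPolynomial.aeval (R := ℂ) v).toRingHom)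
  have h2 := congr_arg (fun k => k.hom f) this
  simp only [CommRingCat.hom_comp, RingHom.comp_apply] at h2
  refine (ConcreteCategory.congr_hom (appLE_top_top (affPt v) _) _).trans (h2.symm.trans ?_)
  rw [← MvPolynomial.aeval_eq_eval]
  rfl

lemma act_appLE_res (g : G) (W W' : L.X.toScheme.Opens) (h : W' ≤ L.act g ⁻¹ᵁ W)
    (f : MvPolynomial σ ℂ) : (L.act g).appLE W W' h (L.res W f) = L.res W' (ρ g f) := by
  rw [appLE_res]
  simp only [L.act_ι]
  rw [← Scheme.Hom.appLE_comp_appLE L.X.ι _ ⊤ ⊤ W' (le_preimage_top _ _) (le_preimage_top _ _), CommRingCat.comp_apply]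
  have := Scheme.ΓSpecIso_inv_naturality (CommRingCat.ofHom (ρ g).toRingHom)
  have h2 := congr_arg (fun k => k.hom f) this
  simp only [CommRingCat.hom_comp, RingHom.comp_apply] at h2
  change (L.X.ι.appLE ⊤ W' (le_preimage_top _ _)).hom _ = (L.X.ι.appLE ⊤ W' (le_preimage_top _ _)).hom _
  exact congr_arg _ ((ConcreteCategory.congr_hom (appLE_top_top _ _) _).trans h2.symm)

lemma map_res {W W' : L.X.toScheme.Opens} (h : W' ≤ W) (f : MvPolynomial σ ℂ) :
    L.X.toScheme.presheaf.map (homOfLE h).op (L.res W f) = L.res W' f := by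
  simp only [res, RingHom.comp_apply]
  exact ConcreteCategory.congr_hom (Scheme.Hom.appLE_map L.X.ι (le_preimage_top L.X.ι W) (homOfLE h).op) _

lemma basicOpen_res (W : L.X.toScheme.Opens) (f : MvPolynomial σ ℂ) :
    L.X.toScheme.basicOpen (L.res W f) =
      W ⊓ L.X.ι ⁻¹ᵁ (PrimeSpectrum.basicOpen f : (AffSp σ).Opens) := by
  simp only [res, RingHom.comp_apply]
  refine (Scheme.basicOpen_appLE _ _ _ _ _).trans ?_
  exact congr_arg (fun U => W ⊓ L.X.ι ⁻¹ᵁ U) (basicOpen_eq_of_affine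
    (R := CommRingCat.of (MvPolynomial σ ℂ)) f)

lemma isUnit_res_F (s) {W : L.X.toScheme.Opens} (h : W ≤ L.D s) : IsUnit (L.res W (S.F s)) := by
  have : L.X.toScheme.basicOpen (L.res W (S.F s)) = W := by
    rw [basicOpen_res]; exact inf_eq_left.mpr h
  refine RingedSpace.isUnit_of_isUnit_germ L.X.toScheme.toLocallyRingedSpace.toRingedSpace _ _
    fun x hx => ?_
  have hx' : x ∈ L.X.toScheme.basicOpen (L.res W (S.F s)) := this.symm ▸ hx
  exact (L.X.toScheme.mem_basicOpen _ x hx).mp hx'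

lemma isAffineOpen_D (s) : IsAffineOpen (L.D s) := by
  have hle : (PrimeSpectrum.basicOpen (S.F s) : (AffSp σ).Opens) ≤ L.X := by
    rw [L.eq_iSup]
    exact le_iSup (fun s => (PrimeSpectrum.basicOpen (S.F s) : (AffSp σ).Opens)) s
  refine IsAffineOpen.preimage_of_isOpenImmersion (IsAffineOpen.Spec_basicOpen _) L.X.ι ?_
  rwa [Scheme.Opens.opensRange_ι]

/-- Pullback of functions along the normal form map `W ⟶ X`, for `W` contained in a chart
domain. -/
def ret (s : Fin (S.n + 1)) (W : L.X.toScheme.Opens) : MvPolynomial σ ℂ →+* Γ(L.X.toScheme, W) :=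
  MvPolynomial.eval₂Hom ((L.res W).comp MvPolynomial.C)
    fun z => L.res W (S.e s z) * Ring.inverse (L.res W (S.F s))

lemma value_ret {p : SpecC ⟶ L.X.toScheme} {v : σ → ℂ} (hp : p ≫ L.X.ι = affPt v) (s)
    (W : L.X.toScheme.Opens) (hW : W ≤ L.D s) (h : ⊤ ≤ p ⁻¹ᵁ W) (f : MvPolynomial σ ℂ) :
    p.appLE W ⊤ h (L.ret s W f) = const (MvPolynomial.eval (S.normal s v) f) := by
  have hF : MvPolynomial.eval v (S.F s) ≠ 0 := by
    rw [← L.mem_D_iff hp]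
    exact hW (h (show specCPoint ∈ (⊤ : SpecC.Opens) from trivial))
  have key : (p.appLE W ⊤ h).hom.comp (L.ret s W) =
      const.comp (MvPolynomial.eval (S.normal s v)) := by
    refine MvPolynomial.ringHom_ext (fun a => ?_) fun z => ?_
    · simp only [ret, RingHom.comp_apply, MvPolynomial.eval₂Hom_C]
      erw [L.value_res hp]
      simp
    · simp only [ret, RingHom.comp_apply, MvPolynomial.eval₂Hom_X', map_mul]
      rw [MvPolynomial.eval_X, normal, div_eq_mul_inv, map_mul]
      congr 1
      · exact L.value_res hp W h _
      · have h1 : (p.appLE W ⊤ h).hom (Ring.inverse (L.res W (S.F s))) *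
            const (MvPolynomial.eval v (S.F s)) = 1 := by
          rw [← L.value_res hp W h]
          erw [← map_mul]
          rw [Ring.inverse_mul_cancel _ (L.isUnit_res_F s hW), map_one]
        have h2 : const (MvPolynomial.eval v (S.F s))⁻¹ *
            const (MvPolynomial.eval v (S.F s)) = 1 := by
          rw [← map_mul, inv_mul_cancel₀ hF, map_one]
        have hu : IsUnit (const (MvPolynomial.eval v (S.F s))) :=
          (isUnit_iff_ne_zero.mpr hF).map const
        exact hu.mul_right_cancel (h1.trans h2.symm)
  exact congr_arg (fun k => k f) key

/-- The normal form map on `W` followed by the inclusion into affine space. -/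
def retMap (s : Fin (S.n + 1)) (W : L.X.toScheme.Opens) : W.toScheme ⟶ AffSp σ :=
  toSpecOf ((W.ι.appLE W ⊤ (by simp)).hom.comp (L.ret s W))

lemma comp_retMap {p : SpecC ⟶ L.X.toScheme} {v : σ → ℂ} (hp : p ≫ L.X.ι = affPt v) (s)
    (W : L.X.toScheme.Opens) (hW : W ≤ L.D s) (q : SpecC ⟶ W.toScheme) (hq : q ≫ W.ι = p) :
    q ≫ L.retMap s W = affPt (S.normal s v) := by
  have hpW : ⊤ ≤ p ⁻¹ᵁ W := by
    rw [← hq]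
    simp
  rw [retMap, comp_toSpecOf, ← toSpecOf_eq (affPt _)]
  congr 1
  refine RingHom.ext fun f => ?_
  have h1 := L.value_ret hp s W hW hpW f
  have h2 : q.appTop (W.ι.appLE W ⊤ (by simp) (L.ret s W f)) = p.appLE W ⊤ hpW (L.ret s W f) := by
    simp only [← hq]
    rw [← appLE_top_top q (le_preimage_top q _)]
    exact ConcreteCategory.congr_hom (Scheme.Hom.appLE_comp_appLE q W.ι W ⊤ ⊤
      (by simp) (le_preimage_top q _)) _
  refine (h2.trans h1).trans ?_
  have := Scheme.ΓSpecIso_inv_naturality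
    (CommRingCat.ofHom (MvPolynomial.aeval (R := ℂ) (S.normal s v)).toRingHom)
  have h3 := congr_arg (fun k => k.hom f) this
  simp only [CommRingCat.hom_comp, RingHom.comp_apply] at h3
  refine Eq.trans ?_ h3
  rw [← MvPolynomial.aeval_eq_eval]
  rfl

lemma affPt_normal {p : SpecC ⟶ L.X.toScheme} {v : σ → ℂ} (hp : p ≫ L.X.ι = affPt v) (s)
    (h : MvPolynomial.eval v (S.F s) ≠ 0) : ∃ g, p ≫ L.act g ≫ L.X.ι = affPt (S.normal s v) := by
  obtain ⟨g, hg, -⟩ := S.exists_act s v h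
  refine ⟨g, ?_⟩
  rw [L.act_ι, ← Category.assoc, hp, affPt, ← Spec.map_comp, affPt]
  congr 1
  refine CommRingCat.hom_ext (RingHom.ext fun f => ?_)
  change MvPolynomial.aeval v (ρ g f) = MvPolynomial.aeval (S.normal s v) f
  rw [MvPolynomial.aeval_eq_eval, MvPolynomial.aeval_eq_eval]
  exact hg f

lemma eval_normal_F (s) (v : σ → ℂ) (h : MvPolynomial.eval v (S.F s) ≠ 0) :
    MvPolynomial.eval (S.normal s v) (S.F s) = 1 := by
  obtain ⟨g, hg, h1⟩ := S.exists_act s v h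
  rw [← h1, hg]; rfl

instance [Finite σ] : AlgebraicGeometry.IsReduced L.X.toScheme := isReduced_of_isOpenImmersion L.X.ι

instance isReduced_opens [Finite σ] (W : L.X.toScheme.Opens) :
    AlgebraicGeometry.IsReduced W.toScheme := isReduced_of_isOpenImmersion W.ι

lemma ret_F [Finite σ] (s) {W : L.X.toScheme.Opens} (h : W ≤ L.D s) : L.ret s W (S.F s) = 1 := by
  refine L.densePoints.section_ext fun p ⟨v, hv⟩ hp => ?_
  rw [L.value_ret hv.symm s W h, eval_normal_F, map_one, map_one]
  rw [← L.mem_D_iff hv.symm]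
  exact h ((specC_mem_iff p W).mp hp)

lemma act_appLE_ret (g : G) (s) {W W' : L.X.toScheme.Opens} (hW : W ≤ L.D s)
    (h : W' ≤ L.act g ⁻¹ᵁ W) (hW' : W' ≤ L.D s)
    (f : MvPolynomial σ ℂ) : (L.act g).appLE W W' h (L.ret s W f) = L.ret s W' f := by
  have key : ((L.act g).appLE W W' h).hom.comp (L.ret s W) = L.ret s W' := by
    refine MvPolynomial.ringHom_ext (fun a => ?_) fun z => ?_
    · simp only [ret, RingHom.comp_apply, MvPolynomial.eval₂Hom_C]
      erw [L.act_appLE_res]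
      rw [← MvPolynomial.algebraMap_eq, AlgHom.commutes]
    · simp only [ret, RingHom.comp_apply, MvPolynomial.eval₂Hom_X', map_mul]
      have hu := L.isUnit_res_F s hW'
      have h1 : ((L.act g).appLE W W' h).hom (Ring.inverse (L.res W (S.F s))) *
          L.res W' (MvPolynomial.C (S.χ g) * S.F s) = 1 := by
        rw [← S.ρ_F, ← L.act_appLE_res g W W' h]
        erw [← map_mul]
        rw [Ring.inverse_mul_cancel _ (L.isUnit_res_F s hW), map_one]
      have h2 : ((L.act g).appLE W W' h).hom (L.res W (S.e s z)) =
          L.res W' (MvPolynomial.C (S.χ g)) * L.res W' (S.e s z) := by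
        rw [← map_mul, ← S.ρ_span g (S.e_mem s z)]
        exact L.act_appLE_res g W W' h _
      refine hu.mul_right_cancel ?_
      rw [h2, mul_assoc _ (Ring.inverse _), Ring.inverse_mul_cancel _ hu]
      rw [map_mul] at h1
      linear_combination (L.res W' (S.e s z)) * h1
  exact congr_arg (fun k => k f) key

end Locus

end ChartSystem

/-! ### Sections of quotient morphisms -/

lemma section_ext_of_cover {Y : Scheme.{0}} {κ : Type} {V : κ → Y.Opens} (hV : ⨆ s, V s = ⊤)
    {W : Y.Opens} {t t' : Γ(Y, W)} (h : ∀ s, (V s).ι.app W t = (V s).ι.app W t') : t = t' := by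
  refine TopCat.Sheaf.eq_of_locally_eq' Y.sheaf (fun s => (V s).ι ''ᵁ (V s).ι ⁻¹ᵁ W) W
    (fun s => homOfLE (by rintro _ ⟨z, hz, rfl⟩; exact hz)) ?_ t t' fun s => ?_
  · intro y hy
    have : y ∈ ⨆ s, V s := hV ▸ trivial
    obtain ⟨s, hs⟩ := Opens.mem_iSup.mp this
    exact Opens.mem_iSup.mpr ⟨s, ⟨y, hs⟩, hy, rfl⟩
  · have := h s
    rw [Scheme.Opens.ι_app] at this
    exact this

lemma appLE_apply_congr {X Y : Scheme.{0}} {a b : X ⟶ Y} (h : a = b) {U : Y.Opens} {W : X.Opens}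
    (ha : W ≤ a ⁻¹ᵁ U) (hb : W ≤ b ⁻¹ᵁ U) (t : Γ(Y, U)) : a.appLE U W ha t = b.appLE U W hb t := by
  subst h; rfl

lemma appLE_apply_appLE {X Y Z : Scheme.{0}} (f : X ⟶ Y) (g : Y ⟶ Z) {U : Z.Opens} {V : Y.Opens}
    {W : X.Opens} (h : V ≤ g ⁻¹ᵁ U) (h' : W ≤ f ⁻¹ᵁ V) (t : Γ(Z, U)) :
    f.appLE V W h' (g.appLE U V h t) =
      (f ≫ g).appLE U W (h'.trans (f.preimage_mono h)) t :=
  ConcreteCategory.congr_hom (Scheme.Hom.appLE_comp_appLE f g U V W h h') t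

namespace ChartSystem.Locus

variable {σ G : Type} {ρ : G → MvPolynomial σ ℂ →ₐ[ℂ] MvPolynomial σ ℂ} {S : ChartSystem ρ}
  (L : S.Locus)

/-- An affine open cover `V s` of `Y`, with preimages the chart domains, and sections `τ s` of `π`
over `V s` such that `τ s ∘ π` is the normal form map. -/
structure Sections {Y : Scheme.{0}} (π : L.X.toScheme ⟶ Y) where
  inv : ∀ g, L.act g ≫ π = π
  /-- The open cover. -/
  V : Fin (S.n + 1) → Y.Opens
  affine : ∀ s, IsAffineOpen (V s)
  preimage : ∀ s, π ⁻¹ᵁ V s = L.D s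
  iSup_V : ⨆ s, V s = ⊤
  /-- The sections. -/
  τ : ∀ s, (V s).toScheme ⟶ L.X.toScheme
  τ_π : ∀ s, τ s ≫ π = (V s).ι
  τ_pt : ∀ s (p : SpecC ⟶ L.X.toScheme) (v : σ → ℂ), p ≫ L.X.ι = affPt v →
    ∀ r : SpecC ⟶ (V s).toScheme, r ≫ (V s).ι = p ≫ π → r ≫ τ s ≫ L.X.ι = affPt (S.normal s v)

variable {L} {Y : Scheme.{0}} {π : L.X.toScheme ⟶ Y}

lemma exists_lift_preimage (π : L.X.toScheme ⟶ Y) {V : Y.Opens} {p : SpecC ⟶ L.X.toScheme}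
    {r : SpecC ⟶ V.toScheme} (h : r ≫ V.ι = p ≫ π) :
    ∃ q : SpecC ⟶ (π ⁻¹ᵁ V).toScheme, q ≫ (π ⁻¹ᵁ V).ι = p ∧ q ≫ (π ∣_ V) = r := by
  have hr : Set.range p ⊆ Set.range (π ⁻¹ᵁ V).ι := by
    rintro _ ⟨y, rfl⟩
    rw [Scheme.Opens.range_ι]
    change π (p y) ∈ V
    rw [← Scheme.Hom.comp_apply, ← h, Scheme.Hom.comp_apply]
    exact (r y).2
  refine ⟨IsOpenImmersion.lift (π ⁻¹ᵁ V).ι p hr, IsOpenImmersion.lift_fac _ _ _, ?_⟩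
  rw [← cancel_mono V.ι, Category.assoc, morphismRestrict_ι, ← Category.assoc,
    IsOpenImmersion.lift_fac, h]

/-- The normal form map of a chart descends to a section of the quotient morphism, since its
components are invariant functions. -/
lemma exists_section [Finite σ] (inv : ∀ g, L.act g ≫ π = π) (s : Fin (S.n + 1)) (V : Y.Opens)
    (hV : π ⁻¹ᵁ V = L.D s) (hinj : Function.Injective (π.app V))
    (hret : ∀ f, L.ret s (π ⁻¹ᵁ V) f ∈ Set.range (π.app V))
    (hc : ∀ a b : V.toScheme ⟶ V.toScheme, (π ∣_ V) ≫ a = (π ∣_ V) ≫ b → a = b) :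
    ∃ τ : V.toScheme ⟶ L.X.toScheme, τ ≫ π = V.ι ∧ Set.range τ ⊆ L.D s ∧
      ∀ (p : SpecC ⟶ L.X.toScheme) (v : σ → ℂ), p ≫ L.X.ι = affPt v →
      ∀ r : SpecC ⟶ V.toScheme, r ≫ V.ι = p ≫ π → r ≫ τ ≫ L.X.ι = affPt (S.normal s v) := by
  let E : Γ(Y, V) ≃+* (π.app V).hom.range :=
    RingEquiv.ofBijective (π.app V).hom.rangeRestrict
      ⟨fun x y h => hinj (congr_arg Subtype.val h), (π.app V).hom.rangeRestrict_surjective⟩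
  let κ : MvPolynomial σ ℂ →+* Γ(Y, V) :=
    E.symm.toRingHom.comp ((L.ret s (π ⁻¹ᵁ V)).codRestrict (π.app V).hom.range hret)
  have hκ : ∀ f, π.app V (κ f) = L.ret s (π ⁻¹ᵁ V) f := fun f =>
    congr_arg Subtype.val (E.apply_symm_apply ⟨L.ret s (π ⁻¹ᵁ V) f, hret f⟩)
  let τ₀ : V.toScheme ⟶ AffSp σ := toSpecOf ((V.ι.appLE V ⊤ (by simp)).hom.comp κ)
  -- the section, composed with the quotient morphism, is the normal form map
  have h₀ : (π ∣_ V) ≫ τ₀ = L.retMap s (π ⁻¹ᵁ V) := by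
    rw [comp_toSpecOf, retMap]
    congr 1
    refine RingHom.ext fun f => ?_
    change (π ∣_ V).appTop (V.ι.appLE V ⊤ (by simp) (κ f)) =
      (π ⁻¹ᵁ V).ι.appLE (π ⁻¹ᵁ V) ⊤ (by simp) (L.ret s (π ⁻¹ᵁ V) f)
    rw [← hκ, ← appLE_top_top _ (le_preimage_top _ _)]
    refine (ConcreteCategory.congr_hom (Scheme.Hom.appLE_comp_appLE (π ∣_ V) V.ι V ⊤ ⊤
      (by simp) (le_preimage_top _ _)) _).trans ?_
    rw [Scheme.Hom.app_eq_appLE]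
    refine Eq.trans ?_ (ConcreteCategory.congr_hom (Scheme.Hom.appLE_comp_appLE (π ⁻¹ᵁ V).ι π V
      (π ⁻¹ᵁ V) ⊤ le_rfl (by simp)) _).symm
    simp only [morphismRestrict_ι]
  have hκF : κ (S.F s) = 1 := hinj (by rw [hκ, L.ret_F s hV.le, map_one])
  have hpre : τ₀ ⁻¹ᵁ (PrimeSpectrum.basicOpen (S.F s) : (AffSp σ).Opens) = ⊤ := by
    rw [toSpecOf_preimage_basicOpen, RingHom.comp_apply, hκF, map_one]
    exact Scheme.basicOpen_of_isUnit _ isUnit_one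
  have hr : Set.range τ₀ ⊆ Set.range L.X.ι := by
    rintro _ ⟨y, rfl⟩
    rw [Scheme.Opens.range_ι]
    refine L.eq_iSup.ge (Opens.mem_iSup.mpr ⟨s, ?_⟩)
    have : y ∈ τ₀ ⁻¹ᵁ (PrimeSpectrum.basicOpen (S.F s) : (AffSp σ).Opens) := by
      rw [hpre]; trivial
    exact this
  let τ : V.toScheme ⟶ L.X.toScheme := IsOpenImmersion.lift L.X.ι τ₀ hr
  have hτ : τ ≫ L.X.ι = τ₀ := IsOpenImmersion.lift_fac _ _ _
  have hτD : ∀ y, τ y ∈ L.D s := by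
    intro y
    change (L.X.ι (τ y)) ∈ (PrimeSpectrum.basicOpen (S.F s) : (AffSp σ).Opens)
    rw [← Scheme.Hom.comp_apply, hτ]
    have : y ∈ τ₀ ⁻¹ᵁ (PrimeSpectrum.basicOpen (S.F s) : (AffSp σ).Opens) := by
      rw [hpre]; trivial
    exact this
  have hpt : ∀ (q : SpecC ⟶ (π ⁻¹ᵁ V).toScheme) (v : σ → ℂ),
      (q ≫ (π ⁻¹ᵁ V).ι) ≫ L.X.ι = affPt v →
      q ≫ (π ∣_ V) ≫ τ ≫ L.X.ι = affPt (S.normal s v) := by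
    intro q v hq
    rw [hτ, h₀]
    exact L.comp_retMap hq s _ hV.le q rfl
  refine ⟨τ, ?_, ?_, ?_⟩
  · have hr2 : Set.range (τ ≫ π) ⊆ Set.range V.ι := by
      rintro _ ⟨y, rfl⟩
      rw [Scheme.Opens.range_ι, Scheme.Hom.comp_apply]
      exact hV.ge (hτD y)
    -- the normal form of a point lies in its orbit, so that `τ` is a section
    have key : IsOpenImmersion.lift V.ι (τ ≫ π) hr2 = 𝟙 _ := by
      refine hc _ _ ?_
      rw [← cancel_mono V.ι, Category.assoc, IsOpenImmersion.lift_fac, Category.comp_id,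
        morphismRestrict_ι]
      refine (L.densePoints.opens (π ⁻¹ᵁ V)).hom_ext fun q ⟨v, hv⟩ => ?_
      have h1 := hpt q v hv.symm
      have hF : MvPolynomial.eval v (S.F s) ≠ 0 := by
        rw [← L.mem_D_iff hv.symm, ← hV, Scheme.Hom.comp_apply]
        exact (q specCPoint).2
      obtain ⟨g, hg⟩ := L.affPt_normal hv.symm s hF
      have h2 : q ≫ (π ∣_ V) ≫ τ = (q ≫ (π ⁻¹ᵁ V).ι) ≫ L.act g := by
        rw [← cancel_mono L.X.ι]
        simp only [Category.assoc] at h1 hg ⊢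
        rw [h1, hg]
      calc q ≫ (π ∣_ V) ≫ τ ≫ π = (q ≫ (π ∣_ V) ≫ τ) ≫ π := by simp only [Category.assoc]
        _ = _ := by rw [h2, Category.assoc, inv, Category.assoc]
    rw [← IsOpenImmersion.lift_fac V.ι (τ ≫ π) hr2, key, Category.id_comp]
  · rintro _ ⟨y, rfl⟩
    exact hτD y
  · intro p v hp r hr'
    obtain ⟨q, rfl, rfl⟩ := exists_lift_preimage π hr'
    rw [Category.assoc]
    exact hpt q v hp

namespace Sections

variable (T : L.Sections π)

include T in
lemma surjective : Function.Surjective π := by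
  intro y
  have : y ∈ ⨆ s, T.V s := T.iSup_V ▸ trivial
  obtain ⟨s, hs⟩ := Opens.mem_iSup.mp this
  exact ⟨T.τ s ⟨y, hs⟩, congr_arg (fun k : (T.V s).toScheme ⟶ Y => k ⟨y, hs⟩) (T.τ_π s)⟩

lemma exists_act (s) {p : SpecC ⟶ L.X.toScheme} (hp : p ∈ L.pts) {r : SpecC ⟶ (T.V s).toScheme}
    (h : r ≫ (T.V s).ι = p ≫ π) : ∃ g, r ≫ T.τ s = p ≫ L.act g := by
  obtain ⟨v, hv⟩ := hp
  have h1 := T.τ_pt s p v hv.symm r h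
  have hF : MvPolynomial.eval v (S.F s) ≠ 0 := by
    rw [← L.mem_D_iff hv.symm, ← T.preimage]
    change π (p specCPoint) ∈ T.V s
    rw [← Scheme.Hom.comp_apply, ← h, Scheme.Hom.comp_apply]
    exact (r specCPoint).2
  obtain ⟨g, hg⟩ := L.affPt_normal hv.symm s hF
  refine ⟨g, ?_⟩
  rw [← cancel_mono L.X.ι, Category.assoc, Category.assoc, h1, hg]

include T in
lemma app_injective (W : Y.Opens) : Function.Injective (π.app W) := by
  intro t t' h
  refine section_ext_of_cover T.iSup_V fun s => ?_
  have key : ∀ t : Γ(Y, W), (T.V s).ι.app W t =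
      (T.τ s).appLE (π ⁻¹ᵁ W) ((T.V s).ι ⁻¹ᵁ W)
        (by rw [← Scheme.Hom.comp_preimage, T.τ_π]) (π.app W t) := by
    intro t
    rw [Scheme.Hom.app_eq_appLE, Scheme.Hom.app_eq_appLE]
    refine Eq.trans ?_ (ConcreteCategory.congr_hom (Scheme.Hom.appLE_comp_appLE (T.τ s) π W
      (π ⁻¹ᵁ W) _ le_rfl _) _).symm
    simp only [T.τ_π]
  rw [key, key, h]

lemma τ_mem [Finite σ] {Z : Set L.X.toScheme} (hZ : IsClosed Z)
    (hinv : ∀ g, L.act g ⁻¹' Z = Z) (s) {x : L.X.toScheme} (hx : x ∈ Z)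
    (hs : π x ∈ T.V s) : T.τ s ⟨π x, hs⟩ ∈ Z := by
  let D := π ⁻¹ᵁ T.V s
  let ν : D.toScheme ⟶ L.X.toScheme := (π ∣_ T.V s) ≫ T.τ s
  let U : L.X.toScheme.Opens := ⟨Zᶜ, hZ.isOpen_compl⟩
  have key : ν ⁻¹ᵁ U ≤ D.ι ⁻¹ᵁ U := by
    refine (L.densePoints.opens D).opens_le fun q hq hqU => ?_
    have h : (q ≫ (π ∣_ T.V s)) ≫ (T.V s).ι = (q ≫ D.ι) ≫ π := by
      rw [Category.assoc, Category.assoc, morphismRestrict_ι]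
    obtain ⟨g, hg⟩ := T.exists_act s hq h
    change ν (q specCPoint) ∉ Z at hqU
    change D.ι (q specCPoint) ∉ Z
    rw [← Scheme.Hom.comp_apply] at hqU ⊢
    rw [Category.assoc] at hg
    rw [hg, Scheme.Hom.comp_apply] at hqU
    rw [← hinv g]
    exact hqU
  by_contra hcon
  have hq : (⟨x, hs⟩ : D) ∈ ν ⁻¹ᵁ U := by
    change ν ⟨x, hs⟩ ∉ Z
    have : (π ∣_ T.V s) ⟨x, hs⟩ = ⟨π x, hs⟩ := by
      refine (T.V s).ι.isOpenEmbedding.injective ?_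
      exact congr_arg (fun k : D.toScheme ⟶ Y => k ⟨x, hs⟩) (morphismRestrict_ι π (T.V s))
    exact fun h => hcon (this ▸ h)
  exact key hq hx

lemma π_τ (s) (y : (T.V s).toScheme) : π (T.τ s y) = y.1 := by
  rw [← Scheme.Hom.comp_apply, T.τ_π]
  rfl

include T in
lemma isClosed_image [Finite σ] {Z : Set L.X.toScheme} (hZ : IsClosed Z)
    (hinv : ∀ g, L.act g ⁻¹' Z = Z) : IsClosed (π '' Z) := by
  have hcov : IsOpenCover T.V := T.iSup_V
  refine hcov.isClosed_iff_coe_preimage.mpr fun s => ?_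
  have : ((fun y : T.V s => (y : Y)) ⁻¹' (π '' Z)) = T.τ s ⁻¹' Z := by
    ext y
    constructor
    · rintro ⟨x, hx, hxy⟩
      have hs : π x ∈ T.V s := by rw [hxy]; exact y.2
      have h := T.τ_mem hZ hinv s hx hs
      have hy : (⟨π x, hs⟩ : T.V s) = y := Subtype.ext hxy
      rw [hy] at h
      exact h
    · intro hy
      exact ⟨T.τ s y, hy, T.π_τ s y⟩
  rw [this]
  exact hZ.preimage (T.τ s).continuous

include T in
lemma disjoint_image [Finite σ] {Z Z' : Set L.X.toScheme} (hZ : IsClosed Z) (hZ' : IsClosed Z')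
    (hinv : ∀ g, L.act g ⁻¹' Z = Z) (hinv' : ∀ g, L.act g ⁻¹' Z' = Z') (hd : Disjoint Z Z') :
    Disjoint (π '' Z) (π '' Z') := by
  rw [Set.disjoint_left]
  rintro _ ⟨x, hx, rfl⟩ ⟨x', hx', h⟩
  have : π x ∈ ⨆ s, T.V s := T.iSup_V ▸ trivial
  obtain ⟨s, hs⟩ := Opens.mem_iSup.mp this
  have h1 := T.τ_mem hZ hinv s hx hs
  have hs' : π x' ∈ T.V s := by rwa [h]
  have h2 := T.τ_mem hZ' hinv' s hx' hs'
  have h3 : (⟨π x', hs'⟩ : T.V s) = ⟨π x, hs⟩ := Subtype.ext h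
  rw [h3] at h2
  exact Set.disjoint_left.mp hd h1 h2

include T in
lemma isAffineHom : IsAffineHom π := by
  refine isAffineHom_of_forall_exists_isAffineOpen _ fun y => ?_
  have : y ∈ ⨆ s, T.V s := T.iSup_V ▸ trivial
  obtain ⟨s, hs⟩ := Opens.mem_iSup.mp this
  refine ⟨T.V s, hs, T.affine s, ?_⟩
  rw [T.preimage]
  exact L.isAffineOpen_D s

/-- The descent of an invariant function to the part of its domain over `V s`. -/
lemma exists_descent [Finite σ] (W : Y.Opens) {t : Γ(L.X.toScheme, π ⁻¹ᵁ W)}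
    (ht : IsInvariantSection L.act π T.inv W t) (s) :
    ∃ u : Γ(Y, (T.V s).ι ''ᵁ (T.V s).ι ⁻¹ᵁ W),
      π.app _ u = L.X.toScheme.presheaf.map (homOfLE (show π ⁻¹ᵁ ((T.V s).ι ''ᵁ (T.V s).ι ⁻¹ᵁ W) ≤
        π ⁻¹ᵁ W from π.preimage_mono (by rintro _ ⟨z, hz, rfl⟩; exact hz))).op t := by
  set ι := (T.V s).ι
  -- the descent is the pullback along the section; it is compared with `t` at complex points, which
  -- the action moves to their normal forms
  have hτ : ι ⁻¹ᵁ W ≤ T.τ s ⁻¹ᵁ π ⁻¹ᵁ W := by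
    rw [← Scheme.Hom.comp_preimage, T.τ_π]
  obtain ⟨u, hu⟩ : ∃ u, ι.appLE (ι ''ᵁ ι ⁻¹ᵁ W) (ι ⁻¹ᵁ W) (ι.preimage_image_eq _).ge u =
      (T.τ s).appLE (π ⁻¹ᵁ W) (ι ⁻¹ᵁ W) hτ t := by
    refine ⟨(ι.appIso (ι ⁻¹ᵁ W)).inv ((T.τ s).appLE (π ⁻¹ᵁ W) (ι ⁻¹ᵁ W) hτ t), ?_⟩
    rw [← Scheme.Hom.appIso_hom']
    rw [← CommRingCat.comp_apply, Iso.inv_hom_id]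
    rfl
  refine ⟨u, L.densePoints.section_ext fun p hp hpW => ?_⟩
  have hpU : ⊤ ≤ p ⁻¹ᵁ π ⁻¹ᵁ (ι ''ᵁ ι ⁻¹ᵁ W) := hpW.ge
  have hpW' : ⊤ ≤ p ⁻¹ᵁ π ⁻¹ᵁ W := hpU.trans (p.preimage_mono (π.preimage_mono (by
    rintro _ ⟨z, hz, rfl⟩; exact hz)))
  have hr : Set.range (p ≫ π) ⊆ Set.range ι := by
    rintro _ ⟨y, rfl⟩
    have : y ∈ p ⁻¹ᵁ π ⁻¹ᵁ (ι ''ᵁ ι ⁻¹ᵁ W) := hpU trivial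
    obtain ⟨z, -, hz⟩ := this
    exact ⟨z, hz⟩
  set r := IsOpenImmersion.lift ι (p ≫ π) hr with hrdef
  have hrι : r ≫ ι = p ≫ π := IsOpenImmersion.lift_fac _ _ _
  obtain ⟨g, hg⟩ := T.exists_act s hp hrι
  have hrW : ⊤ ≤ r ⁻¹ᵁ ι ⁻¹ᵁ W := by
    rw [← Scheme.Hom.comp_preimage, hrι]
    exact hpW'
  have e1 : p.appLE (π ⁻¹ᵁ (ι ''ᵁ ι ⁻¹ᵁ W)) ⊤ hpU (π.app _ u) =
      r.appLE (ι ⁻¹ᵁ W) ⊤ hrW (ι.appLE (ι ''ᵁ ι ⁻¹ᵁ W) (ι ⁻¹ᵁ W) (ι.preimage_image_eq _).ge u) := by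
    rw [Scheme.Hom.app_eq_appLE]
    refine (ConcreteCategory.congr_hom (Scheme.Hom.appLE_comp_appLE p π _ _ ⊤ le_rfl hpU) _).trans
      (Eq.trans ?_ (ConcreteCategory.congr_hom
        (Scheme.Hom.appLE_comp_appLE r ι _ _ ⊤ _ hrW) _).symm)
    simp only [hrι]
  have hgW : ⊤ ≤ (p ≫ L.act g) ⁻¹ᵁ π ⁻¹ᵁ W := by
    rw [← Scheme.Hom.comp_preimage, Category.assoc, T.inv]
    exact hpW'
  have e2 : r.appLE (ι ⁻¹ᵁ W) ⊤ hrW ((T.τ s).appLE (π ⁻¹ᵁ W) (ι ⁻¹ᵁ W) hτ t) =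
      (p ≫ L.act g).appLE (π ⁻¹ᵁ W) ⊤ hgW t := by
    refine (ConcreteCategory.congr_hom
      (Scheme.Hom.appLE_comp_appLE r (T.τ s) _ _ ⊤ _ hrW) _).trans ?_
    simp only [hg]
  have e3 : (p ≫ L.act g).appLE (π ⁻¹ᵁ W) ⊤ hgW t = p.appLE (π ⁻¹ᵁ W) ⊤ hpW' t := by
    conv_rhs => rw [← ht g]
    exact (ConcreteCategory.congr_hom
      (Scheme.Hom.appLE_comp_appLE p (L.act g) _ _ ⊤ _ hpW') _).symm
  rw [e1, hu, e2, e3]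
  exact (ConcreteCategory.congr_hom (Scheme.Hom.map_appLE p _ _) t).symm

lemma mem_range_app_iff [Finite σ] (W : Y.Opens) (t : Γ(L.X.toScheme, π ⁻¹ᵁ W)) :
    t ∈ Set.range (π.app W) ↔ IsInvariantSection L.act π T.inv W t := by
  constructor
  · rintro ⟨u, rfl⟩ g
    rw [Scheme.Hom.app_eq_appLE]
    exact (appLE_apply_appLE (L.act g) π le_rfl _ u).trans (appLE_apply_congr (T.inv g) _ _ u)
  · intro ht
    -- the descents over the sets `V s` are glued
    choose u hu using T.exists_descent W ht
    have hmap : ∀ s {U' : Y.Opens} (i : U' ⟶ (T.V s).ι ''ᵁ (T.V s).ι ⁻¹ᵁ W)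
        (h : π ⁻¹ᵁ U' ≤ π ⁻¹ᵁ W),
        π.app U' (Y.presheaf.map i.op (u s)) = L.X.toScheme.presheaf.map (homOfLE h).op t := by
      intro s U' i h
      rw [← CommRingCat.comp_apply, Scheme.Hom.naturality, CommRingCat.comp_apply, hu,
        ← CommRingCat.comp_apply, ← Functor.map_comp]
      rfl
    have hle : ∀ s, (T.V s).ι ''ᵁ (T.V s).ι ⁻¹ᵁ W ≤ W := fun s => by
      rintro _ ⟨z, hz, rfl⟩; exact hz
    obtain ⟨w, hw, -⟩ := TopCat.Sheaf.existsUnique_gluing' Y.sheaf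
      (fun s => (T.V s).ι ''ᵁ (T.V s).ι ⁻¹ᵁ W) W (fun s => homOfLE (hle s))
      (by
        intro y hy
        have : y ∈ ⨆ s, T.V s := T.iSup_V ▸ trivial
        obtain ⟨s, hs⟩ := Opens.mem_iSup.mp this
        exact Opens.mem_iSup.mpr ⟨s, ⟨y, hs⟩, hy, rfl⟩) u (by
        intro s s'
        refine T.app_injective _ ?_
        have h : π ⁻¹ᵁ ((T.V s).ι ''ᵁ (T.V s).ι ⁻¹ᵁ W ⊓ (T.V s').ι ''ᵁ (T.V s').ι ⁻¹ᵁ W) ≤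
          π ⁻¹ᵁ W := π.preimage_mono (inf_le_left.trans (hle s))
        exact (hmap s _ h).trans (hmap s' _ h).symm)
    refine ⟨w, ?_⟩
    refine TopCat.Sheaf.eq_of_locally_eq' L.X.toScheme.sheaf
      (fun s => π ⁻¹ᵁ ((T.V s).ι ''ᵁ (T.V s).ι ⁻¹ᵁ W)) (π ⁻¹ᵁ W)
      (fun s => homOfLE (π.preimage_mono (hle s))) ?_ _ _ fun s => ?_
    · intro x hx
      have : π x ∈ ⨆ s, T.V s := T.iSup_V ▸ trivial
      obtain ⟨s, hs⟩ := Opens.mem_iSup.mp this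
      exact Opens.mem_iSup.mpr ⟨s, ⟨π x, hs⟩, hx, rfl⟩
    · have h1 := hmap s (𝟙 _) (π.preimage_mono (hle s))
      have h2 := hw s
      have h3 : π.app _ (Y.presheaf.map (homOfLE (hle s)).op w) =
          L.X.toScheme.presheaf.map (homOfLE (π.preimage_mono (hle s))).op (π.app W w) := by
        exact ConcreteCategory.congr_hom (Scheme.Hom.naturality π (homOfLE (hle s)).op) w
      refine h3.symm.trans (Eq.trans (congr_arg _ ?_) h1)
      refine h2.trans ?_
      rw [op_id, Y.presheaf.map_id]
      rfl

include T in
/-- A morphism with sections as above is a good quotient. -/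
lemma isGoodQuotient [Finite σ] : IsGoodQuotient L.act π where
  invariant := T.inv
  affine := T.isAffineHom
  surjective := T.surjective
  app_injective := T.app_injective
  mem_range_app_iff := T.mem_range_app_iff
  isClosed_image _ hZ hinv := T.isClosed_image hZ hinv
  disjoint_image _ _ hZ hZ' hinv hinv' hd := T.disjoint_image hZ hZ' hinv hinv' hd

end Sections

/-- The nonvanishing locus of a polynomial. -/
def basic (L : S.Locus) (f : MvPolynomial σ ℂ) : L.X.toScheme.Opens :=
  L.X.ι ⁻¹ᵁ (PrimeSpectrum.basicOpen f : (AffSp σ).Opens)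

lemma act_preimage_basic (g : G) (f : MvPolynomial σ ℂ) :
    L.act g ⁻¹ᵁ L.basic f = L.basic (ρ g f) := by
  refine (Scheme.Hom.comp_preimage _ _ _).symm.trans ?_
  rw [L.act_ι]
  rfl

lemma basic_C_mul {c : ℂ} (hc : c ≠ 0) (f : MvPolynomial σ ℂ) :
    L.basic (MvPolynomial.C c * f) = L.basic f := by
  have : PrimeSpectrum.basicOpen (MvPolynomial.C c * f) = PrimeSpectrum.basicOpen f := by
    ext x
    exact (Ideal.unit_mul_mem_iff_mem x.asIdeal
      ((isUnit_iff_ne_zero.mpr hc).map MvPolynomial.C)).not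
  exact congr_arg (fun U : (AffSp σ).Opens => L.X.ι ⁻¹ᵁ U) this

lemma mem_basic_iff {p : SpecC ⟶ L.X.toScheme} {v : σ → ℂ} (hp : p ≫ L.X.ι = affPt v)
    (f : MvPolynomial σ ℂ) : p specCPoint ∈ L.basic f ↔ MvPolynomial.eval v f ≠ 0 := by
  rw [← affPt_mem_basicOpen, ← hp]
  rfl

/-- The chart domains of a good quotient are saturated. -/
lemma exists_saturated [Finite σ] (hπ : IsGoodQuotient L.act π) (s : Fin (S.n + 1)) :
    ∃ V : Y.Opens, π ⁻¹ᵁ V = L.D s := by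
  have hB : ∀ g, L.act g ⁻¹' ((L.D s : Set L.X.toScheme)ᶜ) = (L.D s : Set L.X.toScheme)ᶜ := by
    intro g
    have : L.act g ⁻¹ᵁ L.D s = L.D s := by
      change L.act g ⁻¹ᵁ L.basic (S.F s) = L.basic (S.F s)
      rw [act_preimage_basic, S.ρ_F, basic_C_mul (S.χ_ne_zero g)]
    rw [Set.preimage_compl]
    exact congr_arg (fun U : L.X.toScheme.Opens => (U : Set L.X.toScheme)ᶜ) this
  have hcl := hπ.isClosed_image _ (L.D s).2.isClosed_compl hB
  refine ⟨⟨_, hcl.isOpen_compl⟩, le_antisymm (fun x hx => ?_) ?_⟩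
  · by_contra hxD
    exact hx ⟨x, hxD, rfl⟩
  · refine L.densePoints.opens_le fun p ⟨v, hv⟩ hpD => ?_
    have hF := (L.mem_D_iff hv.symm s).mp hpD
    -- the closed set where the point of projective space given by the `F s'` is that of `v`
    let h : Fin (S.n + 1) → MvPolynomial σ ℂ := fun s' =>
      MvPolynomial.C (MvPolynomial.eval v (S.F s')) * S.F s -
        MvPolynomial.C (MvPolynomial.eval v (S.F s)) * S.F s'
    let Z : Set L.X.toScheme := (⨆ s', L.basic (h s') : L.X.toScheme.Opens)ᶜ
    have hZ : IsClosed Z := (⨆ s', L.basic (h s') : L.X.toScheme.Opens).2.isClosed_compl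
    have hZi : ∀ g, L.act g ⁻¹' Z = Z := by
      intro g
      have h1 : ∀ s', ρ g (h s') = MvPolynomial.C (S.χ g) * h s' := by
        intro s'
        simp only [h, map_sub, map_mul, S.ρ_F]
        rw [← MvPolynomial.algebraMap_eq, AlgHom.commutes, AlgHom.commutes]
        ring
      have : L.act g ⁻¹ᵁ (⨆ s', L.basic (h s')) = ⨆ s', L.basic (h s') := by
        rw [Scheme.Hom.preimage_iSup]
        simp only [act_preimage_basic, h1, basic_C_mul (S.χ_ne_zero g)]
      rw [Set.preimage_compl]
      exact congr_arg (fun U : L.X.toScheme.Opens => (U : Set L.X.toScheme)ᶜ) this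
    have hd : Disjoint ((L.D s : Set L.X.toScheme)ᶜ) Z := by
      rw [Set.disjoint_left]
      intro x hx hxZ
      have hxc : x ∈ ⨆ s, L.D s := L.iSup_D ▸ trivial
      obtain ⟨s', hs'⟩ := Opens.mem_iSup.mp hxc
      refine hxZ (Opens.mem_iSup.mpr ⟨s', ?_⟩)
      change h s' ∉ (L.X.ι x : PrimeSpectrum _).asIdeal
      have hx0 : S.F s ∈ (L.X.ι x : PrimeSpectrum _).asIdeal := not_not.mp hx
      have hx1 : S.F s' ∉ (L.X.ι x : PrimeSpectrum _).asIdeal := hs'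
      intro hcon
      have h2 := (Submodule.sub_mem_iff_right _ (Ideal.mul_mem_left _ _ hx0)).mp hcon
      rcases (L.X.ι x : PrimeSpectrum _).2.mem_or_mem h2 with h3 | h3
      · exact (L.X.ι x : PrimeSpectrum _).2.ne_top (Ideal.eq_top_of_isUnit_mem _ h3
          ((isUnit_iff_ne_zero.mpr hF).map MvPolynomial.C))
      · exact hx1 h3
    have hpZ : p specCPoint ∈ Z := by
      intro hcon
      obtain ⟨s', hs'⟩ := Opens.mem_iSup.mp hcon
      refine (mem_basic_iff hv.symm _).mp hs' ?_
      simp [h, mul_comm]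
    have hdi := hπ.disjoint_image _ _ (L.D s).2.isClosed_compl hZ hB hZi hd
    exact fun hcon => Set.disjoint_left.mp hdi hcon ⟨_, hpZ, rfl⟩

/-- A good quotient of the locus has sections over an affine open cover. -/
theorem nonempty_sections [Finite σ] (hπ : IsGoodQuotient L.act π) : Nonempty (L.Sections π) := by
  choose V hV using exists_saturated hπ
  -- the components of the normal form map are invariant, so that they are functions on the quotient
  have hret : ∀ s f, L.ret s (π ⁻¹ᵁ V s) f ∈ Set.range (π.app (V s)) := by
    intro s f
    rw [hπ.mem_range_app_iff]
    intro g
    exact L.act_appLE_ret g s (hV s).le _ (hV s).le f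
  have hc : ∀ s (a b : (V s).toScheme ⟶ (V s).toScheme),
      (π ∣_ V s) ≫ a = (π ∣_ V s) ≫ b → a = b := by
    intro s a b hab
    refine cancel_of_surjective_of_injective (π ∣_ V s) ?_ ?_ hab
    · rintro ⟨y, hy⟩
      obtain ⟨x, rfl⟩ := hπ.surjective y
      exact ⟨⟨x, hy⟩, (V s).ι.isOpenEmbedding.injective
        (congr_arg (fun k : (π ⁻¹ᵁ V s).toScheme ⟶ Y => k ⟨x, hy⟩) (morphismRestrict_ι π (V s)))⟩
    · intro U
      rw [morphismRestrict_app]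
      have h1 := hπ.app_injective ((V s).ι ''ᵁ U)
      intro x y hxy
      refine h1 ?_
      exact (ConcreteCategory.bijective_of_isIso
        (L.X.toScheme.presheaf.map (eqToHom (image_morphismRestrict_preimage π (V s) U)).op)).1 hxy
  choose τ hτ hτD hpt using fun s =>
    exists_section hπ.invariant s (V s) (hV s) (hπ.app_injective _) (hret s) (hc s)
  refine ⟨⟨hπ.invariant, V, fun s => ?_, hV, ?_, τ, hτ, fun s p v hp r hr => hpt s p v hp r hr⟩⟩
  · -- `τ s` is a closed immersion into the affine open `D s`
    have hr : Set.range (τ s) ⊆ Set.range (π ⁻¹ᵁ V s).ι := by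
      rw [Scheme.Opens.range_ι, hV]
      exact hτD s
    let τ' : (V s).toScheme ⟶ (π ⁻¹ᵁ V s).toScheme := IsOpenImmersion.lift (π ⁻¹ᵁ V s).ι (τ s) hr
    have h1 : τ' ≫ (π ∣_ V s) = 𝟙 _ := by
      rw [← cancel_mono (V s).ι, Category.assoc, morphismRestrict_ι, Category.id_comp,
        ← Category.assoc, IsOpenImmersion.lift_fac, hτ]
    have h2 : IsClosedImmersion (τ' ≫ (π ∣_ V s)) := by rw [h1]; infer_instance
    have h3 : IsAffineHom (π ∣_ V s) :=
      MorphismProperty.of_isPullback (isPullback_morphismRestrict π (V s)).flip hπ.affine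
    have h4 : IsClosedImmersion τ' := IsClosedImmersion.of_comp τ' (π ∣_ V s)
    have h5 : IsAffine (π ⁻¹ᵁ V s).toScheme := by
      have := L.isAffineOpen_D s
      rw [← hV] at this
      exact this
    exact isAffine_of_isAffineHom τ'
  · rw [eq_top_iff]
    intro y _
    obtain ⟨x, rfl⟩ := hπ.surjective y
    have hxc : x ∈ ⨆ s, L.D s := L.iSup_D ▸ trivial
    obtain ⟨s, hs⟩ := Opens.mem_iSup.mp hxc
    exact Opens.mem_iSup.mpr ⟨s, (hV s).ge hs⟩

end ChartSystem.Locus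

/-! ### Morphisms to projective space -/

section ToProj

attribute [local instance] MvPolynomial.gradedAlgebra

/-- The standard grading of `ℤ[x₀, …, xₙ]`. -/
abbrev polyGrading (n : ℕ) : ℕ → Submodule ℤ (MvPolynomial (Fin (n + 1)) ℤ) :=
  MvPolynomial.homogeneousSubmodule (Fin (n + 1)) ℤ

variable {n : ℕ}

/-- The ring homomorphism on the degree zero part of the localization at `f` that is induced by
a ring homomorphism sending `f` to a unit. -/
def awayHom {R : Type} [CommRing R] (k : MvPolynomial (Fin (n + 1)) ℤ →+* R)
    (f : MvPolynomial (Fin (n + 1)) ℤ) (hf : IsUnit (k f)) :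
    HomogeneousLocalization.Away (polyGrading n) f →+* R :=
  (Localization.awayLift k f hf).comp (algebraMap _ (Localization.Away f))

lemma awayHom_mk {R : Type} [CommRing R] (k : MvPolynomial (Fin (n + 1)) ℤ →+* R)
    {f : MvPolynomial (Fin (n + 1)) ℤ} (hf : IsUnit (k f)) {d : ℕ} (hd : f ∈ polyGrading n d)
    (m : ℕ) (x : MvPolynomial (Fin (n + 1)) ℤ) (hx : x ∈ polyGrading n (m • d)) :
    awayHom k f hf (HomogeneousLocalization.Away.mk (polyGrading n) hd m x hx) * k f ^ m = k x := by
  obtain ⟨v, hv⟩ := isUnit_iff_exists_inv.mp hf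
  change Localization.awayLift k f hf (Localization.mk x ⟨f ^ m, m, rfl⟩) * _ = _
  rw [Localization.awayLift_mk k f x v hv m, mul_assoc, ← mul_pow, mul_comm v, hv, one_pow, mul_one]

lemma comp_awayHom {R R' : Type} [CommRing R] [CommRing R']
    (k : MvPolynomial (Fin (n + 1)) ℤ →+* R) (h : R →+* R')
    (f : MvPolynomial (Fin (n + 1)) ℤ) (hf : IsUnit (k f)) :
    h.comp (awayHom k f hf) = awayHom (h.comp k) f (hf.map h) := by
  have : h.comp (Localization.awayLift k f hf) = Localization.awayLift (h.comp k) f (hf.map h) := by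
    refine IsLocalization.ringHom_ext (M := .powers f) ?_
    refine RingHom.ext fun x => ?_
    simp [Localization.awayLift]
  rw [awayHom, awayHom, ← this]
  rfl

lemma awayHom_comp_awayMap {R : Type} [CommRing R] (k : MvPolynomial (Fin (n + 1)) ℤ →+* R)
    {f g x : MvPolynomial (Fin (n + 1)) ℤ} {d : ℕ} (hg : g ∈ polyGrading n d) (hx : x = f * g)
    (hf : IsUnit (k f)) (hxu : IsUnit (k x)) :
    (awayHom k x hxu).comp (HomogeneousLocalization.awayMap (polyGrading n) hg hx) =
      awayHom k f hf := by
  refine RingHom.ext fun a => ?_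
  change Localization.awayLift k x hxu (HomogeneousLocalization.val _) = _
  rw [HomogeneousLocalization.val_awayMap]
  change ((Localization.awayLift k x hxu).comp (Localization.awayLift _ f _)) a.val =
    Localization.awayLift k f hf a.val
  refine RingHom.congr_fun ?_ a.val
  refine IsLocalization.ringHom_ext (M := .powers f) (RingHom.ext fun x => ?_)
  simp [Localization.awayLift]

/-- The morphism to projective space whose homogeneous coordinates are the images of the variables
under `k`, if `k f` is a unit for a homogeneous `f` of positive degree. -/
def toProj {T : Scheme.{0}} (k : MvPolynomial (Fin (n + 1)) ℤ →+* Γ(T, ⊤))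
    (f : MvPolynomial (Fin (n + 1)) ℤ) {d : ℕ} (hd : f ∈ polyGrading n d) (h0 : 0 < d)
    (hf : IsUnit (k f)) : T ⟶ Proj (polyGrading n) :=
  toSpecOf (awayHom k f hf) ≫ Proj.awayι (polyGrading n) f hd h0

lemma toProj_mul {T : Scheme.{0}} (k : MvPolynomial (Fin (n + 1)) ℤ →+* Γ(T, ⊤))
    {f g x : MvPolynomial (Fin (n + 1)) ℤ} {d d' e : ℕ} (hd : f ∈ polyGrading n d) (h0 : 0 < d)
    (hg : g ∈ polyGrading n d') (hx : x = f * g) (hf : IsUnit (k f)) (hxu : IsUnit (k x))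
    (he : x ∈ polyGrading n e) (he' : e = d + d') :
    toProj k f hd h0 hf = toProj k x he (he' ▸ Nat.add_pos_left h0 _) hxu := by
  subst he'
  rw [toProj, toProj, ← Proj.SpecMap_awayMap_awayι (polyGrading n) hd h0 hg hx,
    ← awayHom_comp_awayMap k hg hx hf hxu, ← Category.assoc]
  congr 1
  rw [toSpecOf, toSpecOf, Category.assoc, ← Spec.map_comp]
  rfl

lemma X_mem_polyGrading (s : Fin (n + 1)) : MvPolynomial.X s ∈ polyGrading n 1 :=
  MvPolynomial.isHomogeneous_X ℤ s

/-- The morphism with homogeneous coordinates given by `k`, where the coordinate `s` is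
invertible. -/
abbrev toProjX {T : Scheme.{0}} (k : MvPolynomial (Fin (n + 1)) ℤ →+* Γ(T, ⊤)) (s : Fin (n + 1))
    (hs : IsUnit (k (MvPolynomial.X s))) : T ⟶ Proj (polyGrading n) :=
  toProj k (MvPolynomial.X s) (X_mem_polyGrading s) one_pos hs

lemma toProjX_eq {T : Scheme.{0}} (k : MvPolynomial (Fin (n + 1)) ℤ →+* Γ(T, ⊤))
    (s s' : Fin (n + 1)) (hs : IsUnit (k (MvPolynomial.X s)))
    (hs' : IsUnit (k (MvPolynomial.X s'))) : toProjX k s hs = toProjX k s' hs' := by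
  have hu : IsUnit (k (MvPolynomial.X s * MvPolynomial.X s')) := by
    rw [map_mul]; exact hs.mul hs'
  have hm : (MvPolynomial.X s * MvPolynomial.X s' : MvPolynomial (Fin (n + 1)) ℤ) ∈
      polyGrading n 2 := SetLike.mul_mem_graded (X_mem_polyGrading s) (X_mem_polyGrading s')
  rw [toProjX, toProjX, toProj_mul k (X_mem_polyGrading s) one_pos (X_mem_polyGrading s') rfl hs hu
    hm rfl, toProj_mul k (X_mem_polyGrading s') one_pos (X_mem_polyGrading s)
    (mul_comm _ _) hs' hu hm rfl]

lemma comp_toProjX {T T' : Scheme.{0}} (h : T' ⟶ T)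
    (k : MvPolynomial (Fin (n + 1)) ℤ →+* Γ(T, ⊤)) (s : Fin (n + 1))
    (hs : IsUnit (k (MvPolynomial.X s))) :
    h ≫ toProjX k s hs = toProjX (h.appTop.hom.comp k) s (hs.map h.appTop.hom) := by
  rw [toProjX, toProjX, toProj, toProj, ← Category.assoc, comp_toSpecOf, comp_awayHom]

lemma eval₂_smul_of_isHomogeneous {R : Type} [CommRing R] (c : R) (y : Fin (n + 1) → R) {m : ℕ}
    {x : MvPolynomial (Fin (n + 1)) ℤ} (hx : x.IsHomogeneous m) :
    MvPolynomial.eval₂ (Int.castRingHom R) (fun i => c * y i) x =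
      c ^ m * MvPolynomial.eval₂ (Int.castRingHom R) y x := by
  rw [MvPolynomial.eval₂_eq, MvPolynomial.eval₂_eq, Finset.mul_sum]
  refine Finset.sum_congr rfl fun d hd => ?_
  have : ∑ i ∈ d.support, d i = m := by
    have := hx (MvPolynomial.mem_support_iff.mp hd)
    rwa [Finsupp.weight_apply, Finsupp.sum, Finset.sum_congr rfl fun i _ => by
      rw [Pi.one_apply, smul_eq_mul, mul_one]] at this
  simp only [mul_pow, Finset.prod_mul_distrib]
  rw [Finset.prod_pow_eq_pow_sum, this]
  ring

lemma toProjX_smul {T : Scheme.{0}} (k k' : MvPolynomial (Fin (n + 1)) ℤ →+* Γ(T, ⊤))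
    (c : Γ(T, ⊤)) (h : ∀ i, k' (MvPolynomial.X i) = c * k (MvPolynomial.X i)) (s : Fin (n + 1))
    (hs : IsUnit (k (MvPolynomial.X s))) (hs' : IsUnit (k' (MvPolynomial.X s))) :
    toProjX k' s hs' = toProjX k s hs := by
  have key : ∀ (m : ℕ) (x : MvPolynomial (Fin (n + 1)) ℤ), x.IsHomogeneous m →
      k' x = c ^ m * k x := by
    intro m x hx
    have e : ∀ k : MvPolynomial (Fin (n + 1)) ℤ →+* Γ(T, ⊤), k x =
        MvPolynomial.eval₂ (Int.castRingHom _) (fun i => k (MvPolynomial.X i)) x := fun k => by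
      change _ = MvPolynomial.eval₂Hom (Int.castRingHom _) (fun i => k (MvPolynomial.X i)) x
      congr 1
      refine MvPolynomial.ringHom_ext (fun a => by simp) fun i => by simp
    rw [e k', e k, ← eval₂_smul_of_isHomogeneous c _ hx]
    simp only [h]
  rw [toProjX, toProjX, toProj, toProj]
  congr 2
  refine RingHom.ext fun a => ?_
  obtain ⟨m, x, hx, rfl⟩ := HomogeneousLocalization.Away.mk_surjective (polyGrading n)
    (X_mem_polyGrading s) a
  have h1 := awayHom_mk k hs (X_mem_polyGrading s) m x hx
  have h2 := awayHom_mk k' hs' (X_mem_polyGrading s) m x hx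
  refine (hs'.pow m).mul_right_cancel ?_
  have hx' : x.IsHomogeneous m := by
    have : m • 1 = m := by simp
    rw [← this]; exact hx
  rw [h2, key m x hx', h, mul_pow, ← h1]
  ring

lemma toProjX_preimage {T : Scheme.{0}} (k : MvPolynomial (Fin (n + 1)) ℤ →+* Γ(T, ⊤))
    (s : Fin (n + 1)) (hs : IsUnit (k (MvPolynomial.X s))) (s' : Fin (n + 1)) :
    toProjX k s hs ⁻¹ᵁ Proj.basicOpen (polyGrading n) (MvPolynomial.X s') =
      T.basicOpen (k (MvPolynomial.X s')) := by
  rw [toProjX, toProj, Scheme.Hom.comp_preimage,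
    Proj.awayι_preimage_basicOpen (polyGrading n) _ _ (X_mem_polyGrading s') one_pos]
  refine (toSpecOf_preimage_basicOpen _ _).trans ?_
  have h1 := awayHom_mk k hs (X_mem_polyGrading s) 1 (MvPolynomial.X s' ^ 1)
    (by simpa using X_mem_polyGrading s')
  have h2 : k (MvPolynomial.X s' ^ 1) = k (MvPolynomial.X s') := by rw [pow_one]
  rw [pow_one (k _)] at h1
  rw [← h2, ← h1, Scheme.basicOpen_mul, Scheme.basicOpen_of_isUnit _ hs, inf_top_eq]

/-- A section over the chart of projective space that pulls back to a quotient of coordinates. -/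
lemma exists_section_toProjX (s s' : Fin (n + 1)) :
    ∃ u : Γ(Proj (polyGrading n), Proj.basicOpen (polyGrading n) (MvPolynomial.X s)),
      ∀ {T : Scheme.{0}} (k : MvPolynomial (Fin (n + 1)) ℤ →+* Γ(T, ⊤))
        (hs : IsUnit (k (MvPolynomial.X s)))
        (h : ⊤ ≤ toProjX k s hs ⁻¹ᵁ Proj.basicOpen (polyGrading n) (MvPolynomial.X s)),
        (toProjX k s hs).appLE _ ⊤ h u * k (MvPolynomial.X s) = k (MvPolynomial.X s') := by
  let j := Proj.awayι (polyGrading n) (MvPolynomial.X s) (X_mem_polyGrading s) one_pos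
  have hj : j.opensRange = Proj.basicOpen (polyGrading n) (MvPolynomial.X s) :=
    Proj.opensRange_awayι _ _ _ _
  have hj' : ⊤ ≤ j ⁻¹ᵁ Proj.basicOpen (polyGrading n) (MvPolynomial.X s) := by
    rw [← hj]; simp
  let a := HomogeneousLocalization.Away.mk (polyGrading n) (X_mem_polyGrading s) 1
    (MvPolynomial.X s') (by simpa using X_mem_polyGrading s')
  obtain ⟨u, hu⟩ : ∃ u, j.appLE (Proj.basicOpen (polyGrading n) (MvPolynomial.X s)) ⊤ hj' u =
      (Scheme.ΓSpecIso (CommRingCat.of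
        (HomogeneousLocalization.Away (polyGrading n) (MvPolynomial.X s)))).inv a := by
    have hi : j ''ᵁ ⊤ = Proj.basicOpen (polyGrading n) (MvPolynomial.X s) := by
      rw [← hj]; exact j.image_top_eq_opensRange
    refine ⟨(Proj (polyGrading n)).presheaf.map (homOfLE hi.ge).op
      ((j.appIso ⊤).inv ((Scheme.ΓSpecIso (CommRingCat.of
        (HomogeneousLocalization.Away (polyGrading n) (MvPolynomial.X s)))).inv a)), ?_⟩
    refine (ConcreteCategory.congr_hom (Scheme.Hom.map_appLE j hj'
      (homOfLE hi.ge).op) _).trans ?_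
    rw [← Scheme.Hom.appIso_hom']
    exact ConcreteCategory.congr_hom (Iso.inv_hom_id (j.appIso ⊤)) _
  refine ⟨u, fun {T} k hs h => ?_⟩
  have h1 : (toProjX k s hs).appLE _ ⊤ h u = awayHom k (MvPolynomial.X s) hs a := by
    refine (appLE_apply_appLE (toSpecOf (awayHom k (MvPolynomial.X s) hs)) j hj'
      (le_preimage_top _ _) u).symm.trans ?_
    rw [hu, appLE_top_top]
    exact congr_arg (fun r => r a) (toSpecOf_appTop (awayHom k (MvPolynomial.X s) hs))
  rw [h1]
  have h2 := awayHom_mk k hs (X_mem_polyGrading s) 1 (MvPolynomial.X s')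
    (by simpa using X_mem_polyGrading s')
  rw [pow_one] at h2
  exact h2

lemma iSup_basicOpen_X :
    ⨆ s, Proj.basicOpen (polyGrading n) (MvPolynomial.X s) = ⊤ := by
  refine Proj.iSup_basicOpen_eq_top' _ _ (fun s => ⟨1, X_mem_polyGrading s⟩) ?_
  rw [eq_top_iff]
  intro x hx
  clear hx
  induction x using MvPolynomial.induction_on with
  | C a =>
    rw [show (MvPolynomial.C a : MvPolynomial (Fin (n + 1)) ℤ) = (a : MvPolynomial _ ℤ) by simp]
    exact intCast_mem _ _
  | add p q hp hq => exact add_mem hp hq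
  | mul_X p i hp => exact mul_mem hp (Algebra.subset_adjoin ⟨i, rfl⟩)

/-- The morphism to `ℙⁿ` over `S` with the given components. -/
def projLift {T S : Scheme.{0}} (a : T ⟶ S) (b : T ⟶ Proj (polyGrading n)) : T ⟶ ProjSpace n S :=
  Limits.pullback.lift a b (Limits.terminal.hom_ext _ _)

/-- The projection from `ℙⁿ` over `S` to `ℙⁿ` over `ℤ`. -/
def toProjZ (n : ℕ) (S : Scheme.{0}) : ProjSpace n S ⟶ Proj (polyGrading n) :=
  Limits.pullback.snd _ _

lemma projLift_toBase {T S : Scheme.{0}} (a : T ⟶ S) (b : T ⟶ Proj (polyGrading n)) :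
    projLift a b ≫ ProjSpace.toBase n S = a := Limits.pullback.lift_fst _ _ _

lemma projLift_toProjZ {T S : Scheme.{0}} (a : T ⟶ S) (b : T ⟶ Proj (polyGrading n)) :
    projLift a b ≫ toProjZ n S = b := Limits.pullback.lift_snd _ _ _

lemma projSpace_hom_ext {T S : Scheme.{0}} {a b : T ⟶ ProjSpace n S}
    (h : a ≫ ProjSpace.toBase n S = b ≫ ProjSpace.toBase n S)
    (h' : a ≫ toProjZ n S = b ≫ toProjZ n S) : a = b := Limits.pullback.hom_ext h h'

/-- The standard charts of projective space over `S`. -/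
def projChart (S : Scheme.{0}) (s : Fin (n + 1)) : (ProjSpace n S).Opens :=
  toProjZ n S ⁻¹ᵁ Proj.basicOpen (polyGrading n) (MvPolynomial.X s)

lemma isAffineOpen_projChart (S : Scheme.{0}) [IsAffine S] (s : Fin (n + 1)) :
    IsAffineOpen (projChart S s) := by
  have h1 : IsAffineOpen (Proj.basicOpen (polyGrading n) (MvPolynomial.X s)) :=
    Proj.isAffineOpen_basicOpen _ _ (X_mem_polyGrading s) one_pos
  have : IsAffineHom (toProjZ n S) := by
    have : IsAffineHom (Limits.terminal.from S) := isAffineHom_of_isAffine _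
    exact MorphismProperty.of_isPullback (IsPullback.of_hasPullback (Limits.terminal.from S)
      (Limits.terminal.from (Proj (polyGrading n)))) this
  exact h1.preimage (toProjZ n S)

lemma iSup_projChart (S : Scheme.{0}) : ⨆ s : Fin (n + 1), projChart S s = ⊤ := by
  simp only [projChart]
  rw [← Scheme.Hom.preimage_iSup, iSup_basicOpen_X]
  rfl

end ToProj

/-! ### Projectivity and existence of the quotient -/

lemma presheaf_map_bijective {X : Scheme.{0}} {U V : X.Opens} (h : U = V) (i : U ⟶ V) :
    Function.Bijective (X.presheaf.map i.op) := by
  subst h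
  obtain rfl : i = 𝟙 _ := Subsingleton.elim _ _
  rw [op_id, X.presheaf.map_id]
  exact Function.bijective_id

lemma ι_appLE_injective {X : Scheme.{0}} (W : X.Opens) (h : ⊤ ≤ W.ι ⁻¹ᵁ W) :
    Function.Injective (W.ι.appLE W ⊤ h) := by
  rw [Scheme.Opens.ι_appLE]
  exact (presheaf_map_bijective (by simp) _).1

lemma ι_app_bijective {X : Scheme.{0}} {U W : X.Opens} (h : W ≤ U) :
    Function.Bijective (U.ι.app W) := by
  rw [Scheme.Opens.ι_app]
  exact presheaf_map_bijective (by
    rw [Scheme.Hom.image_preimage_eq_opensRange_inf, Scheme.Opens.opensRange_ι]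
    exact inf_eq_right.mpr h) _

lemma exists_glue {Y Z : Scheme.{0}} {κ : Type} {V : κ → Y.Opens} (hV : ⨆ s, V s = ⊤)
    (f : ∀ s, (V s).toScheme ⟶ Z)
    (h : ∀ s s', Y.homOfLE (inf_le_left : V s ⊓ V s' ≤ V s) ≫ f s =
      Y.homOfLE (inf_le_right : V s ⊓ V s' ≤ V s') ≫ f s') :
    ∃ i : Y ⟶ Z, ∀ s, (V s).ι ≫ i = f s := by
  let c := Y.openCoverOfIsOpenCover V hV
  refine ⟨c.glueMorphisms f fun s s' => ?_, fun s => c.ι_glueMorphisms f _ s⟩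
  have hp := isPullback_opens_inf (V s) (V s')
  refine (cancel_epi hp.isoPullback.hom).mp ?_
  have h1 : hp.isoPullback.hom ≫ Limits.pullback.fst (c.f s) (c.f s') =
    Y.homOfLE inf_le_left := hp.isoPullback_hom_fst
  have h2 : hp.isoPullback.hom ≫ Limits.pullback.snd (c.f s) (c.f s') =
    Y.homOfLE inf_le_right := hp.isoPullback_hom_snd
  exact (Category.assoc _ _ _).symm.trans ((congr_arg (· ≫ f s) h1).trans ((h s s').trans
    ((congr_arg (· ≫ f s') h2).symm.trans (Category.assoc _ _ _))))

lemma hom_ext_of_cover {Y Z : Scheme.{0}} {κ : Type} {V : κ → Y.Opens} (hV : ⨆ s, V s = ⊤)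
    {a b : Y ⟶ Z} (h : ∀ s, (V s).ι ≫ a = (V s).ι ≫ b) : a = b :=
  (Y.openCoverOfIsOpenCover V hV).hom_ext _ _ h

namespace ChartSystem.Locus

variable {σ G : Type} {ρ : G → MvPolynomial σ ℂ →ₐ[ℂ] MvPolynomial σ ℂ} {S : ChartSystem ρ}
  (L : S.Locus)

/-- The affine quotient. -/
abbrev Base (ρ : G → MvPolynomial σ ℂ →ₐ[ℂ] MvPolynomial σ ℂ) : Scheme.{0} :=
  Spec (CommRingCat.of (fixedBy ρ))

/-- The morphism from the locus to the affine quotient. -/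
def toBase : L.X.toScheme ⟶ Base ρ :=
  L.X.ι ≫ Spec.map (CommRingCat.ofHom (fixedBy ρ).val.toRingHom)

lemma act_toBase (g : G) : L.act g ≫ L.toBase = L.toBase := by
  rw [toBase, ← Category.assoc, L.act_ι, Category.assoc, ← Spec.map_comp]
  congr 2
  refine CommRingCat.hom_ext (RingHom.ext fun f => ?_)
  exact mem_fixedBy.mp f.2 g

lemma toBase_appLE (W : L.X.toScheme.Opens) (c : fixedBy ρ) :
    L.toBase.appLE ⊤ W (le_preimage_top _ _)
      ((Scheme.ΓSpecIso (CommRingCat.of (fixedBy ρ))).inv c) = L.res W c := by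
  refine (appLE_apply_appLE L.X.ι
    (Spec.map (CommRingCat.ofHom (fixedBy ρ).val.toRingHom)) (le_preimage_top _ _)
    (le_preimage_top _ _) _).symm.trans ?_
  rw [appLE_top_top]
  have := Scheme.ΓSpecIso_inv_naturality (CommRingCat.ofHom (fixedBy ρ).val.toRingHom)
  have h2 := congr_arg (fun k => k.hom c) this
  exact congr_arg (L.X.ι.appLE ⊤ W (le_preimage_top _ _)).hom h2.symm

/-- The pullbacks of the semi-invariants `F s`, as homogeneous coordinates. -/
def coords {T : Scheme.{0}} (h : T ⟶ L.X.toScheme) :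
    MvPolynomial (Fin (S.n + 1)) ℤ →+* Γ(T, ⊤) :=
  h.appTop.hom.comp ((L.res ⊤).comp (MvPolynomial.eval₂Hom (Int.castRingHom _) S.F))

lemma coords_X {T : Scheme.{0}} (h : T ⟶ L.X.toScheme) (s) :
    L.coords h (MvPolynomial.X s) = h.appTop (L.res ⊤ (S.F s)) := by
  simp [coords]

lemma coords_comp {T T' : Scheme.{0}} (a : T' ⟶ T) (h : T ⟶ L.X.toScheme) :
    L.coords (a ≫ h) = a.appTop.hom.comp (L.coords h) := by
  rw [coords, coords, Scheme.Hom.comp_appTop]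
  rfl

lemma basicOpen_coords {T : Scheme.{0}} (h : T ⟶ L.X.toScheme) (s) :
    T.basicOpen (L.coords h (MvPolynomial.X s)) = h ⁻¹ᵁ L.D s := by
  rw [coords_X]
  have h1 := L.basicOpen_res ⊤ (S.F s)
  rw [top_inf_eq] at h1
  exact (Scheme.preimage_basicOpen_top h _).symm.trans (congr_arg (fun U => h ⁻¹ᵁ U) h1)

lemma isUnit_coords {T : Scheme.{0}} (h : T ⟶ L.X.toScheme) (s) (hs : h ⁻¹ᵁ L.D s = ⊤) :
    IsUnit (L.coords h (MvPolynomial.X s)) := by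
  refine RingedSpace.isUnit_of_isUnit_germ T.toLocallyRingedSpace.toRingedSpace _ _ fun x hx => ?_
  have hx' : x ∈ T.basicOpen (L.coords h (MvPolynomial.X s)) := by
    rw [basicOpen_coords, hs]; trivial
  exact (T.mem_basicOpen _ x hx).mp hx'

attribute [local instance] MvPolynomial.gradedAlgebra

lemma exists_toProjZ : ∃ ψ : L.X.toScheme ⟶ Proj (polyGrading S.n),
    ∀ s, (L.D s).ι ≫ ψ = toProjX (L.coords (L.D s).ι) s (L.isUnit_coords _ s (by simp)) := by
  refine exists_glue L.iSup_D _ fun s s' => ?_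
  rw [comp_toProjX, comp_toProjX]
  have e : ∀ s'' (h : L.D s ⊓ L.D s' ≤ L.D s''), (L.X.toScheme.homOfLE h).appTop.hom.comp
      (L.coords (L.D s'').ι) = L.coords (L.D s ⊓ L.D s').ι := by
    intro s'' h
    rw [← coords_comp, Scheme.homOfLE_ι]
  simp only [e]
  exact toProjX_eq _ _ _ _ _

/-- The morphism with homogeneous coordinates `F s`. -/
def projZ : L.X.toScheme ⟶ Proj (polyGrading S.n) := L.exists_toProjZ.choose

lemma comp_projZ {T : Scheme.{0}} (h : T ⟶ L.X.toScheme) (s)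
    (hs : IsUnit (L.coords h (MvPolynomial.X s))) :
    h ≫ L.projZ = toProjX (L.coords h) s hs := by
  have h1 : h ⁻¹ᵁ L.D s = ⊤ := by
    rw [← basicOpen_coords, Scheme.basicOpen_of_isUnit _ hs]
  have hr : Set.range h ⊆ Set.range (L.D s).ι := by
    rintro _ ⟨y, rfl⟩
    rw [Scheme.Opens.range_ι]
    exact h1.ge (show y ∈ (⊤ : T.Opens) from trivial)
  obtain ⟨h', rfl⟩ : ∃ h', h = h' ≫ (L.D s).ι :=
    ⟨IsOpenImmersion.lift (L.D s).ι h hr, (IsOpenImmersion.lift_fac _ _ _).symm⟩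
  rw [Category.assoc, projZ, L.exists_toProjZ.choose_spec s, comp_toProjX]
  simp only [coords_comp]

lemma projZ_preimage (s) :
    L.projZ ⁻¹ᵁ Proj.basicOpen (polyGrading S.n) (MvPolynomial.X s) = L.D s := by
  have key : ∀ s', (L.D s').ι ⁻¹ᵁ L.projZ ⁻¹ᵁ Proj.basicOpen _ (MvPolynomial.X s) =
      (L.D s').ι ⁻¹ᵁ L.D s := by
    intro s'
    rw [← Scheme.Hom.comp_preimage, L.comp_projZ _ s' (L.isUnit_coords _ s' (by simp)),
      toProjX_preimage, basicOpen_coords]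
  ext x
  have hxc : x ∈ ⨆ s, L.D s := L.iSup_D ▸ trivial
  obtain ⟨s', hs'⟩ := Opens.mem_iSup.mp hxc
  exact SetLike.ext_iff.mp (key s') ⟨x, hs'⟩

lemma act_projZ (g : G) : L.act g ≫ L.projZ = L.projZ := by
  refine hom_ext_of_cover L.iSup_D fun s => ?_
  have hc : ∀ i, L.coords ((L.D s).ι ≫ L.act g) (MvPolynomial.X i) =
      (L.D s).ι.appTop (L.res ⊤ (MvPolynomial.C (S.χ g))) *
        L.coords (L.D s).ι (MvPolynomial.X i) := by
    intro i
    rw [coords_comp, RingHom.comp_apply, coords_X, coords_X]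
    refine Eq.trans ?_ (map_mul (L.D s).ι.appTop.hom _ _)
    rw [← map_mul, ← S.ρ_F]
    refine congr_arg (L.D s).ι.appTop ?_
    rw [← appLE_top_top (L.act g) (le_preimage_top _ _)]
    exact L.act_appLE_res g ⊤ ⊤ _ _
  have hu := L.isUnit_coords (L.D s).ι s (by simp)
  have hu' : IsUnit (L.coords ((L.D s).ι ≫ L.act g) (MvPolynomial.X s)) := by
    rw [hc]
    refine IsUnit.mul ?_ hu
    exact (((isUnit_iff_ne_zero.mpr (S.χ_ne_zero g)).map MvPolynomial.C).map _).map _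
  rw [← Category.assoc, L.comp_projZ _ s hu', L.comp_projZ _ s hu]
  exact toProjX_smul _ _ _ hc s hu hu'

/-- The morphism from the locus to projective space over the affine quotient with homogeneous
coordinates `F s`. -/
def proj : L.X.toScheme ⟶ ProjSpace S.n (Base ρ) := projLift L.toBase L.projZ

lemma act_proj (g : G) : L.act g ≫ L.proj = L.proj := by
  refine projSpace_hom_ext ?_ ?_
  · rw [Category.assoc, proj, projLift_toBase, act_toBase]
  · rw [Category.assoc, proj, projLift_toProjZ, act_projZ]

lemma proj_preimage (s) : L.proj ⁻¹ᵁ projChart (Base ρ) s = L.D s := by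
  rw [projChart, ← Scheme.Hom.comp_preimage, proj, projLift_toProjZ, projZ_preimage]

lemma res_fixed_mem (s) (W : L.X.toScheme.Opens) (hW : W ≤ L.proj ⁻¹ᵁ projChart (Base ρ) s)
    (c : fixedBy ρ) : L.res W c ∈ (L.proj.appLE (projChart (Base ρ) s) W hW).hom.range := by
  refine ⟨(ProjSpace.toBase S.n (Base ρ)).appLE ⊤ _ (le_preimage_top _ _)
    ((Scheme.ΓSpecIso (CommRingCat.of (fixedBy ρ))).inv c), ?_⟩
  refine (appLE_apply_appLE L.proj _ _ hW _).trans ?_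
  rw [← L.toBase_appLE]
  exact appLE_apply_congr (projLift_toBase _ _) _ _ _

lemma res_quotient_mem (s s') (W : L.X.toScheme.Opens)
    (hW : W ≤ L.proj ⁻¹ᵁ projChart (Base ρ) s) :
    L.res W (S.F s') * Ring.inverse (L.res W (S.F s)) ∈
      (L.proj.appLE (projChart (Base ρ) s) W hW).hom.range := by
  have hWD : W ≤ L.D s := hW.trans (L.proj_preimage s).le
  obtain ⟨u, hu⟩ := exists_section_toProjX (n := S.n) s s'
  refine ⟨(toProjZ S.n (Base ρ)).appLE _ (projChart (Base ρ) s) le_rfl u, ?_⟩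
  have hFu := L.isUnit_res_F s hWD
  refine hFu.mul_right_cancel ?_
  rw [mul_assoc, Ring.inverse_mul_cancel _ hFu, mul_one]
  have hW' : W ≤ L.projZ ⁻¹ᵁ Proj.basicOpen (polyGrading S.n) (MvPolynomial.X s) := by
    rw [projZ_preimage]; exact hWD
  have h1 : L.proj.appLE (projChart (Base ρ) s) W hW
      ((toProjZ S.n (Base ρ)).appLE _ (projChart (Base ρ) s) le_rfl u) =
      L.projZ.appLE _ W hW' u :=
    (appLE_apply_appLE L.proj _ _ hW _).trans (appLE_apply_congr (projLift_toProjZ _ _) _ _ _)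
  refine (congr_arg (· * L.res W (S.F s)) h1).trans ?_
  refine ι_appLE_injective W (by simp) ?_
  have hunit : IsUnit (L.coords W.ι (MvPolynomial.X s)) := by
    refine L.isUnit_coords _ s ?_
    rw [eq_top_iff]
    exact fun x _ => hWD x.2
  have hX : ∀ i, W.ι.appLE W ⊤ (by simp) (L.res W (S.F i)) = L.coords W.ι (MvPolynomial.X i) := by
    intro i
    rw [coords_X, appLE_res, ← appLE_top_top W.ι (le_preimage_top _ _), appLE_res]
  rw [map_mul, hX, hX]
  have h2 : ⊤ ≤ (W.ι ≫ L.projZ) ⁻¹ᵁ Proj.basicOpen (polyGrading S.n) (MvPolynomial.X s) := by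
    rw [Scheme.Hom.comp_preimage, projZ_preimage]
    exact fun x _ => hWD x.2
  have h3 : W.ι.appLE W ⊤ (by simp) (L.projZ.appLE _ W hW' u) = (W.ι ≫ L.projZ).appLE _ ⊤ h2 u :=
    appLE_apply_appLE W.ι L.projZ hW' _ u
  rw [h3, appLE_apply_congr (L.comp_projZ W.ι s hunit) h2 (by
    rw [← L.comp_projZ W.ι s hunit]; exact h2)]
  exact hu _ hunit _

lemma ret_mem_range (s) (W : L.X.toScheme.Opens) (hW : W ≤ L.proj ⁻¹ᵁ projChart (Base ρ) s)
    (f : MvPolynomial σ ℂ) :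
    L.ret s W f ∈ (L.proj.appLE (projChart (Base ρ) s) W hW).hom.range := by
  have key : ∀ a ∈ Submodule.span (fixedBy ρ) (Set.range S.F),
      L.res W a * Ring.inverse (L.res W (S.F s)) ∈
        (L.proj.appLE (projChart (Base ρ) s) W hW).hom.range := by
    intro a ha
    induction ha using Submodule.span_induction with
    | mem x hx => obtain ⟨s', rfl⟩ := hx; exact L.res_quotient_mem s s' W hW
    | zero => rw [map_zero, zero_mul]; exact zero_mem _
    | add x y _ _ hx hy => rw [map_add, add_mul]; exact add_mem hx hy
    | smul c x _ hx =>
      rw [Algebra.smul_def, map_mul, mul_assoc]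
      exact mul_mem (L.res_fixed_mem s W hW c) hx
  induction f using MvPolynomial.induction_on with
  | C a =>
    rw [ret, MvPolynomial.eval₂Hom_C]
    exact L.res_fixed_mem s W hW (algebraMap ℂ _ a)
  | add p q hp hq => rw [map_add]; exact add_mem hp hq
  | mul_X p i hp =>
    rw [map_mul]
    refine mul_mem hp ?_
    rw [ret, MvPolynomial.eval₂Hom_X']
    exact key _ (S.e_mem s i)

instance noetherianSpace [Finite σ] (U : (AffSp σ).Opens) : NoetherianSpace U.toScheme := by
  have : IsNoetherianRing (MvPolynomial σ ℂ) := inferInstance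
  have : NoetherianSpace (AffSp σ) := inferInstanceAs (NoetherianSpace (PrimeSpectrum _))
  exact U.ι.isOpenEmbedding.isInducing.noetherianSpace

/-- The quotient exists: it is the image of the locus in projective space. -/
theorem exists_sections [Finite σ] : ∃ (Y : Scheme.{0}) (π : L.X.toScheme ⟶ Y) (q : Y ⟶ Base ρ),
    π ≫ q = L.toBase ∧ Nonempty (L.Sections π) := by
  let j := L.proj.imageι
  let π := L.proj.toImage
  have hj : π ≫ j = L.proj := L.proj.toImage_imageι
  have inv : ∀ g, L.act g ≫ π = π := fun g => by
    rw [← cancel_mono j, Category.assoc, hj, act_proj]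
  let V : Fin (S.n + 1) → L.proj.image.Opens := fun s => j ⁻¹ᵁ projChart (Base ρ) s
  have hV : ∀ s, π ⁻¹ᵁ V s = L.D s := fun s => by
    rw [← Scheme.Hom.comp_preimage, hj, proj_preimage]
  have hinj : ∀ s U, U = V s → Function.Injective (π.app U) := by
    rintro s _ rfl
    exact L.proj.toImage_app_injective ⟨_, isAffineOpen_projChart _ s⟩
  have haff : ∀ s, IsAffineOpen (V s) := fun s => (isAffineOpen_projChart _ s).preimage j
  have hret : ∀ s f, L.ret s (π ⁻¹ᵁ V s) f ∈ Set.range (π.app (V s)) := by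
    intro s f
    have hW : π ⁻¹ᵁ V s ≤ L.proj ⁻¹ᵁ projChart (Base ρ) s := by rw [hV, proj_preimage]
    obtain ⟨u, hu⟩ := L.ret_mem_range s (π ⁻¹ᵁ V s) hW f
    refine ⟨j.app _ u, ?_⟩
    rw [← hu, Scheme.Hom.app_eq_appLE, Scheme.Hom.app_eq_appLE]
    exact (appLE_apply_appLE π j _ _ u).trans (appLE_apply_congr hj _ _ _)
  have hc : ∀ s (a b : (V s).toScheme ⟶ (V s).toScheme),
      (π ∣_ V s) ≫ a = (π ∣_ V s) ≫ b → a = b := by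
    intro s a b hab
    have : IsAffine (V s).toScheme := haff s
    refine cancel_of_isAffine (π ∣_ V s) ?_ hab
    rw [Scheme.Hom.appTop, morphismRestrict_app]
    intro x y hxy
    exact hinj s _ (V s).ι_image_top ((ConcreteCategory.bijective_of_isIso
      (L.X.toScheme.presheaf.map (eqToHom (image_morphismRestrict_preimage π (V s) ⊤)).op)).1 hxy)
  choose τ hτ _ hpt using fun s =>
    exists_section inv s (V s) (hV s) (hinj s _ rfl) (hret s) (hc s)
  refine ⟨_, π, j ≫ ProjSpace.toBase _ _, ?_, ⟨⟨inv, V, haff, hV, ?_, τ, hτ,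
    fun s p v hp r hr => hpt s p v hp r hr⟩⟩⟩
  · rw [← Category.assoc, hj, proj, projLift_toBase]
  · change ⨆ s, j ⁻¹ᵁ projChart (Base ρ) s = ⊤
    rw [← Scheme.Hom.preimage_iSup, iSup_projChart]
    rfl

lemma exists_res_eq {f : MvPolynomial σ ℂ}
    (hf : (PrimeSpectrum.basicOpen f : (AffSp σ).Opens) ≤ L.X) {W : L.X.toScheme.Opens}
    (hW : W = L.basic f) (t : Γ(L.X.toScheme, W)) :
    ∃ (a : MvPolynomial σ ℂ) (k : ℕ), L.res W f ^ k * t = L.res W a := by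
  let f' := (Scheme.ΓSpecIso (CommRingCat.of (MvPolynomial σ ℂ))).inv f
  have hf' : (AffSp σ).basicOpen f' = PrimeSpectrum.basicOpen f :=
    basicOpen_eq_of_affine (R := CommRingCat.of (MvPolynomial σ ℂ)) f
  obtain rfl : W = L.X.ι ⁻¹ᵁ (AffSp σ).basicOpen f' := by rw [hW, hf']; rfl
  obtain ⟨t, rfl⟩ := (ι_app_bijective (hf'.trans_le hf)).2 t
  obtain ⟨k, y, hy⟩ := exists_eq_pow_mul_of_isAffineOpen (AffSp σ) ⊤ (isAffineOpen_top _) f' t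
  refine ⟨(Scheme.ΓSpecIso (CommRingCat.of (MvPolynomial σ ℂ))).hom y, k, ?_⟩
  have hres : ∀ z : Γ(AffSp σ, ⊤), L.X.ι.app ((AffSp σ).basicOpen f')
      ((AffSp σ).presheaf.map (homOfLE ((AffSp σ).basicOpen_le f')).op z) =
      L.res _ ((Scheme.ΓSpecIso (CommRingCat.of (MvPolynomial σ ℂ))).hom z) := by
    intro z
    rw [Scheme.Hom.app_eq_appLE]
    refine (ConcreteCategory.congr_hom (Scheme.Hom.map_appLE L.X.ι le_rfl _) z).trans ?_
    refine congr_arg (L.X.ι.appLE ⊤ _ _).hom ?_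
    exact (ConcreteCategory.congr_hom
      (Scheme.ΓSpecIso (CommRingCat.of (MvPolynomial σ ℂ))).hom_inv_id z).symm
  have h1 := congr_arg (L.X.ι.app ((AffSp σ).basicOpen f')).hom hy
  rw [map_mul, map_pow] at h1
  refine Eq.trans (congr_arg (fun x => x ^ k * _) ?_) (h1.symm.trans (hres y))
  refine Eq.trans ?_ (hres f').symm
  congr 1
  exact (ConcreteCategory.congr_hom
    (Scheme.ΓSpecIso (CommRingCat.of (MvPolynomial σ ℂ))).inv_hom_id f).symm

namespace Sections

variable {L} {Y : Scheme.{0}} {π : L.X.toScheme ⟶ Y} (T : L.Sections π)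

lemma basicOpen_F_le (L : S.Locus) (s) :
    (PrimeSpectrum.basicOpen (S.F s) : (AffSp σ).Opens) ≤ L.X := by
  rw [L.eq_iSup]
  exact le_iSup (fun s => (PrimeSpectrum.basicOpen (S.F s) : (AffSp σ).Opens)) s

include T in
lemma exists_ret [Finite σ] (s) {W : Y.Opens} (hW : W = T.V s) (u : Γ(Y, W)) :
    ∃ a, π.app W u = L.ret s (π ⁻¹ᵁ W) a := by
  have hD : π ⁻¹ᵁ W = L.D s := by rw [hW, T.preimage]
  obtain ⟨a, k, ha⟩ := L.exists_res_eq (basicOpen_F_le L s) hD (π.app W u)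
  refine ⟨a, L.densePoints.section_ext fun p ⟨v, hv⟩ hp => ?_⟩
  have hF := (L.mem_D_iff hv.symm s).mp (hD.le ((specC_mem_iff p _).mp hp))
  rw [L.value_ret hv.symm s _ hD.le hp.ge]
  obtain ⟨g, hg⟩ := L.affPt_normal hv.symm s hF
  rw [← Category.assoc] at hg
  have hpπ : (p ≫ L.act g) ≫ π = p ≫ π := by rw [Category.assoc, T.inv]
  have hp' : ⊤ ≤ (p ≫ L.act g) ⁻¹ᵁ π ⁻¹ᵁ W := by
    rw [← Scheme.Hom.comp_preimage, hpπ]; exact hp.ge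
  have h1 := congr_arg ((p ≫ L.act g).appLE (π ⁻¹ᵁ W) ⊤ hp').hom ha
  rw [map_mul, map_pow] at h1
  have h2 : ((p ≫ L.act g).appLE (π ⁻¹ᵁ W) ⊤ hp').hom (L.res (π ⁻¹ᵁ W) (S.F s)) = 1 :=
    (L.value_res hg _ hp' _).trans (by rw [eval_normal_F s v hF, map_one])
  rw [h2, one_pow, one_mul] at h1
  refine Eq.trans ?_ (h1.trans (L.value_res hg _ hp' _))
  rw [Scheme.Hom.app_eq_appLE]
  exact (appLE_apply_appLE p π _ _ u).trans ((appLE_apply_congr hpπ.symm _ _ u).trans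
    (appLE_apply_appLE (p ≫ L.act g) π _ _ u).symm)

lemma morphismRestrict_τ_proj [Finite σ] (s) :
    (π ∣_ T.V s) ≫ T.τ s ≫ L.proj = (π ⁻¹ᵁ T.V s).ι ≫ L.proj := by
  refine (L.densePoints.opens _).hom_ext fun q hq => ?_
  obtain ⟨g, hg⟩ := T.exists_act s hq (r := q ≫ (π ∣_ T.V s)) (by
    rw [Category.assoc, Category.assoc, morphismRestrict_ι])
  rw [← Category.assoc q, ← Category.assoc (q ≫ _), hg, Category.assoc, act_proj, Category.assoc]

include T in
lemma cancel {Z : Scheme.{0}} (W : Y.Opens) {a b : W.toScheme ⟶ Z}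
    (h : (π ∣_ W) ≫ a = (π ∣_ W) ≫ b) : a = b := by
  refine cancel_of_surjective_of_injective (π ∣_ W) ?_ (fun U => ?_) h
  · rintro ⟨y, hy⟩
    obtain ⟨x, rfl⟩ := T.surjective y
    exact ⟨⟨x, hy⟩, W.ι.isOpenEmbedding.injective
      (congr_arg (fun k : (π ⁻¹ᵁ W).toScheme ⟶ Y => k ⟨x, hy⟩) (morphismRestrict_ι π W))⟩
  · rw [morphismRestrict_app]
    intro x y hxy
    exact T.app_injective _ ((ConcreteCategory.bijective_of_isIso
      (L.X.toScheme.presheaf.map (eqToHom (image_morphismRestrict_preimage π W U)).op)).1 hxy)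

include T in
lemma exists_toProjSpace [Finite σ] :
    ∃ i : Y ⟶ ProjSpace S.n (Base ρ), π ≫ i = L.proj := by
  obtain ⟨i, hi⟩ := exists_glue T.iSup_V (fun s => T.τ s ≫ L.proj) fun s s' => by
    refine T.cancel _ ?_
    have e : ∀ s'' (h : T.V s ⊓ T.V s' ≤ T.V s''),
        (π ∣_ (T.V s ⊓ T.V s')) ≫ Y.homOfLE h ≫ T.τ s'' ≫ L.proj =
          (π ⁻¹ᵁ (T.V s ⊓ T.V s')).ι ≫ L.proj := by
      intro s'' h
      have h1 : (π ∣_ (T.V s ⊓ T.V s')) ≫ Y.homOfLE h =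
          L.X.toScheme.homOfLE (π.preimage_mono h) ≫ (π ∣_ T.V s'') := by
        rw [← cancel_mono (T.V s'').ι]
        simp
      rw [reassoc_of% h1, morphismRestrict_τ_proj, Scheme.homOfLE_ι_assoc]
    rw [e, e]
  refine ⟨i, hom_ext_of_cover (V := fun s => π ⁻¹ᵁ T.V s) ?_ fun s => ?_⟩
  · rw [← Scheme.Hom.preimage_iSup, T.iSup_V]
    rfl
  · rw [← morphismRestrict_ι_assoc, hi, morphismRestrict_τ_proj]

include T in
/-- The quotient embeds into projective space over the affine quotient. -/
theorem exists_isClosedImmersion [Finite σ] :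
    ∃ i : Y ⟶ ProjSpace S.n (Base ρ), IsClosedImmersion i ∧ π ≫ i = L.proj := by
  obtain ⟨i, hi⟩ := T.exists_toProjSpace
  refine ⟨i, ?_, hi⟩
  have hpre : ∀ s, i ⁻¹ᵁ projChart (Base ρ) s = T.V s := by
    intro s
    ext y
    obtain ⟨x, rfl⟩ := T.surjective y
    have h1 : π ⁻¹ᵁ i ⁻¹ᵁ projChart (Base ρ) s = π ⁻¹ᵁ T.V s := by
      rw [← Scheme.Hom.comp_preimage, hi, proj_preimage, T.preimage]
    exact SetLike.ext_iff.mp h1 x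
  refine (IsZariskiLocalAtTarget.iff_of_iSup_eq_top (P := @IsClosedImmersion)
    (projChart (Base ρ)) (iSup_projChart _)).mpr fun s => ?_
  have h1 : IsAffine (projChart (Base ρ) s).toScheme := isAffineOpen_projChart _ s
  have h2 : IsAffine (i ⁻¹ᵁ projChart (Base ρ) s).toScheme := by
    rw [hpre]; exact T.affine s
  refine IsClosedImmersion.of_surjective_of_isAffine _ ?_
  rw [Scheme.Hom.appTop, morphismRestrict_app]
  have key : ∀ U, U = projChart (Base ρ) s → Function.Surjective (i.app U) := by
    rintro _ rfl u
    obtain ⟨a, ha⟩ := T.exists_ret s (hpre s) u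
    have hW : π ⁻¹ᵁ i ⁻¹ᵁ projChart (Base ρ) s ≤ L.proj ⁻¹ᵁ projChart (Base ρ) s := by
      rw [← Scheme.Hom.comp_preimage, hi]
    obtain ⟨w, hw⟩ := L.ret_mem_range s _ hW a
    refine ⟨w, T.app_injective _ ?_⟩
    rw [ha, ← hw, Scheme.Hom.app_eq_appLE, Scheme.Hom.app_eq_appLE]
    exact (appLE_apply_appLE π i _ _ w).trans (appLE_apply_congr hi _ _ _)
  intro u
  obtain ⟨u', rfl⟩ := (ConcreteCategory.bijective_of_isIso (Y.presheaf.map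
    (eqToHom (image_morphismRestrict_preimage i (projChart (Base ρ) s) ⊤)).op)).2 u
  obtain ⟨w, rfl⟩ := key _ (projChart (Base ρ) s).ι_image_top u'
  exact ⟨w, rfl⟩

include T in
theorem isProjectiveMorphism [Finite σ] {q : Y ⟶ Base ρ} (hq : π ≫ q = L.toBase) :
    IsProjectiveMorphism q := by
  obtain ⟨i, hi, hπ⟩ := T.exists_isClosedImmersion
  refine ⟨S.n, i, hi, ?_⟩
  refine cancel_of_surjective_of_injective π T.surjective T.app_injective ?_
  rw [hq, ← Category.assoc, hπ, proj, projLift_toBase]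

end Sections

end ChartSystem.Locus

/-! ### Slices: smoothness of the quotient -/

namespace ChartSystem

variable {σ G : Type} {ρ : G → MvPolynomial σ ℂ →ₐ[ℂ] MvPolynomial σ ℂ}

/-- Charts of a chart system whose normal forms make up coordinate slices: the normal forms
for the chart `idx t` are the points of an affine space with coordinates indexed by `J t`,
embedded by setting the remaining coordinates to constants. -/
structure Slices (S : ChartSystem ρ) where
  /-- The index set of the slices. -/
  T : Type
  /-- The chart of a slice. -/
  idx : T → Fin (S.n + 1)
  /-- The coordinates of a slice. -/
  J : T → Type
  finite : ∀ t, Finite (J t)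
  /-- The position of the coordinates of a slice. -/
  c : ∀ t, J t → σ
  /-- The restriction of functions to a slice. -/
  sec : ∀ t, MvPolynomial σ ℂ →ₐ[ℂ] MvPolynomial (J t) ℂ
  sec_c : ∀ t j, sec t (MvPolynomial.X (c t j)) = MvPolynomial.X j
  sec_F : ∀ t, sec t (S.F (idx t)) = 1
  sec_e : ∀ t z, sec t (S.e (idx t) z) = sec t (MvPolynomial.X z)
  exists_coord : ∀ t z, (∃ j, z = c t j) ∨
    ∃ a : ℂ, sec t (MvPolynomial.X z) = MvPolynomial.C a ∧
      S.e (idx t) z = MvPolynomial.C a * S.F (idx t)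
  cover : ∀ s v, MvPolynomial.eval v (S.F s) ≠ 0 →
    ∃ t, MvPolynomial.eval v (S.F (idx t)) ≠ 0

end ChartSystem

lemma affPt_comp_map {κ κ' : Type} (w : κ → ℂ) (f : MvPolynomial κ' ℂ →ₐ[ℂ] MvPolynomial κ ℂ) :
    affPt w ≫ Spec.map (CommRingCat.ofHom f.toRingHom) =
      affPt fun z => MvPolynomial.eval w (f (MvPolynomial.X z)) := by
  rw [affPt, affPt, ← Spec.map_comp]
  congr 1
  refine CommRingCat.hom_ext (RingHom.ext fun p => ?_)
  change MvPolynomial.aeval w (f p) = MvPolynomial.aeval _ p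
  refine congr_arg (fun h => h p) (?_ : (MvPolynomial.aeval w).comp f = _)
  refine MvPolynomial.algHom_ext fun z => ?_
  simp [MvPolynomial.aeval_eq_eval]

namespace ChartSystem.Locus

variable {σ G : Type} {ρ : G → MvPolynomial σ ℂ →ₐ[ℂ] MvPolynomial σ ℂ} {S : ChartSystem ρ}
  (L : S.Locus)

/-- The embedding of a slice. -/
def slice (R : S.Slices) (t : R.T) : AffSp (R.J t) ⟶ L.X.toScheme :=
  IsOpenImmersion.lift L.X.ι (Spec.map (CommRingCat.ofHom (R.sec t).toRingHom)) (by
    rintro _ ⟨y, rfl⟩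
    rw [Scheme.Opens.range_ι]
    refine Sections.basicOpen_F_le L (R.idx t) ?_
    change R.sec t (S.F (R.idx t)) ∉ (y : PrimeSpectrum _).asIdeal
    rw [R.sec_F]
    exact fun h => (y : PrimeSpectrum _).2.ne_top ((Ideal.eq_top_iff_one _).mpr h))

lemma slice_ι (R : S.Slices) (t : R.T) :
    L.slice R t ≫ L.X.ι = Spec.map (CommRingCat.ofHom (R.sec t).toRingHom) :=
  IsOpenImmersion.lift_fac _ _ _

/-- The point of affine space that is given by coordinates on the slice. -/
def sliceVec (R : S.Slices) (t : R.T) (w : R.J t → ℂ) : σ → ℂ :=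
  fun z => MvPolynomial.eval w (R.sec t (MvPolynomial.X z))

lemma affPt_slice (R : S.Slices) (t : R.T) (w : R.J t → ℂ) :
    (affPt w ≫ L.slice R t) ≫ L.X.ι = affPt (sliceVec R t w) := by
  rw [Category.assoc, slice_ι, affPt_comp_map]
  rfl

lemma eval_sliceVec (R : S.Slices) (t : R.T) (w : R.J t → ℂ) (f : MvPolynomial σ ℂ) :
    MvPolynomial.eval (sliceVec R t w) f = MvPolynomial.eval w (R.sec t f) := by
  rw [← MvPolynomial.aeval_eq_eval, ← MvPolynomial.aeval_eq_eval]
  refine congr_arg (fun h => h f) (?_ : _ = (MvPolynomial.aeval w).comp (R.sec t))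
  refine MvPolynomial.algHom_ext fun z => ?_
  simp [MvPolynomial.aeval_eq_eval, sliceVec]

lemma normal_sliceVec (R : S.Slices) (t : R.T) (w : R.J t → ℂ) :
    S.normal (R.idx t) (sliceVec R t w) = sliceVec R t w := by
  funext z
  rw [normal, eval_sliceVec, eval_sliceVec, R.sec_F, R.sec_e, map_one, div_one]
  rfl

lemma sliceVec_normal (R : S.Slices) (t : R.T) (v : σ → ℂ)
    (h : MvPolynomial.eval v (S.F (R.idx t)) ≠ 0) :
    sliceVec R t (fun j => S.normal (R.idx t) v (R.c t j)) = S.normal (R.idx t) v := by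
  funext z
  rcases R.exists_coord t z with ⟨j, rfl⟩ | ⟨a, ha, he⟩
  · rw [sliceVec, R.sec_c, MvPolynomial.eval_X]
  · rw [sliceVec, ha, normal, he, MvPolynomial.eval_C, map_mul, MvPolynomial.eval_C,
      mul_div_assoc, div_self h, mul_one]

namespace Sections

variable {L} {Y : Scheme.{0}} {π : L.X.toScheme ⟶ Y} (T : L.Sections π) (R : S.Slices)

/-- The chart of the quotient by the affine space of a slice. -/
def chart (t : R.T) : AffSp (R.J t) ⟶ (T.V (R.idx t)).toScheme :=
  IsOpenImmersion.lift (T.V (R.idx t)).ι (L.slice R t ≫ π) (by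
    rintro _ ⟨y, rfl⟩
    rw [Scheme.Opens.range_ι]
    change L.slice R t y ∈ π ⁻¹ᵁ T.V (R.idx t)
    rw [T.preimage]
    change (L.slice R t ≫ L.X.ι) y ∈
      (PrimeSpectrum.basicOpen (S.F (R.idx t)) : (AffSp σ).Opens)
    rw [slice_ι]
    change R.sec t (S.F (R.idx t)) ∉ (y : PrimeSpectrum _).asIdeal
    rw [R.sec_F]
    exact fun h => (y : PrimeSpectrum _).2.ne_top ((Ideal.eq_top_iff_one _).mpr h))

lemma chart_ι (t : R.T) : T.chart R t ≫ (T.V (R.idx t)).ι = L.slice R t ≫ π :=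
  IsOpenImmersion.lift_fac _ _ _

/-- The inverse of a chart. -/
def chartInv (t : R.T) : (T.V (R.idx t)).toScheme ⟶ AffSp (R.J t) :=
  T.τ (R.idx t) ≫ L.X.ι ≫ Spec.map (CommRingCat.ofHom
    (MvPolynomial.rename (R := ℂ) (R.c t)).toRingHom)

lemma comp_chartInv (t : R.T) {p : SpecC ⟶ L.X.toScheme} {v : σ → ℂ} (hp : p ≫ L.X.ι = affPt v)
    {r : SpecC ⟶ (T.V (R.idx t)).toScheme} (hr : r ≫ (T.V (R.idx t)).ι = p ≫ π) :
    r ≫ T.chartInv R t = affPt fun j => S.normal (R.idx t) v (R.c t j) := by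
  have h1 := T.τ_pt _ p v hp r hr
  rw [chartInv, ← Category.assoc, ← Category.assoc, Category.assoc r, h1, affPt_comp_map]
  simp

lemma chart_chartInv (t : R.T) : T.chart R t ≫ T.chartInv R t = 𝟙 _ := by
  have := R.finite t
  refine densePoints_affSp.hom_ext ?_
  rintro _ ⟨w, rfl⟩
  rw [← Category.assoc, T.comp_chartInv R t (L.affPt_slice R t w) (by
    rw [Category.assoc, chart_ι, Category.assoc]), normal_sliceVec, Category.comp_id]
  congr 1
  funext j
  rw [sliceVec, R.sec_c, MvPolynomial.eval_X]

lemma chartInv_chart [Finite σ] (t : R.T) : T.chartInv R t ≫ T.chart R t = 𝟙 _ := by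
  refine T.cancel _ ?_
  refine (L.densePoints.opens _).hom_ext fun q ⟨v, hv⟩ => ?_
  have hr : (q ≫ (π ∣_ T.V (R.idx t))) ≫ (T.V (R.idx t)).ι = (q ≫ (π ⁻¹ᵁ T.V (R.idx t)).ι) ≫ π := by
    rw [Category.assoc, Category.assoc, morphismRestrict_ι]
  have h1 := T.comp_chartInv R t hv.symm hr
  have hF : MvPolynomial.eval v (S.F (R.idx t)) ≠ 0 := by
    rw [← L.mem_D_iff hv.symm, ← T.preimage, Scheme.Hom.comp_apply]
    exact (q specCPoint).2
  obtain ⟨g, hg⟩ := L.affPt_normal hv.symm _ hF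
  rw [← cancel_mono (T.V (R.idx t)).ι]
  simp only [Category.assoc, Category.comp_id] at h1 hr ⊢
  rw [reassoc_of% h1, chart_ι, hr]
  have h2 := L.affPt_slice R t fun j => S.normal (R.idx t) v (R.c t j)
  rw [sliceVec_normal R t v hF, ← hg, ← Category.assoc _ _ L.X.ι,
    cancel_mono] at h2
  rw [← Category.assoc, h2, Category.assoc, Category.assoc, T.inv]

lemma iSup_V_slices [Finite σ] : ⨆ t, T.V (R.idx t) = ⊤ := by
  have hD : ⨆ t, L.D (R.idx t) = ⊤ := by
    refine top_le_iff.mp (L.densePoints.opens_le fun p ⟨v, hv⟩ _ => ?_)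
    have hx : p specCPoint ∈ ⨆ s, L.D s := L.iSup_D ▸ trivial
    obtain ⟨s, hs⟩ := Opens.mem_iSup.mp hx
    obtain ⟨t, ht⟩ := R.cover s v ((L.mem_D_iff hv.symm s).mp hs)
    exact Opens.mem_iSup.mpr ⟨t, (L.mem_D_iff hv.symm _).mpr ht⟩
  rw [eq_top_iff]
  intro y _
  obtain ⟨x, rfl⟩ := T.surjective y
  have hx : x ∈ ⨆ t, L.D (R.idx t) := hD ▸ trivial
  obtain ⟨t, ht⟩ := Opens.mem_iSup.mp hx
  exact Opens.mem_iSup.mpr ⟨t, (T.preimage _).ge ht⟩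

/-- The structure morphism of the affine quotient. -/
abbrev _root_.ChartSystem.Locus.baseStr (ρ : G → MvPolynomial σ ℂ →ₐ[ℂ] MvPolynomial σ ℂ) :
    Base ρ ⟶ SpecC := Spec.map (CommRingCat.ofHom (algebraMap ℂ (fixedBy ρ)))

/-- The structure morphism of affine space. -/
abbrev _root_.affSpStr (κ : Type) : AffSp κ ⟶ SpecC :=
  Spec.map (CommRingCat.ofHom (algebraMap ℂ (MvPolynomial κ ℂ)))

lemma chart_str {q : Y ⟶ Base ρ} (hq : π ≫ q = L.toBase) (t : R.T) :
    T.chart R t ≫ (T.V (R.idx t)).ι ≫ q ≫ baseStr ρ = affSpStr (R.J t) := by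
  rw [← Category.assoc, chart_ι, Category.assoc, ← Category.assoc π, hq, toBase, Category.assoc,
    ← Category.assoc (L.slice R t), slice_ι, ← Spec.map_comp, ← Spec.map_comp]
  congr 1
  refine CommRingCat.hom_ext (RingHom.ext fun a => ?_)
  exact (R.sec t).commutes a

include T R in
lemma smooth [Finite σ] {q : Y ⟶ Base ρ} (hq : π ≫ q = L.toBase) : Smooth (q ≫ baseStr ρ) := by
  have : IsZariskiLocalAtSource @Smooth :=
    HasRingHomProperty.instIsZariskiLocalAtSource (Q := RingHom.Smooth)
  refine (IsZariskiLocalAtSource.iff_of_iSup_eq_top (P := @Smooth) _ (T.iSup_V_slices R)).mpr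
    fun t => ?_
  have h1 : Smooth (affSpStr (R.J t)) := by
    rw [HasRingHomProperty.Spec_iff (P := @Smooth)]
    have := R.finite t
    change (algebraMap ℂ (MvPolynomial (R.J t) ℂ)).Smooth
    rw [RingHom.smooth_algebraMap]
    exact { formallySmooth := inferInstance, finitePresentation := inferInstance }
  have h2 : IsIso (T.chartInv R t) := ⟨T.chart R t, T.chartInv_chart R t, T.chart_chartInv R t⟩
  have h3 : (T.V (R.idx t)).ι ≫ q ≫ baseStr ρ = T.chartInv R t ≫ affSpStr (R.J t) := by
    rw [← T.chart_str R hq, ← Category.assoc (T.chartInv R t), T.chartInv_chart, Category.id_comp]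
  rw [h3]
  have h4 : Smooth (T.chartInv R t) := inferInstance
  exact smooth_comp _ _

include T in
lemma noetherianSpace [Finite σ] : NoetherianSpace Y :=
  noetherianSpace_of_surjective π π.continuous T.surjective

include T in
lemma isIntegral [Finite σ] [Nonempty Y] : IsIntegral Y where
  component_integral U hU := by
    obtain ⟨⟨y, hy⟩⟩ := hU
    obtain ⟨x, rfl⟩ := T.surjective y
    have : Nonempty L.X.toScheme := ⟨x⟩
    have : IsIntegral L.X.toScheme := isIntegral_of_isOpenImmersion L.X.ι
    have : Nonempty (π ⁻¹ᵁ U : L.X.toScheme.Opens) := ⟨⟨x, hy⟩⟩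
    exact (T.app_injective U).isDomain (π.app U).hom

lemma _root_.isSeparated_projSpace (n : ℕ) (Z : Scheme.{0}) : IsSeparated (ProjSpace.toBase n Z) := by
  let := MvPolynomial.gradedAlgebra (σ := Fin (n + 1)) (R := ℤ)
  have h : Scheme.IsSeparated (Proj (polyGrading n)) := inferInstance
  have : IsSeparated (Limits.terminal.from (Proj (polyGrading n))) := inferInstance
  exact MorphismProperty.of_isPullback (IsPullback.of_hasPullback (Limits.terminal.from Z)
      (Limits.terminal.from (Proj (polyGrading n)))).flip this

include T R in
lemma isVariety [Finite σ] {q : Y ⟶ Base ρ} (hq : π ≫ q = L.toBase) [Nonempty Y] :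
    IsVariety (q ≫ baseStr ρ) where
  integral := T.isIntegral
  separated := by
    obtain ⟨n, i, hi, rfl⟩ := T.isProjectiveMorphism hq
    have := isSeparated_projSpace n (Base ρ)
    infer_instance
  locallyOfFiniteType := by
    have key : ∀ {A B : Scheme.{0}} (f : A ⟶ B), Smooth f → LocallyOfFiniteType f :=
      fun f hf => inferInstance
    exact key _ (T.smooth R hq)
  quasiCompact := by
    have := T.noetherianSpace
    infer_instance

end Sections

lemma isVariety_base (hfg : (fixedBy ρ).FG) : IsVariety (baseStr ρ) where
  integral := by
    have : IsDomain (CommRingCat.of (fixedBy ρ)) := inferInstanceAs (IsDomain (fixedBy ρ))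
    infer_instance
  separated := inferInstance
  locallyOfFiniteType := by
    rw [HasRingHomProperty.Spec_iff (P := @LocallyOfFiniteType)]
    change (algebraMap ℂ (fixedBy ρ)).FiniteType
    rw [RingHom.finiteType_algebraMap]
    exact (Subalgebra.fg_iff_finiteType _).mp hfg
  quasiCompact := inferInstance

end ChartSystem.Locus

/-! ### Functions on the quotient -/

/-- A morphism to an affine scheme that induces a bijection on global functions has
`f_* 𝒪_Y = 𝒪_Z`. -/
lemma pushforwardStructureSheafEq_of_bijective {Y : Scheme.{0}} [CompactSpace Y]
    [QuasiSeparatedSpace Y] {Z : Scheme.{0}} [IsAffine Z] (f : Y ⟶ Z)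
    (hf : Function.Bijective f.appTop) : PushforwardStructureSheafEq f := by
  -- over a basic open set, both sides are localizations of the global functions
  have hbasic : ∀ h : Γ(Z, ⊤), Function.Bijective (f.app (Z.basicOpen h)) := by
    intro h
    have h1 : IsLocalization.Away h Γ(Z, Z.basicOpen h) :=
      (isAffineOpen_top Z).isLocalization_basicOpen h
    have hp : f ⁻¹ᵁ Z.basicOpen h = Y.basicOpen (f.appTop h) := Scheme.preimage_basicOpen_top f h
    have hres : ∀ a : Γ(Z, ⊤), f.app (Z.basicOpen h) (Z.presheaf.map (homOfLE le_top).op a) =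
        Y.presheaf.map (homOfLE le_top).op (f.appTop a) := fun a =>
      ConcreteCategory.congr_hom (Scheme.Hom.naturality f
        (homOfLE (le_top : Z.basicOpen h ≤ ⊤)).op) a
    have hunit : IsUnit (f.app (Z.basicOpen h) (Z.presheaf.map (homOfLE le_top).op h)) := by
      refine IsUnit.map (f.app (Z.basicOpen h)).hom ?_
      exact RingedSpace.isUnit_res_basicOpen Z.toLocallyRingedSpace.toRingedSpace h
    have hloc : ∀ x : Γ(Z, Z.basicOpen h), ∃ (a : Γ(Z, ⊤)) (k : ℕ),
        x * Z.presheaf.map (homOfLE (le_top : Z.basicOpen h ≤ ⊤)).op h ^ k =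
          Z.presheaf.map (homOfLE le_top).op a := by
      intro x
      obtain ⟨⟨a, _, k, rfl⟩, hx⟩ := h1.1.2 x
      refine ⟨a, k, ?_⟩
      rw [← map_pow]
      exact hx
    constructor
    · rw [injective_iff_map_eq_zero]
      intro x hx
      obtain ⟨a, k, ha⟩ := hloc x
      have h2 := congr_arg (f.app (Z.basicOpen h)).hom ha
      rw [map_mul] at h2
      have h3 : Y.presheaf.map (homOfLE (le_top : f ⁻¹ᵁ Z.basicOpen h ≤ ⊤)).op (f.appTop a) = 0 :=
        (hres a).symm.trans (h2.symm.trans (by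
          refine (congr_arg (· * _) hx).trans (zero_mul _)))
      have h4 : Y.presheaf.map (homOfLE (le_top : Y.basicOpen (f.appTop h) ≤ ⊤)).op
          (f.appTop a) = 0 := by
        have e : ∀ W (hW : W ≤ f ⁻¹ᵁ Z.basicOpen h),
            Y.presheaf.map (homOfLE (le_top : W ≤ ⊤)).op (f.appTop a) = 0 := by
          intro W hW
          have := congr_arg (Y.presheaf.map (homOfLE hW).op).hom h3
          rw [map_zero] at this
          refine Eq.trans ?_ this
          exact (ConcreteCategory.congr_hom (Y.presheaf.map_comp
            (homOfLE (le_top : f ⁻¹ᵁ Z.basicOpen h ≤ ⊤)).op (homOfLE hW).op) _)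
        exact e _ hp.ge
      obtain ⟨N, hN⟩ := exists_of_res_zero_of_qcqs_of_top h4
      rw [← map_pow, ← map_mul] at hN
      have h5 : h ^ N * a = 0 := hf.1 (hN.trans (map_zero _).symm)
      have hu : IsUnit (Z.presheaf.map (homOfLE (le_top : Z.basicOpen h ≤ ⊤)).op h) :=
        RingedSpace.isUnit_res_basicOpen Z.toLocallyRingedSpace.toRingedSpace h
      have h6 : Z.presheaf.map (homOfLE (le_top : Z.basicOpen h ≤ ⊤)).op a = 0 := by
        have := congr_arg (Z.presheaf.map (homOfLE (le_top : Z.basicOpen h ≤ ⊤)).op).hom h5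
        rw [map_mul, map_pow, map_zero] at this
        exact (hu.pow N).mul_right_eq_zero.mp this
      rw [h6] at ha
      exact (hu.pow k).mul_left_eq_zero.mp ha
    · intro y
      have hy : ∃ (k : ℕ) (b : Γ(Y, ⊤)), Y.presheaf.map (homOfLE
          (le_top : f ⁻¹ᵁ Z.basicOpen h ≤ ⊤)).op b = Y.presheaf.map (homOfLE
          (le_top : f ⁻¹ᵁ Z.basicOpen h ≤ ⊤)).op (f.appTop h) ^ k * y := by
        have e : ∀ W, W = Y.basicOpen (f.appTop h) → ∀ y : Γ(Y, W), ∃ (k : ℕ) (b : Γ(Y, ⊤)),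
            Y.presheaf.map (homOfLE (le_top : W ≤ ⊤)).op b =
              Y.presheaf.map (homOfLE (le_top : W ≤ ⊤)).op (f.appTop h) ^ k * y := by
          rintro _ rfl y
          exact exists_eq_pow_mul_of_isCompact_of_isQuasiSeparated Y ⊤ CompactSpace.isCompact_univ
            isQuasiSeparated_univ (f.appTop h) y
        exact e _ hp y
      obtain ⟨k, b, hb⟩ := hy
      obtain ⟨a, rfl⟩ := hf.2 b
      have hu : IsUnit (Z.presheaf.map (homOfLE (le_top : Z.basicOpen h ≤ ⊤)).op h) :=
        RingedSpace.isUnit_res_basicOpen Z.toLocallyRingedSpace.toRingedSpace h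
      obtain ⟨w, hw⟩ := hu.exists_right_inv
      refine ⟨Z.presheaf.map (homOfLE (le_top : Z.basicOpen h ≤ ⊤)).op a * w ^ k, ?_⟩
      refine (hunit.pow k).mul_left_cancel ?_
      have h7 := congr_arg (f.app (Z.basicOpen h)).hom hw
      rw [map_mul, map_one] at h7
      have h8 : Y.presheaf.map (homOfLE (le_top : f ⁻¹ᵁ Z.basicOpen h ≤ ⊤)).op (f.appTop h) *
          f.app (Z.basicOpen h) w = 1 := (congr_arg (· * _) (hres h)).symm.trans h7
      have h9 := (hres a).trans hb
      have h10 : f.app (Z.basicOpen h) (Z.presheaf.map (homOfLE le_top).op a * w ^ k) =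
          f.app (Z.basicOpen h) (Z.presheaf.map (homOfLE le_top).op a) *
            f.app (Z.basicOpen h) w ^ k := by rw [map_mul, map_pow]
      refine (congr_arg (_ * ·) (h10.trans (congr_arg (· * _) h9))).trans ?_
      refine Eq.trans ?_ (congr_arg (fun z => z ^ k * y) (hres h)).symm
      refine (congr_arg (fun z => z ^ k * _) (hres h)).trans ?_
      calc _ = (Y.presheaf.map (homOfLE (le_top : f ⁻¹ᵁ Z.basicOpen h ≤ ⊤)).op (f.appTop h) *
          f.app (Z.basicOpen h) w) ^ k * (Y.presheaf.map (homOfLE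
            (le_top : f ⁻¹ᵁ Z.basicOpen h ≤ ⊤)).op (f.appTop h) ^ k * y) := by ring
        _ = _ := by rw [h8, one_pow, one_mul]
  -- the general case follows since the basic open sets form a basis
  have hcov : ∀ (V : Z.Opens) {z : Z}, z ∈ V → ∃ h : Γ(Z, ⊤), z ∈ Z.basicOpen h ∧
      Z.basicOpen h ≤ V := by
    intro V z hz
    obtain ⟨_, ⟨_, ⟨h, rfl⟩, rfl⟩, hzh, hV⟩ :=
      (isBasis_basicOpen Z).exists_subset_of_mem_open hz V.2
    exact ⟨h, hzh, hV⟩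
  have hinj : ∀ V, Function.Injective (f.app V) := by
    intro V t t' htt
    refine TopCat.Sheaf.eq_of_locally_eq' Z.sheaf
      (fun h : {h : Γ(Z, ⊤) // Z.basicOpen h ≤ V} => Z.basicOpen h.1) V
      (fun h => homOfLE h.2) ?_ t t' fun h => ?_
    · intro z hz
      obtain ⟨h, hzh, hV⟩ := hcov V hz
      exact Opens.mem_iSup.mpr ⟨⟨h, hV⟩, hzh⟩
    · refine (hbasic h.1).1 ?_
      have e : ∀ t : Γ(Z, V), f.app (Z.basicOpen h.1) (Z.presheaf.map (homOfLE h.2).op t) =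
          Y.presheaf.map (homOfLE (f.preimage_mono h.2)).op (f.app V t) := fun t =>
        ConcreteCategory.congr_hom (Scheme.Hom.naturality f (homOfLE h.2).op) t
      exact (e t).trans ((congr_arg _ htt).trans (e t').symm)
  refine fun V => ⟨hinj V, fun u => ?_⟩
  have hex : ∀ h : {h : Γ(Z, ⊤) // Z.basicOpen h ≤ V}, ∃ t, f.app (Z.basicOpen h.1) t =
      Y.presheaf.map (homOfLE (f.preimage_mono h.2)).op u := fun h => (hbasic h.1).2 _
  choose t ht using hex
  have hmap : ∀ h {W : Z.Opens} (i : W ⟶ Z.basicOpen h.1) (hW : W ≤ V),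
      f.app W (Z.presheaf.map i.op (t h)) =
        Y.presheaf.map (homOfLE (f.preimage_mono hW)).op u := by
    intro h W i hW
    refine (ConcreteCategory.congr_hom (Scheme.Hom.naturality f i.op) (t h)).trans ?_
    refine (congr_arg (Y.presheaf.map _).hom (ht h)).trans ?_
    exact (ConcreteCategory.congr_hom (Y.presheaf.map_comp _ _) u).symm
  obtain ⟨w, hw, -⟩ := TopCat.Sheaf.existsUnique_gluing' Z.sheaf
    (fun h : {h : Γ(Z, ⊤) // Z.basicOpen h ≤ V} => Z.basicOpen h.1) V (fun h => homOfLE h.2)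
    (by
      intro z hz
      obtain ⟨h, hzh, hV⟩ := hcov V hz
      exact Opens.mem_iSup.mpr ⟨⟨h, hV⟩, hzh⟩) t (by
      intro h h'
      refine hinj _ ?_
      have hW : Z.basicOpen h.1 ⊓ Z.basicOpen h'.1 ≤ V := inf_le_left.trans h.2
      exact (hmap h _ hW).trans (hmap h' _ hW).symm)
  refine ⟨w, ?_⟩
  refine TopCat.Sheaf.eq_of_locally_eq' Y.sheaf
    (fun h : {h : Γ(Z, ⊤) // Z.basicOpen h ≤ V} => f ⁻¹ᵁ Z.basicOpen h.1) (f ⁻¹ᵁ V)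
    (fun h => homOfLE (f.preimage_mono h.2)) ?_ _ _ fun h => ?_
  · intro y hy
    obtain ⟨h, hzh, hV⟩ := hcov V (z := f y) hy
    exact Opens.mem_iSup.mpr ⟨⟨h, hV⟩, hzh⟩
  · refine Eq.trans ?_ (ht h)
    refine (ConcreteCategory.congr_hom (Scheme.Hom.naturality f (homOfLE h.2).op) w).symm.trans ?_
    exact congr_arg (f.app (Z.basicOpen h.1)).hom (hw h)

namespace ChartSystem.Locus

variable {σ G : Type} {ρ : G → MvPolynomial σ ℂ →ₐ[ℂ] MvPolynomial σ ℂ} {S : ChartSystem ρ}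
  (L : S.Locus)

lemma res_injective [Finite σ] (W : L.X.toScheme.Opens) [hW : Nonempty W] :
    Function.Injective (L.res W) := by
  rw [injective_iff_map_eq_zero]
  intro f hf
  by_contra hf0
  have h1 : L.X.toScheme.basicOpen (L.res W f) = ⊥ := by rw [hf, Scheme.basicOpen_zero]
  rw [L.basicOpen_res] at h1
  let U : (AffSp σ).Opens := PrimeSpectrum.basicOpen f
  have hne : (U : Set (AffSp σ)).Nonempty := by
    obtain ⟨v, hv⟩ : ∃ v, MvPolynomial.eval v f ≠ 0 := by
      by_contra hcon
      push Not at hcon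
      exact hf0 (MvPolynomial.funext fun v => by rw [hcon v, map_zero])
    exact ⟨_, (affPt_mem_basicOpen v f).mpr hv⟩
  have hne2 : ((L.X.ι ''ᵁ W : (AffSp σ).Opens) : Set (AffSp σ)).Nonempty := by
    obtain ⟨⟨x, hx⟩⟩ := hW
    exact ⟨_, x, hx, rfl⟩
  obtain ⟨_, hz, x, hx, rfl⟩ := nonempty_preirreducible_inter U.2 (L.X.ι ''ᵁ W).2 hne hne2
  have : x ∈ W ⊓ L.X.ι ⁻¹ᵁ (PrimeSpectrum.basicOpen f : (AffSp σ).Opens) := ⟨hx, hz⟩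
  rw [h1] at this
  exact this

/-- Invariant rational functions that are regular on the locus are polynomials. -/
def ExtendsRegular (S : ChartSystem ρ) : Prop :=
  ∀ p q : MvPolynomial σ ℂ, q ≠ 0 → (∀ g, ρ g p * q = p * ρ g q) →
    (∀ s, ∃ k, q ∣ p * S.F s ^ k) → q ∣ p

namespace Sections

variable {L} {Y : Scheme.{0}} {π : L.X.toScheme ⟶ Y} (T : L.Sections π)

include T in
/-- A function on the quotient is an invariant function on the locus, and these are polynomials. -/
lemma pushforward [Finite σ] (hext : ExtendsRegular S) [Nonempty Y] {q : Y ⟶ Base ρ}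
    (hq : π ≫ q = L.toBase) : PushforwardStructureSheafEq q := by
  have hns := T.noetherianSpace
  obtain ⟨x₀, -⟩ := T.surjective (Classical.arbitrary Y)
  have hXne : Nonempty L.X.toScheme := ⟨x₀⟩
  have : IsIntegral L.X.toScheme := isIntegral_of_isOpenImmersion L.X.ι
  have hx₀ : x₀ ∈ ⨆ s, L.D s := L.iSup_D ▸ trivial
  obtain ⟨s₀, hs₀⟩ := Opens.mem_iSup.mp hx₀
  have hne₀ : Nonempty (L.D s₀) := ⟨⟨x₀, hs₀⟩⟩
  have htop : Nonempty (⊤ : L.X.toScheme.Opens) := ⟨⟨x₀, trivial⟩⟩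
  have hF₀ : S.F s₀ ≠ 0 := by
    intro h
    have := L.isUnit_res_F s₀ (le_refl (L.D s₀))
    rw [h, map_zero] at this
    exact not_isUnit_zero this
  refine pushforwardStructureSheafEq_of_bijective q ?_
  -- the pullback of an invariant polynomial to the locus is its restriction
  have hpull : ∀ r : fixedBy ρ, π.appTop (q.appTop
      ((Scheme.ΓSpecIso (CommRingCat.of (fixedBy ρ))).inv r)) = L.res ⊤ r := by
    intro r
    have h1 := L.toBase_appLE ⊤ r
    rw [appLE_top_top] at h1
    rw [← h1, ← hq, Scheme.Hom.comp_appTop]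
    rfl
  constructor
  · rw [injective_iff_map_eq_zero]
    intro x hx
    obtain ⟨r, rfl⟩ := (ConcreteCategory.bijective_of_isIso
      (Scheme.ΓSpecIso (CommRingCat.of (fixedBy ρ))).inv).2 x
    have h1 := hpull r
    rw [hx, map_zero] at h1
    have h2 : (r : MvPolynomial σ ℂ) = 0 := L.res_injective ⊤ (by rw [← h1, map_zero])
    have h3 : r = 0 := Subtype.ext h2
    rw [h3, map_zero]
  · intro u
    set t : Γ(L.X.toScheme, ⊤) := π.appTop u with ht
    -- the restriction of `t` to the chart domains
    have hts : ∀ s, ∃ (a : MvPolynomial σ ℂ) (k : ℕ), L.res ⊤ (S.F s) ^ k * t = L.res ⊤ a := by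
      intro s
      by_cases hne : Nonempty (L.D s)
      · obtain ⟨a, k, ha⟩ := L.exists_res_eq (basicOpen_F_le L s) (W := L.D s) rfl
          (L.X.toScheme.presheaf.map (homOfLE le_top).op t)
        refine ⟨a, k, map_injective_of_isIntegral L.X.toScheme
          (homOfLE (le_top : L.D s ≤ ⊤)) ?_⟩
        rw [L.map_res, ← ha, map_mul, map_pow, L.map_res]
      · refine ⟨0, 1, ?_⟩
        have : S.F s = 0 := by
          refine L.res_injective ⊤ ?_
          rw [map_zero, ← basicOpen_eq_bot_iff, L.basicOpen_res, top_inf_eq]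
          ext x
          exact ⟨fun hx => (hne ⟨⟨x, hx⟩⟩).elim, fun hx => hx.elim⟩
        rw [this, pow_one, map_zero, zero_mul]
    obtain ⟨p, k, hp⟩ := hts s₀
    have hval : ∀ g, (L.act g).appTop t = t := by
      intro g
      have := T.inv g
      have h1 : (π.appTop ≫ (L.act g).appTop) u = π.appTop u := by
        rw [← Scheme.Hom.comp_appTop, this]
      exact h1
    have hρ : ∀ g f, (L.act g).appTop (L.res ⊤ f) = L.res ⊤ (ρ g f) := by
      intro g f
      rw [← appLE_top_top _ (le_preimage_top _ _)]
      exact L.act_appLE_res g ⊤ ⊤ _ f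
    -- so `t` is the invariant rational function `p / F s₀ ^ k`, which is regular on all chart domains
    have hinv : ∀ g, ρ g p * S.F s₀ ^ k = p * ρ g (S.F s₀ ^ k) := by
      intro g
      refine L.res_injective ⊤ ?_
      have h1 := congr_arg (L.act g).appTop.hom hp
      rw [map_mul, map_pow] at h1
      have h2 : L.res ⊤ (ρ g (S.F s₀)) ^ k * t = L.res ⊤ (ρ g p) := by
        rw [← hρ, ← hρ]
        refine Eq.trans ?_ h1
        exact congr_arg (_ * ·) (hval g).symm
      rw [map_mul, map_mul, ← h2, ← hp, map_pow, map_pow, map_pow]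
      ring
    obtain ⟨r, hr⟩ := hext p (S.F s₀ ^ k) (pow_ne_zero _ hF₀) hinv fun s => by
      obtain ⟨a, k', ha⟩ := hts s
      refine ⟨k', a, L.res_injective ⊤ ?_⟩
      rw [map_mul, map_mul, ← hp, ← ha, map_pow, map_pow]
      ring
    have htr : t = L.res ⊤ r := by
      have h0 : L.res ⊤ (S.F s₀) ^ k ≠ 0 := by
        rw [← map_pow, Ne, map_eq_zero_iff _ (L.res_injective ⊤)]
        exact pow_ne_zero _ hF₀
      have hdom : IsDomain Γ(L.X.toScheme, ⊤) := inferInstance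
      refine mul_left_cancel₀ h0 ?_
      rw [hp, hr, map_mul, map_pow]
    have hrinv : r ∈ fixedBy ρ := by
      rw [mem_fixedBy]
      intro g
      refine L.res_injective ⊤ ?_
      rw [← hρ, ← htr, hval]
    refine ⟨(Scheme.ΓSpecIso (CommRingCat.of (fixedBy ρ))).inv ⟨r, hrinv⟩, ?_⟩
    refine T.app_injective ⊤ ?_
    exact (hpull ⟨r, hrinv⟩).trans htr.symm

include T in
/-- The morphism to the affine quotient is an isomorphism over the locus where an invariant
multiple of some `F s` does not vanish. -/
lemma isBirational [Finite σ] [Nonempty Y] {q : Y ⟶ Base ρ} (hq : π ≫ q = L.toBase)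
    (hpush : PushforwardStructureSheafEq q) (h : fixedBy ρ) (h0 : h ≠ 0) (s)
    (hs : S.F s ∣ (h : MvPolynomial σ ℂ)) : IsBirationalMorphism q := by
  have hint := T.isIntegral
  have : IsDomain (CommRingCat.of (fixedBy ρ)) := inferInstanceAs (IsDomain (fixedBy ρ))
  let U : (Base ρ).Opens := PrimeSpectrum.basicOpen h
  have hUaff : IsAffineOpen U := IsAffineOpen.Spec_basicOpen (R := CommRingCat.of (fixedBy ρ)) h
  -- the preimage of `U` lies in one chart, so that it is affine, and `q` is an isomorphism over `U`
  -- because the functions are the same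
  have hqU : q ⁻¹ᵁ U ≤ T.V s := by
    intro y hy
    obtain ⟨x, rfl⟩ := T.surjective y
    change x ∈ π ⁻¹ᵁ T.V s
    rw [T.preimage]
    have hx : x ∈ L.toBase ⁻¹ᵁ U := by
      rw [← hq]; exact hy
    change (h : MvPolynomial σ ℂ) ∉ (L.X.ι x : PrimeSpectrum _).asIdeal at hx
    exact fun hF => hx (Ideal.mem_of_dvd _ hs hF)
  have hW : IsAffineOpen (q ⁻¹ᵁ U) := by
    have e : q ⁻¹ᵁ U = Y.basicOpen (Y.presheaf.map (homOfLE (le_top : T.V s ≤ ⊤)).op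
        (q.appTop ((Scheme.ΓSpecIso (CommRingCat.of (fixedBy ρ))).inv h))) := by
      rw [Scheme.basicOpen_res, ← Scheme.preimage_basicOpen_top, basicOpen_eq_of_affine']
      refine le_antisymm (le_inf hqU (le_of_eq ?_)) (inf_le_right.trans (le_of_eq ?_)) <;> simp [U]
    rw [e]
    exact (T.affine s).basicOpen _
  have hiso : IsIso (q ∣_ U) := by
    have : IsAffine (q ⁻¹ᵁ U).toScheme := hW
    have : IsAffine U.toScheme := hUaff
    have : IsIso (q.app (U.ι ''ᵁ ⊤)) :=
      (ConcreteCategory.isIso_iff_bijective _).mpr (hpush _)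
    have : IsIso (q ∣_ U).appTop := by
      rw [morphismRestrict_appTop]
      have h2 : ∀ {V W : Y.Opens} (e : V = W), IsIso (Y.presheaf.map (eqToHom e).op) :=
        fun e => inferInstance
      exact @IsIso.comp_isIso _ _ _ _ _ _ _ (by exact this) (h2 _)
    have h1 := Scheme.isoSpec_hom_naturality (q ∣_ U)
    have : q ∣_ U = (q ⁻¹ᵁ U).toScheme.isoSpec.hom ≫ Spec.map (q ∣_ U).appTop ≫
        U.toScheme.isoSpec.inv := by
      rw [← Category.assoc, h1, Category.assoc, Iso.hom_inv_id, Category.comp_id]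
    rw [this]
    infer_instance
  have hUne : (U : Set (Base ρ)).Nonempty := by
    refine ⟨⟨⊥, Ideal.isPrime_bot⟩, ?_⟩
    exact fun hmem => h0 hmem
  have hWne : (q ⁻¹ᵁ U : Set Y).Nonempty := by
    obtain ⟨x, hx⟩ := hUne
    let y := (CategoryTheory.inv (q ∣_ U)) ⟨x, hx⟩
    exact ⟨y.1, y.2⟩
  have hZirr : IrreducibleSpace (Base ρ) := inferInstanceAs (IrreducibleSpace (PrimeSpectrum _))
  refine ⟨⟨q ⁻¹ᵁ U, (q ⁻¹ᵁ U).2.dense hWne, U, U.2.dense hUne, asIso (q ∣_ U)⟩, ?_⟩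
  change q ∣_ U ≫ U.ι ≫ 𝟙 _ = (q ⁻¹ᵁ U).ι ≫ q
  rw [Category.comp_id, morphismRestrict_ι]

end Sections

end ChartSystem.Locus

/-! ### Differential forms of rational function fields -/

namespace RationalForms

open MvPolynomial KaehlerDifferential

/-- Expansion of an alternating map in a basis: it is determined by its value on the basis, by
the determinant. -/
lemma alternating_eq_det_smul {K M N : Type*} [Field K] [AddCommGroup M] [Module K M]
    [AddCommGroup N] [Module K N] {ι : Type*} [Fintype ι] [DecidableEq ι]
    (φ : M [⋀^ι]→ₗ[K] N) (b : Module.Basis ι K M) (v : ι → M) : φ v = b.det v • φ b := by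
  have : φ = (LinearMap.toSpanSingleton K N (φ b)).compAlternatingMap b.det := by
    refine Module.Basis.ext_alternating b fun u hu => ?_
    have hb := Finite.injective_iff_bijective.mp hu
    have e : (fun i => b (u i)) = b ∘ (Equiv.ofBijective u hb) := rfl
    rw [e, AlternatingMap.map_perm, LinearMap.compAlternatingMap_apply, AlternatingMap.map_perm,
      b.det_self, LinearMap.toSpanSingleton_apply]
    simp only [Units.smul_def, zsmul_eq_mul, mul_one]
    exact (Int.cast_smul_eq_zsmul K _ _).symm
  conv_lhs => rw [this]
  rfl

variable {K J : Type} [Field K] [Algebra ℂ K] (α : MvPolynomial J ℂ →ₐ[ℂ] K)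

lemma derivation_map [Fintype J] {M : Type*} [AddCommGroup M] [Module K M] [Module ℂ M]
    [IsScalarTower ℂ K M]
    (D : Derivation ℂ K M) (a : MvPolynomial J ℂ) :
    D (α a) = ∑ j, α (pderiv j a) • D (α (X j)) := by
  classical
  induction a using MvPolynomial.induction_on with
  | C r =>
    have : α (C r) = algebraMap ℂ K r := α.commutes r
    simp [this]
  | add p q hp hq => simp [hp, hq, add_smul, Finset.sum_add_distrib]
  | mul_X p i hp =>
    rw [map_mul, Derivation.leibniz, hp]
    simp only [Derivation.leibniz, pderiv_X, smul_eq_mul, map_add, map_mul, add_smul,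
      Finset.sum_add_distrib, Finset.smul_sum, smul_smul]
    congr 1
    rw [Finset.sum_eq_single i]
    · simp
    · intro j _ hj
      simp [hj.symm]
    · simp

/-- The differentials of the coordinates form a basis of the differentials of a rational function
field. -/
lemma exists_basis [Finite J] (hinj : Function.Injective α) (hfrac : ∀ k : K, ∃ a b, α b ≠ 0 ∧ k * α b = α a) :
    ∃ b : Module.Basis J K (Ω[K⁄ℂ]), ∀ j, b j = D ℂ K (α (X j)) := by
  let := α.toRingHom.toAlgebra
  have : IsScalarTower ℂ (MvPolynomial J ℂ) K := IsScalarTower.of_algebraMap_eq fun r =>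
    (α.commutes r).symm
  have hM : ∀ y : nonZeroDivisors (MvPolynomial J ℂ), IsUnit (algebraMap (MvPolynomial J ℂ) K y) := by
    intro y
    rw [isUnit_iff_ne_zero]
    exact fun h => nonZeroDivisors.ne_zero y.2 (hinj (h.trans (map_zero α).symm))
  have : IsLocalization (nonZeroDivisors (MvPolynomial J ℂ)) K := by
    refine ⟨⟨hM, fun k => ?_, ?_⟩⟩
    · obtain ⟨a, b, hb, h⟩ := hfrac k
      exact ⟨⟨a, ⟨b, mem_nonZeroDivisors_of_ne_zero fun h0 => hb (by rw [h0, map_zero])⟩⟩, h⟩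
    · intro x y h
      exact ⟨1, by rw [hinj h]⟩
  have : Algebra.FormallyEtale (MvPolynomial J ℂ) K :=
    Algebra.FormallyEtale.of_isLocalization (nonZeroDivisors (MvPolynomial J ℂ))
  let b := ((mvPolynomialBasis ℂ J).baseChange K).map
    (tensorKaehlerEquivOfFormallyEtale ℂ (MvPolynomial J ℂ) K)
  refine ⟨b, fun j => ?_⟩
  simp only [b, Module.Basis.map_apply, Module.Basis.baseChange_apply, mvPolynomialBasis_apply]
  refine (mapBaseChange_tmul ℂ (MvPolynomial J ℂ) K 1 _).trans ?_
  rw [one_smul, map_D]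
  rfl

variable {α}

/-- For functions from a localization `O` of the polynomial ring, the wedge product of the
differentials is a multiple of the wedge product of the coordinate differentials. -/
lemma exists_mem_wedge [Finite J] (b : Module.Basis J K (Ω[K⁄ℂ])) (hb : ∀ j, b j = D ℂ K (α (X j)))
    (O : Subring K) (hO : ∀ a, α a ∈ O)
    (hloc : ∀ k ∈ O, ∃ a c, α c ≠ 0 ∧ (α c)⁻¹ ∈ O ∧ k * α c = α a) {n : ℕ} (ε : Fin n ≃ J)
    (f : Fin n → K) (hf : ∀ i, f i ∈ O) :
    ∃ o ∈ O, exteriorPower.ιMulti K n (fun i => D ℂ K (f i)) =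
      o • exteriorPower.ιMulti K n (fun i => D ℂ K (α (X (ε i)))) := by
  classical
  have := Fintype.ofFinite J
  have hD : ∀ k ∈ O, ∀ j, b.repr (D ℂ K k) j ∈ O := by
    intro k hk j
    obtain ⟨a, c, hc, hc', h⟩ := hloc k hk
    have hrepr : ∀ a, b.repr (D ℂ K (α a)) j = α (pderiv j a) := by
      intro a
      rw [derivation_map α (D ℂ K) a]
      simp only [← hb, map_sum, map_smul, Module.Basis.repr_self]
      simp [Finsupp.single_apply]
    have h2 := congr_arg (fun z => b.repr (D ℂ K z) j) h
    simp only [Derivation.leibniz, map_add, map_smul, Finsupp.add_apply, Finsupp.smul_apply,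
      hrepr, smul_eq_mul] at h2
    have h3 : b.repr (D ℂ K k) j = (α (pderiv j a) - k * α (pderiv j c)) * (α c)⁻¹ := by
      field_simp
      linear_combination h2
    rw [h3]
    exact O.mul_mem (O.sub_mem (hO _) (O.mul_mem hk (hO _))) hc'
  let b' := b.reindex ε.symm
  have hb' : (b' : Fin n → Ω[K⁄ℂ]) = fun i => D ℂ K (α (X (ε i))) := by
    funext i
    simp [b', hb]
  refine ⟨b'.det fun i => D ℂ K (f i), ?_, ?_⟩
  · rw [Module.Basis.det_apply, Matrix.det_apply]
    refine O.sum_mem fun σ _ => ?_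
    rw [Units.smul_def, zsmul_eq_mul]
    refine O.mul_mem (intCast_mem O _) (O.prod_mem fun i _ => ?_)
    simp only [Module.Basis.toMatrix_apply, b', Module.Basis.repr_reindex_apply]
    exact hD _ (hf _) _
  · rw [← hb']
    exact alternating_eq_det_smul _ _ _

lemma smul_wedge_injective [Finite J] (b : Module.Basis J K (Ω[K⁄ℂ])) (hb : ∀ j, b j = D ℂ K (α (X j)))
    {n : ℕ} (ε : Fin n ≃ J) {k l : K}
    (h : k • exteriorPower.ιMulti K n (fun i => D ℂ K (α (X (ε i)))) =
      l • exteriorPower.ιMulti K n (fun i => D ℂ K (α (X (ε i))))) : k = l := by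
  let b' := b.reindex ε.symm
  have hb' : (b' : Fin n → Ω[K⁄ℂ]) = fun i => D ℂ K (α (X (ε i))) := by
    funext i
    simp [b', hb]
  have := congr_arg (exteriorPower.alternatingMapLinearEquiv b'.det) h
  rwa [map_smul, map_smul, ← hb', exteriorPower.alternatingMapLinearEquiv_apply_ιMulti, b'.det_self,
    smul_eq_mul, smul_eq_mul, mul_one, mul_one] at this

/-- Change of coordinates in top forms. -/
lemma wedge_eq_det_smul [Finite J] (b : Module.Basis J K (Ω[K⁄ℂ]))
    (hb : ∀ j, b j = D ℂ K (α (X j))) [Fintype J] {n : ℕ} (ε : Fin n ≃ J) (f : Fin n → K)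
    (A : Matrix (Fin n) J K) (hA : ∀ i, D ℂ K (f i) = ∑ j, A i j • D ℂ K (α (X j))) :
    exteriorPower.ιMulti K n (fun i => D ℂ K (f i)) = (A.submatrix id ε).det •
      exteriorPower.ιMulti K n (fun i => D ℂ K (α (X (ε i)))) := by
  let b' := b.reindex ε.symm
  have hb' : (b' : Fin n → Ω[K⁄ℂ]) = fun i => D ℂ K (α (X (ε i))) := by
    funext i
    simp [b', hb]
  rw [← hb', alternating_eq_det_smul _ b', Module.Basis.det_apply, ← Matrix.det_transpose]
  congr 2
  ext i j
  classical
  simp only [Matrix.transpose_apply, Module.Basis.toMatrix_apply, b', hA, ← hb, map_sum, map_smul,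
    Matrix.submatrix_apply, id]
  simp [Finsupp.single_apply, Equiv.symm_apply_eq]

end RationalForms

/-! ### Ampleness of the canonical sheaf of the quotient -/

lemma affPt_appTop {κ : Type} (v : κ → ℂ) (f : MvPolynomial κ ℂ) :
    (affPt v).appTop ((Scheme.ΓSpecIso (CommRingCat.of (MvPolynomial κ ℂ))).inv f) =
      ChartSystem.Locus.const (MvPolynomial.eval v f) := by
  have := Scheme.ΓSpecIso_inv_naturality
    (CommRingCat.ofHom (MvPolynomial.aeval (R := ℂ) v).toRingHom)
  have h2 := congr_arg (fun k => k.hom f) this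
  simp only [CommRingCat.hom_comp, RingHom.comp_apply] at h2
  refine h2.symm.trans ?_
  rw [← MvPolynomial.aeval_eq_eval]
  rfl

namespace ChartSystem

variable {σ G : Type} {ρ : G → MvPolynomial σ ℂ →ₐ[ℂ] MvPolynomial σ ℂ} (S : ChartSystem ρ)

lemma ρ_e (g : G) (s z) : ρ g (S.e s z) = MvPolynomial.C (S.χ g) * S.e s z :=
  S.ρ_span g (S.e_mem s z)

lemma exists_normal (s v) (h : MvPolynomial.eval v (S.F s) ≠ 0) :
    ∃ g, ∀ f, MvPolynomial.eval v (ρ g f) = MvPolynomial.eval (S.normal s v) f := by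
  obtain ⟨g, hg, -⟩ := S.exists_act s v h
  exact ⟨g, hg⟩

lemma normal_eq {g v v'} (s) (h : ∀ f, MvPolynomial.eval v (ρ g f) = MvPolynomial.eval v' f) :
    S.normal s v' = S.normal s v := by
  funext z
  rw [normal, normal, ← h, ← h, S.ρ_e, S.ρ_F, map_mul, map_mul, MvPolynomial.eval_C,
    mul_div_mul_left _ _ (S.χ_ne_zero g)]

variable {S} in
/-- Semi-invariants `Ψ t` with the nonvanishing loci of the charts of the slices, such that the
Jacobian determinants of the transition maps between slices are their `ε`-th powers, up to
constants. The transition maps are considered on points with values in a field `E`, and the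
Jacobian matrices are tested on the derivations of `E`. -/
structure JacobianWeight (R : S.Slices) (ε : ℤ) where
  /-- The semi-invariants. -/
  Ψ : R.T → MvPolynomial σ ℂ
  /-- Their weight. -/
  χ : G → ℂ
  ρ_Ψ : ∀ g t, ρ g (Ψ t) = MvPolynomial.C (χ g) * Ψ t
  sec_Ψ : ∀ t, R.sec t (Ψ t) = 1
  eval_ne_zero_iff : ∀ t v, MvPolynomial.eval v (Ψ t) ≠ 0 ↔ MvPolynomial.eval v (S.F (R.idx t)) ≠ 0
  exists_jacobian : ∀ (E : Type) [Field E] [Algebra ℂ E] (t t' : R.T)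
    [Fintype (R.J t)] [DecidableEq (R.J t)]
    (α : MvPolynomial (R.J t) ℂ →ₐ[ℂ] E) (α' : MvPolynomial (R.J t') ℂ →ₐ[ℂ] E),
    (∀ z, α' (R.sec t' (MvPolynomial.X z)) * α (R.sec t (S.F (R.idx t'))) =
      α (R.sec t (S.e (R.idx t') z))) → α (R.sec t (S.F (R.idx t'))) ≠ 0 →
    ∃ (e : R.J t ≃ R.J t') (A : Matrix (R.J t) (R.J t) E) (κ : ℂ), κ ≠ 0 ∧
      (∀ (D : Derivation ℂ E E) (j), D (α' (MvPolynomial.X (e j))) =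
        ∑ i, A j i * D (α (MvPolynomial.X i))) ∧
      A.det = algebraMap ℂ E κ * α (R.sec t (Ψ t')) ^ ε

end ChartSystem

namespace ChartSystem.Locus.Sections

variable {σ G : Type} {ρ : G → MvPolynomial σ ℂ →ₐ[ℂ] MvPolynomial σ ℂ} {S : ChartSystem ρ}
  {L : S.Locus} {Y : Scheme.{0}} {π : L.X.toScheme ⟶ Y} (T : L.Sections π) (R : S.Slices)

include T in
lemma section_ext [Finite σ] {W : Y.Opens} {u u' : Γ(Y, W)}
    (h : ∀ (p : SpecC ⟶ L.X.toScheme) (v : σ → ℂ), p ≫ L.X.ι = affPt v →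
      ∀ hW : ⊤ ≤ (p ≫ π) ⁻¹ᵁ W, (p ≫ π).appLE W ⊤ hW u = (p ≫ π).appLE W ⊤ hW u') : u = u' := by
  refine T.app_injective W (L.densePoints.section_ext fun p ⟨v, hv⟩ hp => ?_)
  have key : ∀ u : Γ(Y, W), p.appLE (π ⁻¹ᵁ W) ⊤ hp.ge (π.app W u) =
      (p ≫ π).appLE W ⊤ (hp.ge.trans (by rw [Scheme.Hom.comp_preimage])) u := by
    intro u
    rw [Scheme.Hom.app_eq_appLE]
    exact appLE_apply_appLE p π le_rfl hp.ge u
  rw [key, key]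
  exact h p v hv.symm _

/-- The functions on the chart of a slice are the polynomials in the coordinates of the slice. -/
def chartFn (t : R.T) : MvPolynomial (R.J t) ℂ →+* Γ(Y, T.V (R.idx t)) :=
  ((Scheme.ΓSpecIso (CommRingCat.of (MvPolynomial (R.J t) ℂ))).inv ≫
    (T.chartInv R t).appTop ≫ (T.V (R.idx t)).topIso.hom).hom

lemma bijective_chartFn [Finite σ] (t : R.T) : Function.Bijective (T.chartFn R t) := by
  have : IsIso (T.chartInv R t) := ⟨T.chart R t, T.chartInv_chart R t, T.chart_chartInv R t⟩
  have : IsIso (T.chartInv R t).appTop := inferInstanceAs (IsIso ((T.chartInv R t).app ⊤))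
  exact ((ConcreteCategory.bijective_of_isIso (T.V (R.idx t)).topIso.hom).comp
    (ConcreteCategory.bijective_of_isIso (T.chartInv R t).appTop)).comp
      (ConcreteCategory.bijective_of_isIso
        (Scheme.ΓSpecIso (CommRingCat.of (MvPolynomial (R.J t) ℂ))).inv)

lemma ι_appLE_topIso (V : Y.Opens) (x : Γ(V.toScheme, ⊤)) :
    V.ι.appLE V ⊤ (by simp) (V.topIso.hom x) = x := by
  have : V.topIso.hom ≫ V.ι.appLE V ⊤ (by simp) = 𝟙 _ := by
    rw [Scheme.Opens.ι_appLE, Scheme.Opens.topIso_hom]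
    exact (Y.presheaf.map_comp _ _).symm.trans (Y.presheaf.map_id _)
  exact ConcreteCategory.congr_hom this x

lemma topIso_ι_appLE (V : Y.Opens) (x : Γ(Y, V)) :
    V.topIso.hom (V.ι.appLE V ⊤ (by simp) x) = x := by
  have : V.ι.appLE V ⊤ (by simp) ≫ V.topIso.hom = 𝟙 _ := by
    rw [Scheme.Opens.ι_appLE, Scheme.Opens.topIso_hom]
    exact (Y.presheaf.map_comp _ _).symm.trans (Y.presheaf.map_id _)
  exact ConcreteCategory.congr_hom this x

lemma value_chartFn (t : R.T) {p : SpecC ⟶ L.X.toScheme} {v : σ → ℂ} (hp : p ≫ L.X.ι = affPt v)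
    {W : Y.Opens} (hWV : W ≤ T.V (R.idx t)) (hW : ⊤ ≤ (p ≫ π) ⁻¹ᵁ W)
    (f : MvPolynomial (R.J t) ℂ) :
    (p ≫ π).appLE W ⊤ hW (Y.presheaf.map (homOfLE hWV).op (T.chartFn R t f)) =
      const (MvPolynomial.eval (fun j => S.normal (R.idx t) v (R.c t j)) f) := by
  have hr : Set.range (p ≫ π) ⊆ Set.range (T.V (R.idx t)).ι := by
    rintro _ ⟨y, rfl⟩
    rw [Scheme.Opens.range_ι]
    exact hWV (hW (show y ∈ ⊤ from trivial))
  let r : SpecC ⟶ (T.V (R.idx t)).toScheme := IsOpenImmersion.lift (T.V (R.idx t)).ι (p ≫ π) hr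
  have hrι : r ≫ (T.V (R.idx t)).ι = p ≫ π := IsOpenImmersion.lift_fac _ _ _
  have h1 := T.comp_chartInv R t hp hrι
  rw [← affPt_appTop, ← h1]
  refine (ConcreteCategory.congr_hom (Scheme.Hom.map_appLE (p ≫ π) hW (homOfLE hWV).op) _).trans ?_
  refine (appLE_apply_congr hrι.symm _ (by rw [hrι]; exact hW.trans ((p ≫ π).preimage_mono hWV))
    _).trans ?_
  refine (appLE_apply_appLE r (T.V (R.idx t)).ι (V := ⊤) (by simp) (le_preimage_top _ _) _).symm.trans ?_
  refine (congr_arg (r.appLE ⊤ ⊤ (le_preimage_top _ _)).hom (ι_appLE_topIso _ _)).trans ?_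
  rw [Scheme.Hom.comp_appTop]
  exact ConcreteCategory.congr_hom (appLE_top_top r _) _

include T in
lemma opens_le [Finite σ] {U U' : Y.Opens}
    (h : ∀ (p : SpecC ⟶ L.X.toScheme) (v : σ → ℂ), p ≫ L.X.ι = affPt v →
      (p ≫ π) specCPoint ∈ U → (p ≫ π) specCPoint ∈ U') : U ≤ U' := by
  have h1 : π ⁻¹ᵁ U ≤ π ⁻¹ᵁ U' := L.densePoints.opens_le fun p ⟨v, hv⟩ hU => by
    have := h p v hv.symm (by rw [Scheme.Hom.comp_apply]; exact hU)
    rw [Scheme.Hom.comp_apply] at this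
    exact this
  intro y hy
  obtain ⟨x, rfl⟩ := T.surjective y
  exact h1 hy

lemma mem_V_iff (t : R.T) {p : SpecC ⟶ L.X.toScheme} {v : σ → ℂ} (hp : p ≫ L.X.ι = affPt v) :
    (p ≫ π) specCPoint ∈ T.V (R.idx t) ↔ MvPolynomial.eval v (S.F (R.idx t)) ≠ 0 := by
  rw [← L.mem_D_iff hp, ← T.preimage, Scheme.Hom.comp_apply]
  rfl

lemma eval_coords (t : R.T) {v : σ → ℂ} (hF : MvPolynomial.eval v (S.F (R.idx t)) ≠ 0)
    (f : MvPolynomial σ ℂ) :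
    MvPolynomial.eval (fun j => S.normal (R.idx t) v (R.c t j)) (R.sec t f) =
      MvPolynomial.eval (S.normal (R.idx t) v) f := by
  rw [← eval_sliceVec, sliceVec_normal R t v hF]

lemma _root_.ChartSystem.JacobianWeight.exists_eval {R : S.Slices} {ε : ℤ}
    (J : JacobianWeight R ε) (t : R.T) {v : σ → ℂ}
    (hF : MvPolynomial.eval v (S.F (R.idx t)) ≠ 0) :
    ∃ a : ℂ, a * MvPolynomial.eval v (J.Ψ t) = 1 ∧ ∀ t',
      MvPolynomial.eval (S.normal (R.idx t) v) (J.Ψ t') = a * MvPolynomial.eval v (J.Ψ t') := by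
  obtain ⟨g, hg⟩ := S.exists_normal _ v hF
  have key : ∀ t', MvPolynomial.eval (S.normal (R.idx t) v) (J.Ψ t') =
      J.χ g * MvPolynomial.eval v (J.Ψ t') := by
    intro t'
    rw [← hg, J.ρ_Ψ, map_mul, MvPolynomial.eval_C]
  refine ⟨J.χ g, ?_, key⟩
  rw [← key, ← eval_coords R t hF, J.sec_Ψ, map_one]

lemma basicOpen_chartFn [Finite σ] {ε : ℤ} (J : JacobianWeight R ε) (t t' : R.T) :
    Y.basicOpen (T.chartFn R t (R.sec t (J.Ψ t'))) = T.V (R.idx t) ⊓ T.V (R.idx t') := by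
  have key : ∀ (p : SpecC ⟶ L.X.toScheme) (v : σ → ℂ), p ≫ L.X.ι = affPt v →
      (p ≫ π) specCPoint ∈ T.V (R.idx t) →
      ((p ≫ π) specCPoint ∈ Y.basicOpen (T.chartFn R t (R.sec t (J.Ψ t'))) ↔
        (p ≫ π) specCPoint ∈ T.V (R.idx t')) := by
    intro p v hp hV
    have hF := (T.mem_V_iff R t hp).mp hV
    have h1 := value_eq_zero_iff (T.chartFn R t (R.sec t (J.Ψ t'))) (p ≫ π)
      ((specC_mem_iff _ _).mpr hV)
    have h2 := T.value_chartFn R t hp (le_refl _) ((specC_mem_iff (p ≫ π) _).mpr hV).ge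
      (R.sec t (J.Ψ t'))
    have h3 : ∀ u : Γ(Y, T.V (R.idx t)), Y.presheaf.map (homOfLE (le_refl _)).op u = u := fun u =>
      ConcreteCategory.congr_hom (Y.presheaf.map_id _) u
    rw [h3, eval_coords R t hF] at h2
    rw [h2] at h1
    obtain ⟨a, ha, hat⟩ := J.exists_eval t hF
    rw [hat, map_eq_zero_iff _ (ConcreteCategory.bijective_of_isIso
      (Scheme.ΓSpecIso (CommRingCat.of ℂ)).inv).1,
      mul_eq_zero, or_iff_right (left_ne_zero_of_mul_eq_one ha)] at h1
    rw [T.mem_V_iff R t' hp, ← J.eval_ne_zero_iff, ← not_iff_not, ← h1, not_not]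
  refine le_antisymm (le_inf (Y.basicOpen_le _) ?_) ?_
  · exact T.opens_le fun p v hp h => (key p v hp (Y.basicOpen_le _ h)).mp h
  · exact T.opens_le fun p v hp h => (key p v hp h.1).mpr h.2

section FunctionField

variable {R} {q : Y ⟶ Base ρ} [IsIntegral Y]

lemma genericPoint_mem (t : R.T) : genericPoint Y ∈ T.V (R.idx t) := by
  let y : AffSp (R.J t) := affPt (fun _ => 0) specCPoint
  exact ((genericPoint_spec Y).mem_open_set_iff (T.V (R.idx t)).2).mpr
    ⟨_, trivial, (T.chart R t y).2⟩

/-- The inclusion of the functions on a chart into the function field. -/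
def germ (s : Y ⟶ SpecC) (t : R.T) : Γ(Y, T.V (R.idx t)) →+* FunField s :=
  (Y.presheaf.germ _ (genericPoint Y) (T.genericPoint_mem t)).hom

lemma germ_injective (s : Y ⟶ SpecC) (t : R.T) : Function.Injective (T.germ s t) :=
  germ_injective_of_isIntegral Y _ (T.genericPoint_mem t)

omit [IsIntegral Y] in
lemma chartFn_C [Finite σ] (hq : π ≫ q = L.toBase) (t : R.T) (r : ℂ) :
    T.chartFn R t (MvPolynomial.C r) = Y.presheaf.map (homOfLE le_top).op
      ((q ≫ baseStr ρ).appTop (const r)) := by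
  have h1 : T.chartInv R t ≫ affSpStr (R.J t) = (T.V (R.idx t)).ι ≫ q ≫ baseStr ρ := by
    rw [← T.chart_str R hq, ← Category.assoc (T.chartInv R t), T.chartInv_chart, Category.id_comp]
  have h2 : (Scheme.ΓSpecIso (CommRingCat.of (MvPolynomial (R.J t) ℂ))).inv (MvPolynomial.C r) =
      (affSpStr (R.J t)).appTop (const r) :=
    ConcreteCategory.congr_hom (Scheme.ΓSpecIso_inv_naturality
      (CommRingCat.ofHom (algebraMap ℂ (MvPolynomial (R.J t) ℂ)))) r
  have h3 : (T.chartInv R t).appTop ((affSpStr (R.J t)).appTop (const r)) =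
      (T.V (R.idx t)).ι.appTop ((q ≫ baseStr ρ).appTop (const r)) := by
    have e := congr_arg (fun f : (T.V (R.idx t)).toScheme ⟶ SpecC => f.appTop (const r)) h1
    exact e
  refine Eq.trans ?_ (topIso_ι_appLE (T.V (R.idx t)) _)
  refine congr_arg (T.V (R.idx t)).topIso.hom.hom ?_
  refine ((congr_arg (T.chartInv R t).appTop.hom h2).trans h3).trans ?_
  refine Eq.trans ?_ (ConcreteCategory.congr_hom
    (Scheme.Hom.map_appLE (T.V (R.idx t)).ι _ (homOfLE le_top).op) _).symm
  exact (ConcreteCategory.congr_hom (appLE_top_top _ _) _).symm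

variable [Finite σ] (hq : π ≫ q = L.toBase)

/-- The coordinate ring of a slice as a subring of the function field of the quotient. -/
def coord (t : R.T) : MvPolynomial (R.J t) ℂ →ₐ[ℂ] FunField (q ≫ baseStr ρ) where
  __ := (T.germ (q ≫ baseStr ρ) t).comp (T.chartFn R t)
  commutes' r := by
    change T.germ (q ≫ baseStr ρ) t (T.chartFn R t (MvPolynomial.C r)) = _
    rw [T.chartFn_C hq]
    exact TopCat.Presheaf.germ_res_apply Y.presheaf (homOfLE le_top) _ (T.genericPoint_mem t) _

lemma coord_mul_coord (t t' : R.T) (f : MvPolynomial (R.J t) ℂ) (g h : MvPolynomial (R.J t') ℂ)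
    (H : ∀ v, MvPolynomial.eval v (S.F (R.idx t)) ≠ 0 → MvPolynomial.eval v (S.F (R.idx t')) ≠ 0 →
      MvPolynomial.eval (fun j => S.normal (R.idx t) v (R.c t j)) f *
        MvPolynomial.eval (fun j => S.normal (R.idx t') v (R.c t' j)) g =
      MvPolynomial.eval (fun j => S.normal (R.idx t') v (R.c t' j)) h) :
    T.coord hq t f * T.coord hq t' g = T.coord hq t' h := by
  let W := T.V (R.idx t) ⊓ T.V (R.idx t')
  have h1 : Y.presheaf.map (homOfLE (inf_le_left : W ≤ _)).op (T.chartFn R t f) *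
      Y.presheaf.map (homOfLE (inf_le_right : W ≤ _)).op (T.chartFn R t' g) =
      Y.presheaf.map (homOfLE (inf_le_right : W ≤ _)).op (T.chartFn R t' h) := by
    refine T.section_ext fun p v hp hW => ?_
    have hpW : (p ≫ π) specCPoint ∈ W := hW (show specCPoint ∈ (⊤ : SpecC.Opens) from trivial)
    rw [map_mul, T.value_chartFn R t hp, T.value_chartFn R t' hp, T.value_chartFn R t' hp,
      ← map_mul, H v ((T.mem_V_iff R t hp).mp hpW.1) ((T.mem_V_iff R t' hp).mp hpW.2)]
  have hm : genericPoint Y ∈ W := ⟨T.genericPoint_mem t, T.genericPoint_mem t'⟩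
  have h2 := congr_arg (Y.presheaf.germ W (genericPoint Y) hm).hom h1
  rw [map_mul] at h2
  have h3 : ∀ {V : Y.Opens} (hV : W ≤ V) (u : Γ(Y, V)) (hm : genericPoint Y ∈ W),
      Y.presheaf.germ W (genericPoint Y) hm (Y.presheaf.map (homOfLE hV).op u) =
        Y.presheaf.germ V (genericPoint Y) (hV hm) u := fun hV u hm =>
    TopCat.Presheaf.germ_res_apply Y.presheaf (homOfLE hV) _ hm u
  exact (congr_arg₂ (· * ·) (h3 inf_le_left _ hm) (h3 inf_le_right _ hm)).symm.trans
    (h2.trans (h3 inf_le_right _ hm))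

lemma coord_injective (t : R.T) : Function.Injective (T.coord hq t) :=
  (T.germ_injective _ t).comp (T.bijective_chartFn R t).1

lemma algebraMap_germ (t : R.T) {y : Y} (hy : y ∈ T.V (R.idx t)) (a : MvPolynomial (R.J t) ℂ) :
    algebraMap (Y.presheaf.stalk y) (FunField (q ≫ baseStr ρ))
      (Y.presheaf.germ _ y hy (T.chartFn R t a)) = T.coord hq t a :=
  TopCat.Presheaf.germ_stalkSpecializes_apply Y.presheaf hy
    ((genericPoint_spec Y).specializes trivial) _

lemma exists_frac (t : R.T) {y : Y} (hy : y ∈ T.V (R.idx t)) (o : Y.presheaf.stalk y) :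
    ∃ a b, y ∈ Y.basicOpen (T.chartFn R t b) ∧
      algebraMap _ (FunField (q ≫ baseStr ρ)) o * T.coord hq t b = T.coord hq t a := by
  let := (TopCat.Presheaf.algebra_section_stalk Y.presheaf (⟨y, hy⟩ : T.V (R.idx t)))
  have hloc : IsLocalization ((T.affine (R.idx t)).primeIdealOf ⟨y, hy⟩).asIdeal.primeCompl
      (Y.presheaf.stalk y) := (T.affine (R.idx t)).isLocalization_stalk ⟨y, hy⟩
  obtain ⟨⟨a, b⟩, hab⟩ := hloc.1.2 o
  have hb := hloc.1.1 b
  obtain ⟨a', ha'⟩ := (T.bijective_chartFn R t).2 a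
  obtain ⟨b', hb'⟩ := (T.bijective_chartFn R t).2 b.1
  refine ⟨a', b', ?_, ?_⟩
  · rw [hb', Y.mem_basicOpen _ _ hy]
    exact hb
  · rw [← T.algebraMap_germ hq t hy, ← T.algebraMap_germ hq t hy, ← map_mul, ha', hb']
    exact congr_arg _ hab

lemma mem_basicOpen_iff (t : R.T) {y : Y} (hy : y ∈ T.V (R.idx t)) (b : MvPolynomial (R.J t) ℂ) :
    y ∈ Y.basicOpen (T.chartFn R t b) ↔
      ∃ o : Y.presheaf.stalk y, algebraMap _ (FunField (q ≫ baseStr ρ)) o * T.coord hq t b = 1 := by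
  have hinj : Function.Injective (algebraMap (Y.presheaf.stalk y) (FunField (q ≫ baseStr ρ))) :=
    IsFractionRing.injective (Y.presheaf.stalk y) Y.functionField
  rw [Y.mem_basicOpen _ _ hy]
  constructor
  · intro h
    obtain ⟨o, ho⟩ := h.exists_left_inv
    exact ⟨o, by rw [← T.algebraMap_germ hq t hy, ← map_mul, ho, map_one]⟩
  · rintro ⟨o, ho⟩
    rw [← T.algebraMap_germ hq t hy, ← map_mul] at ho
    exact IsUnit.of_mul_eq_one_right o (hinj (ho.trans (map_one _).symm))

lemma coord_frac (t : R.T) (k : FunField (q ≫ baseStr ρ)) :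
    ∃ a b, T.coord hq t b ≠ 0 ∧ k * T.coord hq t b = T.coord hq t a := by
  obtain ⟨x, hx⟩ : ∃ x : Y.presheaf.stalk (genericPoint Y),
      algebraMap _ (FunField (q ≫ baseStr ρ)) x = k := by
    exact ⟨k, ConcreteCategory.congr_hom (Y.presheaf.stalkSpecializes_refl (genericPoint Y)) k⟩
  obtain ⟨a, b, hb, h⟩ := T.exists_frac hq t (T.genericPoint_mem t) x
  obtain ⟨o, ho⟩ := (T.mem_basicOpen_iff hq t (T.genericPoint_mem t) b).mp hb
  exact ⟨a, b, right_ne_zero_of_mul_eq_one ho, by rw [← hx, h]⟩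

/-- The regular top forms on a chart are the multiples of the product of the differentials of the
coordinates. -/
lemma mem_regularTopForms_iff (t : R.T) {y : Y} (hy : y ∈ T.V (R.idx t))
    (ε : Fin (varietyDim (q ≫ baseStr ρ)) ≃ R.J t) (ω : RatTopForm (q ≫ baseStr ρ)) :
    ω ∈ regularTopForms (q ≫ baseStr ρ) y ↔ ∃ o : Y.presheaf.stalk y,
      ω = algebraMap _ (FunField (q ≫ baseStr ρ)) o •
        exteriorPower.ιMulti (FunField (q ≫ baseStr ρ)) (varietyDim (q ≫ baseStr ρ))
          (fun i => KaehlerDifferential.D ℂ (FunField (q ≫ baseStr ρ))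
            (T.coord hq t (MvPolynomial.X (ε i)))) := by
  have := R.finite t
  obtain ⟨b, hb⟩ := RationalForms.exists_basis (T.coord hq t) (T.coord_injective hq t)
    (T.coord_frac hq t)
  constructor
  · intro h
    induction h using AddSubmonoid.closure_induction with
    | mem ω h =>
      obtain ⟨c, f, rfl⟩ := h
      obtain ⟨_, ⟨o, rfl⟩, ho⟩ := RationalForms.exists_mem_wedge b hb
        (algebraMap (Y.presheaf.stalk y) (FunField (q ≫ baseStr ρ))).range
        (fun a => ⟨_, T.algebraMap_germ hq t hy a⟩) (by
          rintro _ ⟨o, rfl⟩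
          obtain ⟨a, c, hc, h⟩ := T.exists_frac hq t hy o
          obtain ⟨u, hu⟩ := (T.mem_basicOpen_iff hq t hy c).mp hc
          exact ⟨a, c, right_ne_zero_of_mul_eq_one hu, ⟨u, eq_inv_of_mul_eq_one_left hu⟩, h⟩) ε
        (fun i => algebraMap _ (FunField (q ≫ baseStr ρ)) (f i)) fun i => ⟨_, rfl⟩
      exact ⟨c * o, by rw [ho, smul_smul, map_mul]⟩
    | zero => exact ⟨0, by rw [map_zero, zero_smul]⟩
    | add ω ω' _ _ h h' =>
      obtain ⟨o, rfl⟩ := h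
      obtain ⟨o', rfl⟩ := h'
      exact ⟨o + o', by rw [map_add, add_smul]⟩
  · rintro ⟨o, rfl⟩
    refine AddSubmonoid.subset_closure ⟨o, fun i => Y.presheaf.germ _ y hy
      (T.chartFn R t (MvPolynomial.X (ε i))), ?_⟩
    simp only [T.algebraMap_germ hq t hy]

include T hq in
lemma nonempty_dim_equiv (t : R.T) :
    Nonempty (Fin (varietyDim (q ≫ baseStr ρ)) ≃ R.J t) := by
  have := R.finite t
  obtain ⟨b, hb⟩ := RationalForms.exists_basis (T.coord hq t) (T.coord_injective hq t)
    (T.coord_frac hq t)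
  have := Fintype.ofFinite (R.J t)
  exact ⟨(finCongr (Module.finrank_eq_card_basis b)).trans (Fintype.equivFin _).symm⟩

/-- The top forms of two charts differ by a constant multiple of a power of the transition function
of the semi-invariants `Ψ`. -/
lemma coord_jacobian {ε : ℤ} (J : JacobianWeight R ε) (t₀ t : R.T)
    (ε₀ : Fin (varietyDim (q ≫ baseStr ρ)) ≃ R.J t₀) :
    T.coord hq t (R.sec t (J.Ψ t₀)) ≠ 0 ∧
    ∃ (εt : Fin (varietyDim (q ≫ baseStr ρ)) ≃ R.J t) (κ : ℂ), κ ≠ 0 ∧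
      exteriorPower.ιMulti (FunField (q ≫ baseStr ρ)) (varietyDim (q ≫ baseStr ρ))
          (fun i => KaehlerDifferential.D ℂ (FunField (q ≫ baseStr ρ))
            (T.coord hq t₀ (MvPolynomial.X (ε₀ i)))) =
        (algebraMap ℂ _ κ * T.coord hq t (R.sec t (J.Ψ t₀)) ^ ε) •
          exteriorPower.ιMulti (FunField (q ≫ baseStr ρ)) (varietyDim (q ≫ baseStr ρ))
          (fun i => KaehlerDifferential.D ℂ (FunField (q ≫ baseStr ρ))
            (T.coord hq t (MvPolynomial.X (εt i)))) := by
  classical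
  have := R.finite t
  have := Fintype.ofFinite (R.J t)
  obtain ⟨b, hb⟩ := RationalForms.exists_basis (T.coord hq t) (T.coord_injective hq t)
    (T.coord_frac hq t)
  have hnorm : ∀ t t' {v : σ → ℂ}, MvPolynomial.eval v (S.F (R.idx t)) ≠ 0 →
      S.normal (R.idx t') (S.normal (R.idx t) v) = S.normal (R.idx t') v := by
    intro t t' v hv
    obtain ⟨g, hg⟩ := S.exists_normal _ v hv
    exact S.normal_eq _ hg
  have hFne : ∀ t t' {v : σ → ℂ}, MvPolynomial.eval v (S.F (R.idx t)) ≠ 0 →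
      MvPolynomial.eval v (S.F (R.idx t')) ≠ 0 →
      MvPolynomial.eval (S.normal (R.idx t) v) (S.F (R.idx t')) ≠ 0 := by
    intro t t' v hv hv'
    obtain ⟨g, hg⟩ := S.exists_normal _ v hv
    rw [← hg, S.ρ_F, map_mul, MvPolynomial.eval_C]
    exact mul_ne_zero (S.χ_ne_zero g) hv'
  -- the transition functions of `Ψ` and of `F` have inverses, so they do not vanish
  have h1 : T.coord hq t₀ (R.sec t₀ (J.Ψ t)) * T.coord hq t (R.sec t (J.Ψ t₀)) =
      T.coord hq t 1 := by
    refine T.coord_mul_coord hq t₀ t _ _ _ fun v hv hv' => ?_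
    obtain ⟨a, ha, hat⟩ := J.exists_eval t₀ hv
    obtain ⟨a', ha', hat'⟩ := J.exists_eval t hv'
    rw [eval_coords R _ hv, eval_coords R _ hv', hat, hat', map_one]
    linear_combination (a' * MvPolynomial.eval v (J.Ψ t)) * ha + ha'
  rw [map_one] at h1
  have h2 : T.coord hq t₀ (R.sec t₀ (S.F (R.idx t))) * T.coord hq t (R.sec t (S.F (R.idx t₀))) =
      T.coord hq t 1 := by
    refine T.coord_mul_coord hq t₀ t _ _ _ fun v hv hv' => ?_
    obtain ⟨g, hg⟩ := S.exists_normal _ v hv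
    obtain ⟨g', hg'⟩ := S.exists_normal _ v hv'
    have e1 := eval_normal_F _ v hv
    have e2 := eval_normal_F _ v hv'
    rw [← hg, S.ρ_F, map_mul, MvPolynomial.eval_C] at e1
    rw [← hg', S.ρ_F, map_mul, MvPolynomial.eval_C] at e2
    rw [eval_coords R _ hv, eval_coords R _ hv', ← hg, ← hg', S.ρ_F, S.ρ_F, map_mul, map_mul,
      MvPolynomial.eval_C, MvPolynomial.eval_C, map_one]
    linear_combination (S.χ g' * MvPolynomial.eval v (S.F (R.idx t))) * e1 + e2
  rw [map_one] at h2
  refine ⟨right_ne_zero_of_mul_eq_one h1, ?_⟩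
  -- each derivation of the function field sees the Jacobian matrix; derivations are the linear forms
  -- on the differentials
  obtain ⟨e, A, κ, hκ, hA, hdet⟩ := J.exists_jacobian _ t t₀ (T.coord hq t) (T.coord hq t₀)
    (fun z => by
      refine T.coord_mul_coord hq t₀ t _ _ _ fun v hv hv' => ?_
      rw [eval_coords R _ hv, eval_coords R _ hv', eval_coords R _ hv', MvPolynomial.eval_X,
        ← hnorm t t₀ hv', normal, div_mul_cancel₀ _ (hFne t t₀ hv' hv)])
    (right_ne_zero_of_mul_eq_one h2)
  refine ⟨ε₀.trans e.symm, κ, hκ, ?_⟩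
  rw [RationalForms.wedge_eq_det_smul b hb (ε₀.trans e.symm)
    (fun i => T.coord hq t₀ (MvPolynomial.X (ε₀ i))) (A.submatrix (ε₀.trans e.symm) id)
    (fun i => by
      rw [← sub_eq_zero, ← Module.forall_dual_apply_eq_zero_iff (FunField (q ≫ baseStr ρ))]
      intro φ
      have := hA (φ.compDer (KaehlerDifferential.D ℂ (FunField (q ≫ baseStr ρ)))) (e.symm (ε₀ i))
      rw [e.apply_symm_apply] at this
      rw [map_sub, map_sum, sub_eq_zero]
      refine this.trans (Finset.sum_congr rfl fun j _ => ?_)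
      rw [map_smul]
      rfl)]
  rw [Matrix.submatrix_submatrix, ← hdet]
  simp only [Function.comp_id, Function.id_comp]
  rw [Matrix.det_submatrix_equiv_self]

omit [IsIntegral Y] in
lemma exists_t (y : Y) (T : L.Sections π) (R : S.Slices) : ∃ t, y ∈ T.V (R.idx t) := by
  have : y ∈ ⨆ t, T.V (R.idx t) := T.iSup_V_slices R ▸ trivial
  exact Opens.mem_iSup.mp this

/-- The sheaf that is generated on the chart `t` by the quotient of `Ψ t` by a fixed `Ψ t₀` is
relatively ample: its sections `Ψ t / Ψ t₀` have the charts as nonvanishing loci. -/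
lemma isRelAmple {ε : ℤ} (J : JacobianWeight R ε) (t₀ : R.T) (N : FracStalks (q ≫ baseStr ρ))
    (hN : ∀ t, ∀ y ∈ T.V (R.idx t), N y = Submodule.span (Y.presheaf.stalk y)
      {(T.coord hq t (R.sec t (J.Ψ t₀)))⁻¹})
    (h0 : ∀ t, T.coord hq t (R.sec t (J.Ψ t₀)) ≠ 0) : N.IsRelAmple q := by
  have := T.noetherianSpace
  refine ⟨fun y => ?_, inferInstance, fun V hV y hy => ⟨1, le_rfl, ?_⟩⟩
  · obtain ⟨t, ht⟩ := exists_t y T R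
    exact ⟨_, ht, _, inv_ne_zero (h0 t), hN t⟩
  obtain ⟨t, ht⟩ := exists_t y T R
  -- the section for the chart `t`, in terms of the generator on another chart
  have hmul : ∀ t', (T.coord hq t (R.sec t (J.Ψ t₀)))⁻¹ =
      T.coord hq t' (R.sec t' (J.Ψ t)) * (T.coord hq t' (R.sec t' (J.Ψ t₀)))⁻¹ := by
    intro t'
    have h1 : T.coord hq t (R.sec t (J.Ψ t₀)) * T.coord hq t' (R.sec t' (J.Ψ t)) =
        T.coord hq t' (R.sec t' (J.Ψ t₀)) := by
      refine T.coord_mul_coord hq t t' _ _ _ fun v hv hv' => ?_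
      obtain ⟨a, ha, hat⟩ := J.exists_eval t hv
      obtain ⟨a', ha', hat'⟩ := J.exists_eval t' hv'
      rw [eval_coords R _ hv, eval_coords R _ hv', eval_coords R _ hv', hat, hat', hat']
      linear_combination (a' * MvPolynomial.eval v (J.Ψ t₀)) * ha
    rw [eq_mul_inv_iff_mul_eq₀ (h0 t'), ← h1, inv_mul_cancel_left₀ (h0 t)]
  refine ⟨(T.coord hq t (R.sec t (J.Ψ t₀)))⁻¹, fun x _ => ?_, T.V (R.idx t) ⊓ q ⁻¹ᵁ V, ?_,
    ⟨ht, hy⟩, fun x => ?_⟩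
  · obtain ⟨t', ht'⟩ := exists_t x T R
    rw [pow_one, hN t' x ht', Submodule.mem_span_singleton]
    refine ⟨Y.presheaf.germ _ x ht' (T.chartFn R t' (R.sec t' (J.Ψ t))), ?_⟩
    rw [hmul t', Algebra.smul_def, T.algebraMap_germ hq t' ht']
  · have hVa : IsAffine (T.V (R.idx t)).toScheme := T.affine _
    have h1 : IsAffineOpen (((T.V (R.idx t)).ι ≫ q) ⁻¹ᵁ V) := hV.preimage _
    have h2 := h1.image_of_isOpenImmersion (T.V (R.idx t)).ι
    have h3 : (T.V (R.idx t)).ι ''ᵁ (((T.V (R.idx t)).ι ≫ q) ⁻¹ᵁ V) = T.V (R.idx t) ⊓ q ⁻¹ᵁ V := by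
      rw [Scheme.Hom.comp_preimage, Scheme.Hom.image_preimage_eq_opensRange_inf,
        Scheme.Opens.opensRange_ι]
    rwa [h3] at h2
  · rw [pow_one]
    constructor
    · rintro ⟨h1, h2⟩
      exact ⟨h2, (hN t x h1).symm⟩
    · rintro ⟨h1, h2⟩
      refine ⟨?_, h1⟩
      obtain ⟨t', ht'⟩ := exists_t x T R
      have h3 : (T.coord hq t' (R.sec t' (J.Ψ t₀)))⁻¹ ∈ Submodule.span (Y.presheaf.stalk x)
          {(T.coord hq t (R.sec t (J.Ψ t₀)))⁻¹} := by
        rw [h2, hN t' x ht']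
        exact Submodule.mem_span_singleton_self _
      obtain ⟨o, ho⟩ := Submodule.mem_span_singleton.mp h3
      have h4 : x ∈ Y.basicOpen (T.chartFn R t' (R.sec t' (J.Ψ t))) := by
        refine (T.mem_basicOpen_iff hq t' ht' _).mpr ⟨o, ?_⟩
        rw [hmul t', Algebra.smul_def, ← mul_assoc] at ho
        exact mul_right_cancel₀ (inv_ne_zero (h0 t')) (ho.trans (one_mul _).symm)
      rw [T.basicOpen_chartFn R J] at h4
      exact h4.2

lemma canonicalStalks_eq {ε : ℤ} (J : JacobianWeight R ε) (t₀ : R.T)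
    (ε₀ : Fin (varietyDim (q ≫ baseStr ρ)) ≃ R.J t₀) (t : R.T) {y : Y} (hy : y ∈ T.V (R.idx t)) :
    canonicalStalks (q ≫ baseStr ρ) (exteriorPower.ιMulti (FunField (q ≫ baseStr ρ))
        (varietyDim (q ≫ baseStr ρ)) (fun i => KaehlerDifferential.D ℂ (FunField (q ≫ baseStr ρ))
            (T.coord hq t₀ (MvPolynomial.X (ε₀ i))))) y =
      Submodule.span (Y.presheaf.stalk y) {T.coord hq t (R.sec t (J.Ψ t₀)) ^ (-ε)} := by
  have := R.finite t
  obtain ⟨b, hb⟩ := RationalForms.exists_basis (T.coord hq t) (T.coord_injective hq t)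
    (T.coord_frac hq t)
  obtain ⟨h0, εt, κ, hκ, h⟩ := T.coord_jacobian hq J t₀ t ε₀
  have hκ' : algebraMap ℂ (FunField (q ≫ baseStr ρ)) κ ≠ 0 :=
    (map_ne_zero_iff _ (algebraMap ℂ (FunField (q ≫ baseStr ρ))).injective).mpr hκ
  have hc : ∀ r : ℂ, ∃ o : Y.presheaf.stalk y, algebraMap _ (FunField (q ≫ baseStr ρ)) o =
      algebraMap ℂ _ r := fun r => ⟨_, (T.algebraMap_germ hq t hy (MvPolynomial.C r)).trans
        ((T.coord hq t).commutes r)⟩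
  ext k
  change k • _ ∈ regularTopForms _ y ↔ _
  rw [T.mem_regularTopForms_iff hq t hy εt, Submodule.mem_span_singleton, h]
  constructor
  · rintro ⟨o, ho⟩
    rw [smul_smul] at ho
    have h1 := RationalForms.smul_wedge_injective b hb εt ho
    obtain ⟨u, hu⟩ := hc κ⁻¹
    refine ⟨o * u, ?_⟩
    rw [Algebra.smul_def, map_mul, hu, ← h1, zpow_neg, map_inv₀]
    field_simp
  · rintro ⟨o, rfl⟩
    obtain ⟨u, hu⟩ := hc κ
    refine ⟨o * u, ?_⟩
    rw [Algebra.smul_def, map_mul, hu, smul_smul, zpow_neg]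
    congr 1
    field_simp

lemma wedge_ne_zero (t : R.T) (εt : Fin (varietyDim (q ≫ baseStr ρ)) ≃ R.J t) :
    exteriorPower.ιMulti (FunField (q ≫ baseStr ρ)) (varietyDim (q ≫ baseStr ρ))
      (fun i => KaehlerDifferential.D ℂ (FunField (q ≫ baseStr ρ))
            (T.coord hq t (MvPolynomial.X (εt i)))) ≠ 0 := by
  have := R.finite t
  obtain ⟨b, hb⟩ := RationalForms.exists_basis (T.coord hq t) (T.coord_injective hq t)
    (T.coord_frac hq t)
  intro h
  refine one_ne_zero (α := FunField (q ≫ baseStr ρ)) ?_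
  exact RationalForms.smul_wedge_injective b hb εt (by rw [h, smul_zero, smul_zero])

end FunctionField

include T in
lemma canonicalIsRelAmple [Finite σ] {q : Y ⟶ Base ρ} (hq : π ≫ q = L.toBase)
    (J : JacobianWeight R 1) : CanonicalIsRelAmple (q ≫ baseStr ρ) q := by
  intro hY
  have hint := T.isIntegral
  obtain ⟨t₀, -⟩ := exists_t (Classical.arbitrary Y) T R
  obtain ⟨ε₀⟩ := T.nonempty_dim_equiv hq t₀
  refine ⟨hint, _, T.wedge_ne_zero hq t₀ ε₀, T.isRelAmple hq J t₀ _ (fun t y hy => ?_)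
    fun t => (T.coord_jacobian hq J t₀ t ε₀).1⟩
  rw [T.canonicalStalks_eq hq J t₀ ε₀ t hy, zpow_neg_one]

include T in
lemma anticanonicalIsRelAmple [Finite σ] {q : Y ⟶ Base ρ} (hq : π ≫ q = L.toBase)
    (J : JacobianWeight R (-1)) : AnticanonicalIsRelAmple (q ≫ baseStr ρ) q := by
  intro hY
  have hint := T.isIntegral
  obtain ⟨t₀, -⟩ := exists_t (Classical.arbitrary Y) T R
  obtain ⟨ε₀⟩ := T.nonempty_dim_equiv hq t₀
  refine ⟨hint, _, T.wedge_ne_zero hq t₀ ε₀, T.isRelAmple hq J t₀ _ (fun t y hy => ?_)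
    fun t => (T.coord_jacobian hq J t₀ t ε₀).1⟩
  have h0 := (T.coord_jacobian hq J t₀ t ε₀).1
  rw [anticanonicalStalks, T.canonicalStalks_eq hq J t₀ ε₀ t hy, neg_neg, zpow_one]
  ext k
  rw [Submodule.mem_div_iff_forall_mul_mem, Submodule.mem_span_singleton]
  constructor
  · intro h
    obtain ⟨o, ho⟩ := Submodule.mem_one.mp (h _ (Submodule.mem_span_singleton_self _))
    refine ⟨o, ?_⟩
    rw [Algebra.smul_def, ho]
    field_simp
  · rintro ⟨o, rfl⟩ x hx
    obtain ⟨o', rfl⟩ := Submodule.mem_span_singleton.mp hx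
    refine Submodule.mem_one.mpr ⟨o * o', ?_⟩
    rw [map_mul, Algebra.smul_def, Algebra.smul_def]
    field_simp

end ChartSystem.Locus.Sections

/-! ### Words and frames in representations of quivers -/

namespace QuiverRep

open Quiver Matrix

variable {V : Type} [Quiver.{0} V] {d : V → ℕ} {E E' : Type} [CommRing E] [CommRing E']

/-- The matrix of an edge in a representation with coefficients in a ring. -/
def mat (v : Coord d → E) {i j : V} (e : i ⟶ j) : Matrix (Fin (d j)) (Fin (d i)) E :=
  Matrix.of fun p q => v ⟨i, j, e, p, q⟩

lemma mat_map (φ : E →+* E') (v : Coord d → E) {i j : V} (e : i ⟶ j) :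
    mat (φ ∘ v) e = (mat v e).map φ := rfl

variable {o : V}

/-- The vector that a path from `o` produces from the vector `(1, …, 1)` at `o`. -/
def word (v : Coord d → E) : ∀ {i : V}, Path o i → Fin (d i) → E
  | _, .nil => fun _ => 1
  | _, .cons p e => mat v e *ᵥ word v p

lemma word_cons (v : Coord d → E) {i j : V} (p : Path o i) (e : i ⟶ j) :
    word v (p.cons e) = mat v e *ᵥ word v p := rfl

lemma word_map (φ : E →+* E') (v : Coord d → E) {i : V} (p : Path o i) :
    word (φ ∘ v) p = φ ∘ word v p := by
  induction p with
  | nil => funext r; simp [word]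
  | cons p e ih =>
    funext r
    simp only [word_cons, ih, mat_map, Function.comp, mulVec, dotProduct, Matrix.map_apply,
      map_sum, map_mul]

variable (d o) in
/-- A choice of `d i` paths from `o` to each vertex `i`, with the constant path at `o`. -/
structure Words where
  path : ∀ i : V, Fin (d i) → Path o i
  path_o : ∀ k, path o k = .nil

namespace Words

variable (S : Words d o)

/-- The matrix of the vectors of the chosen paths to `i`. -/
def frame (v : Coord d → E) (i : V) : Matrix (Fin (d i)) (Fin (d i)) E :=
  Matrix.of fun r k => word v (S.path i k) r

lemma frame_map (φ : E →+* E') (v : Coord d → E) (i : V) :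
    S.frame (φ ∘ v) i = (S.frame v i).map φ := by
  ext r k
  simp [frame, word_map]

lemma frame_o (ho : d o = 1) (v : Coord d → E) : S.frame v o = 1 := by
  have : Subsingleton (Fin (d o)) := by rw [ho]; infer_instance
  ext r k
  rw [Subsingleton.elim r k]
  simp [frame, S.path_o, word]

lemma det_frame_o (ho : d o = 1) (v : Coord d → E) : (S.frame v o).det = 1 := by
  rw [frame_o S ho, det_one]

/-- The path of the entry `(r, c)` of an edge: it continues the path chosen for the column by
the edge. -/
def ext (z : Coord d) : Path o z.tgt := (S.path z.src z.col).cons z.edge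

variable [Fintype V]

/-- The product of the determinants of the frames. -/
def discr (v : Coord d → E) : E := ∏ i, (S.frame v i).det

lemma discr_map (φ : E →+* E') (v : Coord d → E) : S.discr (φ ∘ v) = φ (S.discr v) := by
  simp only [discr, frame_map, map_prod]
  exact Finset.prod_congr rfl fun i _ => (RingHom.map_det φ _).symm

variable [DecidableEq V]

/-- The numerators of the entries of the representation in the bases that are given by the
frames, with denominator `discr` (Cramer's rule). -/
def num (v : Coord d → E) (z : Coord d) : E :=
  ((S.frame v z.tgt).updateCol z.row (word v (S.ext z))).det *
    ∏ i ∈ Finset.univ.erase z.tgt, (S.frame v i).det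

lemma num_map (φ : E →+* E') (v : Coord d → E) (z : Coord d) :
    S.num (φ ∘ v) z = φ (S.num v z) := by
  simp only [num, frame_map, map_prod, map_mul, RingHom.map_det]
  congr 2
  rw [word_map, RingHom.mapMatrix_apply]
  ext r k
  simp only [updateCol_apply, Function.comp, Matrix.map_apply]
  split <;> rfl

lemma num_eq (v : Coord d → E) (z : Coord d) (h : IsUnit (S.frame v z.tgt).det) :
    S.num v z = ((S.frame v z.tgt)⁻¹ * mat v z.edge * S.frame v z.src) z.row z.col *
      S.discr v := by
  rw [num, discr, ← Finset.mul_prod_erase _ _ (Finset.mem_univ z.tgt), ← mul_assoc]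
  congr 1
  rw [← cramer_apply, cramer_eq_adjugate_mulVec, Matrix.mul_assoc, inv_def, Matrix.smul_mul,
    Matrix.smul_apply, smul_eq_mul, mul_right_comm, Ring.inverse_mul_cancel _ h, one_mul]
  rfl

omit [Fintype V]

/-- A `Words` structure with one path replaced. -/
def update (j : V) (hj : j ≠ o) (r : Fin (d j)) (p : Path o j) : Words d o where
  path := Function.update S.path j (Function.update (S.path j) r p)
  path_o k := by rw [Function.update_of_ne hj.symm]; exact S.path_o k

lemma frame_update (v : Coord d → E) {j : V} (hj : j ≠ o) (r : Fin (d j)) (p : Path o j) :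
    (S.update j hj r p).frame v j = (S.frame v j).updateCol r (word v p) := by
  ext x k
  simp only [frame, update, Function.update_self, Matrix.of_apply, updateCol_apply]
  by_cases hk : k = r
  · subst hk; simp
  · simp [hk]

lemma frame_update_of_ne (v : Coord d → E) {j : V} (hj : j ≠ o) (r : Fin (d j)) (p : Path o j)
    {i : V} (hi : i ≠ j) : (S.update j hj r p).frame v i = S.frame v i := by
  ext x k
  simp [frame, update, Function.update_of_ne hi]

lemma num_eq_discr_update [Fintype V] (v : Coord d → E) (z : Coord d)
    (hz : z.tgt ≠ o) : S.num v z = (S.update z.tgt hz z.row (S.ext z)).discr v := by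
  rw [num, discr, ← Finset.mul_prod_erase _ _ (Finset.mem_univ z.tgt), frame_update]
  congr 1
  exact Finset.prod_congr rfl fun i hi => by
    rw [frame_update_of_ne _ _ _ _ _ (Finset.ne_of_mem_erase hi)]

lemma num_eq_word_mul [Fintype V] (ho : d o = 1) (v : Coord d → E) (z : Coord d)
    (hz : z.tgt = o) : S.num v z = word v (S.ext z) z.row * S.discr v := by
  rw [num, discr, ← Finset.mul_prod_erase _ _ (Finset.mem_univ z.tgt)]
  obtain ⟨i, j, e, r, c⟩ := z
  obtain rfl : j = o := hz
  rw [← mul_assoc, det_frame_o S ho, mul_one]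
  congr 1
  rw [frame_o S ho]
  have : Subsingleton (Fin (d j)) := by rw [ho]; infer_instance
  rw [det_eq_elem_of_subsingleton _ r, updateCol_self]

end Words

/-! ### The action of the gauge group on words -/

section Action

variable (ho : d o = 1)

lemma mat_act (g : GaugeGroup d) (v : Rep d) {i j : V} (e : i ⟶ j) :
    mat (act g v) e = ((g j)⁻¹ : GL (Fin (d j)) ℂ).val * mat v e * (g i).val := rfl

include ho in
lemma word_act (g : GaugeGroup d) (v : Rep d) {i : V} (p : Path o i) :
    word (act g v) p = (g o).val.det • (((g i)⁻¹ : GL (Fin (d i)) ℂ).val *ᵥ word v p) := by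
  induction p with
  | nil =>
    have : Subsingleton (Fin (d o)) := by rw [ho]; infer_instance
    have h1 : (g o).val *ᵥ word v (.nil : Path o o) = (g o).val.det • word v .nil := by
      funext k
      rw [det_eq_elem_of_subsingleton _ k, Pi.smul_apply, mulVec, dotProduct,
        Fintype.sum_subsingleton _ k]
      rfl
    have h2 : word (act g v) (.nil : Path o o) = word v .nil := rfl
    rw [h2, ← mulVec_smul, ← h1, mulVec_mulVec, Units.inv_mul, one_mulVec]
  | @cons i j p e ih =>
    rw [word_cons, word_cons, ih, mat_act, mulVec_smul, mulVec_mulVec, mulVec_mulVec,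
      Matrix.mul_assoc, Units.mul_inv, Matrix.mul_one]

include ho in
lemma frame_act (g : GaugeGroup d) (v : Rep d) (S : Words d o) (i : V) :
    S.frame (act g v) i =
      (g o).val.det • (((g i)⁻¹ : GL (Fin (d i)) ℂ).val * S.frame v i) := by
  ext r k
  simp only [Words.frame, Matrix.of_apply, word_act ho]
  rfl

variable [Fintype V]

/-- The weight of the functions `discr`. -/
def weight (o : V) (g : GaugeGroup d) : ℂ := ∏ i, ((g o).val.det ^ d i * (g i).val.det⁻¹)

omit [Quiver V] in
lemma weight_ne_zero (g : GaugeGroup d) : weight o g ≠ 0 :=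
  Finset.prod_ne_zero_iff.mpr fun i _ => mul_ne_zero
    (pow_ne_zero _ ((isUnit_iff_isUnit_det _).mp (g o).isUnit).ne_zero)
    (inv_ne_zero ((isUnit_iff_isUnit_det _).mp (g i).isUnit).ne_zero)

lemma det_gl_inv {n : ℕ} (h : GL (Fin n) ℂ) : (h⁻¹).val.det = h.val.det⁻¹ := by
  have : (h⁻¹).val.det * h.val.det = 1 := by rw [← det_mul, Units.inv_mul, det_one]
  exact eq_inv_of_mul_eq_one_left this

omit [Fintype V] in
include ho in
lemma det_frame_act (g : GaugeGroup d) (v : Rep d) (S : Words d o) (i : V) :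
    (S.frame (act g v) i).det =
      (g o).val.det ^ d i * (g i).val.det⁻¹ * (S.frame v i).det := by
  rw [frame_act ho, det_smul, det_mul, Fintype.card_fin, det_gl_inv, mul_assoc]

include ho in
lemma discr_act (g : GaugeGroup d) (v : Rep d) (S : Words d o) :
    S.discr (act g v) = weight o g * S.discr v := by
  simp only [Words.discr, weight, det_frame_act ho, ← Finset.prod_mul_distrib]

omit [Fintype V]

/-- The generic representation. -/
abbrev generic (d : V → ℕ) : Coord d → RepRing d := MvPolynomial.X

lemma eval_comp_generic (v : Rep d) : MvPolynomial.eval v ∘ generic d = v := by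
  funext z; simp

lemma eval_word (v : Rep d) {i : V} (p : Path o i) (r) :
    MvPolynomial.eval v (word (generic d) p r) = word v p r := by
  have := word_map (MvPolynomial.eval v) (generic d) p
  rw [eval_comp_generic] at this
  exact (congr_fun this r).symm

lemma eval_det_frame (v : Rep d) (S : Words d o) (i : V) :
    MvPolynomial.eval v (S.frame (generic d) i).det = (S.frame v i).det := by
  rw [RingHom.map_det, RingHom.mapMatrix_apply, ← S.frame_map, eval_comp_generic]

lemma eval_discr [Fintype V] (v : Rep d) (S : Words d o) :
    MvPolynomial.eval v (S.discr (generic d)) = S.discr v := by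
  rw [← S.discr_map, eval_comp_generic]

lemma eval_num [Fintype V] [DecidableEq V] (v : Rep d) (S : Words d o) (z) :
    MvPolynomial.eval v (S.num (generic d) z) = S.num v z := by
  rw [← S.num_map, eval_comp_generic]

include ho in
lemma actRing_discr [Fintype V] (g : GaugeGroup d) (S : Words d o) :
    actRing g (S.discr (generic d)) = MvPolynomial.C (weight o g) * S.discr (generic d) := by
  refine MvPolynomial.funext fun v => ?_
  rw [eval_actRing, eval_discr, map_mul, eval_discr, MvPolynomial.eval_C, discr_act ho]

include ho in
lemma word_closed_mem (p : Path o o) (r) : word (generic d) p r ∈ fixedBy (actRing (m := d)) := by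
  rw [mem_fixedBy]
  intro g
  refine MvPolynomial.funext fun v => ?_
  rw [eval_actRing, eval_word, eval_word, word_act ho]
  have : Subsingleton (Fin (d o)) := by rw [ho]; infer_instance
  have e : ((g o)⁻¹).val r r = ((g o)⁻¹).val.det := (det_eq_elem_of_subsingleton _ r).symm
  rw [Pi.smul_apply, mulVec, dotProduct, Fintype.sum_subsingleton _ r, e, det_gl_inv, smul_eq_mul, ← mul_assoc,
    mul_inv_cancel₀ ((isUnit_iff_isUnit_det _).mp (g o).isUnit).ne_zero, one_mul]

end Action

/-! ### The matrices of the action -/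

section Adjoint

instance finite_coord [Finite V] [∀ i j : V, Finite (i ⟶ j)] : Finite (Coord d) := by
  let f : (Σ (i j : V) (_ : i ⟶ j), Fin (d j) × Fin (d i)) → Coord d :=
    fun x => ⟨x.1, x.2.1, x.2.2.1, x.2.2.2.1, x.2.2.2.2⟩
  exact Finite.of_surjective f fun ⟨i, j, e, r, c⟩ => ⟨⟨i, j, e, r, c⟩, rfl⟩

open Classical in
/-- The matrix of the action of a group element on representations. -/
def actMatrix (g : GaugeGroup d) : Matrix (Coord d) (Coord d) ℂ :=
  Matrix.of fun x y => act g (Pi.single y 1) x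

lemma act_apply (g : GaugeGroup d) (v : Rep d) (x : Coord d) : act g v x =
    ∑ p, ∑ q, ((g x.tgt)⁻¹ : GL (Fin (d x.tgt)) ℂ).val x.row p * v ⟨x.src, x.tgt, x.edge, p, q⟩ *
      (g x.src).val q x.col := by
  simp only [act, Matrix.mul_apply, edgeMatrix, Matrix.of_apply, Finset.sum_mul]
  exact Finset.sum_comm

lemma actMatrix_same (g : GaugeGroup d) {i j : V} (e : i ⟶ j) (r p : Fin (d j)) (c q : Fin (d i)) :
    actMatrix g ⟨i, j, e, r, c⟩ ⟨i, j, e, p, q⟩ =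
      ((g j)⁻¹ : GL (Fin (d j)) ℂ).val r p * (g i).val q c := by
  classical
  rw [actMatrix, Matrix.of_apply, act_apply, Finset.sum_eq_single p, Finset.sum_eq_single q]
  · simp
  · intro q' _ hq
    rw [Pi.single_eq_of_ne, mul_zero, zero_mul]
    simpa using hq
  · simp
  · intro p' _ hp
    refine Finset.sum_eq_zero fun q' _ => ?_
    rw [Pi.single_eq_of_ne, mul_zero, zero_mul]
    simp [hp]
  · simp

lemma actMatrix_eq_zero (g : GaugeGroup d) (x y : Coord d)
    (h : ∀ p q, y ≠ ⟨x.src, x.tgt, x.edge, p, q⟩) : actMatrix g x y = 0 := by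
  classical
  rw [actMatrix, Matrix.of_apply, act_apply]
  refine Finset.sum_eq_zero fun p _ => Finset.sum_eq_zero fun q _ => ?_
  rw [Pi.single_eq_of_ne (h p q).symm, mul_zero, zero_mul]

variable [Fintype (Coord d)]

lemma actRing_eq_subst (g : GaugeGroup d) : actRing g = Fischer.subst (actMatrix g) := by
  classical
  refine MvPolynomial.algHom_ext fun x => MvPolynomial.funext fun v => ?_
  rw [eval_actRing, MvPolynomial.eval_X, Fischer.subst_X, map_sum]
  simp only [map_mul, MvPolynomial.eval_C, MvPolynomial.eval_X]
  have h : v = ∑ y, v y • Pi.single y (1 : ℂ) := by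
    funext z
    simp [Finset.sum_apply, Pi.single_apply]
  conv_lhs => rw [h, act_apply]
  simp only [Finset.sum_apply, Pi.smul_apply, smul_eq_mul, Finset.mul_sum, Finset.sum_mul,
    actMatrix, Matrix.of_apply, act_apply]
  rw [Finset.sum_comm]
  conv_lhs => rw [Finset.sum_comm]; enter [2, p]; rw [Finset.sum_comm]
  rw [Finset.sum_comm]
  refine Finset.sum_congr rfl fun y _ => Finset.sum_congr rfl fun p _ => Finset.sum_congr rfl
    fun q _ => ?_
  ring

omit [Fintype (Coord d)] in
/-- The gauge group is closed under conjugate transposes. -/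
lemma exists_conjTranspose (o : V) [Fintype V] (g : GaugeGroup d) : ∃ g' : GaugeGroup d,
    actMatrix g' = (actMatrix g).conjTranspose ∧ weight o g' = starRingEnd ℂ (weight o g) := by
  let g' : GaugeGroup d := fun i => ⟨(g i).val.conjTranspose, ((g i)⁻¹).val.conjTranspose,
    by rw [← conjTranspose_mul, Units.inv_mul, conjTranspose_one],
    by rw [← conjTranspose_mul, Units.mul_inv, conjTranspose_one]⟩
  have h1 : ∀ i, (g' i).val = (g i).val.conjTranspose := fun i => rfl
  have h2 : ∀ i, ((g' i)⁻¹).val = ((g i)⁻¹).val.conjTranspose := fun i => rfl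
  refine ⟨g', ?_, ?_⟩
  · ext x y
    rw [conjTranspose_apply]
    by_cases h : ∃ p q, y = ⟨x.src, x.tgt, x.edge, p, q⟩
    · obtain ⟨p, q, rfl⟩ := h
      refine (actMatrix_same g' x.edge x.row p x.col q).trans ?_
      rw [actMatrix_same, star_mul', h1, h2]
      simp [conjTranspose_apply]
    · push Not at h
      rw [actMatrix_eq_zero _ _ _ h, actMatrix_eq_zero, star_zero]
      rintro p q rfl
      exact h y.row y.col rfl
  · simp only [weight, h1, det_conjTranspose, map_prod, map_mul, map_pow, map_inv₀]
    rfl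

end Adjoint

end QuiverRep

/-! ### Generated representations and trees of words -/

namespace QuiverRep

open Quiver Matrix

variable {V : Type} [Quiver.{0} V] {d : V → ℕ} {o : V}

/-- The representation is generated by the vertex `o`. -/
def IsGenerated (o : V) (v : Rep d) : Prop :=
  ∀ X : SubRep v, X.space o = ⊤ → ∀ i, X.space i = ⊤

lemma SubRep.word_mem {v : Rep d} (X : SubRep v) (hX : X.space o = ⊤) {i : V} (p : Path o i) :
    word v p ∈ X.space i := by
  induction p with
  | nil => rw [hX]; trivial
  | cons p e ih => exact X.map_mem e _ ih

lemma isGenerated_of_discr [Fintype V] {v : Rep d} (S : Words d o) (h : S.discr v ≠ 0) :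
    IsGenerated o v := by
  intro X hX i
  have hdet : IsUnit (S.frame v i).det :=
    isUnit_iff_ne_zero.mpr fun h0 => h (Finset.prod_eq_zero (Finset.mem_univ i) h0)
  rw [eq_top_iff]
  intro x _
  have : x = S.frame v i *ᵥ ((S.frame v i)⁻¹ *ᵥ x) := by
    rw [mulVec_mulVec, mul_nonsing_inv _ hdet, one_mulVec]
  rw [this, mulVec_eq_sum]
  refine (X.space i).sum_mem fun k _ => ?_
  rw [op_smul_eq_smul]
  exact (X.space i).smul_mem _ (X.word_mem hX (S.path i k))

/-- The chosen paths form a tree: they are distinct, and closed under removal of the last edge. -/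
structure Words.IsTree (S : Words d o) : Prop where
  prefix_mem : ∀ {i j : V} (p : Path o i) (e : i ⟶ j) (k), S.path j k = p.cons e →
    ∃ l, S.path i l = p
  injective : ∀ i, Function.Injective (S.path i)

/-- A maximal prefix closed family of paths with linearly independent words yields bases of a
generated representation. -/
lemma exists_tree [Fintype V] (ho : d o = 1) {v : Rep d} (hv : IsGenerated o v) :
    ∃ S : Words d o, S.IsTree ∧ S.discr v ≠ 0 := by
  classical
  by_contra hcon
  -- prefix closed families of paths with linearly independent words, of any size
  have key : ∀ n : ℕ, ∃ P : ∀ i, Finset (Path o i), .nil ∈ P o ∧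
      (∀ {i j} (p : Path o i) (e : i ⟶ j), p.cons e ∈ P j → p ∈ P i) ∧
      (∀ i, LinearIndepOn ℂ (word v) (P i : Set (Path o i))) ∧ n ≤ ∑ i, (P i).card := by
    intro n
    induction n with
    | zero =>
      refine ⟨fun i => if h : o = i then {h ▸ .nil} else ∅, by simp, ?_, ?_, Nat.zero_le _⟩
      · intro i j p e h
        by_cases hj : o = j
        · subst hj
          simp at h
        · simp [hj] at h
      · intro i
        by_cases hi : o = i
        · subst hi
          simp only [dite_true, Finset.coe_singleton]
          refine LinearIndepOn.singleton ?_
          intro h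
          have := congr_fun h ⟨0, by omega⟩
          exact one_ne_zero this
        · simp [hi]
    | succ n ih =>
      obtain ⟨P, hnil, hpre, hind, hcard⟩ := ih
      -- either the words span a subrepresentation, which is everything, or the family can be enlarged
      by_cases hstab : ∀ {i j} (p : Path o i) (e : i ⟶ j), p ∈ P i →
          word v (p.cons e) ∈ Submodule.span ℂ (word v '' (P j : Set (Path o j)))
      · exfalso
        let X : SubRep v :=
          { space := fun i => Submodule.span ℂ (word v '' (P i : Set (Path o i)))
            map_mem := by
              intro i j e x hx
              have : Submodule.span ℂ (word v '' (P i : Set (Path o i))) ≤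
                  (Submodule.span ℂ (word v '' (P j : Set (Path o j)))).comap
                    (edgeMatrix v e).mulVecLin := by
                rw [Submodule.span_le]
                rintro _ ⟨p, hp, rfl⟩
                exact hstab p e hp
              exact this hx }
        have hXo : X.space o = ⊤ := by
          rw [eq_top_iff]
          intro x _
          have h1 : word v (.nil : Path o o) ∈ X.space o := Submodule.subset_span ⟨_, hnil, rfl⟩
          have hs : Subsingleton (Fin (d o)) := by rw [ho]; infer_instance
          have h2 : x = x ⟨0, by omega⟩ • word v (.nil : Path o o) := by
            funext k
            rw [Subsingleton.elim k ⟨0, by omega⟩]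
            simp [word]
          rw [h2]
          exact Submodule.smul_mem _ _ h1
        have htop := hv X hXo
        have hdim : ∀ i, Fintype.card (P i) = d i := by
          intro i
          have h1 := hind i
          have h2 := finrank_span_eq_card (R := ℂ) (b := fun p : P i => word v p.1) h1
          have h3 : Set.range (fun p : P i => word v p.1) = word v '' (P i : Set (Path o i)) := by
            rw [Set.image_eq_range]; rfl
          rw [h3] at h2
          have h4 : Submodule.span ℂ (word v '' (P i : Set (Path o i))) = ⊤ := htop i
          rw [h4, finrank_top, Module.finrank_fin_fun] at h2
          exact h2.symm
        let E : ∀ i, Fin (d i) ≃ P i := fun i => (Fintype.equivFinOfCardEq (hdim i)).symm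
        have hPo : ∀ p ∈ P o, p = .nil := by
          intro p hp
          have h1 : Fintype.card (P o) = 1 := (hdim o).trans ho
          have h2 := (Fintype.card_le_one_iff.mp h1.le) ⟨p, hp⟩ ⟨.nil, hnil⟩
          exact congr_arg Subtype.val h2
        refine hcon ⟨⟨fun i k => (E i k).1, fun k => hPo _ (E o k).2⟩, ⟨?_, ?_⟩, ?_⟩
        · intro i j p e k h
          have h1 : p ∈ P i := hpre p e (h ▸ (E j k).2)
          exact ⟨(E i).symm ⟨p, h1⟩, by simp⟩
        · exact fun i => Subtype.val_injective.comp (E i).injective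
        · refine Finset.prod_ne_zero_iff.mpr fun i _ => ?_
          rw [← isUnit_iff_ne_zero, ← isUnit_iff_isUnit_det, ← linearIndependent_cols_iff_isUnit]
          exact (hind i).linearIndependent.comp _ (E i).injective
      · push Not at hstab
        obtain ⟨i, j, p, e, hp, hnot⟩ := hstab
        have hnotin : p.cons e ∉ P j := fun h => hnot (Submodule.subset_span ⟨_, h, rfl⟩)
        have hself : Function.update P j (insert (p.cons e) (P j)) j = insert (p.cons e) (P j) :=
          Function.update_self _ _ _
        have hle : ∀ i, P i ⊆ Function.update P j (insert (p.cons e) (P j)) i := by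
          intro i
          by_cases hij : i = j
          · subst hij
            rw [hself]
            exact Finset.subset_insert _ _
          · rw [Function.update_of_ne hij]
        refine ⟨Function.update P j (insert (p.cons e) (P j)), hle _ hnil, ?_, ?_, ?_⟩
        · intro i' j' p' e' h
          by_cases hj : j' = j
          · subst hj
            rw [hself, Finset.mem_insert] at h
            rcases h with h | h
            · cases h
              exact hle _ hp
            · exact hle _ (hpre p' e' h)
          · rw [Function.update_of_ne hj] at h
            exact hle _ (hpre p' e' h)
        · intro i'
          by_cases hj : i' = j
          · subst hj
            rw [hself, Finset.coe_insert]
            exact (hind i').insert hnot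
          · rw [Function.update_of_ne hj]
            exact hind i'
        · refine hcard.trans_lt (Finset.sum_lt_sum (fun i _ => Finset.card_le_card (hle i))
            ⟨j, Finset.mem_univ j, ?_⟩)
          rw [hself, Finset.card_insert_of_notMem hnotin]
          exact Nat.lt_succ_self _
  obtain ⟨P, -, -, hind, hcard⟩ := key (∑ i, d i + 1)
  have : ∑ i, (P i).card ≤ ∑ i, d i := Finset.sum_le_sum fun i _ => by
    have h := (hind i).linearIndependent.fintype_card_le_finrank
    rw [Module.finrank_fin_fun] at h
    simpa using h
  omega

/-! ### Charts and slices for the locus of generated representations -/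

section Charts

variable [Fintype V] [∀ i j : V, Finite (i ⟶ j)] (ho : d o = 1)

/-- The functions of a list of words. -/
def listDiscr {n : ℕ} (w : Fin n → Option (Words d o)) (k : Fin n) : RepRing d :=
  (w k).elim 0 fun S => S.discr (generic d)

include ho in
variable (d o) in
/-- Finitely many functions `discr` span all of them over the invariants, and finitely many trees
suffice to cover the locus of generated representations. -/
lemma exists_list : ∃ (n : ℕ) (w : Fin (n + 1) → Option (Words d o)),
    (∀ S : Words d o, S.discr (generic d) ∈
      Submodule.span (fixedBy (actRing (m := d))) (Set.range (listDiscr w))) ∧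
    ∀ S : Words d o, ∀ v : Rep d, S.discr v ≠ 0 → ∃ k S', w k = some S' ∧ S'.IsTree ∧
      S'.discr v ≠ 0 := by
  classical
  have := Fintype.ofFinite (Coord d)
  -- the words in `s` span over the invariants; the trees in `T'` generate the ideal of all trees, so
  -- that they have the same common zeros
  obtain ⟨s, hs⟩ := Fischer.exists_finset_span_semiInvariants (M := actMatrix (d := d)) (weight o)
    weight_ne_zero (exists_conjTranspose o) (fun S : Words d o => S.discr (generic d))
    fun g S => by rw [← actRing_eq_subst, actRing_discr ho]
  obtain ⟨T, hT, hT2⟩ := (Submodule.fg_span_iff_fg_span_finset_subset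
    ((fun S : Words d o => S.discr (generic d)) '' {S | S.IsTree})).mp
      (IsNoetherian.noetherian (Ideal.span ((fun S : Words d o => S.discr (generic d)) ''
        {S | S.IsTree})))
  obtain ⟨T', hT', rfl⟩ := Finset.subset_set_image_iff.mp hT
  -- one more entry, without words and hence with `listDiscr` zero, keeps the list nonempty
  let w : Fin ((s ∪ T').card + 1) → Option (Words d o) := fun k =>
    if h : k.1 < (s ∪ T').card then some ((s ∪ T').equivFin.symm ⟨k.1, h⟩).1 else none
  have hw : ∀ S ∈ s ∪ T', ∃ k, w k = some S := by
    intro S hS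
    refine ⟨⟨((s ∪ T').equivFin ⟨S, hS⟩).1, by omega⟩, ?_⟩
    simp [w]
  refine ⟨_, w, fun S => ?_, fun S v hS => ?_⟩
  · obtain ⟨c, hc, h⟩ := hs S
    rw [h]
    refine Submodule.sum_mem _ fun S' hS' => ?_
    have hmem : c S' ∈ fixedBy (actRing (m := d)) := by
      rw [mem_fixedBy]
      intro g
      rw [actRing_eq_subst]
      exact Fischer.mem_fixed.mp (hc S') g
    obtain ⟨k, hk⟩ := hw S' (Finset.mem_union_left _ hS')
    have := Submodule.smul_mem (Submodule.span (fixedBy (actRing (m := d)))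
      (Set.range (listDiscr w))) ⟨c S', hmem⟩ (Submodule.subset_span ⟨k, rfl⟩)
    simp only [listDiscr, hk, Option.elim_some] at this
    exact this
  · obtain ⟨S₁, hS₁, hd⟩ := exists_tree ho (isGenerated_of_discr S hS)
    have h1 : S₁.discr (generic d) ∈ Submodule.span (RepRing d)
        (((fun S : Words d o => S.discr (generic d)) '' {S | S.IsTree})) :=
      Submodule.subset_span ⟨S₁, hS₁, rfl⟩
    rw [hT2] at h1
    by_contra hcon
    push Not at hcon
    have h2 : Submodule.span (RepRing d)
        ((T'.image fun S : Words d o => S.discr (generic d) : Finset _) : Set (RepRing d)) ≤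
        RingHom.ker (MvPolynomial.eval v) := by
      refine Submodule.span_le.mpr fun f hf => ?_
      obtain ⟨S', hS', rfl⟩ := Finset.mem_image.mp (Finset.mem_coe.mp hf)
      obtain ⟨k, hk⟩ := hw S' (Finset.mem_union_right _ hS')
      exact (eval_discr v S').trans (hcon k S' hk (hT' hS'))
    exact hd ((eval_discr v S₁).symm.trans (h2 h1))

variable {n : ℕ} (w : Fin (n + 1) → Option (Words d o))

omit [∀ i j : V, Finite (i ⟶ j)] in
include ho in
lemma normal_act [DecidableEq V] (S : Words d o) (v : Rep d) (h : S.discr v ≠ 0) :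
    ∃ g : GaugeGroup d, (g o).val.det = 1 ∧ act g v = (fun z => S.num v z / S.discr v) ∧
      S.discr (act g v) = 1 := by
  have hdet : ∀ i, (S.frame v i).det ≠ 0 := fun i =>
    Finset.prod_ne_zero_iff.mp h i (Finset.mem_univ i)
  let g : GaugeGroup d := fun i => GeneralLinearGroup.mkOfDetNeZero (S.frame v i) (hdet i)
  have hg : ∀ i, (g i).val = S.frame v i := fun i => rfl
  have hg' : ∀ i, ((g i)⁻¹).val = (S.frame v i)⁻¹ := fun i => coe_units_inv _
  have hgo : (g o).val.det = 1 := by rw [hg, S.det_frame_o ho]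
  refine ⟨g, hgo, ?_, ?_⟩
  · funext z
    rw [S.num_eq v z (isUnit_iff_ne_zero.mpr (hdet _)), mul_div_cancel_right₀ _ h]
    have e : act g v z = (((g z.tgt)⁻¹).val * mat v z.edge * (g z.src).val) z.row z.col := rfl
    rw [e, hg, hg']
  · rw [discr_act ho]
    simp only [weight, Words.discr, hg, S.det_frame_o ho, one_pow, one_mul,
      ← Finset.prod_mul_distrib]
    exact Finset.prod_eq_one fun i _ => inv_mul_cancel₀ (hdet i)

variable [DecidableEq V]

/-- The chart system of the locus of representations that are generated by the vertex `o`. -/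
def charts (hw : ∀ S : Words d o, S.discr (generic d) ∈
      Submodule.span (fixedBy (actRing (m := d))) (Set.range (listDiscr w))) :
    ChartSystem (actRing (m := d)) where
  n := n
  F := listDiscr w
  χ := weight o
  χ_ne_zero := weight_ne_zero
  ρ_F g k := by
    cases h : w k with
    | none => simp [listDiscr, h]
    | some S => simpa [listDiscr, h] using actRing_discr ho g S
  e k z := (w k).elim 0 fun S => S.num (generic d) z
  e_mem k z := by
    cases h : w k with
    | none => simp
    | some S =>
      rw [Option.elim_some]
      by_cases hz : z.tgt = o
      · rw [S.num_eq_word_mul ho _ _ hz]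
        have hr : word (generic d) (S.ext z) z.row ∈ fixedBy (actRing (m := d)) := by
          have key : ∀ {i : V} (p : Path o i) (r), i = o →
              word (generic d) p r ∈ fixedBy (actRing (m := d)) := by
            rintro i p r rfl
            exact word_closed_mem ho p r
          exact key _ _ hz
        exact Submodule.smul_mem _ (⟨_, hr⟩ : fixedBy (actRing (m := d))) (hw S)
      · rw [S.num_eq_discr_update _ _ hz]
        exact hw _
  exists_act k v hv := by
    cases h : w k with
    | none => simp [listDiscr, h] at hv
    | some S =>
      simp only [listDiscr, h, Option.elim_some, eval_discr, eval_num] at hv ⊢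
      obtain ⟨g, -, hg, hg'⟩ := normal_act ho S v hv
      refine ⟨g, fun f => ?_, ?_⟩
      · rw [eval_actRing, hg]
      · rw [eval_actRing, eval_discr, hg']

end Charts

section Slices

namespace Words

variable (S : Words d o)

/-- The coordinates on the slice of a tree: the entries that do not belong to the edges of the
tree. -/
def FreeCoord : Type := {z : Coord d // ∀ k, S.path z.tgt k ≠ S.ext z}

open Classical in
/-- The generic representation on the slice of a tree, where the vectors of the chosen paths are
the standard basis vectors. -/
def sliceRep (z : Coord d) : MvPolynomial S.FreeCoord ℂ :=
  if h : ∀ k, S.path z.tgt k ≠ S.ext z then MvPolynomial.X ⟨z, h⟩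
  else MvPolynomial.C (if S.path z.tgt z.row = S.ext z then 1 else 0)

lemma sliceRep_free (z : S.FreeCoord) : S.sliceRep z.1 = MvPolynomial.X z :=
  dif_pos z.2

open Classical in
lemma sliceRep_of_eq {z : Coord d} {k} (h : S.path z.tgt k = S.ext z) :
    S.sliceRep z = MvPolynomial.C (if S.path z.tgt z.row = S.ext z then 1 else 0) :=
  dif_neg fun h' => h' k h

variable {S} in
lemma IsTree.word_sliceRep (hS : S.IsTree) (ho : d o = 1) {i : V} (p : Path o i) :
    ∀ k, S.path i k = p → word S.sliceRep p = Pi.single k 1 := by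
  classical
  induction p with
  | nil =>
    intro k _
    have : Subsingleton (Fin (d o)) := by rw [ho]; infer_instance
    funext r
    rw [Subsingleton.elim r k]
    simp [word]
  | @cons i j p e ih =>
    intro k hk
    obtain ⟨l, hl⟩ := hS.prefix_mem p e k hk
    rw [word_cons, ih l hl, mulVec_single_one]
    funext r
    change S.sliceRep ⟨i, j, e, r, l⟩ = _
    have h1 : S.ext ⟨i, j, e, r, l⟩ = p.cons e := by rw [ext, hl]
    rw [S.sliceRep_of_eq (k := k) (hk.trans h1.symm), h1, ← hk, Pi.single_apply]
    simp only [(hS.injective j).eq_iff]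
    split <;> simp

variable {S} in
lemma IsTree.frame_sliceRep (hS : S.IsTree) (ho : d o = 1) (i : V) :
    S.frame S.sliceRep i = 1 := by
  ext1 r k
  rw [frame, of_apply, hS.word_sliceRep ho _ k rfl, one_apply, Pi.single_apply]

variable {S} in
lemma IsTree.discr_sliceRep [Fintype V] (hS : S.IsTree) (ho : d o = 1) :
    S.discr S.sliceRep = 1 := by
  simp [discr, hS.frame_sliceRep ho]

variable {S} in
lemma IsTree.num_sliceRep [Fintype V] [DecidableEq V] (hS : S.IsTree) (ho : d o = 1)
    (z : Coord d) : S.num S.sliceRep z = S.sliceRep z := by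
  have h : IsUnit (S.frame S.sliceRep z.tgt).det := by
    rw [hS.frame_sliceRep ho, det_one]; exact isUnit_one
  rw [S.num_eq _ _ h, hS.discr_sliceRep ho, hS.frame_sliceRep ho, hS.frame_sliceRep ho, inv_one,
    Matrix.one_mul, Matrix.mul_one, mul_one]
  rfl

open Classical in
lemma num_of_eq [Fintype V] [DecidableEq V] {E : Type} [CommRing E] (v : Coord d → E) {z : Coord d} {k}
    (h : S.path z.tgt k = S.ext z) (hS : S.IsTree) :
    S.num v z = (if S.path z.tgt z.row = S.ext z then 1 else 0) * S.discr v := by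
  rw [num, discr, ← Finset.mul_prod_erase _ _ (Finset.mem_univ z.tgt), ← mul_assoc]
  congr 1
  have h1 : word v (S.ext z) = (S.frame v z.tgt).col k := by
    rw [← h]; rfl
  rw [h1, ← h]
  simp only [(hS.injective _).eq_iff]
  by_cases hr : z.row = k
  · subst hr
    rw [if_pos rfl, one_mul]
    congr 1
    ext a b
    rw [updateCol_apply]
    split
    · subst_vars; rfl
    · rfl
  · rw [if_neg hr, zero_mul]
    refine det_zero_of_column_eq hr fun a => ?_
    rw [updateCol_self, updateCol_ne (Ne.symm hr)]
    rfl

end Words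

lemma aeval_comp_generic {J : Type} (x : Coord d → MvPolynomial J ℂ) :
    (MvPolynomial.aeval x : RepRing d →ₐ[ℂ] _).toRingHom ∘ generic d = x := by
  funext z
  simp

variable [Fintype V] [∀ i j : V, Finite (i ⟶ j)] (ho : d o = 1) [DecidableEq V]
  {n : ℕ} (w : Fin (n + 1) → Option (Words d o))

omit [∀ i j : V, Finite (i ⟶ j)] [DecidableEq V] in
lemma aeval_discr {J : Type} (x : Coord d → MvPolynomial J ℂ) (S : Words d o) :
    MvPolynomial.aeval x (S.discr (generic d)) = S.discr x := by
  have := S.discr_map (MvPolynomial.aeval x : RepRing d →ₐ[ℂ] _).toRingHom (generic d)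
  rw [aeval_comp_generic] at this
  exact this.symm

omit [∀ i j : V, Finite (i ⟶ j)] in
lemma aeval_num {J : Type} (x : Coord d → MvPolynomial J ℂ) (S : Words d o) (z : Coord d) :
    MvPolynomial.aeval x (S.num (generic d) z) = S.num x z := by
  have := S.num_map (MvPolynomial.aeval x : RepRing d →ₐ[ℂ] _).toRingHom (generic d) z
  rw [aeval_comp_generic] at this
  exact this.symm

/-- The slices of the trees in a list. -/
def slices (hw : ∀ S : Words d o, S.discr (generic d) ∈
      Submodule.span (fixedBy (actRing (m := d))) (Set.range (listDiscr w)))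
    (hcover : ∀ S : Words d o, ∀ v : Rep d, S.discr v ≠ 0 → ∃ k S', w k = some S' ∧ S'.IsTree ∧
      S'.discr v ≠ 0) : (charts ho w hw).Slices where
  T := {t : Fin (n + 1) × Words d o // w t.1 = some t.2 ∧ t.2.IsTree}
  idx t := t.1.1
  J t := t.1.2.FreeCoord
  finite t := Subtype.finite
  c t z := z.1
  sec t := MvPolynomial.aeval t.1.2.sliceRep
  sec_c t z := by rw [MvPolynomial.aeval_X, t.1.2.sliceRep_free z]
  sec_F t := by
    simp only [charts, listDiscr, t.2.1, Option.elim_some]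
    rw [aeval_discr, t.2.2.discr_sliceRep ho]
  sec_e t z := by
    simp only [charts, t.2.1, Option.elim_some]
    rw [aeval_num, t.2.2.num_sliceRep ho, MvPolynomial.aeval_X]
  exists_coord t z := by
    classical
    by_cases h : ∀ k, t.1.2.path z.tgt k ≠ t.1.2.ext z
    · exact Or.inl ⟨⟨z, h⟩, rfl⟩
    · push Not at h
      obtain ⟨k, hk⟩ := h
      by_cases hr : t.1.2.path z.tgt z.row = t.1.2.ext z
      · refine Or.inr ⟨1, ?_, ?_⟩
        · rw [MvPolynomial.aeval_X, t.1.2.sliceRep_of_eq hk, if_pos hr]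
        · simp only [charts, listDiscr, t.2.1, Option.elim_some]
          rw [t.1.2.num_of_eq _ hk t.2.2, if_pos hr, MvPolynomial.C_1]
      · refine Or.inr ⟨0, ?_, ?_⟩
        · rw [MvPolynomial.aeval_X, t.1.2.sliceRep_of_eq hk, if_neg hr]
        · simp only [charts, listDiscr, t.2.1, Option.elim_some]
          rw [t.1.2.num_of_eq _ hk t.2.2, if_neg hr, MvPolynomial.C_0]
  cover k v hv := by
    cases h : w k with
    | none => simp [charts, listDiscr, h] at hv
    | some S =>
      simp only [charts, listDiscr, h, Option.elim_some, eval_discr] at hv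
      obtain ⟨k', S', hk', hS', hv'⟩ := hcover S v hv
      refine ⟨⟨⟨k', S'⟩, hk', hS'⟩, ?_⟩
      simp only [charts, listDiscr, hk', Option.elim_some, eval_discr]
      exact hv'

end Slices

end QuiverRep

/-! ### Jacobian determinants of the transitions between slices -/

open Matrix in
/-- Linear algebra of a change of slices: complements of the images of `B` and `B'` that are
spanned by coordinate vectors are compared modulo these images. -/
lemma exists_compare_complements {E J J' Λ Z : Type} [Field E] [Fintype J] [Fintype J'] [Fintype Λ]
    [Fintype Z] [DecidableEq J] [DecidableEq J'] [DecidableEq Λ] [DecidableEq Z]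
    (Φ : Matrix Z Z E) (B B' : Matrix Z Λ E) (A : Matrix Λ Λ E) (η : J ⊕ Λ ≃ Z) (η' : J' ⊕ Λ ≃ Z)
    (e : J ≃ J') (hΦ : Φ * B = B' * A) (hN' : (B'.submatrix (η' ∘ Sum.inr) id).det ≠ 0) :
    ∃ (M : Matrix J' J E) (K : Matrix Λ J E) (s : ℤˣ),
      Φ * (1 : Matrix Z Z E).submatrix id (η ∘ Sum.inl) =
        (1 : Matrix Z Z E).submatrix id (η' ∘ Sum.inl) * M + B' * K ∧
      (M.submatrix e id).det * A.det * (B'.submatrix (η' ∘ Sum.inr) id).det =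
        ((s : ℤ) : E) * Φ.det * (B.submatrix (η ∘ Sum.inr) id).det := by
  have hblock : ∀ {J : Type} [Fintype J] [DecidableEq J] (B : Matrix Z Λ E) (η : J ⊕ Λ ≃ Z),
      (fromCols ((1 : Matrix Z Z E).submatrix id (η ∘ Sum.inl)) B).submatrix η id =
        fromBlocks 1 (B.submatrix (η ∘ Sum.inl) id) 0 (B.submatrix (η ∘ Sum.inr) id) := by
    intro J _ _ B η
    ext x y
    rcases x with x | x <;> rcases y with y | y <;> simp [one_apply]
  -- `X` is the matrix of `Φ` in the bases `P` and `P'`; it is block triangular, with blocks `M`, `A`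
  set P := fromCols ((1 : Matrix Z Z E).submatrix id (η ∘ Sum.inl)) B with hP
  set P' := fromCols ((1 : Matrix Z Z E).submatrix id (η' ∘ Sum.inl)) B' with hP'
  have hdet : (P.submatrix η id).det = (B.submatrix (η ∘ Sum.inr) id).det := by
    rw [hP, hblock, det_fromBlocks_zero₂₁, det_one, one_mul]
  have hdet' : (P'.submatrix η' id).det = (B'.submatrix (η' ∘ Sum.inr) id).det := by
    rw [hP', hblock, det_fromBlocks_zero₂₁, det_one, one_mul]
  have hu : IsUnit (P'.submatrix η' id).det := isUnit_iff_ne_zero.mpr (hdet' ▸ hN')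
  have hsub : ∀ {m n : Type} [Fintype n] (X : Matrix Z n E) (Y : Matrix n m E),
      (X * Y).submatrix η' id = X.submatrix η' id * Y := by
    intro m n _ X Y
    rfl
  have hinj : ∀ {m : Type} (X Y : Matrix (J' ⊕ Λ) m E), P' * X = P' * Y → X = Y := by
    intro m X Y h
    have h1 := congr_arg (fun W => (P'.submatrix η' id)⁻¹ * W.submatrix η' id) h
    simpa only [hsub, nonsing_inv_mul_cancel_left _ _ hu] using h1
  let X : Matrix (J' ⊕ Λ) (J ⊕ Λ) E := (P'.submatrix η' id)⁻¹ * (Φ * P).submatrix η' id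
  have hX : P' * X = Φ * P := by
    have h1 : (P' * X).submatrix η' id = (Φ * P).submatrix η' id := by
      rw [hsub, mul_nonsing_inv_cancel_left _ _ hu]
    have h2 := congr_arg (fun W => W.submatrix η'.symm id) h1
    simpa [submatrix_submatrix] using h2
  have hXe : X = fromCols X.toCols₁ X.toCols₂ := (fromCols_toCols X).symm
  rw [hXe, mul_fromCols, hP, mul_fromCols] at hX
  have h1 := congr_arg toCols₁ hX
  have h2 := congr_arg toCols₂ hX
  rw [toCols₁_fromCols, toCols₁_fromCols] at h1
  rw [toCols₂_fromCols, toCols₂_fromCols, hΦ] at h2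
  have h3 : X.toCols₂ = fromRows 0 A := by
    refine hinj _ _ ?_
    rw [h2, hP', fromCols_mul_fromRows, Matrix.mul_zero, zero_add]
  have h4 : P' * X.toCols₁ = (1 : Matrix Z Z E).submatrix id (η' ∘ Sum.inl) * X.toCols₁.toRows₁ +
      B' * X.toCols₁.toRows₂ := by
    conv_lhs => rw [← fromRows_toRows X.toCols₁, hP', fromCols_mul_fromRows]
  have h5 : X = fromBlocks X.toCols₁.toRows₁ 0 X.toCols₁.toRows₂ A := by
    conv_lhs => rw [hXe, h3, ← fromRows_toRows X.toCols₁]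
    exact fromCols_fromRows_eq_fromBlocks _ _ _ _
  let ee : J ⊕ Λ ≃ J' ⊕ Λ := Equiv.sumCongr e (Equiv.refl Λ)
  have h6 : (P'.submatrix η' id).submatrix ee ee * X.submatrix ee id =
      Φ.submatrix (ee.trans η') η * P.submatrix η id := by
    have h7 : P'.submatrix η' id * X = Φ.submatrix η' id * P := by
      rw [← hsub, ← hsub, hXe, mul_fromCols, hX, hP, mul_fromCols]
    have h8 := congr_arg (fun W => W.submatrix ee id) h7
    have h9 : (P'.submatrix η' id * X).submatrix ee id =
        (P'.submatrix η' id).submatrix ee ee * X.submatrix ee id :=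
      (submatrix_mul_equiv _ _ _ ee _).symm
    have h10 : (Φ.submatrix η' id * P).submatrix ee id =
        Φ.submatrix (ee.trans η') η * P.submatrix η id := by
      refine Eq.trans ?_ (submatrix_mul_equiv _ _ _ η _).symm
      rfl
    exact h9.symm.trans (h8.trans h10)
  have h11 : (X.submatrix ee id).det = (X.toCols₁.toRows₁.submatrix e id).det * A.det := by
    have : X.submatrix ee id = fromBlocks (X.toCols₁.toRows₁.submatrix e id) 0
        X.toCols₁.toRows₂ A := by
      conv_lhs => rw [h5]
      ext x y
      rcases x with x | x <;> rcases y with y | y <;> simp [ee]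
    rw [this, det_fromBlocks_zero₁₂]
  let perm : Equiv.Perm Z := η.symm.trans (ee.trans η')
  have h12 : (Φ.submatrix (ee.trans η') η).det = ((Equiv.Perm.sign perm : ℤ) : E) * Φ.det := by
    have : Φ.submatrix (ee.trans η') η = (Φ.submatrix perm id).submatrix η η := by
      ext x y
      simp [perm]
    rw [this, det_submatrix_equiv_self, det_permute]
  refine ⟨X.toCols₁.toRows₁, X.toCols₁.toRows₂, Equiv.Perm.sign perm, h1.symm.trans h4, ?_⟩
  have h13 := congr_arg det h6
  rw [det_mul, det_mul, det_submatrix_equiv_self, h11, h12, hdet, hdet'] at h13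
  rw [← h13]
  ring

namespace QuiverRep

open Quiver Matrix

section Conj

variable {ι : Type} [DecidableEq ι] {p q : ι → ℕ} {E : Type} [CommRing E]

/-- The matrix of the linear map `Y ↦ (L i * Y i * R i)` on families of matrices. -/
def sandwich (L : ∀ i, Matrix (Fin (p i)) (Fin (p i)) E)
    (R : ∀ i, Matrix (Fin (q i)) (Fin (q i)) E) :
    Matrix (Σ i, Fin (p i) × Fin (q i)) (Σ i, Fin (p i) × Fin (q i)) E :=
  blockDiagonal' fun i => kroneckerMap (· * ·) (L i) (R i)ᵀ

variable [Fintype ι]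

lemma sandwich_mulVec (L : ∀ i, Matrix (Fin (p i)) (Fin (p i)) E)
    (R : ∀ i, Matrix (Fin (q i)) (Fin (q i)) E) (Y : (Σ i, Fin (p i) × Fin (q i)) → E) (i : ι)
    (r : Fin (p i)) (c : Fin (q i)) : (sandwich L R *ᵥ Y) ⟨i, r, c⟩ =
      (L i * Matrix.of (fun x y => Y ⟨i, x, y⟩) * R i) r c := by
  rw [mulVec, dotProduct, Fintype.sum_sigma, Finset.sum_eq_single i]
  · simp only [sandwich, blockDiagonal'_apply_eq, Fintype.sum_prod_type, kroneckerMap_apply,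
      transpose_apply, Matrix.mul_apply, of_apply, Finset.sum_mul]
    rw [Finset.sum_comm]
    exact Finset.sum_congr rfl fun _ _ => Finset.sum_congr rfl fun _ _ => by ring
  · intro j _ hj
    exact Finset.sum_eq_zero fun x _ => by
      rw [sandwich, blockDiagonal'_apply_ne _ _ _ hj.symm, zero_mul]
  · simp

lemma det_sandwich (L : ∀ i, Matrix (Fin (p i)) (Fin (p i)) E)
    (R : ∀ i, Matrix (Fin (q i)) (Fin (q i)) E) :
    (sandwich L R).det = ∏ i, ((L i).det ^ q i * (R i).det ^ p i) := by
  let e := Fintype.equivFin ι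
  let b : (Σ i, Fin (p i) × Fin (q i)) → Fin (Fintype.card ι) := fun x => e x.1
  have hb : BlockTriangular (sandwich L R) b := by
    rintro ⟨i, x⟩ ⟨j, y⟩ h
    refine blockDiagonal'_apply_ne _ _ _ ?_
    rintro rfl
    exact lt_irrefl _ h
  rw [hb.det_fintype, ← e.prod_comp]
  refine Finset.prod_congr rfl fun i _ => ?_
  let f : Fin (p i) × Fin (q i) → {x // b x = e i} := fun x => ⟨⟨i, x⟩, rfl⟩
  have hf : Function.Bijective f := by
    constructor
    · intro x y h
      have h1 := congr_arg Subtype.val h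
      exact eq_of_heq (Sigma.mk.inj h1).2
    · rintro ⟨⟨j, y⟩, hy⟩
      have : j = i := e.injective hy
      subst this
      exact ⟨y, rfl⟩
  rw [← det_submatrix_equiv_self (Equiv.ofBijective f hf)]
  have : ((sandwich L R).toSquareBlock b (e i)).submatrix (Equiv.ofBijective f hf)
      (Equiv.ofBijective f hf) = kroneckerMap (· * ·) (L i) (R i)ᵀ := by
    ext x y
    exact blockDiagonal'_apply_eq (fun i => kroneckerMap (· * ·) (L i) (R i)ᵀ) i x y
  rw [this, det_kronecker, det_transpose, Fintype.card_fin, Fintype.card_fin]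

end Conj

variable {V : Type} [Quiver.{0} V] {d : V → ℕ} {o : V}

/-- The edges of a quiver, as a type. -/
abbrev EdgeType (V : Type) [Quiver.{0} V] : Type := Σ i : V, Σ j : V, (i ⟶ j)

variable (d) in
/-- The coordinates of representations, grouped by edges. -/
def coordEquiv : Coord d ≃ Σ x : EdgeType V, Fin (d x.2.1) × Fin (d x.1) where
  toFun z := ⟨⟨z.src, z.tgt, z.edge⟩, z.row, z.col⟩
  invFun x := ⟨x.1.1, x.1.2.1, x.1.2.2, x.2.1, x.2.2⟩
  left_inv _ := rfl
  right_inv _ := rfl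

variable (d o) in
/-- The entries of the matrices in the Lie algebra of the group, without the factor of `o`. -/
abbrev LieCoord : Type := Σ i : {i : V // i ≠ o}, Fin (d i) × Fin (d i)

variable {E : Type} [CommRing E]

open Classical in
/-- An element of the Lie algebra as a family of matrices, with the matrix zero at `o`. -/
def lieMat (θ : LieCoord d o → E) (i : V) : Matrix (Fin (d i)) (Fin (d i)) E :=
  Matrix.of fun x y => if h : i ≠ o then θ ⟨⟨i, h⟩, x, y⟩ else 0

omit [Quiver V] in
lemma lieMat_of_ne (θ : LieCoord d o → E) {i : V} (h : i ≠ o) :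
    lieMat θ i = Matrix.of fun x y => θ ⟨⟨i, h⟩, x, y⟩ := by
  ext x y
  simp [lieMat, h]

omit [Quiver V] in
lemma lieMat_o (θ : LieCoord d o → E) : lieMat θ o = 0 := by
  ext x y
  simp [lieMat]

/-- The infinitesimal action of the Lie algebra at a representation. -/
def bracket (v : Coord d → E) : (LieCoord d o → E) →ₗ[E] (Coord d → E) where
  toFun θ z := (mat v z.edge * lieMat θ z.src - lieMat θ z.tgt * mat v z.edge) z.row z.col
  map_add' θ θ' := by
    have h : ∀ i, lieMat (θ + θ') i = lieMat θ i + lieMat θ' i := by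
      intro i; ext x y; simp only [lieMat, of_apply, Matrix.add_apply, Pi.add_apply]
      split <;> simp
    funext z
    simp only [h, Matrix.mul_add, Matrix.add_mul, Matrix.add_apply, Matrix.sub_apply, Pi.add_apply]
    ring
  map_smul' c θ := by
    have h : ∀ i, lieMat (c • θ) i = c • lieMat θ i := by
      intro i; ext x y; simp only [lieMat, of_apply, Matrix.smul_apply, Pi.smul_apply]
      split <;> simp
    funext z
    simp only [h, Matrix.mul_smul, Matrix.smul_mul, Matrix.sub_apply, Matrix.smul_apply,
      Pi.smul_apply, smul_sub, RingHom.id_apply]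

namespace Words

variable {S : Words d o}

lemma IsTree.exists_parent (hS : S.IsTree) (x : LieCoord d o) :
    ∃ (j : V) (e : j ⟶ x.1.1) (l : Fin (d j)), S.path x.1 x.2.2 = (S.path j l).cons e := by
  obtain ⟨⟨i, hi⟩, r, k⟩ := x
  cases h : S.path i k with
  | nil => exact absurd rfl hi
  | cons p e =>
    obtain ⟨l, hl⟩ := hS.prefix_mem p e k h
    exact ⟨_, e, l, by rw [hl]⟩

/-- The entries of the edges of the tree: the last edge of the path that belongs to the column
index of `x`, in the row of `x`. -/
def treeCoord (hS : S.IsTree) (x : LieCoord d o) : Coord d where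
  src := (hS.exists_parent x).choose
  tgt := x.1
  edge := (hS.exists_parent x).choose_spec.choose
  row := x.2.1
  col := (hS.exists_parent x).choose_spec.choose_spec.choose

lemma ext_treeCoord (hS : S.IsTree) (x : LieCoord d o) :
    S.ext (treeCoord hS x) = S.path x.1 x.2.2 :=
  (hS.exists_parent x).choose_spec.choose_spec.choose_spec.symm

lemma treeCoord_injective (hS : S.IsTree) : Function.Injective (treeCoord hS) := by
  intro x y h
  have key : ∀ z z' : Coord d, z = z' → ∀ i j (k : Fin (d i)) (l : Fin (d j)) (hi : z.tgt = i)
      (hj : z'.tgt = j), hi ▸ S.ext z = S.path i k → hj ▸ S.ext z' = S.path j l →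
      (⟨i, hi ▸ z.row, k⟩ : Σ i, Fin (d i) × Fin (d i)) = ⟨j, hj ▸ z'.row, l⟩ := by
    rintro z _ rfl i j k l rfl rfl hk hl
    rw [hS.injective _ (hk.symm.trans hl)]
  have h1 := key _ _ h x.1 y.1 x.2.2 y.2.2 rfl rfl (ext_treeCoord hS x) (ext_treeCoord hS y)
  obtain ⟨⟨i, hi⟩, r, k⟩ := x
  obtain ⟨⟨j, hj⟩, r', k'⟩ := y
  obtain ⟨h2, h3⟩ := Sigma.mk.inj h1
  have h4 : i = j := h2
  subst h4
  rw [heq_iff_eq] at h3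
  exact congr_arg (Sigma.mk _) h3

lemma exists_treeCoord (hS : S.IsTree) {z : Coord d} {k} (h : S.path z.tgt k = S.ext z) :
    ∃ x, treeCoord hS x = z := by
  have hz : z.tgt ≠ o := by
    intro ho
    have key : ∀ {i : V} (k : Fin (d i)), i = o → ∀ {j} (p : Path o j) (e : j ⟶ i),
        S.path i k ≠ p.cons e := by
      rintro i k rfl j p e h
      rw [S.path_o] at h
      cases h
    exact key k ho _ _ h
  refine ⟨⟨⟨z.tgt, hz⟩, z.row, k⟩, ?_⟩
  have key : ∀ z z' : Coord d, ∀ ht : z.tgt = z'.tgt, ht ▸ z.row = z'.row →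
      ht ▸ S.ext z = S.ext z' → z = z' := by
    rintro ⟨i, j, e, r, c⟩ ⟨i', j', e', r', c'⟩ ht hr hp
    change j = j' at ht
    subst ht
    change r = r' at hr
    subst hr
    change (S.path i c).cons e = (S.path i' c').cons e' at hp
    obtain ⟨h1, h2⟩ := Path.cons.inj hp
    subst h1
    rw [heq_iff_eq, heq_iff_eq] at h2
    obtain ⟨h2, rfl⟩ := h2
    rw [hS.injective _ h2]
  exact key _ _ rfl rfl ((ext_treeCoord hS ⟨⟨z.tgt, hz⟩, z.row, k⟩).trans h)

/-- The coordinates of representations are the coordinates on the slice of a tree and the entries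
of the edges of the tree. -/
def coordSplit (hS : S.IsTree) : S.FreeCoord ⊕ LieCoord d o ≃ Coord d :=
  Equiv.ofBijective (Sum.elim Subtype.val (treeCoord hS)) (by
    constructor
    · refine Function.Injective.sumElim Subtype.val_injective (treeCoord_injective hS) ?_
      rintro ⟨z, hz⟩ x rfl
      exact hz _ (ext_treeCoord hS x).symm
    · intro z
      by_cases h : ∀ k, S.path z.tgt k ≠ S.ext z
      · exact ⟨.inl ⟨z, h⟩, rfl⟩
      · push Not at h
        obtain ⟨k, hk⟩ := h
        obtain ⟨x, hx⟩ := exists_treeCoord hS hk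
        exact ⟨.inr x, hx⟩)

/-- The infinitesimal action is unipotent in the entries of the edges of the tree at points of the
slice, by induction on the lengths of the paths. -/
lemma det_bracket_tree [DecidableEq V] [Fintype V] (hS : S.IsTree) : ∃ u : ℤˣ, ∀ v : Coord d → E,
    (∀ x : LieCoord d o, v (treeCoord hS x) = if x.2.1 = x.2.2 then 1 else 0) →
    ((LinearMap.toMatrix' (bracket (o := o) v)).submatrix (treeCoord hS) id).det =
      ((u : ℤ) : E) := by
  let b : LieCoord d o → ℕᵒᵈ := fun x => OrderDual.toDual (S.path x.1 x.2.2).length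
  refine ⟨∏ a ∈ Finset.univ.image b, (-1) ^ Fintype.card {x // b x = a}, fun v hv => ?_⟩
  -- the column of the entry `x` of a tree edge is a standard basis vector, so that the entry of
  -- `bracket v θ` there is `-θ x` and terms `θ y` with shorter paths
  have hentry : ∀ x y : LieCoord d o, ¬ (b y > b x) →
      LinearMap.toMatrix' (bracket (o := o) v) (treeCoord hS x) y = if x = y then -1 else 0 := by
    intro x y hxy
    rw [LinearMap.toMatrix'_apply]
    have h1 : ∀ k : Fin (d x.1), mat v (j := x.1) (treeCoord hS x).edge k (treeCoord hS x).col =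
        if k = x.2.2 then 1 else 0 := fun k => hv ⟨x.1, k, x.2.2⟩
    have h2 : ∀ k, lieMat (Pi.single y (1 : E)) (treeCoord hS x).src k (treeCoord hS x).col = 0 := by
      intro k
      by_cases hs : (treeCoord hS x).src = o
      · simp [lieMat, hs]
      · rw [lieMat_of_ne _ hs, of_apply, Pi.single_apply, if_neg]
        rintro rfl
        refine hxy (OrderDual.toDual_lt_toDual.mpr ?_)
        rw [← ext_treeCoord hS x]
        exact Nat.lt_succ_self _
    have h3 : ∀ k : Fin (d x.1), lieMat (Pi.single y (1 : E)) x.1 x.2.1 k =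
        if (⟨x.1, x.2.1, k⟩ : LieCoord d o) = y then 1 else 0 := by
      intro k
      rw [lieMat_of_ne _ x.1.2, of_apply, Pi.single_apply]
    have h4 : bracket v (Pi.single y (1 : E)) (treeCoord hS x) =
        (mat v (treeCoord hS x).edge * lieMat (Pi.single y (1 : E)) (treeCoord hS x).src)
          (treeCoord hS x).row (treeCoord hS x).col -
        (lieMat (Pi.single y (1 : E)) x.1 * mat v (j := x.1) (treeCoord hS x).edge)
          x.2.1 (treeCoord hS x).col := rfl
    rw [h4, Matrix.mul_apply, Matrix.mul_apply]
    simp only [h1, h2, h3, mul_zero, Finset.sum_const_zero, zero_sub, mul_ite, mul_one]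
    rw [Finset.sum_ite_eq' Finset.univ x.2.2, if_pos (Finset.mem_univ _)]
    split <;> simp
  have htri : BlockTriangular ((LinearMap.toMatrix' (bracket (o := o) v)).submatrix
      (treeCoord hS) id) b := by
    intro x y hxy
    rw [submatrix_apply, id, hentry x y (not_lt.mpr hxy.le), if_neg]
    rintro rfl
    exact lt_irrefl _ hxy
  rw [htri.det]
  push_cast
  refine Finset.prod_congr rfl fun a _ => ?_
  have : ((LinearMap.toMatrix' (bracket (o := o) v)).submatrix (treeCoord hS) id).toSquareBlock b a
      = -1 := by
    ext ⟨x, hx⟩ ⟨y, hy⟩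
    refine (hentry x y (by rw [hx, hy]; exact lt_irrefl _)).trans ?_
    rw [Matrix.neg_apply, one_apply]
    simp only [Subtype.mk.injEq]
    split <;> simp
  rw [this, det_neg, det_one, mul_one]

end Words

end QuiverRep

namespace QuiverRep

open Quiver Matrix

variable {V : Type} [Quiver.{0} V] {d : V → ℕ} {o : V} {E : Type} [Field E]

section Adjoint

variable (h : ∀ i, Matrix (Fin (d i)) (Fin (d i)) E)

open Classical in
/-- The matrix of the action of invertible matrices on representations. -/
def gaugeMatrix [Fintype V] [Fintype (EdgeType V)] : Matrix (Coord d) (Coord d) E :=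
  (sandwich (p := fun x : EdgeType V => d x.2.1) (q := fun x => d x.1)
    (fun x => (h x.2.1)⁻¹) fun x => h x.1).submatrix (coordEquiv d) (coordEquiv d)

lemma gaugeMatrix_mulVec [Fintype V] [Fintype (EdgeType V)] [Fintype (Coord d)]
    (Y : Coord d → E) (z : Coord d) :
    (gaugeMatrix h *ᵥ Y) z = ((h z.tgt)⁻¹ * mat Y z.edge * h z.src) z.row z.col := by
  classical
  refine (congr_fun (submatrix_mulVec_equiv (sandwich (p := fun x : EdgeType V => d x.2.1)
    (q := fun x => d x.1) (fun x => (h x.2.1)⁻¹) fun x => h x.1) Y (coordEquiv d) (coordEquiv d))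
    z).trans ?_
  exact sandwich_mulVec (p := fun x : EdgeType V => d x.2.1) (q := fun x => d x.1)
    (fun x => (h x.2.1)⁻¹) (fun x => h x.1) (Y ∘ (coordEquiv d).symm)
    (⟨z.src, z.tgt, z.edge⟩ : EdgeType V) z.row z.col

lemma det_gaugeMatrix [Fintype V] [Fintype (EdgeType V)] [Fintype (Coord d)]
    [DecidableEq (Coord d)] : (gaugeMatrix h).det =
      ∏ x : EdgeType V, ((h x.2.1).det⁻¹ ^ d x.1 * (h x.1).det ^ d x.2.1) := by
  classical
  rw [gaugeMatrix, det_submatrix_equiv_self, det_sandwich]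
  simp only [det_nonsing_inv, Ring.inverse_eq_inv']

open Classical in
variable (o) in
/-- The matrix of the adjoint action of invertible matrices on the Lie algebra. -/
def adjointMatrix [Fintype V] : Matrix (LieCoord d o) (LieCoord d o) E :=
  sandwich (fun i : {i // i ≠ o} => (h i)⁻¹) fun i => h i

omit [Quiver V] in
lemma lieMat_adjointMatrix [Fintype V] [Fintype (LieCoord d o)] (θ : LieCoord d o → E) (i : V) :
    lieMat (adjointMatrix o h *ᵥ θ) i = (h i)⁻¹ * lieMat θ i * h i := by
  classical
  by_cases hi : i = o
  · subst hi
    rw [lieMat_o, lieMat_o, Matrix.mul_zero, Matrix.zero_mul]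
  · ext r c
    rw [lieMat_of_ne _ hi, lieMat_of_ne _ hi, of_apply]
    convert sandwich_mulVec (fun i : {i // i ≠ o} => (h i)⁻¹) (fun i => h i) θ ⟨i, hi⟩ r c
    rw [adjointMatrix]

omit [Quiver V] in
lemma det_adjointMatrix [Fintype V] [Fintype (LieCoord d o)] [DecidableEq (LieCoord d o)]
    (hdet : ∀ i, IsUnit (h i).det) : (adjointMatrix o h).det = 1 := by
  classical
  have := det_sandwich (fun i : {i // i ≠ o} => (h i)⁻¹) fun i => h i
  rw [adjointMatrix]
  convert this
  refine (Finset.prod_eq_one fun i _ => ?_).symm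
  rw [← mul_pow, ← det_mul, nonsing_inv_mul _ (hdet i), det_one, one_pow]

variable {h} in
/-- The infinitesimal action is equivariant. -/
lemma gaugeMatrix_bracket [Fintype V] [Fintype (EdgeType V)] [Fintype (Coord d)]
    [Fintype (LieCoord d o)] {y y' : Coord d → E} (hdet : ∀ i, IsUnit (h i).det)
    (hy : ∀ z, y' z = ((h z.tgt)⁻¹ * mat y z.edge * h z.src) z.row z.col)
    (θ : LieCoord d o → E) :
    gaugeMatrix h *ᵥ bracket y θ = bracket y' (adjointMatrix o h *ᵥ θ) := by
  funext z
  have h1 : mat y' z.edge = (h z.tgt)⁻¹ * mat y z.edge * h z.src := by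
    ext r c
    exact hy ⟨z.src, z.tgt, z.edge, r, c⟩
  have h2 : mat (bracket y θ) z.edge =
      mat y z.edge * lieMat θ z.src - lieMat θ z.tgt * mat y z.edge := rfl
  have h3 : bracket y' (adjointMatrix o h *ᵥ θ) z =
      (mat y' z.edge * lieMat (adjointMatrix o h *ᵥ θ) z.src -
        lieMat (adjointMatrix o h *ᵥ θ) z.tgt * mat y' z.edge) z.row z.col := rfl
  rw [gaugeMatrix_mulVec, h2, h3, h1, lieMat_adjointMatrix, lieMat_adjointMatrix]
  simp only [Matrix.mul_sub, Matrix.sub_mul, Matrix.mul_assoc,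
    mul_nonsing_inv_cancel_left _ _ (hdet _)]

end Adjoint

variable [Algebra ℂ E]

lemma derivation_mul (D : Derivation ℂ E E) {l m n : Type} [Fintype m] (A : Matrix l m E)
    (B : Matrix m n E) : (A * B).map D = A.map D * B + A * B.map D := by
  ext i j
  simp only [Matrix.map_apply, Matrix.mul_apply, map_sum, Derivation.leibniz, smul_eq_mul,
    Matrix.add_apply, ← Finset.sum_add_distrib]
  exact Finset.sum_congr rfl fun _ _ => by ring

/-- The derivative of a representation in a moving basis: the action on the derivative corrected
by the infinitesimal action of the logarithmic derivative of the basis. -/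
lemma derivation_gauge [Fintype V] [Fintype (EdgeType V)] [Fintype (Coord d)]
    [Fintype (LieCoord d o)]
    {h : ∀ i, Matrix (Fin (d i)) (Fin (d i)) E} {y y' : Coord d → E}
    (hdet : ∀ i, IsUnit (h i).det) (ho : h o = 1)
    (hy : ∀ z, y' z = ((h z.tgt)⁻¹ * mat y z.edge * h z.src) z.row z.col)
    (D : Derivation ℂ E E) : ∃ θ : LieCoord d o → E,
      D ∘ y' = gaugeMatrix h *ᵥ (D ∘ y + bracket y θ) := by
  let T : ∀ i, Matrix (Fin (d i)) (Fin (d i)) E := fun i => (h i).map D * (h i)⁻¹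
  have hTo : T o = 0 := by
    have : (h o).map D = 0 := by
      rw [ho]
      ext i j
      rw [Matrix.map_apply, one_apply]
      split <;> simp
    simp [T, this]
  let θ : LieCoord d o → E := fun x => T x.1 x.2.1 x.2.2
  have hθ : ∀ i, lieMat θ i = T i := by
    intro i
    by_cases hi : i = o
    · subst hi; rw [lieMat_o, hTo]
    · rw [lieMat_of_ne _ hi]; rfl
  refine ⟨θ, ?_⟩
  funext z
  have h1 : mat y' z.edge = (h z.tgt)⁻¹ * mat y z.edge * h z.src := by
    ext r c
    exact hy ⟨z.src, z.tgt, z.edge, r, c⟩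
  have h2 : h z.tgt * mat y' z.edge = mat y z.edge * h z.src := by
    rw [h1, Matrix.mul_assoc, mul_nonsing_inv_cancel_left _ _ (hdet _)]
  have h3 := congr_arg (fun M => M.map D) h2
  simp only [derivation_mul] at h3
  have h4 : (mat y' z.edge).map D = (h z.tgt)⁻¹ *
      ((mat y z.edge).map D * h z.src + mat y z.edge * (h z.src).map D -
        (h z.tgt).map D * mat y' z.edge) := by
    rw [← h3, add_sub_cancel_left, nonsing_inv_mul_cancel_left _ _ (hdet _)]
  have h5 : mat (D ∘ y + bracket y θ) z.edge = (mat y z.edge).map D +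
      (mat y z.edge * lieMat θ z.src - lieMat θ z.tgt * mat y z.edge) := rfl
  rw [gaugeMatrix_mulVec, h5, hθ, hθ]
  refine (congr_fun (congr_fun h4 z.row) z.col).trans ?_
  simp only [T, h1, Matrix.mul_add, Matrix.add_mul, Matrix.mul_sub, Matrix.sub_mul,
    Matrix.mul_assoc, nonsing_inv_mul _ (hdet _), Matrix.mul_one, add_sub_assoc]

open Classical in
/-- The Jacobian of the transition between the slices of two trees is the determinant of the
action on all representations, up to sign. -/
lemma exists_jacobian_slices [Fintype V] [Fintype (EdgeType V)] {S S' : Words d o} (hS : S.IsTree)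
    (hS' : S'.IsTree) [Fintype S.FreeCoord] [DecidableEq S.FreeCoord]
    {h : ∀ i, Matrix (Fin (d i)) (Fin (d i)) E} {y y' : Coord d → E}
    (hdet : ∀ i, IsUnit (h i).det) (ho : h o = 1)
    (hyy : ∀ z, y' z = ((h z.tgt)⁻¹ * mat y z.edge * h z.src) z.row z.col)
    (hy : ∀ x, y (Words.treeCoord hS x) = if x.2.1 = x.2.2 then 1 else 0)
    (hy' : ∀ x, y' (Words.treeCoord hS' x) = if x.2.1 = x.2.2 then 1 else 0) :
    ∃ (e : S.FreeCoord ≃ S'.FreeCoord) (A : Matrix S.FreeCoord S.FreeCoord E) (u : ℤˣ),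
      (∀ (D : Derivation ℂ E E) (j), D (y' (e j).1) = ∑ i, A j i * D (y i.1)) ∧
      A.det = ((u : ℤ) : E) *
        ∏ x : EdgeType V, ((h x.2.1).det⁻¹ ^ d x.1 * (h x.1).det ^ d x.2.1) := by
  have : ∀ i j : V, Finite (i ⟶ j) := fun i j =>
    Finite.of_injective (fun e => (⟨i, j, e⟩ : EdgeType V)) fun e e' he => by
      simpa using he
  have := Fintype.ofFinite (Coord d)
  have : Finite S'.FreeCoord := Subtype.finite
  have := Fintype.ofFinite S'.FreeCoord
  have hcard : Fintype.card S.FreeCoord = Fintype.card S'.FreeCoord := by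
    have := Fintype.card_congr ((Words.coordSplit hS).trans (Words.coordSplit hS').symm)
    rw [Fintype.card_sum, Fintype.card_sum] at this
    omega
  let e : S.FreeCoord ≃ S'.FreeCoord := Fintype.equivOfCardEq hcard
  obtain ⟨u, hu⟩ := Words.det_bracket_tree (E := E) hS
  obtain ⟨u', hu'⟩ := Words.det_bracket_tree (E := E) hS'
  have hunit : ∀ u : ℤˣ, ((u : ℤ) : E) * ((u : ℤ) : E) = 1 := fun u => by
    rw [← Int.cast_mul, ← Units.val_mul, Int.units_mul_self]; simp
  set B := LinearMap.toMatrix' (bracket (o := o) y) with hB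
  set B' := LinearMap.toMatrix' (bracket (o := o) y') with hB'
  have hBv : ∀ θ, B *ᵥ θ = bracket y θ := LinearMap.toMatrix'_mulVec _
  have hBv' : ∀ θ, B' *ᵥ θ = bracket y' θ := LinearMap.toMatrix'_mulVec _
  have hN : (B.submatrix (Words.coordSplit hS ∘ Sum.inr) id).det = ((u : ℤ) : E) := hu y hy
  have hN' : (B'.submatrix (Words.coordSplit hS' ∘ Sum.inr) id).det = ((u' : ℤ) : E) := hu' y' hy'
  have hN0 : (B'.submatrix (Words.coordSplit hS' ∘ Sum.inr) id).det ≠ 0 := by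
    rw [hN']
    exact left_ne_zero_of_mul_eq_one (hunit u')
  have hΦ : gaugeMatrix h * B = B' * adjointMatrix o h := by
    refine ext_of_mulVec_single fun i => ?_
    rw [← mulVec_mulVec, ← mulVec_mulVec, hBv, hBv', gaugeMatrix_bracket hdet hyy]
  -- `M` is the action of `h` on representations modulo the tangent spaces of the orbits
  obtain ⟨M, K, s, hM, hMdet⟩ := exists_compare_complements (gaugeMatrix h) B B'
    (adjointMatrix o h) (Words.coordSplit hS) (Words.coordSplit hS') e hΦ hN0
  refine ⟨e, M.submatrix e id, s * u * u', fun D j => ?_, ?_⟩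
  · obtain ⟨θ, hθ⟩ := derivation_gauge hdet ho hyy D
    have hconst : ∀ c : Prop, ∀ [Decidable c], D (if c then (1 : E) else 0) = 0 := by
      intro c _
      split <;> simp
    have h1 : ∀ {S : Words d o} (hS : S.IsTree) [Fintype S.FreeCoord] (y : Coord d → E),
        (∀ x, y (Words.treeCoord hS x) = if x.2.1 = x.2.2 then 1 else 0) →
        D ∘ y = (1 : Matrix (Coord d) (Coord d) E).submatrix id
          (Words.coordSplit hS ∘ Sum.inl) *ᵥ fun i => D (y i.1) := by
      intro S hS _ y hy
      funext z
      obtain ⟨x, rfl⟩ := (Words.coordSplit hS).surjective z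
      simp only [mulVec, dotProduct, submatrix_apply, id, one_apply, Function.comp,
        EmbeddingLike.apply_eq_iff_eq]
      rcases x with x | x
      · simp only [Sum.inl.injEq, ite_mul, one_mul, zero_mul, Finset.sum_ite_eq,
          Finset.mem_univ, if_true]
        rfl
      · simp only [reduceCtorEq, if_false, zero_mul, Finset.sum_const_zero]
        exact (congr_arg D (hy x)).trans (hconst _)
    have h2 := h1 hS y hy
    have h3 := h1 hS' y' hy'
    set Dy : S.FreeCoord → E := fun i => D (y i.1)
    set Dy' : S'.FreeCoord → E := fun i => D (y' i.1)
    rw [h3, h2, mulVec_add, mulVec_mulVec, hM, gaugeMatrix_bracket hdet hyy, ← hBv', add_mulVec,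
      ← mulVec_mulVec, ← mulVec_mulVec, add_assoc, ← mulVec_add] at hθ
    have hinr : ∀ w : S'.FreeCoord → E, ∀ x, ((1 : Matrix (Coord d) (Coord d) E).submatrix id
        (Words.coordSplit hS' ∘ Sum.inl) *ᵥ w) (Words.coordSplit hS' (Sum.inr x)) = 0 := by
      intro w x
      simp [mulVec, dotProduct, one_apply]
    -- the tree entries of `y'` are constant, which determines the infinitesimal correction `θ`
    have h4 : K *ᵥ Dy + adjointMatrix o h *ᵥ θ = 0 := by
      refine eq_zero_of_mulVec_eq_zero hN0 ?_
      funext x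
      have := congr_fun hθ (Words.coordSplit hS' (Sum.inr x))
      rw [hinr, Pi.add_apply, hinr, zero_add] at this
      exact this.symm
    rw [h4, mulVec_zero, add_zero] at hθ
    have h5 := congr_fun hθ (Words.coordSplit hS' (Sum.inl (e j)))
    have hinl : ∀ w : S'.FreeCoord → E, ∀ x, ((1 : Matrix (Coord d) (Coord d) E).submatrix id
        (Words.coordSplit hS' ∘ Sum.inl) *ᵥ w) (Words.coordSplit hS' (Sum.inl x)) = w x := by
      intro w x
      simp [mulVec, dotProduct, one_apply]
    rw [hinl, hinl] at h5
    exact h5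
  · rw [det_adjointMatrix h hdet, hN, hN', mul_one] at hMdet
    rw [← det_gaugeMatrix]
    have h1 := hunit u'
    push_cast
    calc _ = (M.submatrix e id).det * (((u' : ℤ) : E) * ((u' : ℤ) : E)) := by rw [h1, mul_one]
      _ = _ := by rw [← mul_assoc, hMdet]; ring

omit [Algebra ℂ E] in
/-- The exponent of a vertex is the number of outgoing minus the number of incoming arrows, counted
with the dimensions at their other ends. -/
lemma prod_edges [Fintype V] [inst : Fintype (EdgeType V)] [∀ i j : V, Finite (i ⟶ j)] {δ : V → E}
    (hδ : ∀ i, δ i ≠ 0) (hδo : δ o = 1) {k : V → ℕ} {ε : ℤ}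
    (hflow : ∀ i ≠ o, ∑ j, (d j * Nat.card (i ⟶ j) : ℤ) - ∑ j, (d j * Nat.card (j ⟶ i) : ℤ) =
      ε * k i) :
    ∏ x : EdgeType V, ((δ x.2.1)⁻¹ ^ d x.1 * δ x.1 ^ d x.2.1) = (∏ i, δ i ^ k i) ^ ε := by
  classical
  have := fun i j : V => Fintype.ofFinite (i ⟶ j)
  have h1 : ∏ x : EdgeType V, ((δ x.2.1)⁻¹ ^ d x.1 * δ x.1 ^ d x.2.1) =
      ∏ i, ∏ j, ((δ j)⁻¹ ^ d i * δ i ^ d j) ^ Nat.card (i ⟶ j) := by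
    rw [show inst = Sigma.instFintype from Subsingleton.elim _ _, Fintype.prod_sigma]
    refine Finset.prod_congr rfl fun i _ => ?_
    rw [Fintype.prod_sigma]
    refine Finset.prod_congr rfl fun j _ => ?_
    refine (Finset.prod_const ((δ j)⁻¹ ^ d i * δ i ^ d j)).trans ?_
    rw [Nat.card_eq_fintype_card, Finset.card_univ]
  rw [h1]
  simp only [mul_pow, Finset.prod_mul_distrib]
  rw [Finset.prod_comm, ← Finset.prod_mul_distrib, ← Finset.prod_zpow]
  refine Finset.prod_congr rfl fun i _ => ?_
  by_cases hi : i = o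
  · subst hi
    simp [hδo]
  · rw [← zpow_natCast (δ i) (k i), ← _root_.zpow_mul, mul_comm, mul_comm (k i : ℤ), ← hflow i hi,
      zpow_sub₀ (hδ i), div_eq_mul_inv]
    congr 1
    · simp only [← pow_mul]
      rw [Finset.prod_pow_eq_pow_sum, ← zpow_natCast]
      push_cast
      rfl
    · simp only [← pow_mul]
      rw [Finset.prod_pow_eq_pow_sum, inv_pow, ← zpow_natCast]
      push_cast
      rfl

lemma map_prod_det_frame [Fintype V] {J : Type} (x : Coord d → MvPolynomial J ℂ)
    (β : MvPolynomial J ℂ →ₐ[ℂ] E) (S : Words d o) (k : V → ℕ) :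
    β (MvPolynomial.aeval x (∏ i, (S.frame (generic d) i).det ^ k i)) =
      ∏ i, (S.frame (β ∘ x) i).det ^ k i := by
  have h1 : ∀ i, β (MvPolynomial.aeval x (S.frame (generic d) i).det) =
      (S.frame (β ∘ x) i).det := by
    intro i
    let φ : RepRing d →+* E := β.toRingHom.comp (MvPolynomial.aeval x : RepRing d →ₐ[ℂ] _).toRingHom
    have h2 : φ ∘ generic d = β ∘ x := by
      funext z
      exact congr_arg β (MvPolynomial.aeval_X x z)
    have h3 := S.frame_map φ (generic d) i
    rw [h2] at h3
    rw [h3]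
    exact RingHom.map_det φ _
  simp only [map_prod, map_pow, h1]

section Weight

variable [Fintype V] [DecidableEq V] [∀ i j : V, Finite (i ⟶ j)] (hd : d o = 1)
  {n : ℕ} {w : Fin (n + 1) → Option (Words d o)}

/-- The determinants of frames, with multiplicities that are given by the difference of the numbers
of outgoing and incoming arrows, are semi-invariants that compute the Jacobians. -/
def jacobianWeight {hw : ∀ S : Words d o, S.discr (generic d) ∈
      Submodule.span (fixedBy (actRing (m := d))) (Set.range (listDiscr w))}
    {hcover : ∀ S : Words d o, ∀ v : Rep d, S.discr v ≠ 0 → ∃ k S', w k = some S' ∧ S'.IsTree ∧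
      S'.discr v ≠ 0} {k : V → ℕ} {ε : ℤ} (hk : ∀ i ≠ o, 0 < k i)
    (hflow : ∀ i ≠ o, ∑ j, (d j * Nat.card (i ⟶ j) : ℤ) - ∑ j, (d j * Nat.card (j ⟶ i) : ℤ) =
      ε * k i) : ChartSystem.JacobianWeight (slices hd w hw hcover) ε where
  Ψ t := ∏ i, (t.1.2.frame (generic d) i).det ^ k i
  χ g := ∏ i, ((g o).val.det ^ d i * (g i).val.det⁻¹) ^ k i
  ρ_Ψ g t := by
    refine MvPolynomial.funext fun v => ?_
    simp only [eval_actRing, map_mul, map_prod, map_pow, eval_det_frame, MvPolynomial.eval_C,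
      det_frame_act hd, ← Finset.prod_mul_distrib, mul_pow]
  sec_Ψ t := by
    have h : ∀ i, MvPolynomial.aeval t.1.2.sliceRep (t.1.2.frame (generic d) i).det = 1 := by
      intro i
      have := t.1.2.frame_map
        (MvPolynomial.aeval t.1.2.sliceRep : RepRing d →ₐ[ℂ] _).toRingHom (generic d) i
      rw [aeval_comp_generic, t.2.2.frame_sliceRep hd] at this
      have h2 := congr_arg det this
      rw [det_one] at h2
      refine Eq.trans ?_ h2.symm
      exact RingHom.map_det _ _
    refine (map_prod (MvPolynomial.aeval t.1.2.sliceRep : RepRing d →ₐ[ℂ] _) _ _).trans (Finset.prod_eq_one fun i _ => ?_)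
    rw [map_pow, h, one_pow]
  eval_ne_zero_iff t v := by
    simp only [slices, charts, listDiscr, t.2.1, Option.elim_some, map_prod, map_pow,
      eval_det_frame, Words.discr, Finset.prod_ne_zero_iff]
    refine forall_congr' fun i => imp_congr_right fun _ => ?_
    by_cases hi : i = o
    · subst hi
      simp [t.1.2.det_frame_o hd]
    · rw [Ne, pow_eq_zero_iff (hk i hi).ne']
  exists_jacobian E _ _ t t' iF iD α α' hrel hne := by
    classical
    let : Fintype t.1.2.FreeCoord := iF
    let : DecidableEq t.1.2.FreeCoord := iD
    have := fun i j : V => Fintype.ofFinite (i ⟶ j)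
    have hS := t.2.2
    have hS' := t'.2.2
    let y : Coord d → E := α ∘ t.1.2.sliceRep
    let y' : Coord d → E := α' ∘ t'.1.2.sliceRep
    -- the change of basis to the normal form for the second tree
    let h : ∀ i, Matrix (Fin (d i)) (Fin (d i)) E := t'.1.2.frame y
    have hF : α (MvPolynomial.aeval t.1.2.sliceRep (listDiscr w t'.1.1)) = t'.1.2.discr y := by
      simp only [listDiscr, t'.2.1, Option.elim_some]
      rw [aeval_discr]
      exact (t'.1.2.discr_map α.toRingHom _).symm
    have he : ∀ z, α (MvPolynomial.aeval t.1.2.sliceRep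
        ((w t'.1.1).elim 0 fun S => S.num (generic d) z)) = t'.1.2.num y z := by
      intro z
      simp only [t'.2.1, Option.elim_some]
      rw [aeval_num]
      exact (t'.1.2.num_map α.toRingHom _ _).symm
    change α (MvPolynomial.aeval t.1.2.sliceRep (listDiscr w t'.1.1)) ≠ 0 at hne
    change ∀ z, α' (MvPolynomial.aeval t'.1.2.sliceRep (MvPolynomial.X z)) *
      α (MvPolynomial.aeval t.1.2.sliceRep (listDiscr w t'.1.1)) =
        α (MvPolynomial.aeval t.1.2.sliceRep
        ((w t'.1.1).elim 0 fun S => S.num (generic d) z)) at hrel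
    rw [hF] at hne
    have hdet : ∀ i, (h i).det ≠ 0 := fun i =>
      Finset.prod_ne_zero_iff.mp hne i (Finset.mem_univ i)
    have hyy : ∀ z, y' z = ((h z.tgt)⁻¹ * mat y z.edge * h z.src) z.row z.col := by
      intro z
      have h1 := hrel z
      rw [hF, he, MvPolynomial.aeval_X, t'.1.2.num_eq y z (isUnit_iff_ne_zero.mpr (hdet _))] at h1
      exact mul_right_cancel₀ hne h1
    have htree : ∀ {S : Words d o} (hS : S.IsTree) (β : MvPolynomial S.FreeCoord ℂ →ₐ[ℂ] E)
        (x : LieCoord d o), β (S.sliceRep (Words.treeCoord hS x)) =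
          if x.2.1 = x.2.2 then 1 else 0 := by
      intro S hS β x
      have h2 : S.path x.1 x.2.2 = S.ext (Words.treeCoord hS x) := (Words.ext_treeCoord hS x).symm
      have h1 := S.sliceRep_of_eq (z := Words.treeCoord hS x) (k := x.2.2) h2
      rw [h1]
      have h3 : (S.path (Words.treeCoord hS x).tgt (Words.treeCoord hS x).row =
          S.ext (Words.treeCoord hS x)) ↔ x.2.1 = x.2.2 := by
        rw [← h2]
        exact (hS.injective _).eq_iff
      simp only [h3]
      split <;> simp
    obtain ⟨e, A, u, hA, hAdet⟩ := exists_jacobian_slices hS hS'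
      (fun i => isUnit_iff_ne_zero.mpr (hdet i)) (t'.1.2.frame_o hd y) hyy (htree hS α)
      (htree hS' α')
    refine ⟨e, A, ((u : ℤ) : ℂ), by simp, fun D j => ?_, ?_⟩
    · have h1 : ∀ {S : Words d o} (β : MvPolynomial S.FreeCoord ℂ →ₐ[ℂ] E) (i : S.FreeCoord),
          β (MvPolynomial.X i) = β (S.sliceRep i.1) := fun β i => by rw [Words.sliceRep_free]
      refine (congr_arg D (h1 α' (e j))).trans ((hA D j).trans (Finset.sum_congr rfl fun i _ => ?_))
      exact congr_arg (A j i * D ·) (h1 α i).symm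
    · have h2 : α (MvPolynomial.aeval t.1.2.sliceRep
          (∏ i, (t'.1.2.frame (generic d) i).det ^ k i)) = ∏ i, (h i).det ^ k i :=
        map_prod_det_frame _ α _ _
      refine hAdet.trans ?_
      rw [map_intCast]
      refine congr_arg (((u : ℤ) : E) * ·) ?_
      refine (prod_edges (o := o) (k := k) (ε := ε) hdet (t'.1.2.det_frame_o hd y) hflow).trans ?_
      exact congr_arg (· ^ ε) h2.symm

end Weight

end QuiverRep

/-! ### Degeneration of representations that are not generated -/

namespace QuiverRep

open Quiver Matrix

variable {V : Type} [Quiver.{0} V] {d : V → ℕ} {o : V}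

/-- Families of endomorphisms of the spaces at the vertices. -/
abbrev EndFamily (d : V → ℕ) : Type := ∀ i, Matrix (Fin (d i)) (Fin (d i)) ℂ

/-- The bimodule structure of the space of representations over the families of endomorphisms. -/
def part (a : EndFamily d) (v : Rep d) (b : EndFamily d) : Rep d := fun z =>
  (a z.tgt * mat v z.edge * b z.src) z.row z.col

lemma mat_part (a : EndFamily d) (v : Rep d) (b : EndFamily d) {i j : V} (e : i ⟶ j) :
    mat (part a v b) e = a j * mat v e * b i := rfl

lemma mat_ext {v w : Rep d} (h : ∀ (i j : V) (e : i ⟶ j), mat v e = mat w e) : v = w := by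
  funext z
  exact congr_fun (congr_fun (h z.src z.tgt z.edge) z.row) z.col

lemma mat_add (v w : Rep d) {i j : V} (e : i ⟶ j) : mat (v + w) e = mat v e + mat w e := rfl

lemma mat_sub (v w : Rep d) {i j : V} (e : i ⟶ j) : mat (v - w) e = mat v e - mat w e := rfl

lemma mat_smul (c : ℂ) (v : Rep d) {i j : V} (e : i ⟶ j) : mat (c • v) e = c • mat v e := rfl

lemma mat_zero {i j : V} (e : i ⟶ j) : mat (0 : Rep d) e = 0 := rfl

lemma part_part (a a' : EndFamily d) (v : Rep d) (b b' : EndFamily d) :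
    part a (part a' v b') b = part (a * a') v (b' * b) := by
  refine mat_ext fun i j e => ?_
  simp only [mat_part, Pi.mul_apply, Matrix.mul_assoc]

lemma part_add (a : EndFamily d) (v w : Rep d) (b : EndFamily d) :
    part a (v + w) b = part a v b + part a w b := by
  refine mat_ext fun i j e => ?_
  simp only [mat_part, mat_add, Matrix.mul_add, Matrix.add_mul]

lemma part_sub (a : EndFamily d) (v w : Rep d) (b : EndFamily d) :
    part a (v - w) b = part a v b - part a w b := by
  refine mat_ext fun i j e => ?_
  simp only [mat_part, mat_sub, Matrix.mul_sub, Matrix.sub_mul]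

lemma part_smul (a : EndFamily d) (c : ℂ) (v : Rep d) (b : EndFamily d) :
    part a (c • v) b = c • part a v b := by
  refine mat_ext fun i j e => ?_
  simp only [mat_part, mat_smul, Matrix.mul_smul, Matrix.smul_mul]

lemma add_part (a a' : EndFamily d) (v : Rep d) (b : EndFamily d) :
    part (a + a') v b = part a v b + part a' v b := by
  refine mat_ext fun i j e => ?_
  simp only [mat_part, mat_add, Pi.add_apply, Matrix.add_mul]

lemma sub_part (a a' : EndFamily d) (v : Rep d) (b : EndFamily d) :
    part (a - a') v b = part a v b - part a' v b := by
  refine mat_ext fun i j e => ?_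
  simp only [mat_part, mat_sub, Pi.sub_apply, Matrix.sub_mul]

lemma part_add' (a : EndFamily d) (v : Rep d) (b b' : EndFamily d) :
    part a v (b + b') = part a v b + part a v b' := by
  refine mat_ext fun i j e => ?_
  simp only [mat_part, mat_add, Pi.add_apply, Matrix.mul_add]

lemma smul_part (c : ℂ) (a : EndFamily d) (v : Rep d) (b : EndFamily d) :
    part (c • a) v b = c • part a v b := by
  refine mat_ext fun i j e => ?_
  simp only [mat_part, mat_smul, Pi.smul_apply, Matrix.smul_mul]

lemma part_smul' (c : ℂ) (a : EndFamily d) (v : Rep d) (b : EndFamily d) :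
    part a v (c • b) = c • part a v b := by
  refine mat_ext fun i j e => ?_
  simp only [mat_part, mat_smul, Pi.smul_apply, Matrix.mul_smul]

lemma part_zero (v : Rep d) (b : EndFamily d) : part 0 v b = 0 := by
  refine mat_ext fun i j e => ?_
  simp only [mat_part, mat_zero, Pi.zero_apply, Matrix.zero_mul]

lemma part_zero' (a : EndFamily d) (v : Rep d) : part a v 0 = 0 := by
  refine mat_ext fun i j e => ?_
  simp only [mat_part, mat_zero, Pi.zero_apply, Matrix.mul_zero]

lemma part_one (v : Rep d) : part 1 v 1 = v := by
  refine mat_ext fun i j e => ?_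
  simp only [mat_part, Pi.one_apply, Matrix.one_mul, Matrix.mul_one]

lemma bracket_eq_part (v : Rep d) (θ : LieCoord d o → ℂ) :
    bracket v θ = part 1 v (lieMat θ) - part (lieMat θ) v 1 := by
  refine mat_ext fun i j e => ?_
  rw [mat_sub, mat_part, mat_part, Pi.one_apply, Pi.one_apply, Matrix.one_mul, Matrix.mul_one]
  rfl

/-- The associated graded representation of `v` for the images of the idempotents `e`. -/
def graded (e : EndFamily d) (v : Rep d) : Rep d := part e v e + part (1 - e) v (1 - e)

section Idempotent

variable {e : EndFamily d} (he : e * e = e)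

include he

omit [Quiver V] in
lemma idem_compl : e * (1 - e) = 0 ∧ (1 - e) * e = 0 ∧ (1 - e) * (1 - e) = 1 - e := by
  refine ⟨by rw [mul_sub, he, mul_one, sub_self], by rw [sub_mul, he, one_mul, sub_self], ?_⟩
  rw [mul_sub, mul_one, sub_mul, one_mul, he, sub_self, sub_zero]

/-- The one parameter group that contracts a representation to its associated graded
representation, and stretches the entries that it kills. -/
lemma exists_act_eq (v : Rep d) (n : Rep d) (hv : part (1 - e) v e = 0) (t : ℂ) (ht : t ≠ 0) :
    ∃ g : GaugeGroup d, act g v = graded e v + t • part e v (1 - e) ∧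
      act g (graded e v + t • part (1 - e) n e) = graded e v + part (1 - e) n e := by
  obtain ⟨h1, h2, h3⟩ := idem_compl he
  set f : EndFamily d := 1 - e with hf
  have hef : e + f = 1 := by rw [hf, add_sub_cancel]
  have key : ∀ s : ℂ, s ≠ 0 → (e + s • f) * (e + s⁻¹ • f) = 1 := by
    intro s hs
    rw [add_mul, mul_add, mul_add, he, mul_smul_comm, smul_mul_assoc, smul_mul_smul_comm, h1, h2,
      h3, mul_inv_cancel₀ hs, smul_zero, smul_zero, one_smul, add_zero, zero_add, hef]
  have key' := key t⁻¹ (inv_ne_zero ht)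
  rw [inv_inv] at key'
  let g : GaugeGroup d := fun i => ⟨(e + t • f) i, (e + t⁻¹ • f) i, congr_fun (key t ht) i,
    congr_fun key' i⟩
  have hg : ∀ w, act g w = part (e + t⁻¹ • f) w (e + t • f) := fun w => rfl
  have hexp : ∀ w, act g w = part e w e + part f w f + t • part e w f + t⁻¹ • part f w e := by
    intro w
    rw [hg, add_part, part_add', part_add', smul_part, smul_part, part_smul', part_smul',
      smul_smul, inv_mul_cancel₀ ht, one_smul]
    abel
  refine ⟨g, ?_, ?_⟩
  · rw [hexp, hv, smul_zero, add_zero, graded]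
  · rw [hexp, graded]
    simp only [← hf, part_add, part_smul, part_part, he, h1, h2, h3, part_zero, part_zero', smul_zero,
      add_zero, zero_add, smul_smul, inv_mul_cancel₀ ht, one_smul]

/-- Semi-invariants that do not vanish extend along the contraction to the associated graded
representation, and bound the others. -/
lemma eval_graded_add {p q : RepRing d} {c : GaugeGroup d → ℂ}
    (hp : ∀ g v, MvPolynomial.eval (act g v) p = c g * MvPolynomial.eval v p)
    (hq : ∀ g v, MvPolynomial.eval (act g v) q = c g * MvPolynomial.eval v q) {v : Rep d}
    (hv : part (1 - e) v e = 0) (hpv : MvPolynomial.eval v p ≠ 0)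
    (hqv : MvPolynomial.eval v q = 0) (n : Rep d) :
    MvPolynomial.eval (graded e v + part (1 - e) n e) q = 0 := by
  have hcont : ∀ (r : RepRing d) (x y : Rep d),
      Continuous fun t : ℂ => MvPolynomial.eval (x + t • y) r := by
    intro r x y
    refine MvPolynomial.continuous_eval r |>.comp ?_
    exact continuous_pi fun z => by
      simp only [Pi.add_apply, Pi.smul_apply, smul_eq_mul]
      fun_prop
  have hlim : ∀ f₁ f₂ : ℂ → ℂ, Continuous f₁ → Continuous f₂ → (∀ t ≠ 0, f₁ t = f₂ t) →
      f₁ 0 = f₂ 0 := by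
    intro f₁ f₂ h₁ h₂ h
    have := h₁.ext_on (dense_compl_singleton (0 : ℂ)) h₂ fun t ht => h t ht
    exact congr_fun this 0
  -- let `t` tend to zero, first along the contraction of `v`, then in `p (v) q (g • x) = p (g • v) q (x)`,
  -- which holds since `p` and `q` have the same weight
  have h1 : MvPolynomial.eval (graded e v) q = 0 := by
    have := hlim (fun t => MvPolynomial.eval (graded e v + t • part e v (1 - e)) q) (fun _ => 0)
      (hcont _ _ _) continuous_const fun t ht => by
        obtain ⟨g, hg, -⟩ := exists_act_eq he v n hv t ht
        rw [← hg, hq, hqv, mul_zero]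
    simpa using this
  have h2 := hlim (fun t => MvPolynomial.eval v p *
      MvPolynomial.eval (graded e v + part (1 - e) n e) q)
    (fun t => MvPolynomial.eval (graded e v + t • part e v (1 - e)) p *
      MvPolynomial.eval (graded e v + t • part (1 - e) n e) q)
    continuous_const ((hcont _ _ _).mul (hcont _ _ _)) fun t ht => by
      obtain ⟨g, hg, hg'⟩ := exists_act_eq he v n hv t ht
      rw [← hg, ← hg', hp, hq]
      ring
  simp only [zero_smul, add_zero, h1, mul_zero] at h2
  exact (mul_eq_zero.mp h2).resolve_left hpv

end Idempotent

end QuiverRep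

namespace QuiverRep

open Quiver Matrix

variable {V : Type} [Quiver.{0} V] {d : V → ℕ} {o : V}

/-- A representation with a proper invariant subspace that is the range of a conjugate of an
idempotent, trivial at `o`, is not generated by `o`. -/
lemma not_isGenerated_conj {e a b : EndFamily d} (he : e * e = e) (heo : e o = 1) (hao : a o = 1)
    (he1 : e ≠ 1) (hba : b * a = 1) {x : Rep d} (hx : part (1 - e) x e = 0) :
    ¬ IsGenerated o (part a x b) := by
  intro hgen
  let X : SubRep (part a x b) :=
    { space := fun i => LinearMap.range ((a * e) i).mulVecLin
      map_mem := by
        rintro i j ε _ ⟨y, rfl⟩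
        refine ⟨(mat x ε * e i) *ᵥ y, ?_⟩
        have h1 : mat x ε * e i = e j * mat x ε * e i := by
          have h2 : (1 - e) j * mat x ε * e i = 0 := congr_arg (fun w => mat w ε) hx
          rw [Pi.sub_apply, Pi.one_apply, Matrix.sub_mul, Matrix.sub_mul, Matrix.one_mul,
            sub_eq_zero] at h2
          exact h2
        have h3 : ∀ i, b i * a i = 1 := fun i => congr_fun hba i
        have h4 : ∀ i, e i * e i = e i := fun i => congr_fun he i
        change (a j * e j) *ᵥ ((mat x ε * e i) *ᵥ y) =
          (a j * mat x ε * b i) *ᵥ ((a i * e i) *ᵥ y)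
        rw [mulVec_mulVec, mulVec_mulVec]
        congr 1
        rw [Matrix.mul_assoc (a j * mat x ε), ← Matrix.mul_assoc (b i), h3, Matrix.one_mul,
          Matrix.mul_assoc (a j), Matrix.mul_assoc (a j), h1, Matrix.mul_assoc (e j),
          ← Matrix.mul_assoc (e j) (e j), h4] }
  have hXo : X.space o = ⊤ := by
    change LinearMap.range ((a * e) o).mulVecLin = ⊤
    rw [Pi.mul_apply, heo, hao, mul_one, mulVecLin_one, LinearMap.range_id]
  refine he1 (funext fun i => ?_)
  have hi := LinearMap.range_eq_top.mp (hgen X hXo i)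
  have hu : IsUnit ((a * e) i) := mulVec_surjective_iff_isUnit.mp hi
  have h3 : b i * a i = 1 := congr_fun hba i
  have h4 : e i * e i = e i := congr_fun he i
  have hb : IsUnit (b i) := ⟨⟨b i, a i, h3, mul_eq_one_comm.mp h3⟩, rfl⟩
  have hu2 : IsUnit (e i) := by
    have := hb.mul hu
    rwa [Pi.mul_apply, ← mul_assoc, h3, one_mul] at this
  exact hu2.mul_left_cancel (h4.trans (mul_one _).symm)

section Dominant

variable [Fintype V] [∀ i j : V, Finite (i ⟶ j)]

/-- If the infinitesimal action maps onto the entries outside of an invariant subspace, then the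
representations that have a conjugate invariant subspace form a neighbourhood, so that the
representations that are generated by `o` are not dense. -/
lemma discr_eq_zero_of_bracket {e : EndFamily d} (he : e * e = e) (heo : e o = 1) (he1 : e ≠ 1)
    (v : Rep d) (hv : part (1 - e) v e = 0)
    (hsurj : ∀ n : Rep d, ∃ θ : LieCoord d o → ℂ, (lieMat θ : EndFamily d) = (1 - e) * lieMat θ * e ∧
      part (1 - e) n e = bracket v θ) (S : Words d o) : S.discr (generic d) = 0 := by
  classical
  have := Fintype.ofFinite (Coord d)
  obtain ⟨h1, h2, h3⟩ := idem_compl he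
  set f : EndFamily d := 1 - e with hf
  -- conjugates by `1 + Θ` of the representations with the given invariant subspace; `Φ` is a submersion
  -- at `(0, v)`, so that its range has interior points
  let Θ : (LieCoord d o → ℂ) → EndFamily d := fun θ => f * lieMat θ * e
  let Φ : (LieCoord d o → ℂ) × Rep d → Rep d := fun p =>
    part (1 - Θ p.1) (p.2 - part f p.2 e) (1 + Θ p.1)
  have hΘ : ∀ θ, Θ θ * Θ θ = 0 := fun θ => by
    have : Θ θ * Θ θ = f * lieMat θ * (e * f) * (lieMat θ * e) := by simp only [Θ, mul_assoc]
    rw [this, h1, mul_zero, zero_mul]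
  have hlin : ∀ i j k, ContDiff ℂ 1 fun p : (LieCoord d o → ℂ) × Rep d => lieMat p.1 i j k := by
    intro i j k
    by_cases hi : i = o
    · simp only [lieMat, hi, ne_eq, not_true_eq_false, dite_false, of_apply]
      exact contDiff_const
    · simp only [lieMat, hi, ne_eq, not_false_eq_true, dite_true, of_apply]
      fun_prop
  have hsm : ContDiff ℂ 1 Φ := by
    refine contDiff_pi.mpr fun z => ?_
    have hmat : ∀ {i j : V} (ε : i ⟶ j) r c, ContDiff ℂ 1
        fun p : (LieCoord d o → ℂ) × Rep d => mat p.2 ε r c := by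
      intro i j ε r c
      simp only [mat, of_apply]
      fun_prop
    simp only [Φ, part, Θ, Matrix.mul_apply, Pi.sub_apply, Pi.add_apply, Pi.one_apply,
      Matrix.sub_apply, Matrix.add_apply, mat_sub, mat_part, Pi.mul_apply]
    fun_prop
  have hstrict := hsm.contDiffAt.hasStrictFDerivAt (x := (0, v)) one_ne_zero
  -- `Φ` is a polynomial of degree three along a line, with the given linear term
  have hder : ∀ θ x, fderiv ℂ Φ (0, v) (θ, x) =
      x - part f x e + (part 1 v (Θ θ) - part (Θ θ) v 1) := by
    intro θ x
    have hline : HasDerivAt (fun t : ℂ => ((0, v) : (LieCoord d o → ℂ) × Rep d) + t • (θ, x))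
        (θ, x) 0 := by
      simpa using (((hasDerivAt_id (0 : ℂ)).smul_const (θ, x)).const_add
        ((0, v) : (LieCoord d o → ℂ) × Rep d))
    have hc := (hstrict.hasFDerivAt.comp_hasDerivAt_of_eq (0 : ℂ) hline (by simp))
    set x' := x - part f x e
    set Z := Θ θ
    have hexp : (Φ ∘ fun t : ℂ => ((0, v) : (LieCoord d o → ℂ) × Rep d) + t • (θ, x)) =
        fun t => v + (t • (x' + (part 1 v Z - part Z v 1)) +
          (t ^ 2 • (part 1 x' Z - part Z x' 1 - part Z v Z) - t ^ 3 • part Z x' Z)) := by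
      funext t
      have hΘt : Θ (((0, v) : (LieCoord d o → ℂ) × Rep d) + t • (θ, x)).1 = t • Z := by
        have : (lieMat (t • θ) : EndFamily d) = t • lieMat θ := by
          funext i
          ext r c
          simp only [lieMat, Pi.smul_apply, Matrix.smul_apply, of_apply]
          split <;> simp
        simp only [Prod.fst_add, Prod.smul_fst, zero_add, Θ, Z, this, mul_smul_comm,
          smul_mul_assoc]
      have hxt : (((0, v) : (LieCoord d o → ℂ) × Rep d) + t • (θ, x)).2 -
          part f (((0, v) : (LieCoord d o → ℂ) × Rep d) + t • (θ, x)).2 e = v + t • x' := by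
        simp only [Prod.snd_add, Prod.smul_snd, part_add, part_smul, hv, x', smul_sub]
        abel
      change part (1 - Θ _) _ (1 + Θ _) = _
      rw [hΘt, hxt]
      simp only [sub_part, part_add', part_add, part_smul, smul_part, part_smul', part_one]
      simp only [smul_add, smul_sub, smul_smul, pow_succ, pow_zero, one_mul, mul_assoc]
      abel
    rw [hexp] at hc
    have hid := hasDerivAt_id (0 : ℂ)
    have hd2 : HasDerivAt (fun t => v + (t • (x' + (part 1 v Z - part Z v 1)) +
          (t ^ 2 • (part 1 x' Z - part Z x' 1 - part Z v Z) - t ^ 3 • part Z x' Z)))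
        (x' + (part 1 v Z - part Z v 1)) (0 : ℂ) := by
      have h4 := ((hid.smul_const (x' + (part 1 v Z - part Z v 1))).add
        (((hasDerivAt_pow 2 (0 : ℂ)).smul_const (part 1 x' Z - part Z x' 1 - part Z v Z)).sub
          ((hasDerivAt_pow 3 (0 : ℂ)).smul_const (part Z x' Z)))).const_add v
      simpa using h4
    exact hc.unique hd2
  have hrange : (fderiv ℂ Φ (0, v)).range = ⊤ := by
    rw [LinearMap.range_eq_top]
    intro y
    obtain ⟨θ, hθ, hn⟩ := hsurj y
    refine ⟨(θ, y), ?_⟩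
    have h4 : Θ θ = lieMat θ := hθ.symm
    refine (hder θ y).trans ?_
    rw [h4, ← bracket_eq_part, ← hn, sub_add_cancel]
  have hopen := hstrict.map_nhds_eq_of_surj hrange
  have hmem : Set.range Φ ∈ nhds (Φ (0, v)) := by
    rw [← hopen]
    exact Filter.mem_map.mpr (Filter.univ_mem' fun p => ⟨p, rfl⟩)
  obtain ⟨ε, hε, hball⟩ := Metric.mem_nhds_iff.mp hmem
  rw [ball_pi _ hε] at hball
  refine MvPolynomial.funext_set (fun z => Metric.ball (Φ (0, v) z) ε) (fun z => ?_) fun y hy => ?_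
  · exact infinite_of_mem_nhds _ (Metric.ball_mem_nhds _ hε)
  · obtain ⟨p, rfl⟩ := hball hy
    rw [map_zero, eval_discr]
    by_contra hne
    have hb : (1 + Θ p.1) * (1 - Θ p.1) = 1 := by
      rw [mul_sub, add_mul, add_mul, hΘ]; simp
    refine not_isGenerated_conj he heo ?_ he1 hb ?_ (isGenerated_of_discr S hne)
    · have hfo : f o = 0 := by rw [hf, Pi.sub_apply, heo, Pi.one_apply, sub_self]
      simp [Θ, hfo]
    · rw [part_sub, part_part, ← hf, h3, he, sub_self]

end Dominant

end QuiverRep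

namespace QuiverRep

open Quiver Matrix

variable {V : Type} [Quiver.{0} V] {d : V → ℕ} {o : V}

variable (o) in
/-- The spaces of the subrepresentation that is generated by the vector `(1, …, 1)` at `o`. -/
def gen (v : Rep d) (i : V) : Submodule ℂ (Fin (d i) → ℂ) :=
  Submodule.span ℂ (Set.range fun p : Path o i => word v p)

lemma gen_map_mem (v : Rep d) {i j : V} (ε : i ⟶ j) {x} (hx : x ∈ gen o v i) :
    mat v ε *ᵥ x ∈ gen o v j := by
  have : gen o v i ≤ (gen o v j).comap (mat v ε).mulVecLin := by
    refine Submodule.span_le.mpr ?_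
    rintro _ ⟨p, rfl⟩
    exact Submodule.subset_span ⟨p.cons ε, rfl⟩
  exact this hx

lemma gen_o (ho : d o = 1) (v : Rep d) : gen o v o = ⊤ := by
  rw [eq_top_iff]
  intro x _
  have hs : Subsingleton (Fin (d o)) := by rw [ho]; infer_instance
  have h2 : x = x ⟨0, by omega⟩ • word v (.nil : Path o o) := by
    funext k
    rw [Subsingleton.elim k ⟨0, by omega⟩]
    simp [word]
  rw [h2]
  exact Submodule.smul_mem _ _ (Submodule.subset_span ⟨_, rfl⟩)

lemma isGenerated_of_gen {v : Rep d} (h : ∀ i, gen o v i = ⊤) : IsGenerated o v := by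
  intro X hX i
  rw [eq_top_iff, ← h i]
  refine Submodule.span_le.mpr ?_
  rintro _ ⟨p, rfl⟩
  exact X.word_mem hX p

/-- The dimensions of the generated subrepresentation are lower semicontinuous. -/
lemma exists_poly_finrank_gen [Fintype V] (v₁ : Rep d) : ∃ P : RepRing d,
    MvPolynomial.eval v₁ P ≠ 0 ∧ ∀ v, MvPolynomial.eval v P ≠ 0 → ∀ i,
      Module.finrank ℂ (gen o v₁ i) ≤ Module.finrank ℂ (gen o v i) := by
  have key : ∀ i, ∃ P : RepRing d, MvPolynomial.eval v₁ P ≠ 0 ∧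
      ∀ v, MvPolynomial.eval v P ≠ 0 →
        Module.finrank ℂ (gen o v₁ i) ≤ Module.finrank ℂ (gen o v i) := by
    intro i
    obtain ⟨f, hf, -, hli⟩ := Submodule.exists_fun_fin_finrank_span_eq ℂ
      (Set.range fun p : Path o i => word v₁ p)
    choose p hp using hf
    let W : ∀ {E : Type} [CommRing E], (Coord d → E) → Matrix (Fin (d i)) (Fin _) E :=
      fun v => Matrix.of fun r k => word v (p k) r
    have hW : (W v₁).col = f := funext fun k => hp k
    have hinj : Function.Injective (W v₁).mulVec := by
      rw [mulVec_injective_iff, hW]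
      exact hli
    -- a left inverse `L` of the matrix of a basis of words at `v₁`; the words stay independent where the
    -- determinant of `L * W` does not vanish
    obtain ⟨g, hg⟩ := (W v₁).mulVecLin.exists_leftInverse_of_injective
      (LinearMap.ker_eq_bot.mpr hinj)
    let L : Matrix (Fin _) (Fin (d i)) ℂ := LinearMap.toMatrix' g
    let L' : Matrix (Fin _) (Fin (d i)) (RepRing d) := L.map MvPolynomial.C
    let M : Matrix (Fin _) (Fin _) (RepRing d) := L' * W (generic d)
    have hL : L * W v₁ = 1 := by
      have := congr_arg LinearMap.toMatrix' hg
      rw [LinearMap.toMatrix'_comp, LinearMap.toMatrix'_id, ← toLin'_apply',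
        LinearMap.toMatrix'_toLin'] at this
      exact this
    have heval : ∀ v : Rep d, MvPolynomial.eval v M.det =
        (L * W v).det := by
      intro v
      rw [RingHom.map_det, RingHom.mapMatrix_apply, Matrix.map_mul]
      congr 2
      · ext a b; simp [L']
      · ext a b; simp [W, eval_word]
    refine ⟨M.det, ?_, fun v hv => ?_⟩
    · rw [heval, hL, det_one]
      exact one_ne_zero
    · rw [heval] at hv
      have h1 : Function.Injective (W v).mulVec := by
        intro x y hxy
        have h2 : (L * W v) *ᵥ x = (L * W v) *ᵥ y := by
          rw [← mulVec_mulVec, ← mulVec_mulVec]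
          exact congr_arg (L *ᵥ ·) hxy
        exact mulVec_injective_of_isUnit ((isUnit_iff_isUnit_det _).mpr
          (isUnit_iff_ne_zero.mpr hv)) h2
      have h2 : LinearIndependent ℂ fun k => word v (p k) := mulVec_injective_iff.mp h1
      have h3 : LinearIndependent ℂ fun k => (⟨word v (p k), Submodule.subset_span ⟨p k, rfl⟩⟩ :
          gen o v i) := LinearIndependent.of_comp (gen o v i).subtype h2
      have h4 := h3.fintype_card_le_finrank
      rw [Fintype.card_fin] at h4
      exact h4
  choose P hP hP' using key
  refine ⟨∏ i, P i, ?_, fun v hv i => hP' i v ?_⟩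
  · rw [map_prod]
    exact Finset.prod_ne_zero_iff.mpr fun i _ => hP i
  · rw [map_prod] at hv
    exact Finset.prod_ne_zero_iff.mp hv i (Finset.mem_univ i)

/-- Projections onto the spaces of the generated subrepresentation. -/
lemma exists_idem_gen (ho : d o = 1) (v : Rep d) : ∃ e : EndFamily d, e * e = e ∧ e o = 1 ∧
    (∀ i x, e i *ᵥ x ∈ gen o v i) ∧ (∀ i, ∀ x ∈ gen o v i, e i *ᵥ x = x) ∧
    part (1 - e) v e = 0 := by
  have key : ∀ i, ∃ E : Matrix (Fin (d i)) (Fin (d i)) ℂ, (∀ x, E *ᵥ x ∈ gen o v i) ∧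
      ∀ x ∈ gen o v i, E *ᵥ x = x := by
    intro i
    obtain ⟨π, hπ⟩ := (gen o v i).subtype.exists_leftInverse_of_injective
      (Submodule.ker_subtype _)
    refine ⟨LinearMap.toMatrix' ((gen o v i).subtype ∘ₗ π), fun x => ?_, fun x hx => ?_⟩
    · rw [LinearMap.toMatrix'_mulVec]
      exact (π x).2
    · rw [LinearMap.toMatrix'_mulVec]
      exact congr_arg Subtype.val (LinearMap.congr_fun hπ ⟨x, hx⟩)
  choose e he he' using key
  have hext : ∀ {m n : ℕ} (A B : Matrix (Fin m) (Fin n) ℂ), (∀ x, A *ᵥ x = B *ᵥ x) → A = B :=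
    fun A B h => ext_of_mulVec_single fun i => h _
  refine ⟨e, ?_, ?_, he, he', ?_⟩
  · refine funext fun i => hext _ _ fun x => ?_
    rw [Pi.mul_apply, ← mulVec_mulVec, he' i _ (he i x)]
  · refine hext _ _ fun x => ?_
    rw [he' o x (by rw [gen_o ho]; trivial), one_mulVec]
  · refine mat_ext fun i j ε => hext _ _ fun x => ?_
    rw [mat_part, mat_zero, zero_mulVec, ← mulVec_mulVec, ← mulVec_mulVec, Pi.sub_apply,
      Pi.one_apply, sub_mulVec, one_mulVec, he' j _ (gen_map_mem v ε (he i x)), sub_self]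

/-- A representation with the same generated dimensions as its contraction is a conjugate of the
associated graded representation, at first order. -/
lemma exists_bracket_eq [Fintype V] {v : Rep d} {e : EndFamily d} (he : e * e = e)
    (heo : e o = 1) (hmem : ∀ i x, e i *ᵥ x ∈ gen o v i) (hid : ∀ i, ∀ x ∈ gen o v i, e i *ᵥ x = x)
    (n : Rep d)
    (hmax : ∑ i, Module.finrank ℂ (gen o (graded e v + part (1 - e) n e) i) ≤
      ∑ i, Module.finrank ℂ (gen o v i)) :
    ∃ θ : LieCoord d o → ℂ, (lieMat θ : EndFamily d) = (1 - e) * lieMat θ * e ∧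
      part (1 - e) n e = bracket (graded e v) θ := by
  obtain ⟨h1, h2, h3⟩ := idem_compl he
  set f : EndFamily d := 1 - e with hf
  set v' := graded e v + part f n e with hv'
  have he1 : ∀ i, e i * e i = e i := fun i => congr_fun he i
  have hef : ∀ i, e i * f i = 0 := fun i => congr_fun h1 i
  have hff : ∀ i, f i * f i = f i := fun i => congr_fun h3 i
  have hfe : ∀ i, f i * e i = 0 := fun i => congr_fun h2 i
  have hmat : ∀ {i j : V} (ε : i ⟶ j), mat v' ε =
      e j * mat v ε * e i + f j * mat v ε * f i + f j * mat n ε * e i := fun ε => rfl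
  have hev : ∀ {i j : V} (ε : i ⟶ j), e j * mat v' ε = e j * mat v ε * e i := by
    intro i j ε
    simp only [hmat, Matrix.mul_add, ← Matrix.mul_assoc, he1, hef, Matrix.zero_mul, add_zero]
  -- the projection `e` maps the generated spaces of `v'` onto those of `v`, so that they are graphs
  -- over these by the dimensions
  have hword : ∀ {i : V} (p : Path o i), e i *ᵥ word v' p = word v p := by
    intro i p
    induction p with
    | nil => rw [heo, one_mulVec]; rfl
    | @cons i j p ε ih =>
      have hp : word v p ∈ gen o v i := Submodule.subset_span ⟨p, rfl⟩
      rw [word_cons, word_cons, mulVec_mulVec, hev, Matrix.mul_assoc, ← mulVec_mulVec,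
        ← mulVec_mulVec, ih, hid j _ (gen_map_mem v ε hp)]
  have hmap : ∀ i, (gen o v' i).map (e i).mulVecLin = gen o v i := by
    intro i
    rw [gen, gen, Submodule.map_span, ← Set.range_comp]
    congr 2
    funext p
    exact hword p
  have hle : ∀ i, Module.finrank ℂ (gen o v i) ≤ Module.finrank ℂ (gen o v' i) := fun i => by
    rw [← hmap i]
    exact Submodule.finrank_map_le _ _
  have heq : ∀ i, Module.finrank ℂ (gen o v i) = Module.finrank ℂ (gen o v' i) := fun i =>
    (Finset.sum_eq_sum_iff_of_le fun i _ => hle i).mp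
      (le_antisymm (Finset.sum_le_sum fun i _ => hle i) hmax) i (Finset.mem_univ i)
  have key : ∀ i, ∃ φ : Matrix (Fin (d i)) (Fin (d i)) ℂ, f i * φ * e i = φ ∧
      ∀ x ∈ gen o v' i, f i *ᵥ x = φ *ᵥ x := by
    intro i
    let E := (e i).mulVecLin ∘ₗ (gen o v' i).subtype
    have hE : LinearMap.ker E = ⊥ := by
      have hr : LinearMap.range E = gen o v i := by
        rw [LinearMap.range_comp, Submodule.range_subtype, hmap]
      have := E.finrank_range_add_finrank_ker
      rw [hr, heq] at this
      exact Submodule.finrank_eq_zero.mp (by omega)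
    obtain ⟨r, hr⟩ := E.exists_leftInverse_of_injective hE
    refine ⟨f i * LinearMap.toMatrix' ((gen o v' i).subtype ∘ₗ r) * e i, ?_, fun x hx => ?_⟩
    · simp only [Matrix.mul_assoc, he1]
      simp only [← Matrix.mul_assoc, hff]
    · rw [← mulVec_mulVec, ← mulVec_mulVec, LinearMap.toMatrix'_mulVec]
      exact congr_arg (fun y => f i *ᵥ y)
        (congr_arg Subtype.val (LinearMap.congr_fun hr ⟨x, hx⟩)).symm
  choose φ hφ hφx using key
  have hfφ : ∀ i, f i * φ i = φ i := fun i => by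
    rw [← hφ i, ← Matrix.mul_assoc, ← Matrix.mul_assoc, hff]
  have hφe : ∀ i, φ i * e i = φ i := fun i => by
    rw [← hφ i, Matrix.mul_assoc, Matrix.mul_assoc, he1, Matrix.mul_assoc]
  have hφo : φ o = 0 := by
    have hfo : f o = 0 := by rw [hf, Pi.sub_apply, heo, Pi.one_apply, sub_self]
    rw [← hφ o, hfo, Matrix.zero_mul, Matrix.zero_mul]
  let θ : LieCoord d o → ℂ := fun x => -φ x.1 x.2.1 x.2.2
  have hθ : (lieMat θ : EndFamily d) = -φ := by
    funext i
    by_cases hi : i = o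
    · subst hi; rw [lieMat_o, Pi.neg_apply, hφo, neg_zero]
    · rw [lieMat_of_ne _ hi]; rfl
  refine ⟨θ, ?_, ?_⟩
  · rw [hθ, mul_neg, neg_mul]
    congr 1
    exact funext fun i => (hφ i).symm
  · rw [bracket_eq_part, hθ]
    refine mat_ext fun i j ε => ext_of_mulVec_single fun k => ?_
    have hg : mat (graded e v) ε = e j * mat v ε * e i + f j * mat v ε * f i := rfl
    have hR : mat (part 1 (graded e v) (-φ) - part (-φ) (graded e v) 1) ε =
        φ j * mat v ε * e i - f j * mat v ε * φ i := by
      rw [mat_sub, mat_part, mat_part, hg, Pi.neg_apply, Pi.neg_apply, Pi.one_apply, Pi.one_apply,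
        Matrix.one_mul, Matrix.mul_one]
      have h4 : e i * φ i = 0 := by rw [← hfφ, ← Matrix.mul_assoc, hef, Matrix.zero_mul]
      have h5 : φ j * f j = 0 := by rw [← hφe, Matrix.mul_assoc, hef, Matrix.mul_zero]
      simp only [Matrix.mul_neg, Matrix.neg_mul, Matrix.add_mul, Matrix.mul_add]
      simp only [Matrix.mul_assoc, h4, hfφ, Matrix.mul_zero, zero_add]
      simp only [← Matrix.mul_assoc, h5, hφe, Matrix.zero_mul]
      abel
    rw [hR, mat_part]
    -- the vector `e y` lifts to the generated subrepresentation of the deformed representation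
    obtain ⟨x, hx, hxe⟩ : ∃ x ∈ gen o v' i, e i *ᵥ x = e i *ᵥ (Pi.single k 1) := by
      have h6 := hmem i (Pi.single k 1)
      rw [← hmap i] at h6
      exact h6
    have h7 := hφx j _ (gen_map_mem v' ε hx)
    have h8 : f j * mat v' ε = f j * mat v ε * f i + f j * mat n ε * e i := by
      simp only [hmat, Matrix.mul_add, ← Matrix.mul_assoc, hfe, hff, Matrix.zero_mul, zero_add]
    have h9 : φ j * mat v' ε = φ j * mat v ε * e i := by
      rw [← hφe j, Matrix.mul_assoc, hev, ← Matrix.mul_assoc, ← Matrix.mul_assoc, hφe]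
    have h10 : φ i *ᵥ x = φ i *ᵥ (Pi.single k 1) := by
      rw [← hφe i, ← mulVec_mulVec, hxe, mulVec_mulVec]
    rw [mulVec_mulVec, mulVec_mulVec, h8, h9, add_mulVec] at h7
    simp only [← mulVec_mulVec, hφx i x hx, h10, hxe] at h7
    simp only [sub_mulVec, ← mulVec_mulVec]
    rw [← h7, add_sub_cancel_left]

end QuiverRep

namespace QuiverRep

open Quiver Matrix

lemma exists_root_of_not_dvd {σ : Type} [Finite σ] {q P : MvPolynomial σ ℂ} (hq : Prime q)
    (h : ¬ q ∣ P) : ∃ v, MvPolynomial.eval v q = 0 ∧ MvPolynomial.eval v P ≠ 0 := by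
  by_contra hcon
  push Not at hcon
  have hprime : (Ideal.span {q}).IsPrime := (Ideal.span_singleton_prime hq.ne_zero).mpr hq
  have h1 : P ∈ MvPolynomial.vanishingIdeal ℂ (MvPolynomial.zeroLocus ℂ (Ideal.span {q})) := by
    rw [MvPolynomial.mem_vanishingIdeal_iff]
    intro v hv
    rw [MvPolynomial.mem_zeroLocus_iff] at hv
    exact hcon v (hv q (Ideal.mem_span_singleton_self q))
  rw [MvPolynomial.IsPrime.vanishingIdeal_zeroLocus, Ideal.mem_span_singleton] at h1
  exact h h1

lemma exists_prime_factor_root {σ : Type} {q : MvPolynomial σ ℂ} (hq : q ≠ 0) {v : σ → ℂ}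
    (h : MvPolynomial.eval v q = 0) : ∃ q₁, Prime q₁ ∧ q₁ ∣ q ∧ MvPolynomial.eval v q₁ = 0 := by
  classical
  have h1 := UniqueFactorizationMonoid.factors_prod hq
  obtain ⟨u, hu⟩ := h1
  have h2 : MvPolynomial.eval v (UniqueFactorizationMonoid.factors q).prod = 0 := by
    rw [← hu, map_mul] at h
    exact (mul_eq_zero.mp h).resolve_right (u.isUnit.map _).ne_zero
  rw [map_multiset_prod, Multiset.prod_eq_zero_iff, Multiset.mem_map] at h2
  obtain ⟨q₁, hmem, hq₁⟩ := h2
  exact ⟨q₁, UniqueFactorizationMonoid.prime_of_factor _ hmem,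
    UniqueFactorizationMonoid.dvd_of_mem_factors hmem, hq₁⟩

variable {V : Type} [Quiver.{0} V] {d : V → ℕ} {o : V}

/-- Numerator and denominator of an invariant rational function in lowest terms are
semi-invariants of the same weight. -/
lemma exists_weight_of_isRelPrime {p q : RepRing d} (hq : q ≠ 0)
    (hrel : IsRelPrime q p) (hinv : ∀ g : GaugeGroup d, actRing g p * q = p * actRing g q) :
    ∃ c : GaugeGroup d → ℂ, (∀ g v, MvPolynomial.eval (act g v) p = c g * MvPolynomial.eval v p) ∧
      ∀ g v, MvPolynomial.eval (act g v) q = c g * MvPolynomial.eval v q := by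
  -- group elements preserve the divisor of `q`, so that they multiply `q` by a unit
  have hdvd : ∀ g : GaugeGroup d, q ∣ actRing g q := fun g =>
    hrel.dvd_of_dvd_mul_left ((dvd_mul_left q _).trans (hinv g).dvd)
  have key : ∀ g : GaugeGroup d, ∃ c : ℂ, actRing g q = MvPolynomial.C c * q := by
    intro g
    obtain ⟨u, hu⟩ := hdvd g
    obtain ⟨u', hu'⟩ := hdvd g⁻¹
    have h1 : q * 1 = q * (u * actRing g u') := by
      have h2 := congr_arg (actRing g) hu'
      rw [actRing_actRing, mul_inv_cancel, actRing_one, map_mul, hu] at h2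
      rw [mul_one, ← mul_assoc]
      exact h2
    have h2 := mul_left_cancel₀ hq h1
    have h3 : IsUnit u := IsUnit.of_mul_eq_one _ h2.symm
    obtain ⟨r, -, rfl⟩ := MvPolynomial.isUnit_iff_eq_C_of_isReduced.mp h3
    exact ⟨r, hu.trans (mul_comm _ _)⟩
  choose c hc using key
  refine ⟨c, fun g v => ?_, fun g v => ?_⟩
  · rw [← eval_actRing]
    have h1 : actRing g p * q = (MvPolynomial.C (c g) * p) * q := by
      rw [hinv, hc]; ring
    rw [mul_right_cancel₀ hq h1, map_mul, MvPolynomial.eval_C]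
  · rw [← eval_actRing, hc, map_mul, MvPolynomial.eval_C]

variable [Fintype V] [∀ i j : V, Finite (i ⟶ j)] (ho : d o = 1) [DecidableEq V]
  {n : ℕ} (w : Fin (n + 1) → Option (Words d o))

/-- If there are generated representations, then invariant rational functions that are regular on
their locus are polynomials: otherwise the locus would be disjoint from the zero set of a
semi-invariant. At a zero with the largest possible generated subrepresentation the semi-invariant
vanishes on all deformations of the associated graded representation, so that these are
conjugate to it at first order, and generated representations could not be dense. -/
theorem extendsRegular (hw : ∀ S : Words d o, S.discr (generic d) ∈
      Submodule.span (fixedBy (actRing (m := d))) (Set.range (listDiscr w)))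
    (hne : ∃ S : Words d o, S.discr (generic d) ≠ 0) :
    ChartSystem.Locus.ExtendsRegular (charts ho w hw) := by
  intro p q hq hinv hdiv
  have := Fintype.ofFinite (Coord d)
  obtain ⟨q', p', c, hrel, rfl, rfl⟩ :=
    UniqueFactorizationMonoid.exists_reduced_factors q hq p
  have hc : c ≠ 0 := left_ne_zero_of_mul hq
  have hq' : q' ≠ 0 := right_ne_zero_of_mul hq
  by_cases hunit : IsUnit q'
  · exact mul_dvd_mul_left c hunit.dvd
  exfalso
  have hinv' : ∀ g : GaugeGroup d, actRing g p' * q' = p' * actRing g q' := by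
    intro g
    have h1 := hinv g
    have h2 : actRing g c ≠ 0 := by
      intro h0
      have h3 := congr_arg (actRing g⁻¹) h0
      rw [actRing_actRing, inv_mul_cancel, actRing_one, map_zero] at h3
      exact hc h3
    refine mul_left_cancel₀ (mul_ne_zero h2 hc) ?_
    rw [map_mul, map_mul] at h1
    linear_combination h1
  obtain ⟨χ, hpχ, hqχ⟩ := exists_weight_of_isRelPrime hq' hrel hinv'
  -- the zero set of the denominator does not meet the locus of generated representations
  have hgen : ∀ v, MvPolynomial.eval v q' = 0 → ¬ IsGenerated o v := by
    intro v hv hgv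
    obtain ⟨S, -, hS⟩ := exists_tree ho hgv
    have hF : ∀ k, MvPolynomial.eval v (listDiscr w k) = 0 := by
      intro k
      obtain ⟨m, hm⟩ := hdiv k
      rw [mul_assoc] at hm
      obtain ⟨r, hr⟩ := hrel.dvd_of_dvd_mul_left ((mul_dvd_mul_iff_left hc).mp hm)
      have h1 := congr_arg (MvPolynomial.eval v) hr
      rw [map_pow, map_mul, hv, zero_mul] at h1
      exact eq_zero_of_pow_eq_zero h1
    have h2 : MvPolynomial.eval v (S.discr (generic d)) = 0 := by
      refine Submodule.span_induction ?_ (map_zero _) (fun x y _ _ hx hy => ?_)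
        (fun a x _ hx => ?_) (hw S)
      · rintro _ ⟨k, rfl⟩
        exact hF k
      · rw [map_add, hx, hy, add_zero]
      · rw [Algebra.smul_def, map_mul, hx, mul_zero]
    exact hS ((eval_discr v S).symm.trans h2)
  obtain ⟨q₀, hq₀, hq₀q⟩ := WfDvdMonoid.exists_irreducible_factor hunit hq'
  obtain ⟨v₂, hv₂, -⟩ := exists_root_of_not_dvd hq₀.prime (P := 1) fun h =>
    hq₀.not_isUnit (isUnit_of_dvd_one h)
  have hroot : ∀ {r : RepRing d} {v}, r ∣ q' → MvPolynomial.eval v r = 0 →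
      MvPolynomial.eval v q' = 0 := by
    rintro r v ⟨s, hs⟩ hv
    rw [hs, map_mul, hv, zero_mul]
  let δ : Rep d → ℕ := fun v => ∑ i, Module.finrank ℂ (gen o v i)
  have hδ : ∀ v, δ v ≤ ∑ i, d i := fun v => Finset.sum_le_sum fun i _ => by
    simpa using Submodule.finrank_le (gen o v i)
  -- a zero `v₁` of the denominator with the largest generated subrepresentation; nearby, on a
  -- component of the zero set, there is such a zero `v` where the numerator does not vanish
  obtain ⟨v₁, hv₁, hmax⟩ : ∃ v₁, MvPolynomial.eval v₁ q' = 0 ∧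
      ∀ v, MvPolynomial.eval v q' = 0 → δ v ≤ δ v₁ := by
    obtain ⟨v₁, hv₁, h1⟩ := WellFounded.has_min (measure fun v : Rep d => ∑ i, d i - δ v).wf
      {v | MvPolynomial.eval v q' = 0} ⟨v₂, hroot hq₀q hv₂⟩
    refine ⟨v₁, hv₁, fun v hv => ?_⟩
    have h2 : ¬ (∑ i, d i - δ v < ∑ i, d i - δ v₁) := h1 v hv
    have h3 := hδ v
    omega
  obtain ⟨q₁, hq₁, hq₁q, hq₁v⟩ := exists_prime_factor_root hq' hv₁
  obtain ⟨P, hP, hPmax⟩ := exists_poly_finrank_gen (o := o) v₁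
  obtain ⟨v, hvq, hv⟩ := exists_root_of_not_dvd hq₁ (P := P * p') (by
    intro h
    rcases hq₁.dvd_or_dvd h with ⟨r, h⟩ | h
    · rw [h, map_mul, hq₁v, zero_mul] at hP
      exact hP rfl
    · exact hq₁.not_isUnit (hrel hq₁q h))
  rw [map_mul] at hv
  have hvq' := hroot hq₁q hvq
  have hvmax : ∀ v', MvPolynomial.eval v' q' = 0 → δ v' ≤ δ v := fun v' hv' =>
    (hmax v' hv').trans (Finset.sum_le_sum fun i _ => hPmax v (left_ne_zero_of_mul hv) i)
  obtain ⟨e, he, heo, hmem, hid, hinvt⟩ := exists_idem_gen ho v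
  have he1 : e ≠ 1 := by
    rintro rfl
    refine hgen v hvq' (isGenerated_of_gen fun i => ?_)
    rw [eq_top_iff]
    intro x _
    have := hmem i x
    rwa [Pi.one_apply, one_mulVec] at this
  obtain ⟨S, hS⟩ := hne
  refine hS (discr_eq_zero_of_bracket he heo he1 (graded e v) ?_ (fun n => ?_) S)
  · obtain ⟨h1, h2, h3⟩ := idem_compl he
    rw [graded, part_add, part_part, part_part, h2, part_zero, part_zero', add_zero]
  · exact exists_bracket_eq he heo hmem hid n (hvmax _
      (eval_graded_add he hpχ hqχ hinvt (right_ne_zero_of_mul hv) hvq' n))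

end QuiverRep

/-! ### Transport of chart systems along a renaming of the coordinates -/

namespace ChartSystem

variable {σ σ' G G' : Type} {ρ : G → MvPolynomial σ ℂ →ₐ[ℂ] MvPolynomial σ ℂ}
  {ρ' : G' → MvPolynomial σ' ℂ →ₐ[ℂ] MvPolynomial σ' ℂ} (ψ : σ ≃ σ') {γ : G → G'}

lemma rename_rename_symm (f : MvPolynomial σ' ℂ) :
    MvPolynomial.rename ψ (MvPolynomial.rename ψ.symm f) = f := by
  rw [MvPolynomial.rename_rename, Equiv.self_comp_symm, MvPolynomial.rename_id_apply]

lemma rename_symm_rename (f : MvPolynomial σ ℂ) :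
    MvPolynomial.rename ψ.symm (MvPolynomial.rename ψ f) = f := by
  rw [MvPolynomial.rename_rename, Equiv.symm_comp_self, MvPolynomial.rename_id_apply]

section

variable (hρ : ∀ g f, MvPolynomial.rename ψ (ρ g f) = ρ' (γ g) (MvPolynomial.rename ψ f))

include hρ

lemma act_rename_symm (g : G) (f : MvPolynomial σ' ℂ) :
    ρ g (MvPolynomial.rename ψ.symm f) = MvPolynomial.rename ψ.symm (ρ' (γ g) f) := by
  rw [← rename_symm_rename ψ (ρ g _), hρ, rename_rename_symm]

lemma rename_symm_mem_span {κ : Type} {F : κ → MvPolynomial σ' ℂ} {x : MvPolynomial σ' ℂ}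
    (hx : x ∈ Submodule.span (fixedBy ρ') (Set.range F)) :
    MvPolynomial.rename ψ.symm x ∈
      Submodule.span (fixedBy ρ) (Set.range fun s => MvPolynomial.rename ψ.symm (F s)) := by
  induction hx using Submodule.span_induction with
  | mem x hx =>
    obtain ⟨s, rfl⟩ := hx
    exact Submodule.subset_span ⟨s, rfl⟩
  | zero => rw [map_zero]; exact Submodule.zero_mem _
  | add x y _ _ hx hy => rw [map_add]; exact Submodule.add_mem _ hx hy
  | smul a x _ hx =>
    have ha : MvPolynomial.rename ψ.symm (a : MvPolynomial σ' ℂ) ∈ fixedBy ρ := by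
      rw [mem_fixedBy]
      intro g
      rw [act_rename_symm ψ hρ, mem_fixedBy.mp a.2]
    have := Submodule.smul_mem _ (⟨_, ha⟩ : fixedBy ρ) hx
    rw [Algebra.smul_def, map_mul]
    rwa [Algebra.smul_def] at this

end

variable (hγ : Function.Surjective γ)
  (hρ : ∀ g f, MvPolynomial.rename ψ (ρ g f) = ρ' (γ g) (MvPolynomial.rename ψ f))

/-- The transport of a chart system. -/
def transport (S : ChartSystem ρ') : ChartSystem ρ where
  n := S.n
  F s := MvPolynomial.rename ψ.symm (S.F s)
  χ g := S.χ (γ g)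
  χ_ne_zero g := S.χ_ne_zero _
  ρ_F g s := by rw [act_rename_symm ψ hρ, S.ρ_F, map_mul, MvPolynomial.rename_C]
  e s z := MvPolynomial.rename ψ.symm (S.e s (ψ z))
  e_mem s z := rename_symm_mem_span ψ hρ (S.e_mem s (ψ z))
  exists_act s v hv := by
    simp only [MvPolynomial.eval_rename] at hv ⊢
    obtain ⟨g', h1, h2⟩ := S.exists_act s _ hv
    obtain ⟨g, rfl⟩ := hγ g'
    refine ⟨g, fun f => ?_, ?_⟩
    · have h3 := h1 (MvPolynomial.rename ψ f)
      rw [MvPolynomial.eval_rename] at h3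
      rw [← rename_symm_rename ψ (ρ g f), hρ, MvPolynomial.eval_rename, h3]
      rfl
    · rw [act_rename_symm ψ hρ, MvPolynomial.eval_rename, h2]

/-- The transport of slices. -/
def Slices.transport {S : ChartSystem ρ'} (R : S.Slices) : (S.transport ψ hγ hρ).Slices where
  T := R.T
  idx := R.idx
  J := R.J
  finite := R.finite
  c t j := ψ.symm (R.c t j)
  sec t := (R.sec t).comp (MvPolynomial.rename ψ)
  sec_c t j := by
    rw [AlgHom.comp_apply, MvPolynomial.rename_X, Equiv.apply_symm_apply, R.sec_c]
  sec_F t := by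
    rw [AlgHom.comp_apply]
    exact (congr_arg (R.sec t) (rename_rename_symm ψ _)).trans (R.sec_F t)
  sec_e t z := by
    rw [AlgHom.comp_apply, AlgHom.comp_apply, MvPolynomial.rename_X, ← R.sec_e]
    exact congr_arg (R.sec t) (rename_rename_symm ψ _)
  exists_coord t z := by
    rcases R.exists_coord t (ψ z) with ⟨j, hj⟩ | ⟨a, ha, ha'⟩
    · exact Or.inl ⟨j, by rw [← hj, Equiv.symm_apply_apply]⟩
    · refine Or.inr ⟨a, by rw [AlgHom.comp_apply, MvPolynomial.rename_X, ha], ?_⟩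
      change MvPolynomial.rename ψ.symm (S.e (R.idx t) (ψ z)) =
        MvPolynomial.C a * MvPolynomial.rename ψ.symm (S.F (R.idx t))
      rw [ha', map_mul, MvPolynomial.rename_C]
  cover s v hv := by
    obtain ⟨t, ht⟩ := R.cover s (v ∘ ψ.symm) (by rw [← MvPolynomial.eval_rename]; exact hv)
    exact ⟨t, by rw [← MvPolynomial.eval_rename] at ht; exact ht⟩

/-- The transport of Jacobian weights. -/
def JacobianWeight.transport {S : ChartSystem ρ'} {R : S.Slices} {ε : ℤ} (J : JacobianWeight R ε) :
    JacobianWeight (R.transport ψ hγ hρ) ε where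
  Ψ t := MvPolynomial.rename ψ.symm (J.Ψ t)
  χ g := J.χ (γ g)
  ρ_Ψ g (t : R.T) := by
    have h := J.ρ_Ψ (γ g) t
    rw [act_rename_symm ψ hρ, h, map_mul, MvPolynomial.rename_C]
  sec_Ψ t := (congr_arg (R.sec t) (rename_rename_symm ψ _)).trans (J.sec_Ψ t)
  eval_ne_zero_iff t v := by
    have h := J.eval_ne_zero_iff t (v ∘ ψ.symm)
    rw [← MvPolynomial.eval_rename, ← MvPolynomial.eval_rename] at h
    exact h
  exists_jacobian := fun E _ _ (t t' : R.T) (_ : Fintype (R.J t)) (_ : DecidableEq (R.J t))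
      (α : MvPolynomial (R.J t) ℂ →ₐ[ℂ] E) (α' : MvPolynomial (R.J t') ℂ →ₐ[ℂ] E)
      (h1 : ∀ z, α' (R.sec t' (MvPolynomial.rename ψ (MvPolynomial.X z))) *
        α (R.sec t (MvPolynomial.rename ψ (MvPolynomial.rename ψ.symm (S.F (R.idx t'))))) =
        α (R.sec t (MvPolynomial.rename ψ (MvPolynomial.rename ψ.symm (S.e (R.idx t') (ψ z))))))
      (h2 : α (R.sec t (MvPolynomial.rename ψ (MvPolynomial.rename ψ.symm (S.F (R.idx t'))))) ≠ 0)
      => by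
    simp only [rename_rename_symm, MvPolynomial.rename_X] at h1 h2
    obtain ⟨e, A, κ, hκ, hA, hdet⟩ := J.exists_jacobian E t t' α α' (fun z => by
      have h := h1 (ψ.symm z)
      rwa [Equiv.apply_symm_apply] at h) h2
    refine ⟨e, A, κ, hκ, hA, hdet.trans ?_⟩
    exact congr_arg (fun f => algebraMap ℂ E κ * α (R.sec t f) ^ ε)
      (rename_rename_symm ψ (J.Ψ t')).symm

lemma Locus.ExtendsRegular.transport {S : ChartSystem ρ'} (h : Locus.ExtendsRegular S) :
    Locus.ExtendsRegular (S.transport ψ hγ hρ) := by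
  intro p q hq hinv hdiv
  have hdvd : ∀ {a b : MvPolynomial σ ℂ}, MvPolynomial.rename ψ a ∣ MvPolynomial.rename ψ b →
      a ∣ b := by
    intro a b hab
    have := map_dvd (MvPolynomial.rename (R := ℂ) ψ.symm) hab
    rwa [rename_symm_rename, rename_symm_rename] at this
  refine hdvd (h _ _ ?_ (fun g' => ?_) fun s => ?_)
  · rw [Ne, map_eq_zero_iff _ (MvPolynomial.rename_injective _ ψ.injective)]
    exact hq
  · obtain ⟨g, rfl⟩ := hγ g'
    rw [← hρ, ← hρ, ← map_mul, ← map_mul, hinv]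
  · obtain ⟨k, hk⟩ := hdiv s
    refine ⟨k, ?_⟩
    have := map_dvd (MvPolynomial.rename (R := ℂ) ψ) hk
    rw [map_mul, map_pow] at this
    refine this.trans (dvd_of_eq ?_)
    congr 2
    exact rename_rename_symm ψ _

end ChartSystem

/-! ### Generated and cogenerated representations -/

namespace QuiverRep

open Quiver Matrix

variable {V : Type} [Quiver.{0} V]

instance fintypeOpposite [Fintype V] : Fintype Vᵒᵖ := Fintype.ofEquiv V Opposite.equivToOpposite

instance finite_hom_opposite [∀ i j : V, Finite (i ⟶ j)] (i j : Vᵒᵖ) : Finite (i ⟶ j) :=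
  Finite.of_equiv (j.unop ⟶ i.unop) Quiver.Hom.opEquiv

variable (d : V → ℕ) in
/-- The coordinates of the transposed representations of the opposite quiver. -/
def coordOp : Coord d ≃ Coord fun i : Vᵒᵖ => d i.unop where
  toFun z := ⟨.op z.tgt, .op z.src, z.edge.op, z.col, z.row⟩
  invFun z := ⟨z.tgt.unop, z.src.unop, z.edge.unop, z.col, z.row⟩
  left_inv _ := rfl
  right_inv _ := rfl

variable {d : V → ℕ} {o : V}

/-- The transposed representation of the opposite quiver. -/
def transposeRep (v : Rep d) : Rep fun i : Vᵒᵖ => d i.unop := v ∘ (coordOp d).symm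

/-- The inverse transposed group element. -/
def contragredient (g : GaugeGroup d) : GaugeGroup fun i : Vᵒᵖ => d i.unop := fun i =>
  ⟨((g i.unop)⁻¹).valᵀ, (g i.unop).valᵀ, by rw [← transpose_mul, Units.mul_inv, transpose_one],
    by rw [← transpose_mul, Units.inv_mul, transpose_one]⟩

omit [Quiver V] in
lemma contragredient_surjective : Function.Surjective (contragredient (d := d)) := by
  intro g
  refine ⟨fun i => ⟨((g (.op i))⁻¹).valᵀ, (g (.op i)).valᵀ,
    by rw [← transpose_mul, Units.mul_inv, transpose_one],
    by rw [← transpose_mul, Units.inv_mul, transpose_one]⟩, ?_⟩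
  funext i
  exact Units.ext (transpose_transpose _)

lemma transposeRep_act (g : GaugeGroup d) (v : Rep d) :
    transposeRep (act g v) = act (contragredient g) (transposeRep v) := by
  funext z
  obtain ⟨⟨i⟩, ⟨j⟩, ⟨e⟩, r, c⟩ := z
  have h : ∀ (A : Matrix (Fin (d i)) (Fin (d i)) ℂ) (M : Matrix (Fin (d i)) (Fin (d j)) ℂ)
      (B : Matrix (Fin (d j)) (Fin (d j)) ℂ), (A * M * B)ᵀ = Bᵀ * Mᵀ * Aᵀ := by
    intro A M B
    rw [transpose_mul, transpose_mul, Matrix.mul_assoc]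
  exact congr_fun (congr_fun (h _ (edgeMatrix v e) _) r) c

lemma rename_actRing (g : GaugeGroup d) (f : RepRing d) :
    MvPolynomial.rename (coordOp d) (actRing g f) =
      actRing (contragredient g) (MvPolynomial.rename (coordOp d) f) := by
  refine MvPolynomial.funext fun v => ?_
  rw [MvPolynomial.eval_rename, eval_actRing, eval_actRing, MvPolynomial.eval_rename]
  congr 2
  have h := transposeRep_act g (v ∘ coordOp d)
  have h2 : transposeRep (v ∘ coordOp d) = v := by
    rw [transposeRep, Function.comp_assoc, Equiv.self_comp_symm, Function.comp_id]
  rw [h2] at h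
  rw [← h, transposeRep, Function.comp_assoc, Equiv.symm_comp_self, Function.comp_id]

omit [Quiver V] in
lemma weight_contragredient [Fintype V] (g : GaugeGroup d) :
    weight (.op o) (contragredient g) = (weight o g)⁻¹ := by
  have h : ∀ i : V, (contragredient g (.op i)).val.det = (g i).val.det⁻¹ := fun i =>
    (det_transpose _).trans (det_gl_inv _)
  rw [weight, weight, ← Finset.prod_inv_distrib, ← Opposite.equivToOpposite.prod_comp]
  refine Finset.prod_congr rfl fun i _ => ?_
  change (contragredient g (.op o)).val.det ^ d i * (contragredient g (.op i)).val.det⁻¹ = _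
  rw [h, h, mul_inv, inv_inv, inv_pow]

/-- Subrepresentations that are zero at `o` are zero. -/
def IsCogenerated (o : V) (v : Rep d) : Prop :=
  ∀ X : SubRep v, X.space o = ⊥ → ∀ i, X.space i = ⊥

/-- The vectors orthogonal to a subspace, for the bilinear dot product. -/
def perp {n : ℕ} (W : Submodule ℂ (Fin n → ℂ)) : Submodule ℂ (Fin n → ℂ) where
  carrier := {y | ∀ x ∈ W, y ⬝ᵥ x = 0}
  add_mem' hy hy' x hx := by rw [add_dotProduct, hy x hx, hy' x hx, add_zero]
  zero_mem' x _ := zero_dotProduct x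
  smul_mem' c y hy x hx := by rw [smul_dotProduct, hy x hx, smul_zero]

lemma perp_bot {n : ℕ} : perp (⊥ : Submodule ℂ (Fin n → ℂ)) = ⊤ := by
  rw [eq_top_iff]
  rintro y - x hx
  rw [(Submodule.mem_bot ℂ).mp hx, dotProduct_zero]

lemma perp_eq_top {n : ℕ} {W : Submodule ℂ (Fin n → ℂ)} (h : perp W = ⊤) : W = ⊥ := by
  rw [eq_bot_iff]
  intro x hx
  rw [Submodule.mem_bot]
  funext k
  have : Pi.single k 1 ∈ perp W := h ▸ trivial
  simpa using this x hx

lemma perp_top {n : ℕ} : perp (⊤ : Submodule ℂ (Fin n → ℂ)) = ⊥ := by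
  rw [eq_bot_iff]
  intro y hy
  rw [Submodule.mem_bot]
  funext k
  simpa using hy (Pi.single k 1) trivial

lemma perp_eq_bot {n : ℕ} {W : Submodule ℂ (Fin n → ℂ)} (h : perp W = ⊥) : W = ⊤ := by
  by_contra hW
  obtain ⟨f, hf, hfW⟩ := W.exists_le_ker_of_lt_top (lt_top_iff_ne_top.mpr hW)
  have hdot : ∀ x, (fun k => f (Pi.single k 1)) ⬝ᵥ x = f x := by
    intro x
    conv_rhs => rw [← Finset.univ_sum_single x]
    rw [map_sum, dotProduct]
    refine Finset.sum_congr rfl fun k _ => ?_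
    have : (Pi.single k (x k) : Fin n → ℂ) = x k • Pi.single k 1 := by
      rw [← Pi.single_smul, smul_eq_mul, mul_one]
    rw [this, map_smul, smul_eq_mul, mul_comm]
  have hmem : (fun k => f (Pi.single k 1)) ∈ perp W := fun x hx => by
    rw [hdot]
    exact hfW hx
  rw [h, Submodule.mem_bot] at hmem
  refine hf (LinearMap.ext fun x => ?_)
  rw [← hdot, hmem, zero_dotProduct, LinearMap.zero_apply]

lemma isCogenerated_iff (v : Rep d) : IsCogenerated o v ↔ IsGenerated (.op o) (transposeRep v) := by
  have hdot : ∀ {i j : V} (e : i ⟶ j) x y, y ⬝ᵥ (edgeMatrix v e *ᵥ x) =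
      ((edgeMatrix v e)ᵀ *ᵥ y) ⬝ᵥ x := by
    intro i j e x y
    rw [dotProduct_mulVec, ← mulVec_transpose]
  constructor
  · intro h X hX i
    let W : SubRep v :=
      { space := fun i => perp (X.space (.op i))
        map_mem := by
          intro i j e x hx y hy
          rw [dotProduct_comm, hdot, dotProduct_comm]
          exact hx _ (X.map_mem e.op y hy) }
    exact perp_eq_bot (h W (by change perp _ = ⊥; rw [hX, perp_top]) i.unop)
  · intro h W hW i
    let X : SubRep (transposeRep v) :=
      { space := fun i => perp (W.space i.unop)
        map_mem := by
          rintro ⟨i⟩ ⟨j⟩ ⟨e⟩ y hy x hx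
          refine (hdot e x y).symm.trans ?_
          exact hy _ (W.map_mem e x hx) }
    exact perp_eq_top (h X (by change perp _ = ⊤; rw [hW, perp_bot]) (.op i))

end QuiverRep

/-! ### Comparison with semistability -/

lemma arg_le_arg_iff {z w : ℂ} (hz : 0 < z.im) (hw : 0 < w.im) :
    z.arg ≤ w.arg ↔ w.re * z.im ≤ z.re * w.im := by
  have key : ∀ {z w : ℂ}, ‖z‖ * ‖w‖ * Real.sin (w.arg - z.arg) = z.re * w.im - w.re * z.im := by
    intro z w
    rw [Real.sin_sub, ← Complex.norm_mul_cos_arg z, ← Complex.norm_mul_cos_arg w,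
      ← Complex.norm_mul_sin_arg z, ← Complex.norm_mul_sin_arg w]
    ring
  have hbound : ∀ {z : ℂ}, 0 < z.im → 0 < ‖z‖ ∧ 0 ≤ z.arg ∧ z.arg < Real.pi := by
    intro z hz
    refine ⟨norm_pos_iff.mpr ?_, Complex.arg_nonneg_iff.mpr hz.le,
      Complex.arg_lt_pi_iff.mpr (Or.inr hz.ne')⟩
    rintro rfl
    exact lt_irrefl _ hz
  obtain ⟨hz0, hz1, hz2⟩ := hbound hz
  obtain ⟨hw0, hw1, hw2⟩ := hbound hw
  constructor
  · intro h
    have h1 := Real.sin_nonneg_of_nonneg_of_le_pi (sub_nonneg.mpr h) (by linarith)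
    have h2 := mul_nonneg (mul_pos hz0 hw0).le h1
    rw [key] at h2
    linarith
  · intro h
    by_contra! hlt
    have h1 := Real.sin_pos_of_pos_of_lt_pi (sub_pos.mpr hlt) (by linarith)
    have h2 := mul_pos (mul_pos hw0 hz0) h1
    rw [key] at h2
    linarith

namespace QuiverRep

open Quiver

variable {V : Type} [Quiver.{0} V] [Fintype V] {d : V → ℕ} {o : V}

section Stability

variable (ho : d o = 1) {ξ : V → UpperHalfPlane} (hξ : ∀ i ≠ o, (ξ i : ℂ) = Complex.I)

omit [Quiver V] in
include hξ in
open Classical in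
lemma centralCharge_eq (f : V → ℕ) : (centralCharge ξ f).re = f o * (ξ o).re ∧
    (centralCharge ξ f).im = f o * (ξ o).im + (∑ i ∈ Finset.univ.erase o, f i : ℕ) := by
  have h : centralCharge ξ f = f o * (ξ o : ℂ) +
      ((∑ i ∈ Finset.univ.erase o, f i : ℕ) : ℂ) * Complex.I := by
    rw [centralCharge, ← Finset.add_sum_erase _ _ (Finset.mem_univ o), Nat.cast_sum,
      Finset.sum_mul]
    congr 1
    exact Finset.sum_congr rfl fun i hi => by rw [hξ i (Finset.ne_of_mem_erase hi)]
  rw [h]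
  constructor <;> simp

include ho hξ

open Classical in
lemma isSemistable_iff (v : Rep d) : IsSemistable ξ v ↔ ∀ W : SubRep v, (∃ i, W.space i ≠ ⊥) →
    (ξ o).re * (∑ i ∈ Finset.univ.erase o, Module.finrank ℂ (W.space i) : ℕ) ≤
      Module.finrank ℂ (W.space o) * (ξ o).re * (∑ i ∈ Finset.univ.erase o, d i : ℕ) := by
  refine forall₂_congr fun W hW => ?_
  obtain ⟨h1, h2⟩ := centralCharge_eq hξ d
  obtain ⟨h3, h4⟩ := centralCharge_eq hξ fun i => Module.finrank ℂ (W.space i)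
  rw [ho, Nat.cast_one, one_mul] at h1 h2
  have him : 0 < (ξ o).im := (ξ o).im_pos
  have h5 : 0 < (centralCharge ξ d).im := by rw [h2]; positivity
  have h6 : 0 < (centralCharge ξ fun i => Module.finrank ℂ (W.space i)).im := by
    rw [h4]
    obtain ⟨i, hi⟩ := hW
    have hpos : 0 < Module.finrank ℂ (W.space i) :=
      Nat.pos_of_ne_zero fun h => hi (Submodule.finrank_eq_zero.mp h)
    by_cases hio : i = o
    · subst hio
      have : (0 : ℝ) < Module.finrank ℂ (W.space i) := Nat.cast_pos.mpr hpos
      positivity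
    · have h7 : 0 < ∑ i ∈ Finset.univ.erase o, Module.finrank ℂ (W.space i) :=
        Finset.sum_pos' (fun _ _ => Nat.zero_le _)
          ⟨i, Finset.mem_erase.mpr ⟨hio, Finset.mem_univ i⟩, hpos⟩
      have : (0 : ℝ) < (∑ i ∈ Finset.univ.erase o, Module.finrank ℂ (W.space i) : ℕ) :=
        Nat.cast_pos.mpr h7
      positivity
  rw [arg_le_arg_iff h6 h5, h1, h2, h3, h4]
  constructor <;> intro h <;> linarith

lemma isSemistable_iff_isGenerated (hre : (ξ o).re < 0) (v : Rep d) :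
    IsSemistable ξ v ↔ IsGenerated o v := by
  classical
  rw [isSemistable_iff ho hξ]
  have hle : ∀ W : SubRep v, ∀ i ∈ Finset.univ.erase o, Module.finrank ℂ (W.space i) ≤ d i :=
    fun W i _ => by simpa using Submodule.finrank_le (W.space i)
  constructor
  · intro h X hX i
    by_cases hi : i = o
    · rw [hi, hX]
    have h1 : Module.finrank ℂ (X.space o) = 1 := by rw [hX, finrank_top, Module.finrank_fin_fun, ho]
    have h2 := h X ⟨o, fun h0 => by rw [h0, finrank_bot] at h1; omega⟩
    rw [h1, Nat.cast_one, one_mul] at h2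
    have h3 := Nat.cast_le.mp ((mul_le_mul_left_of_neg hre).mp h2)
    have h4 := (Finset.sum_eq_sum_iff_of_le (hle X)).mp
      (le_antisymm (Finset.sum_le_sum (hle X)) h3) i (Finset.mem_erase.mpr ⟨hi, Finset.mem_univ i⟩)
    exact Submodule.eq_top_of_finrank_eq (by rw [h4, Module.finrank_fin_fun])
  · intro h W _
    have h1 : Module.finrank ℂ (W.space o) ≤ 1 := by
      simpa [ho] using Submodule.finrank_le (W.space o)
    rcases Nat.le_one_iff_eq_zero_or_eq_one.mp h1 with h2 | h2
    · rw [h2, Nat.cast_zero, zero_mul, zero_mul]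
      exact mul_nonpos_of_nonpos_of_nonneg hre.le (Nat.cast_nonneg _)
    · have h3 : W.space o = ⊤ :=
        Submodule.eq_top_of_finrank_eq (by rw [h2, Module.finrank_fin_fun, ho])
      have h4 : ∀ i, Module.finrank ℂ (W.space i) = d i := fun i => by
        rw [h W h3 i, finrank_top, Module.finrank_fin_fun]
      simp only [h4, ho, Nat.cast_one, one_mul, le_refl]

lemma isSemistable_iff_isCogenerated (hre : 0 < (ξ o).re) (v : Rep d) :
    IsSemistable ξ v ↔ IsCogenerated o v := by
  classical
  rw [isSemistable_iff ho hξ]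
  constructor
  · intro h W hW i
    by_contra hi
    have h1 := h W ⟨i, hi⟩
    rw [hW, finrank_bot, Nat.cast_zero, zero_mul, zero_mul] at h1
    have h2 : (∑ i ∈ Finset.univ.erase o, Module.finrank ℂ (W.space i) : ℕ) ≤ 0 := by
      have := nonpos_of_mul_nonpos_right h1 hre
      exact_mod_cast this
    have hio : i ≠ o := fun h0 => hi (h0 ▸ hW)
    have h3 := Finset.sum_eq_zero_iff.mp (Nat.le_zero.mp h2) i
      (Finset.mem_erase.mpr ⟨hio, Finset.mem_univ i⟩)
    exact hi (Submodule.finrank_eq_zero.mp h3)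
  · intro h W hW
    have h1 : Module.finrank ℂ (W.space o) = 1 := by
      have h2 : Module.finrank ℂ (W.space o) ≤ 1 := by
        simpa [ho] using Submodule.finrank_le (W.space o)
      refine le_antisymm h2 (Nat.pos_of_ne_zero fun h0 => ?_)
      obtain ⟨i, hi⟩ := hW
      exact hi (h W (Submodule.finrank_eq_zero.mp h0) i)
    rw [h1, Nat.cast_one, one_mul]
    refine mul_le_mul_of_nonneg_left (Nat.cast_le.mpr (Finset.sum_le_sum fun i _ => ?_)) hre.le
    simpa using Submodule.finrank_le (W.space i)

end Stability

/-! ### Charts for the two loci -/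

/-- A chart system for the locus of the representations with the property `P`, with all that its
quotient is going to need. -/
structure LocusCharts (P : Rep d → Prop) (χ : GaugeGroup d → ℂ) (ε : ℤ) where
  /-- The charts. -/
  S : ChartSystem (actRing (m := d))
  /-- The slices. -/
  R : S.Slices
  /-- The weight of the Jacobians. -/
  J : ChartSystem.JacobianWeight R ε
  ext : (∃ s, S.F s ≠ 0) → ChartSystem.Locus.ExtendsRegular S
  χ_eq : S.χ = χ
  iff : ∀ v, P v ↔ ∃ s, MvPolynomial.eval v (S.F s) ≠ 0

variable [∀ i j : V, Finite (i ⟶ j)] (ho : d o = 1) {k : V → ℕ} {ε : ℤ}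

include ho

lemma nonempty_locusCharts_isGenerated (hk : ∀ i ≠ o, 0 < k i)
    (hflow : ∀ i ≠ o, ∑ j, (d j * Nat.card (i ⟶ j) : ℤ) - ∑ j, (d j * Nat.card (j ⟶ i) : ℤ) =
      ε * k i) : Nonempty (LocusCharts (d := d) (IsGenerated o) (weight o) ε) := by
  classical
  obtain ⟨n, w, hw, hcover⟩ := exists_list d o ho
  have hF : ∀ v (s : Fin (n + 1)), MvPolynomial.eval v (listDiscr w s) ≠ 0 → ∃ S : Words d o,
      w s = some S ∧ S.discr v ≠ 0 := by
    intro v s hs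
    cases h : w s with
    | none => simp [listDiscr, h] at hs
    | some S => exact ⟨S, rfl, by simpa [listDiscr, h, eval_discr] using hs⟩
  refine ⟨⟨charts ho w hw, slices ho w hw hcover, jacobianWeight ho hk hflow, ?_, rfl, fun v => ?_⟩⟩
  · rintro ⟨s, hs⟩
    refine extendsRegular ho w hw ?_
    change listDiscr w s ≠ 0 at hs
    cases h : w s with
    | none => simp [listDiscr, h] at hs
    | some S => exact ⟨S, by simpa [listDiscr, h] using hs⟩
  · constructor
    · intro hv
      obtain ⟨S, -, hS⟩ := exists_tree ho hv
      obtain ⟨s, S', hs, -, hS'⟩ := hcover S v hS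
      refine ⟨s, ?_⟩
      change MvPolynomial.eval v (listDiscr w s) ≠ 0
      simpa [listDiscr, hs, eval_discr] using hS'
    · rintro ⟨s, hs⟩
      obtain ⟨S, -, hS⟩ := hF v s hs
      exact isGenerated_of_discr S hS

lemma nonempty_locusCharts_isCogenerated (hk : ∀ i ≠ o, 0 < k i)
    (hflow : ∀ i ≠ o, ∑ j, (d j * Nat.card (i ⟶ j) : ℤ) - ∑ j, (d j * Nat.card (j ⟶ i) : ℤ) =
      ε * k i) :
    Nonempty (LocusCharts (d := d) (IsCogenerated o) (fun g => (weight o g)⁻¹) (-ε)) := by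
  have hcard : ∀ i j : V, Nat.card ((.op i : Vᵒᵖ) ⟶ .op j) = Nat.card (j ⟶ i) := fun i j =>
    Nat.card_congr Quiver.Hom.opEquiv.symm
  obtain ⟨C⟩ := nonempty_locusCharts_isGenerated (V := Vᵒᵖ) (d := fun i => d i.unop) (o := .op o)
    (k := fun i => k i.unop) (ε := -ε) ho (fun i hi => hk i.unop fun h => hi (by rw [← h])) (by
      rintro ⟨i⟩ hi
      have h := hflow i fun h => hi (by rw [h])
      rw [← Opposite.equivToOpposite.sum_comp, ← Opposite.equivToOpposite.sum_comp]
      simp only [Opposite.equivToOpposite_coe, hcard]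
      linarith)
  refine ⟨⟨C.S.transport (coordOp d) contragredient_surjective rename_actRing, C.R.transport _ _ _,
    C.J.transport _ _ _, fun ⟨s, hs⟩ => (C.ext ⟨s, fun h => hs ?_⟩).transport _ _ _, ?_, fun v => ?_⟩⟩
  · change MvPolynomial.rename (coordOp d).symm (C.S.F s) = 0
    rw [h, map_zero]
  · funext g
    change C.S.χ (contragredient g) = _
    rw [C.χ_eq, weight_contragredient]
  · rw [isCogenerated_iff, C.iff]
    refine exists_congr fun s => ?_
    change _ ↔ MvPolynomial.eval v (MvPolynomial.rename (coordOp d).symm (C.S.F s)) ≠ 0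
    rw [MvPolynomial.eval_rename]
    rfl

end QuiverRep

/-! ### The moduli spaces of semistable representations -/

namespace QuiverRep

open Quiver Matrix

variable {V : Type} [Quiver.{0} V] {d : V → ℕ} {o : V}

lemma affPt_eq_point (v : Rep d) : affPt v specCPoint = point v := by
  refine PrimeSpectrum.ext (Ideal.ext fun f => ?_)
  have h1 := affPt_mem_basicOpen v f
  have h2 : f ∈ (affPt v specCPoint).asIdeal ↔ MvPolynomial.eval v f = 0 :=
    not_iff_not.mp h1
  refine h2.trans ?_
  change _ ↔ f ∈ MvPolynomial.vanishingIdeal ℂ {v}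
  simp [MvPolynomial.mem_vanishingIdeal_iff, MvPolynomial.aeval_eq_eval]

lemma isVariety_moduli [Finite V] [∀ i j : V, Finite (i ⟶ j)] :
    IsVariety (Moduli.structureMap d) := by
  have := Fintype.ofFinite V
  have := Fintype.ofFinite (Coord d)
  refine ChartSystem.Locus.isVariety_base (ρ := actRing (m := d)) ?_
  have h : fixedBy (actRing (m := d)) = Fischer.fixed (actMatrix (d := d)) := by
    ext f
    rw [mem_fixedBy, Fischer.mem_fixed]
    exact forall_congr' fun g => by rw [actRing_eq_subst]
  rw [h]
  by_cases hV : Nonempty V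
  · refine Fischer.fixed_fg fun g => ?_
    obtain ⟨g', hg', -⟩ := exists_conjTranspose (Classical.arbitrary V) g
    exact ⟨g', hg'⟩
  · exact Fischer.fixed_fg fun g => ⟨g, Matrix.ext fun x => (hV ⟨x.src⟩).elim⟩

variable [Fintype V] [∀ i j : V, Finite (i ⟶ j)] {ξ : V → UpperHalfPlane}

namespace LocusCharts

variable {P : Rep d → Prop} {χ : GaugeGroup d → ℂ} {ε : ℤ} (C : LocusCharts P χ ε)
  (hP : ∀ v, IsSemistable ξ v ↔ P v)

include C hP

lemma semistableLocus_eq : semistableLocus d ξ =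
    ⨆ s, (PrimeSpectrum.basicOpen (C.S.F s) : (AffSp (Coord d)).Opens) := by
  have hmem : ∀ v : Rep d, affPt v specCPoint ∈
      (⨆ s, (PrimeSpectrum.basicOpen (C.S.F s) : (AffSp (Coord d)).Opens)) ↔
        IsSemistable ξ v := by
    intro v
    rw [hP, C.iff]
    exact Opens.mem_iSup.trans (exists_congr fun s => affPt_mem_basicOpen v _)
  refine le_antisymm ?_ (le_sSup fun v hv => (hmem v).mp (by rwa [affPt_eq_point]))
  refine sSup_le fun U hU => densePoints_affSp.opens_le ?_
  rintro _ ⟨v, rfl⟩ hv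
  exact (hmem v).mpr (hU v (by rwa [← affPt_eq_point]))

lemma point_mem (v : Rep d) : point v ∈ semistableLocus d ξ ↔ IsSemistable ξ v := by
  rw [C.semistableLocus_eq hP, hP, C.iff, ← affPt_eq_point]
  exact Opens.mem_iSup.trans (exists_congr fun s => affPt_mem_basicOpen v _)

/-- The semistable locus, as a locus of the chart system. -/
def locus : C.S.Locus where
  X := semistableLocus d ξ
  eq_iSup := C.semistableLocus_eq hP
  act := locusAct ξ
  act_ι _ := Scheme.Hom.resLE_comp_ι _ _

lemma nonempty_semistableModuli : Nonempty (SemistableModuli d ξ) := by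
  obtain ⟨Y, π, q, hq, ⟨T⟩⟩ := (C.locus hP).exists_sections
  exact ⟨⟨Y, π, T.isGoodQuotient, q, hq⟩⟩

variable (M : SemistableModuli d ξ)

lemma nonempty_space_iff : Nonempty M.space ↔ ∃ v, P v := by
  constructor
  · rintro ⟨y⟩
    obtain ⟨⟨x, hx⟩, -⟩ := M.isGoodQuotient.surjective y
    rw [C.semistableLocus_eq hP] at hx
    obtain ⟨s, hs⟩ := Opens.mem_iSup.mp hx
    have h0 : C.S.F s ≠ 0 := fun h => hs (by rw [h]; exact Ideal.zero_mem _)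
    by_contra! hcon
    refine h0 (MvPolynomial.funext fun v => ?_)
    by_contra hv
    exact hcon v ((C.iff v).mpr ⟨s, by rwa [map_zero] at hv⟩)
  · rintro ⟨v, hv⟩
    exact ⟨M.proj ⟨point v, (C.point_mem hP v).mpr ((hP v).mpr hv)⟩⟩

lemma exists_ne_zero [hY : Nonempty M.space] : ∃ s, C.S.F s ≠ 0 := by
  obtain ⟨v, hv⟩ := (C.nonempty_space_iff hP M).mp hY
  obtain ⟨s, hs⟩ := (C.iff v).mp hv
  exact ⟨s, fun h => hs (by rw [h, map_zero])⟩

lemma isDiagramLeg : IsDiagramLeg (Moduli.structureMap d) M.q := by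
  obtain ⟨T⟩ := ChartSystem.Locus.nonempty_sections (L := C.locus hP) M.isGoodQuotient
  exact
    { smooth := T.smooth C.R M.proj_q
      variety := fun _ => T.isVariety C.R M.proj_q
      projective := T.isProjectiveMorphism M.proj_q
      pushforward := fun _ => T.pushforward (C.ext (C.exists_ne_zero hP M)) M.proj_q }

lemma isBirationalMorphism [Nonempty M.space] (h : fixedBy (actRing (m := d))) (h0 : h ≠ 0) (s)
    (hs : C.S.F s ∣ (h : RepRing d)) : IsBirationalMorphism M.q := by
  obtain ⟨T⟩ := ChartSystem.Locus.nonempty_sections (L := C.locus hP) M.isGoodQuotient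
  exact T.isBirational M.proj_q
    (T.pushforward (C.ext (C.exists_ne_zero hP M)) M.proj_q) h h0 s hs

lemma canonicalIsRelAmple (hε : ε = 1) :
    CanonicalIsRelAmple (M.q ≫ Moduli.structureMap d) M.q := by
  subst hε
  obtain ⟨T⟩ := ChartSystem.Locus.nonempty_sections (L := C.locus hP) M.isGoodQuotient
  exact T.canonicalIsRelAmple C.R M.proj_q C.J

lemma anticanonicalIsRelAmple (hε : ε = -1) :
    AnticanonicalIsRelAmple (M.q ≫ Moduli.structureMap d) M.q := by
  subst hε
  obtain ⟨T⟩ := ChartSystem.Locus.nonempty_sections (L := C.locus hP) M.isGoodQuotient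
  exact T.anticanonicalIsRelAmple C.R M.proj_q C.J

end LocusCharts

/-! ### The diagram of the two moduli spaces -/

omit [Fintype V] in
/-- If each edge `i ⟶ j` with `i ≠ o` has its own edge `j ⟶ i`, then transposing the matrices of
a cogenerated representation along these pairs gives a generated representation. -/
lemma exists_isGenerated {v : Rep d} (hv : IsCogenerated o v)
    (hle : ∀ i ≠ o, ∀ j, Nat.card (i ⟶ j) ≤ Nat.card (j ⟶ i)) : ∃ u : Rep d, IsGenerated o u := by
  classical
  have hf : ∀ i j, i ≠ o → Nonempty ((i ⟶ j) ↪ (j ⟶ i)) := fun i j hi => by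
    have := Fintype.ofFinite (i ⟶ j)
    have := Fintype.ofFinite (j ⟶ i)
    exact Function.Embedding.nonempty_of_card_le (by
      simpa only [Nat.card_eq_fintype_card] using hle i hi j)
  let f : ∀ i j, i ≠ o → ((i ⟶ j) ↪ (j ⟶ i)) := fun i j hi => (hf i j hi).some
  let u : Rep d := fun z =>
    if h : ∃ (hi : z.tgt ≠ o) (e : z.tgt ⟶ z.src), f _ _ hi e = z.edge then
      v ⟨z.tgt, z.src, h.choose_spec.choose, z.col, z.row⟩ else 0
  have hu : ∀ {i j : V} (hi : i ≠ o) (e : i ⟶ j),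
      edgeMatrix u (f i j hi e) = (edgeMatrix v e)ᵀ := by
    intro i j hi e
    ext r c
    have h : ∃ (hi' : i ≠ o) (e' : i ⟶ j), f i j hi' e' = f i j hi e := ⟨hi, e, rfl⟩
    have h1 : u ⟨j, i, f i j hi e, r, c⟩ = v ⟨i, j, h.choose_spec.choose, c, r⟩ := dif_pos h
    have h2 : h.choose_spec.choose = e := (f i j hi).injective h.choose_spec.choose_spec
    rw [h2] at h1
    exact h1
  refine ⟨u, fun X hX i => ?_⟩
  let W : SubRep v :=
    { space := fun i => perp (X.space i)
      map_mem := by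
        intro i j e x hx y hy
        by_cases hi : i = o
        · subst hi
          have h0 : x ∈ perp (⊤ : Submodule ℂ (Fin (d i) → ℂ)) := hX ▸ hx
          rw [perp_top, Submodule.mem_bot] at h0
          rw [h0, mulVec_zero, zero_dotProduct]
        · have h := hx _ (X.map_mem (f i j hi e) y hy)
          rwa [hu hi, mulVec_transpose, dotProduct_comm, ← dotProduct_mulVec, dotProduct_comm] at h }
  exact perp_eq_bot (hv W (by change perp _ = ⊥; rw [hX, perp_top]) i)

variable {ξp ξm : V → UpperHalfPlane} {k : V → ℕ}

/-- The loci of the generated and of the cogenerated representations have semi-invariants of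
opposite weights, and their Jacobians have opposite weights, too. -/
theorem wall_crossing (ho : d o = 1) (hξp : ∀ i ≠ o, (ξp i : ℂ) = Complex.I)
    (hξm : ∀ i ≠ o, (ξm i : ℂ) = Complex.I) (hp : (ξp o).re < 0) (hm : 0 < (ξm o).re)
    (hk : ∀ i ≠ o, 0 < k i)
    (hflow : ∀ i ≠ o, ∑ j, (d j * Nat.card (i ⟶ j) : ℤ) - ∑ j, (d j * Nat.card (j ⟶ i) : ℤ) =
      -1 * k i)
    (hle : ∀ i ≠ o, ∀ j, Nat.card (i ⟶ j) ≤ Nat.card (j ⟶ i)) :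
    (∀ ξ ∈ ({ξp, ξm} : Set (V → UpperHalfPlane)), ∀ v : Rep d,
      point v ∈ semistableLocus d ξ ↔ IsSemistable ξ v) ∧
    Nonempty (SemistableModuli d ξp) ∧ Nonempty (SemistableModuli d ξm) ∧
    ∀ (Mp : SemistableModuli d ξp) (Mm : SemistableModuli d ξm),
      (IsEmpty Mm.space ∧ IsGeneralizedMFS (Moduli.structureMap d) Mp.q Mm.q) ∨
      (Nonempty Mp.space ∧ Nonempty Mm.space ∧
        IsGeneralizedFlip (Moduli.structureMap d) Mp.q Mm.q) := by
  obtain ⟨Cp⟩ := nonempty_locusCharts_isGenerated ho hk hflow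
  obtain ⟨Cm⟩ := nonempty_locusCharts_isCogenerated ho hk hflow
  have hPp := isSemistable_iff_isGenerated ho hξp hp
  have hPm := isSemistable_iff_isCogenerated ho hξm hm
  refine ⟨?_, Cp.nonempty_semistableModuli hPp, Cm.nonempty_semistableModuli hPm,
    fun Mp Mm => ?_⟩
  · rintro ξ (rfl | rfl) v
    · exact Cp.point_mem hPp v
    · exact Cm.point_mem hPm v
  have legp := Cp.isDiagramLeg hPp Mp
  have legm := Cm.isDiagramLeg hPm Mm
  have amplep := Cp.anticanonicalIsRelAmple hPp Mp rfl
  have amplem := Cm.canonicalIsRelAmple hPm Mm (neg_neg 1)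
  rcases isEmpty_or_nonempty Mm.space with hYm | hYm
  · exact Or.inl ⟨hYm, isVariety_moduli, legp, legm, amplep, hYm⟩
  have hYp : Nonempty Mp.space := by
    obtain ⟨v, hv⟩ := (Cm.nonempty_space_iff hPm Mm).mp hYm
    exact (Cp.nonempty_space_iff hPp Mp).mpr (exists_isGenerated hv hle)
  -- the product of semi-invariants of opposite weights is invariant
  obtain ⟨s, hs⟩ := Cp.exists_ne_zero hPp Mp
  obtain ⟨t, ht⟩ := Cm.exists_ne_zero hPm Mm
  have hmem : Cp.S.F s * Cm.S.F t ∈ fixedBy (actRing (m := d)) := by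
    rw [mem_fixedBy]
    intro g
    rw [map_mul, Cp.S.ρ_F, Cm.S.ρ_F, Cp.χ_eq, Cm.χ_eq, mul_mul_mul_comm, ← map_mul,
      mul_inv_cancel₀ (weight_ne_zero g), map_one, one_mul]
  have h0 : (⟨_, hmem⟩ : fixedBy (actRing (m := d))) ≠ 0 := fun h =>
    mul_ne_zero hs ht (congr_arg Subtype.val h)
  exact Or.inr ⟨hYp, hYm, isVariety_moduli, legp, legm,
    Cp.isBirationalMorphism hPp Mp _ h0 s (dvd_mul_right _ _),
    Cm.isBirationalMorphism hPm Mm _ h0 t (dvd_mul_left _ _), amplep, amplem⟩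

end QuiverRep

namespace ExtQuiver

variable {V : Type} [Quiver.{0} V] {a b : V → ℕ} {c : ℕ}

instance finite_hom [∀ i j : V, Finite (i ⟶ j)] : ∀ i j : ExtQuiver a b c, Finite (i ⟶ j)
  | none, none => inferInstanceAs (Finite (Fin c))
  | none, some i => inferInstanceAs (Finite (Fin (a i)))
  | some i, none => inferInstanceAs (Finite (Fin (b i)))
  | some i, some j => inferInstanceAs (Finite (i ⟶ j))

lemma card_to_zero (i : V) : Nat.card ((vertex i : ExtQuiver a b c) ⟶ zero) = b i :=
  Nat.card_fin (b i)

lemma card_from_zero (i : V) : Nat.card ((zero : ExtQuiver a b c) ⟶ vertex i) = a i :=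
  Nat.card_fin (a i)

/-- The Euler form at the vertices of the given quiver only sees the edges at the additional
vertex. -/
lemma flow [Fintype V] (hsymm : IsSymmetricQuiver V) (hab : ∀ i, b i < a i) (m : V → ℕ) (i : V) :
    ∑ j : ExtQuiver a b c, (dimVector m j * Nat.card (vertex i ⟶ j) : ℤ) -
      ∑ j : ExtQuiver a b c, (dimVector m j * Nat.card (j ⟶ vertex i) : ℤ) =
        -1 * (a i - b i : ℕ) := by
  have hsum : ∀ f : ExtQuiver a b c → ℤ, ∑ j, f j = f zero + ∑ j, f (vertex j) :=
    fun f => Fintype.sum_option f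
  rw [hsum, hsum, card_to_zero, card_from_zero, Nat.cast_sub (hab i).le]
  have h1 : ∀ j : V, Nat.card ((vertex i : ExtQuiver a b c) ⟶ vertex j) =
      Nat.card ((vertex j : ExtQuiver a b c) ⟶ vertex i) := fun j => hsymm i j
  have h2 : dimVector m (zero : ExtQuiver a b c) = 1 := rfl
  simp only [h1, h2]
  push_cast
  ring

end ExtQuiver

theorem proposition6p10 {V : Type} [Fintype V] [Quiver.{0} V] [∀ i j : V, Finite (i ⟶ j)]
    (hsymm : IsSymmetricQuiver V) (a b : V → ℕ) (c : ℕ) (hab : ∀ i, b i < a i) (m : V → ℕ)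
    (ξp ξm : ExtQuiver a b c → UpperHalfPlane)
    (hξp : ∀ i : V, (ξp (ExtQuiver.vertex i) : ℂ) = Complex.I)
    (hξm : ∀ i : V, (ξm (ExtQuiver.vertex i) : ℂ) = Complex.I)
    (hξp_zero : (ξp ExtQuiver.zero).re < 0) (hξm_zero : 0 < (ξm ExtQuiver.zero).re) :
    -- the `ℂ`-points of the semistable loci are exactly the semistable representations
    (∀ ξ ∈ ({ξp, ξm} : Set (ExtQuiver a b c → UpperHalfPlane)),
      ∀ v : QuiverRep.Rep (ExtQuiver.dimVector m : ExtQuiver a b c → ℕ),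
        QuiverRep.point v ∈ QuiverRep.semistableLocus _ ξ ↔ QuiverRep.IsSemistable ξ v) ∧
    -- the moduli spaces `M^{ξ±}` exist
    Nonempty (QuiverRep.SemistableModuli (ExtQuiver.dimVector m) ξp) ∧
    Nonempty (QuiverRep.SemistableModuli (ExtQuiver.dimVector m) ξm) ∧
    -- the diagram `M^{ξ+} ⟶ M ⟵ M^{ξ-}`
    ∀ (Mp : QuiverRep.SemistableModuli (ExtQuiver.dimVector m) ξp)
      (Mm : QuiverRep.SemistableModuli (ExtQuiver.dimVector m) ξm),
      (IsEmpty Mm.space ∧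
        IsGeneralizedMFS (QuiverRep.Moduli.structureMap (ExtQuiver.dimVector m)) Mp.q Mm.q) ∨
      (Nonempty Mp.space ∧ Nonempty Mm.space ∧
        IsGeneralizedFlip (QuiverRep.Moduli.structureMap (ExtQuiver.dimVector m)) Mp.q Mm.q) := by
  have hcases : ∀ {P : ExtQuiver a b c → Prop}, (∀ i : V, P (ExtQuiver.vertex i)) →
      ∀ i ≠ ExtQuiver.zero, P i := by
    rintro P hP (_ | i) hi
    · exact absurd rfl hi
    · exact hP i
  refine QuiverRep.wall_crossing (o := ExtQuiver.zero)
    (k := fun i : Option V => i.elim 0 fun i => a i - b i) rfl (hcases hξp) (hcases hξm)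
    hξp_zero hξm_zero (hcases fun i => Nat.sub_pos_of_lt (hab i))
    (hcases fun i => ExtQuiver.flow hsymm hab m i) (hcases fun i => ?_)
  rintro (_ | j)
  · exact (ExtQuiver.card_to_zero i).trans_le
      ((hab i).le.trans (ExtQuiver.card_from_zero i).ge)
  · exact (hsymm i j).le
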